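/- Let $M\subset\mathbb C^n$ ($n\ge 1$) be a smooth real hypersurface. Write $T=TM$, $\mathbb CT=\mathbb C\otimes T=T\oplus iT$, $H^{10}\subset\mathbb CT$ for the bundle of $(1,0)$ tangent vectors, $\mathbb CH=H^{10}\oplus\overline{H^{10}}$ and $\mathbb CQ=\mathbb CT/\mathbb CH$. A contact form is a $1$-form $\theta$ on $M$ that is real on $T$ and vanishes on $\mathbb CH$. The Levi kernel is $K^{10}_p=\{L_p : L\in H^{10},\ [L,\overline{L'}]_p\in\mathbb CH_p\ \forall L'\in H^{10}\}$; put $\mathbb CK_p=K^{10}_p\oplus\overline{K^{10}_p}$ and $K_p=\mathbb CK_p\cap T_p$. The Levi rank of $p$ is $\dim H^{10}_p-\dim K^{10}_p$. Assume that $M$ is pseudoconvex: near each point there is a nowhere zero contact form $\theta$ which is positive, i.e. $i\langle\theta,[L,\overline L]\rangle\ge0$ for all $(1,0)$ fields $L$. A $(1,0)$ field $L$ is in the Levi kernel up to order $1$ at $p$ if $\langle\theta,[L^1,\overline L]\rangle_p=(L^2\langle\theta,[L^1,\overline L]\rangle)_p=0$ for all contact forms $\theta$, all $L^1\in H^{10}$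 and $L^2\in\mathbb CT$. For $q\in\{0,\dots,n-1\}$ let $\mathcal S^{10}(q)$ consist of the germs of smooth $(1,0)$ fields on $M$ that are in the Levi kernel up to order $1$ at every point of Levi rank $\le q$. Fix $q\in\{0,\dots,n-1\}$. Then $\mathcal S^{10}(q)$ is a submodule sheaf of the sheaf of $(1,0)$ fields, there is an ideal sheaf $\mathcal I(q)$ of smooth complex functions on $M$, both invariant under local biholomorphic maps, and for every $p\in M$ of Levi rank $q$ there are a unique quartic tensor $$\tau^4_p:\mathbb CT_p\times\mathbb CT_p\times K^{10}_p\times\overline{K^{10}_p}\to\mathbb CQ_p$$ satisfying $$\langle\theta_p,\tau^4_p(L^4_p,L^3_p,L^2_p,L^1_p)\rangle=i\,(L^4L^3\langle\theta,[L^2,L^1]\rangle)_p$$ for all contact forms $\theta$, all $L^4,L^3\in\mathbb CT$ and all $(1,0)$ fields $L^2,\overline{L^1}$ in the Levi kernel up to order $1$ at $p$, which is likewise invariant, and a real submanifold $S\subset M$ through $p$, such that: 1. $S$ contains all points of Levi rank $q$ in a neighborhood of $p$ in $M$. 2. $T_pS=\mathrm{Re}\ker\tau^4_p=\{v\in T_p:\tau^4_p(v,v^3,v^2,v^1)=0\text{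 for all }v^3,v^2,v^1\}$. 3. There are local holomorphic coordinates $(w,z_2,z_4)\in\mathbb C\times\mathbb C^q\times\mathbb C^{n-q-1}$ vanishing at $p$ in which $M$ is given by $$2\,\mathrm{Re}\,w=\sum_{j=1}^q|z_{2j}|^2+\varphi^4(z_4,\bar z_4)+o_w(1),$$ where $o_w(1)$ is a smooth function of $(z,\bar z,\mathrm{Im}\,w)$, $z=(z_2,z_4)$, all of whose Taylor terms have weight $>1$ when $w,z_2,z_4$ (and their conjugates) have weights $1,\frac12,\frac14$, and $\varphi^4$ is a plurisubharmonic real-valued homogeneous polynomial of degree $4$ in $(z_4,\bar z_4)$ with $\tau^4_p(v^4,v^3,v^2,v^1)=\partial_{v^4}\partial_{v^3}\partial_{v^2}\partial_{v^1}\varphi^4$ for $v^4,v^3\in\mathbb CK_p$ and $v^2,\overline{v^1}\in K^{10}_p$; here $\mathbb CQ_p$ is identified with $\mathbb C$ by the contact covector $i\,dw$, which is the value at $p$ of the positive contact form $i\,\partial(2\mathrm{Re}\,w-\sum_j|z_{2j}|^2-\varphi^4-o_w(1))$. 4. In a neighborhood of $p$, $S=\{f^1=\dots=f^m=0\}$ with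 $df^1\wedge\dots\wedge df^m\ne0$ and $f^j\in\mathrm{Re}\,\mathcal I(q)$ (real parts of sections of $\mathcal I(q)$). In fact any $f\in\mathrm{Re}\,\mathcal I(q)$ vanishes at all points of Levi rank $q$. 5. $\mathcal I(q)$ is the ideal sheaf generated by all functions $\langle\theta,[L^2,L^1]\rangle$ and $L^3\langle\theta,[L^2,L^1]\rangle$, where $\theta$ is a contact form, $L^3\in\mathbb CT$, and $L^2,\overline{L^1}\in\mathcal S^{10}(q)$. 6. $\mathcal S^{10}(q)$ contains every germ of a $(1,0)$ field $L$ that is Levi-orthogonal to some rank $q$ subbundle $V_L\subset H^{10}$ on which the Levi form is nondegenerate. In particular, at each point $x$ of Levi rank $q$ the values at $x$ of the sections of $\mathcal S^{10}(q)$ form $K^{10}_x$. 7. $\tau^4_p(v^2,v^2,v^1,\overline{v^1})\ge0$ (when paired with any positive contact form) for $v^2\in T_p$, $v^1\in K^{10}_p$. If moreover the D'Angelo type of $M$ at $p$ is at most $4$, then: (i) $T_pS\cap K_p$ is totally real. (ii) For every nonzero $v\in K^{10}_p$, $\tau^4_p$ does not vanish identically on $(\mathbb Cv+\mathbb C\bar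 v)\times(\mathbb Cv+\mathbb C\bar v)\times\mathbb Cv\times\mathbb C\bar v$. The regular type at $p$ (the supremum of the orders of contact of $M$ with regular holomorphic curves) equals the D'Angelo type; if $n\ge2$ it is $2$ or $4$; it is $4$ whenever $K^{10}_p\neq0$. (iii) The Catlin multitype of $M$ at $p$ (the lexicographic supremum of the admissible weights $\Lambda$ for which $M$ has a defining function that is $O_\Lambda(1)$ in suitable holomorphic coordinates vanishing at $p$) is $(1,\underbrace{2,\dots,2}_{q},\underbrace{4,\dots,4}_{n-q-1})$. -/

import Mathlib

open scoped ContDiff ENNReal Topology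

namespace LeviGeom

/-! ### Complex vector fields and derivations on `ℂⁿ` -/

/-- The ambient space `ℂⁿ`. -/
abbrev Cn (n : ℕ) := Fin n → ℂ

/-- Complexified tangent vectors of `ℂⁿ`: the pair `(a, b)` is
`∑ aⱼ ∂/∂zⱼ + ∑ bⱼ ∂/∂z̄ⱼ`. -/
abbrev CVec (n : ℕ) := Cn n × Cn n

variable {n : ℕ}

/-- Complex conjugation of complexified tangent vectors. -/
def conjV (X : CVec n) : CVec n := (star X.2, star X.1)

/-- The real tangent vector `v` seen as `∑ vⱼ ∂/∂zⱼ + ∑ v̄ⱼ ∂/∂z̄ⱼ`. -/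
def ofRealV (v : Cn n) : CVec n := (v, star v)

/-- The derivative at `x`, in the direction of the complex tangent vector `X`, of a function that is
differentiable in the real sense: `∑ aⱼ ∂f/∂zⱼ + ∑ bⱼ ∂f/∂z̄ⱼ` for `X = (a, b)`. -/
noncomputable def cderiv {F : Type*} [NormedAddCommGroup F] [NormedSpace ℂ F]
    (f : Cn n → F) (x : Cn n) (X : CVec n) : F :=
  (1 / 2 : ℂ) •
    ((fderiv ℝ f x X.1 - Complex.I • fderiv ℝ f x (Complex.I • X.1)) +
      (fderiv ℝ f x (star X.2) + Complex.I • fderiv ℝ f x (Complex.I • star X.2)))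

/-- The Lie bracket of complex vector fields. -/
noncomputable def bracket (X Y : Cn n → CVec n) (x : Cn n) : CVec n :=
  cderiv Y x (X x) - cderiv X x (Y x)

/-- Successive differentiation along constant complex vectors, the head of the list being the
outermost derivative. -/
noncomputable def iterCderiv (l : List (CVec n)) (f : Cn n → ℂ) : Cn n → ℂ :=
  l.foldr (fun X g x => cderiv g x X) f

section lemmas

variable {F : Type*} [NormedAddCommGroup F] [NormedSpace ℂ F]

theorem cderiv_add_right (f : Cn n → F) (x : Cn n) (X Y : CVec n) :
    cderiv f x (X + Y) = cderiv f x X + cderiv f x Y := by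
  simp only [cderiv, Prod.fst_add, Prod.snd_add, star_add, smul_add, map_add]
  module

theorem cderiv_zero_right (f : Cn n → F) (x : Cn n) : cderiv f x (0 : CVec n) = 0 := by
  simp [cderiv]

theorem map_smul_complex (D : Cn n →L[ℝ] F) (c : ℂ) (v : Cn n) :
    D (c • v) = (c.re : ℂ) • D v + (c.im : ℂ) • D (Complex.I • v) := by
  have h : c • v = c.re • v + c.im • (Complex.I • v) := by
    conv_lhs => rw [← Complex.re_add_im c]
    rw [add_smul, mul_smul, Complex.coe_smul, Complex.coe_smul]
  rw [h, map_add, map_smul, map_smul, Complex.coe_smul, Complex.coe_smul]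

theorem cderiv_smul_right (f : Cn n → F) (x : Cn n) (c : ℂ) (X : CVec n) :
    cderiv f x (c • X) = c • cderiv f x X := by
  have hI : ∀ v : Cn n, Complex.I • (Complex.I • v) = -v := by
    intro v; rw [smul_smul, Complex.I_mul_I, neg_one_smul]
  have hc : ((c.re : ℂ) + (c.im : ℂ) * Complex.I) = c := Complex.re_add_im c
  have hI2 := Complex.I_mul_I
  simp only [cderiv, Prod.smul_fst, Prod.smul_snd, star_smul, smul_comm Complex.I]
  simp only [map_smul_complex _ c, map_smul_complex _ (star c), hI, map_neg]
  simp only [Complex.star_def, Complex.conj_re, Complex.conj_im, Complex.ofReal_neg]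
  conv_rhs => rw [← hc]
  match_scalars <;> ring_nf <;> simp only [Complex.I_sq] <;> ring

theorem cderiv_add_left {f g : Cn n → F} {x : Cn n} (hf : DifferentiableAt ℝ f x)
    (hg : DifferentiableAt ℝ g x) (X : CVec n) :
    cderiv (f + g) x X = cderiv f x X + cderiv g x X := by
  simp only [cderiv, fderiv_add hf hg, add_apply]
  module

theorem cderiv_const_smul_left {f : Cn n → F} {x : Cn n} (c : ℂ)
    (hf : DifferentiableAt ℝ f x) (X : CVec n) :
    cderiv (c • f) x X = c • cderiv f x X := by
  simp only [cderiv, fderiv_const_smul hf c, smul_apply]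
  module

end lemmas

/-! ### Real hypersurfaces and their tangent spaces -/

/-- `ρ` is a defining function of `M` on the open set `U`. -/
def IsDefiningFunction (M U : Set (Cn n)) (ρ : Cn n → ℝ) : Prop :=
  IsOpen U ∧ ContDiffOn ℝ ∞ ρ U ∧ (∀ x ∈ U, fderiv ℝ ρ x ≠ 0) ∧ ∀ x ∈ U, (x ∈ M ↔ ρ x = 0)

/-- `M ⊂ ℂⁿ` is a smooth (embedded, not necessarily closed) real hypersurface. -/
def IsRealHypersurface (M : Set (Cn n)) : Prop :=
  ∀ p ∈ M, ∃ U ρ, p ∈ U ∧ IsDefiningFunction M U ρ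

/-- The complexified tangent space `ℂT_p` of a submanifold `S ⊂ ℂⁿ`: the complex tangent vectors
that annihilate all smooth functions near `p` vanishing on `S`. -/
def CT (S : Set (Cn n)) (p : Cn n) : Submodule ℂ (CVec n) where
  carrier := {X | ∀ (U : Set (Cn n)) (h : Cn n → ℂ), IsOpen U → p ∈ U → ContDiffOn ℝ ∞ h U →
    (∀ x ∈ S ∩ U, h x = 0) → cderiv h p X = 0}
  zero_mem' := fun _ h _ _ _ _ => cderiv_zero_right h p
  add_mem' := by
    intro X Y hX hY U h hU hp hh h0
    rw [cderiv_add_right, hX U h hU hp hh h0, hY U h hU hp hh h0, add_zero]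
  smul_mem' := by
    intro c X hX U h hU hp hh h0
    rw [cderiv_smul_right, hX U h hU hp hh h0, smul_zero]

/-- The real vectors of a space of complex tangent vectors. -/
def realVectors (V : Submodule ℂ (CVec n)) : Submodule ℝ (Cn n) where
  carrier := {v | ofRealV v ∈ V}
  zero_mem' := by
    have : ofRealV (0 : Cn n) = 0 := by simp [ofRealV]
    simp [this]
  add_mem' := by
    intro v w hv hw
    have : ofRealV (v + w) = ofRealV v + ofRealV w := by simp [ofRealV]
    simpa [this] using V.add_mem hv hw
  smul_mem' := by
    intro c v hv
    have : ofRealV (c • v) = (c : ℂ) • ofRealV v := by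
      refine Prod.ext ?_ ?_ <;> funext i <;> simp [ofRealV]
    simpa [this] using V.smul_mem (c : ℂ) hv

/-- The real tangent space `T_p` of a submanifold. -/
def realTangent (S : Set (Cn n)) (p : Cn n) : Submodule ℝ (Cn n) := realVectors (CT S p)

/-- The space `H¹⁰_p` of tangent vectors of type `(1,0)`. -/
def H10 (M : Set (Cn n)) (p : Cn n) : Submodule ℂ (CVec n) :=
  CT M p ⊓ LinearMap.ker (LinearMap.snd ℂ (Cn n) (Cn n))

/-- The space `H⁰¹_p` of tangent vectors of type `(0,1)`. -/
def H01 (M : Set (Cn n)) (p : Cn n) : Submodule ℂ (CVec n) :=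
  CT M p ⊓ LinearMap.ker (LinearMap.fst ℂ (Cn n) (Cn n))

/-- `ℂH_p = H¹⁰_p ⊕ H⁰¹_p`. -/
def CH (M : Set (Cn n)) (p : Cn n) : Submodule ℂ (CVec n) := H10 M p ⊔ H01 M p

/-- `ℂQ_p = ℂT_p / ℂH_p`. -/
abbrev CQ (M : Set (Cn n)) (p : Cn n) := CT M p ⧸ (CH M p).submoduleOf (CT M p)

/-- `X` is a smooth section over `M ∩ U` of the family of subspaces `V`. Sections on `M` are given
by smooth ambient extensions. -/
def IsSection (M : Set (Cn n)) (V : Cn n → Submodule ℂ (CVec n)) (U : Set (Cn n))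
    (X : Cn n → CVec n) : Prop :=
  ContDiffOn ℝ ∞ X U ∧ ∀ x ∈ M ∩ U, X x ∈ V x

/-- The conjugate of a vector field. -/
def conjField (X : Cn n → CVec n) : Cn n → CVec n := fun x => conjV (X x)

/-- `θ` is a smooth contact form over `M ∩ U`: it vanishes on `ℂH` and is real on real tangent
vectors. -/
def IsContactForm (M U : Set (Cn n)) (θ : Cn n → (CVec n →L[ℂ] ℂ)) : Prop :=
  ContDiffOn ℝ ∞ θ U ∧ ∀ x ∈ M ∩ U,
    (∀ X ∈ CH M x, θ x X = 0) ∧ ∀ v ∈ realTangent M x, (θ x (ofRealV v)).im = 0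

/-- The function `⟨θ, [X, Y]⟩`. -/
noncomputable def leviFn (θ : Cn n → (CVec n →L[ℂ] ℂ)) (X Y : Cn n → CVec n) : Cn n → ℂ :=
  fun x => θ x (bracket X Y x)

/-- The Levi form `i⟨θ, [L, L̄]⟩` is nonnegative at all points of `M ∩ U`. -/
def LeviNonneg (M U : Set (Cn n)) (θ : Cn n → (CVec n →L[ℂ] ℂ)) : Prop :=
  ∀ x ∈ M ∩ U, ∀ (U' : Set (Cn n)) (L : Cn n → CVec n), IsOpen U' → x ∈ U' →
    IsSection M (H10 M) U' L → 0 ≤ (Complex.I * leviFn θ L (conjField L) x).re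

/-- Pseudoconvexity: locally there is a nowhere vanishing contact form with nonnegative Levi
form. -/
def IsPseudoconvex (M : Set (Cn n)) : Prop :=
  ∀ p ∈ M, ∃ (U : Set (Cn n)) (θ : Cn n → (CVec n →L[ℂ] ℂ)), IsOpen U ∧ p ∈ U ∧
    IsContactForm M U θ ∧ (∀ x ∈ M ∩ U, ∃ X ∈ CT M x, θ x X ≠ 0) ∧ LeviNonneg M U θ

/-! ### Levi kernel and Levi rank -/

theorem bracket_add_left {X X' Y : Cn n → CVec n} {x : Cn n} (hX : DifferentiableAt ℝ X x)
    (hX' : DifferentiableAt ℝ X' x) :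
    bracket (X + X') Y x = bracket X Y x + bracket X' Y x := by
  simp only [bracket, Pi.add_apply, cderiv_add_right, cderiv_add_left hX hX']
  module

theorem bracket_smul_left {X Y : Cn n → CVec n} {x : Cn n} (c : ℂ)
    (hX : DifferentiableAt ℝ X x) :
    bracket (c • X) Y x = c • bracket X Y x := by
  simp only [bracket, Pi.smul_apply, cderiv_smul_right, cderiv_const_smul_left c hX]
  module

theorem IsSection.differentiableAt {M U : Set (Cn n)} {V : Cn n → Submodule ℂ (CVec n)}
    {X : Cn n → CVec n} (h : IsSection M V U X) (hU : IsOpen U) {x : Cn n} (hx : x ∈ U) :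
    DifferentiableAt ℝ X x :=
  (h.1.contDiffAt (hU.mem_nhds hx)).differentiableAt (by simp)

/-- The Levi kernel `K¹⁰_p`: the values at `p` of the `(1,0)` fields `X` with
`[X, Ȳ]_p ∈ ℂH_p` for all `(1,0)` fields `Y`. -/
def K10 (M : Set (Cn n)) (p : Cn n) : Submodule ℂ (CVec n) where
  carrier := {v | v ∈ H10 M p ∧ ∃ (U : Set (Cn n)) (X : Cn n → CVec n), IsOpen U ∧ p ∈ U ∧
    IsSection M (H10 M) U X ∧ X p = v ∧
    ∀ (U' : Set (Cn n)) (Y : Cn n → CVec n), IsOpen U' → p ∈ U' →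
      IsSection M (H10 M) U' Y → bracket X (conjField Y) p ∈ CH M p}
  zero_mem' := by
    refine ⟨zero_mem _, Set.univ, fun _ => 0, isOpen_univ, trivial,
      ⟨contDiffOn_const, fun x _ => zero_mem _⟩, rfl, ?_⟩
    intro U' Y _ _ _
    have h0 : bracket (fun _ => (0 : CVec n)) (conjField Y) p = 0 := by
      simp [bracket, cderiv]
    rw [h0]; exact zero_mem _
  add_mem' := by
    rintro v v' ⟨hv, U, X, hU, hp, hX, hXv, hX2⟩ ⟨hv', U', X', hU', hp', hX', hXv', hX2'⟩
    refine ⟨add_mem hv hv', U ∩ U', X + X', hU.inter hU', ⟨hp, hp'⟩,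
      ⟨(hX.1.mono Set.inter_subset_left).add (hX'.1.mono Set.inter_subset_right),
        fun x hx => add_mem (hX.2 x ⟨hx.1, hx.2.1⟩) (hX'.2 x ⟨hx.1, hx.2.2⟩)⟩,
      by simp [hXv, hXv'], ?_⟩
    intro W Y hW hpW hY
    rw [bracket_add_left (hX.differentiableAt hU hp) (hX'.differentiableAt hU' hp')]
    exact add_mem (hX2 W Y hW hpW hY) (hX2' W Y hW hpW hY)
  smul_mem' := by
    rintro c v ⟨hv, U, X, hU, hp, hX, hXv, hX2⟩
    refine ⟨Submodule.smul_mem _ c hv, U, c • X, hU, hp,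
      ⟨hX.1.const_smul c, fun x hx => Submodule.smul_mem _ c (hX.2 x hx)⟩,
      by simp [hXv], ?_⟩
    intro W Y hW hpW hY
    rw [bracket_smul_left c (hX.differentiableAt hU hp)]
    exact Submodule.smul_mem _ c (hX2 W Y hW hpW hY)

/-- The conjugate Levi kernel `K⁰¹_p`. -/
def K01 (M : Set (Cn n)) (p : Cn n) : Submodule ℂ (CVec n) where
  carrier := {v | conjV v ∈ K10 M p}
  zero_mem' := by
    have : conjV (0 : CVec n) = 0 := by simp [conjV]
    simp [this]
  add_mem' := by
    intro v w hv hw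
    have : conjV (v + w) = conjV v + conjV w := by simp [conjV]
    simpa [this] using add_mem hv hw
  smul_mem' := by
    intro c v hv
    have : conjV (c • v) = (star c) • conjV v := by
      refine Prod.ext ?_ ?_ <;> funext i <;> simp [conjV]
    simpa [this] using Submodule.smul_mem (K10 M p) (star c) hv

/-- `ℂK_p = K¹⁰_p ⊕ K⁰¹_p`. -/
def CK (M : Set (Cn n)) (p : Cn n) : Submodule ℂ (CVec n) := K10 M p ⊔ K01 M p

/-- The Levi rank at `p`: the rank of the Levi form, i.e. the codimension of its kernel. -/
noncomputable def leviRank (M : Set (Cn n)) (p : Cn n) : ℕ :=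
  Module.finrank ℂ (H10 M p) - Module.finrank ℂ (K10 M p)

/-- The `(1,0)` field `L` is in the Levi kernel up to order `1` at `p`. -/
def InLeviKernelOrderOne (M : Set (Cn n)) (p : Cn n) (L : Cn n → CVec n) : Prop :=
  ∀ (U : Set (Cn n)) (L₁ L₂ : Cn n → CVec n) (θ : Cn n → (CVec n →L[ℂ] ℂ)),
    IsOpen U → p ∈ U → IsSection M (H10 M) U L₁ → IsSection M (CT M) U L₂ →
    IsContactForm M U θ →
    leviFn θ L₁ (conjField L) p = 0 ∧ cderiv (leviFn θ L₁ (conjField L)) p (L₂ p) = 0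

/-! ### The submodule sheaves and the ideal sheaves -/

/-- Sections of `S¹⁰(q)` over `M ∩ U` (for `U` open): `(1,0)` fields that are in the Levi kernel up
to order `1` at every point of Levi rank at most `q`. -/
def S10 (M : Set (Cn n)) (q : ℕ) (U : Set (Cn n)) (X : Cn n → CVec n) : Prop :=
  IsSection M (H10 M) U X ∧
    ∀ x ∈ M ∩ U, leviRank M x ≤ q → InLeviKernelOrderOne M x X

/-- `𝒮` is a subsheaf of modules, over smooth complex functions, of the sheaf of smooth `(1,0)`
vector fields on `M`. -/
structure IsSubmoduleSheaf (M : Set (Cn n)) (𝒮 : Set (Cn n) → (Cn n → CVec n) → Prop) :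
    Prop where
  isSection : ∀ U X, IsOpen U → 𝒮 U X → IsSection M (H10 M) U X
  congr : ∀ U X Y, IsOpen U → 𝒮 U X → ContDiffOn ℝ ∞ Y U → (∀ x ∈ M ∩ U, Y x = X x) → 𝒮 U Y
  restrict : ∀ U U' X, IsOpen U → IsOpen U' → U' ⊆ U → 𝒮 U X → 𝒮 U' X
  locality : ∀ U X, IsOpen U → ContDiffOn ℝ ∞ X U →
    (∀ x ∈ M ∩ U, ∃ U' ⊆ U, IsOpen U' ∧ x ∈ U' ∧ 𝒮 U' X) → 𝒮 U X
  zero : ∀ U, IsOpen U → 𝒮 U 0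
  add : ∀ U X Y, IsOpen U → 𝒮 U X → 𝒮 U Y → 𝒮 U (X + Y)
  smul : ∀ U (a : Cn n → ℂ) X, IsOpen U → ContDiffOn ℝ ∞ a U → 𝒮 U X →
    𝒮 U (fun x => a x • X x)

/-- `ℐ` is an ideal sheaf in the sheaf of smooth complex functions on `M`. -/
structure IsIdealSheaf (M : Set (Cn n)) (ℐ : Set (Cn n) → (Cn n → ℂ) → Prop) : Prop where
  smooth : ∀ U f, IsOpen U → ℐ U f → ContDiffOn ℝ ∞ f U
  congr : ∀ U f g, IsOpen U → ℐ U f → ContDiffOn ℝ ∞ g U → (∀ x ∈ M ∩ U, g x = f x) → ℐ U g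
  restrict : ∀ U U' f, IsOpen U → IsOpen U' → U' ⊆ U → ℐ U f → ℐ U' f
  locality : ∀ U f, IsOpen U → ContDiffOn ℝ ∞ f U →
    (∀ x ∈ M ∩ U, ∃ U' ⊆ U, IsOpen U' ∧ x ∈ U' ∧ ℐ U' f) → ℐ U f
  zero : ∀ U, IsOpen U → ℐ U 0
  add : ∀ U f g, IsOpen U → ℐ U f → ℐ U g → ℐ U (f + g)
  mul : ∀ U (a f : Cn n → ℂ), IsOpen U → ContDiffOn ℝ ∞ a U → ℐ U f → ℐ U (a * f)

/-- The functions `⟨θ, [L², L¹]⟩` and `L³⟨θ, [L², L¹]⟩` over `M ∩ U`, with `θ` a contact form, `L³` a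
section of `ℂT` and `L²`, `L̄¹` sections of `S¹⁰(q)`. -/
def IsIdealGenerator (M : Set (Cn n)) (q : ℕ) (U : Set (Cn n)) (g : Cn n → ℂ) : Prop :=
  ∃ (θ : Cn n → (CVec n →L[ℂ] ℂ)) (L₂ L₁ : Cn n → CVec n),
    IsContactForm M U θ ∧ S10 M q U L₂ ∧ S10 M q U (conjField L₁) ∧
    (g = leviFn θ L₂ L₁ ∨
      ∃ L₃, IsSection M (CT M) U L₃ ∧ g = fun x => cderiv (leviFn θ L₂ L₁) x (L₃ x))

/-- Sections over `M ∩ U` (for `U` open) of the ideal sheaf `I(q)`: the smooth functions that are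
locally finite combinations, with smooth coefficients, of the generators. -/
def idealSheaf (M : Set (Cn n)) (q : ℕ) (U : Set (Cn n)) (f : Cn n → ℂ) : Prop :=
  ContDiffOn ℝ ∞ f U ∧ ∀ x ∈ M ∩ U, ∃ U' ⊆ U, IsOpen U' ∧ x ∈ U' ∧
    ∃ (k : ℕ) (a g : Fin k → Cn n → ℂ), (∀ i, ContDiffOn ℝ ∞ (a i) U') ∧
      (∀ i, IsIdealGenerator M q U' (g i)) ∧
      ∀ y ∈ M ∩ U', f y = ∑ i, a i y * g i y

/-- Sections over `M ∩ U` of `Re I(q)`. -/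
def reIdealSheaf (M : Set (Cn n)) (q : ℕ) (U : Set (Cn n)) (f : Cn n → ℝ) : Prop :=
  ContDiffOn ℝ ∞ f U ∧ ∃ h, idealSheaf M q U h ∧ ∀ x ∈ M ∩ U, f x = (h x).re

/-- `F₁, …, F_k` is a frame over `M ∩ U` of a Levi-nondegenerate subbundle of `H¹⁰` of rank `k`. -/
def IsLeviNondegenerateFrame (M U : Set (Cn n)) {k : ℕ} (F : Fin k → Cn n → CVec n) : Prop :=
  (∀ j, IsSection M (H10 M) U (F j)) ∧
  (∀ x ∈ M ∩ U, LinearIndependent ℂ fun j => F j x) ∧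
  ∀ x ∈ M ∩ U, ∀ c : Fin k → ℂ,
    (∀ l, ∑ j, c j • bracket (F j) (conjField (F l)) x ∈ CH M x) → c = 0

/-- `L` is a `(1,0)` field over `M ∩ U` that is Levi-orthogonal to the span of the `F j`. -/
def IsLeviOrthogonal (M U : Set (Cn n)) {k : ℕ} (F : Fin k → Cn n → CVec n)
    (L : Cn n → CVec n) : Prop :=
  IsSection M (H10 M) U L ∧ ∀ x ∈ M ∩ U, ∀ l, bracket L (conjField (F l)) x ∈ CH M x

/-! ### The quartic tensor -/

/-- Tensors `ℂT_p × ℂT_p × K¹⁰_p × K⁰¹_p → ℂQ_p`. -/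
abbrev Tensor4 (M : Set (Cn n)) (p : Cn n) :=
  CT M p →ₗ[ℂ] CT M p →ₗ[ℂ] K10 M p →ₗ[ℂ] K01 M p →ₗ[ℂ] CQ M p

/-- The pairing of the contact covector `θ` with `s ∈ ℂQ_p` has the value `c`. -/
def PairsTo {M : Set (Cn n)} {p : Cn n} (θ : CVec n → ℂ) (s : CQ M p) (c : ℂ) : Prop :=
  ∀ t : CT M p, Submodule.Quotient.mk t = s → θ t = c

/-- `τ` is the quartic tensor of `M` at `p`:
`⟨θ_p, τ(L⁴_p, L³_p, L²_p, L¹_p)⟩ = i (L⁴ L³ ⟨θ, [L², L¹]⟩)_p` for all contact forms `θ`, complex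
vector fields `L⁴, L³` and `(1,0)` fields `L², L̄¹` in the Levi kernel up to order `1` at `p`. -/
def IsQuarticTensor (M : Set (Cn n)) (p : Cn n) (τ : Tensor4 M p) : Prop :=
  ∀ (U : Set (Cn n)) (θ : Cn n → (CVec n →L[ℂ] ℂ)) (L₄ L₃ L₂ L₁ : Cn n → CVec n),
    IsOpen U → p ∈ U → IsContactForm M U θ →
    IsSection M (CT M) U L₄ → IsSection M (CT M) U L₃ →
    IsSection M (H10 M) U L₂ → InLeviKernelOrderOne M p L₂ →
    IsSection M (H10 M) U (conjField L₁) → InLeviKernelOrderOne M p (conjField L₁) →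
    ∀ (v₄ v₃ : CT M p) (v₂ : K10 M p) (v₁ : K01 M p),
      (v₄ : CVec n) = L₄ p → (v₃ : CVec n) = L₃ p → (v₂ : CVec n) = L₂ p →
      (v₁ : CVec n) = L₁ p →
      PairsTo (θ p) (τ v₄ v₃ v₂ v₁)
        (Complex.I * cderiv (fun x => cderiv (leviFn θ L₂ L₁) x (L₃ x)) p (L₄ p))

/-! ### Holomorphic coordinates and weights -/

/-- A biholomorphic map between open subsets of `ℂⁿ`. -/
def IsBiholomorphic (Φ : OpenPartialHomeomorph (Cn n) (Cn n)) : Prop :=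
  AnalyticOnNhd ℂ Φ Φ.source ∧ AnalyticOnNhd ℂ Φ.symm Φ.target

/-- The complexified differential of a holomorphic map. -/
noncomputable def pushV (Φ : Cn n → Cn n) (x : Cn n) (X : CVec n) : CVec n :=
  (fderiv ℂ Φ x X.1, star (fderiv ℂ Φ x (star X.2)))

/-- The push-forward of a vector field under a biholomorphic map. -/
noncomputable def pushField (Φ : OpenPartialHomeomorph (Cn n) (Cn n)) (X : Cn n → CVec n) :
    Cn n → CVec n :=
  fun y => pushV Φ (Φ.symm y) (X (Φ.symm y))

/-- `Φ` is a biholomorphic map taking `M` (in its source) to `M'` (in its target). -/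
def IsCRMap (M M' : Set (Cn n)) (Φ : OpenPartialHomeomorph (Cn n) (Cn n)) : Prop :=
  IsBiholomorphic Φ ∧ ∀ x ∈ Φ.source, (Φ x ∈ M' ↔ x ∈ M)

/-- The index of the variable `zⱼ` (`Sum.inl j`) or `z̄ⱼ` (`Sum.inr j`). -/
def varIndex (s : Fin n ⊕ Fin n) : Fin n := Sum.elim id id s

/-- The coordinate field `∂/∂zⱼ` or `∂/∂z̄ⱼ`. -/
def coordV : Fin n ⊕ Fin n → CVec n
  | Sum.inl j => (Pi.single j 1, 0)
  | Sum.inr j => (0, Pi.single j 1)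

/-- The weight of the monomial that is the product of the variables in the list, each `zⱼ`, `z̄ⱼ`
having the weight `1 / Λⱼ`. -/
noncomputable def weight (Λ : Fin n → ℝ≥0∞) (l : List (Fin n ⊕ Fin n)) : ℝ≥0∞ :=
  (l.map fun s => (Λ (varIndex s))⁻¹).sum

/-- `f = O_Λ(1)`: the Taylor coefficients of `f` at `0` of weight less than `1` vanish. -/
def IsBigOWeight (Λ : Fin n → ℝ≥0∞) (f : Cn n → ℂ) : Prop :=
  ∀ l : List (Fin n ⊕ Fin n), weight Λ l < 1 → iterCderiv (l.map coordV) f 0 = 0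

/-- `f = o_w(1)`: all terms in the Taylor expansion of `f` at `0` have weight greater than `1`. -/
def IsLittleOWeight (Λ : Fin n → ℝ≥0∞) (f : Cn n → ℂ) : Prop :=
  ∀ l : List (Fin n ⊕ Fin n), weight Λ l ≤ 1 → iterCderiv (l.map coordV) f 0 = 0

/-- The tuple `(1, 2, …, 2, 4, …, 4)` with `q` entries equal to `2`. -/
noncomputable def blockWeights (n q : ℕ) (j : Fin n) : ℝ≥0∞ :=
  if (j : ℕ) = 0 then 1 else if (j : ℕ) ≤ q then 2 else 4

/-- `φ` is a real-valued homogeneous polynomial of degree `4` in `zⱼ, z̄ⱼ`, `j > q`. -/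
def IsRealQuarticPolynomial (q : ℕ) (φ : Cn n → ℝ) : Prop :=
  ∃ P : MvPolynomial (Fin n ⊕ Fin n) ℂ, P.IsHomogeneous 4 ∧
    (∀ s ∈ P.vars, q < (varIndex s : ℕ)) ∧
    ∀ x, (φ x : ℂ) = MvPolynomial.eval (Sum.elim x (star x)) P

/-- Plurisubharmonicity of a `C²` function: its complex Hessian is positive semidefinite. -/
def IsPlurisubharmonic (φ : Cn n → ℝ) : Prop :=
  ContDiff ℝ 2 φ ∧ ∀ x a : Cn n,
    0 ≤ (iterCderiv [((a, 0) : CVec n), ((0, star a) : CVec n)] (fun y => (φ y : ℂ)) x).re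

/-! ### Type and multitype -/

/-- The vanishing order at `0` of a function of one complex variable. -/
noncomputable def vanishingOrder {F : Type*} [NormedAddCommGroup F] (f : ℂ → F) : ℕ∞ :=
  sSup {k : ℕ∞ | ∃ m : ℕ, k = m ∧ f =O[𝓝 0] fun t => ‖t‖ ^ m}

/-- A germ at `0` of a nonconstant holomorphic curve through `p`. -/
def IsCurveGerm (p : Cn n) (γ : ℂ → Cn n) : Prop :=
  AnalyticAt ℂ γ 0 ∧ γ 0 = p ∧ ¬ ∀ᶠ t in 𝓝 0, γ t = p

/-- The D'Angelo type of `M` at `p`, the supremum of `ν(ρ ∘ γ) / ν(γ - p)`. (The order does not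
depend on the choice of the defining function `ρ`.) -/
noncomputable def dAngeloType (M : Set (Cn n)) (p : Cn n) : ℝ≥0∞ :=
  ⨆ (γ : ℂ → Cn n) (_ : IsCurveGerm p γ) (U : Set (Cn n)) (ρ : Cn n → ℝ)
    (_ : p ∈ U ∧ IsDefiningFunction M U ρ),
    (vanishingOrder (fun t => ρ (γ t)) : ℝ≥0∞) / (vanishingOrder (fun t => γ t - p) : ℝ≥0∞)

/-- The regular type of `M` at `p`, the supremum of `ν(ρ ∘ γ)` over regular curves `γ`. -/
noncomputable def regularType (M : Set (Cn n)) (p : Cn n) : ℝ≥0∞ :=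
  ⨆ (γ : ℂ → Cn n) (_ : IsCurveGerm p γ ∧ deriv γ 0 ≠ 0) (U : Set (Cn n)) (ρ : Cn n → ℝ)
    (_ : p ∈ U ∧ IsDefiningFunction M U ρ),
    (vanishingOrder (fun t => ρ (γ t)) : ℝ≥0∞)

/-- Admissible weights: `1 ≤ λ₁ ≤ … ≤ λₙ ≤ ∞`, and for each `k` either `λₖ = ∞` or
`∑_{j ≤ k} aⱼ / λⱼ = 1` for some nonnegative integers `aⱼ` with `aₖ > 0`. -/
def IsAdmissibleWeight (Λ : Fin n → ℝ≥0∞) : Prop :=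
  Monotone Λ ∧ (∀ j, 1 ≤ Λ j) ∧ ∀ k, Λ k = ⊤ ∨
    ∃ a : Fin n → ℕ, (∀ j, k < j → a j = 0) ∧ 0 < a k ∧ ∑ j, (a j : ℝ≥0∞) * (Λ j)⁻¹ = 1

/-- The admissible weights `Λ` for which there are holomorphic coordinates vanishing at `p`, where
`M` has a defining function that is `O_Λ(1)`. -/
def distinguishedWeights (M : Set (Cn n)) (p : Cn n) : Set (Fin n → ℝ≥0∞) :=
  {Λ | IsAdmissibleWeight Λ ∧
    ∃ (Φ : OpenPartialHomeomorph (Cn n) (Cn n)) (U : Set (Cn n)) (ρ : Cn n → ℝ),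
      IsBiholomorphic Φ ∧ p ∈ Φ.source ∧ Φ p = 0 ∧ (0 : Cn n) ∈ U ∧ U ⊆ Φ.target ∧
      IsDefiningFunction (Φ.symm ⁻¹' M) U ρ ∧ IsBigOWeight Λ fun x => (ρ x : ℂ)}

/-- `Λ` is Catlin's multitype of `M` at `p`: the supremum of the distinguished admissible weights in
the lexicographic order. -/
def IsMultitype (M : Set (Cn n)) (p : Cn n) (Λ : Fin n → ℝ≥0∞) : Prop :=
  IsLUB (toLex '' distinguishedWeights M p) (toLex Λ)

/-- A totally real subspace of `ℂⁿ`. -/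
def IsTotallyReal (W : Submodule ℝ (Cn n)) : Prop :=
  ∀ v ∈ W, Complex.I • v ∈ W → v = 0

end LeviGeom

open LeviGeom

/-!
The proof computes with a local defining function `ρ`, signed so that its Levi form `lev ρ` is
nonnegative on `(1,0)` tangent vectors (`LevPsd`). Up to a smooth factor, `⟨θ, [L², L¹]⟩`
is `lev ρ` of the components, so the Levi kernel and every Levi-kernel condition become conditions on
`lev ρ` and its derivatives along `M`.

*Sections of `S¹⁰(q)`.* A nonnegative function has vanishing first derivatives at a zero. For the
Levi form this says that `⟨θ, [L¹, L̄]⟩` has vanishing derivatives at `p` as soon as `L¹` and `L`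
have values in the Levi kernel at `p` (`cderiv_lev_eq_zero`). Let `L` be orthogonal to a
nondegenerate rank `q` subbundle `V`, and `p` a point of rank at most `q`. Then `V` spans a
complement of the Levi kernel at `p`, so `L` is in the kernel up to order `1`: its products with
sections of `V` vanish identically. Projecting along `V` gives sections of `S¹⁰(q)` with prescribed
values in `K¹⁰` (`exists_S10_of_mem_K10`).

*The tensor.* On fields in the kernel up to order `1` the Levi form vanishes to first order at `p`,
so its second derivatives there depend on point values only; they are `quarticVal`, and give
`exists_isQuarticTensor`. Positivity is the second-order condition at a minimum (`D2_nonneg`).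

*The submanifold.* The functions `L³⟨θ, [L², L¹]⟩` with `L², L̄¹` in `S¹⁰(q)` vanish at the points
of rank `q`, and their differentials at `p` are the components of the tensor. A maximal family of
their real and imaginary parts with independent differentials cuts out `S`, whose tangent space is
then the real kernel of the tensor (`exists_submanifold`).

*The normal form.* Taylor polynomials of `ρ` and of its derivatives along a basis adapted to the
Levi form are holomorphic coordinates that remove the holomorphic terms of `ρ` (`exists_chart`);
solving for `Re w` writes `M` as a graph (`exists_isGraphChart`). The low-weight terms that no
coordinate change removes are first derivatives of the Levi form along its kernel, and vanish by
`cderiv_lev_eq_zero` again (`iterCderiv_remainder_eq_zero`). The remaining terms of weight `1` are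
the squares and the quartic part, whose fourth derivatives are the tensor (`quarticVal_eq`).

*Type at most `4`.* If the tensor vanished on the line of `v ∈ K¹⁰`, the quartic part on that line
would be the real part of `κ ζ⁴` (`exists_re_pow_of_line`), and bending the line in the direction of
`w` would give a regular curve with contact of order at least `5` (`five_le_regularType`). This
yields `exists_tensor_ne_zero`, total reality and the equality of the types. For the multitype
(`isMultitype_blockWeights`), the normal form shows that the block weight is admissible. A
lexicographically larger weight first differs from it at the entry `1`, against `dρ ≠ 0`, at an
entry `2`, where it would force the Levi rank below `q`, or at an entry `4`, where an axis would
have contact of order at least `5`.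
-/

noncomputable section

namespace LeviGeom

open Complex (I ofReal_re ofReal_im reCLM ofRealCLM star_def I_mul_I conj_mul' add_conj add_re
  neg_re sub_re re_ofReal_mul ofReal_sum ofReal_pow ofReal_mul continuous_re coe_smul re_add_im
  I_ne_zero zero_re ofReal_zero ofReal_eq_zero isBigO_ofReal_left)
open Finset (sum_congr univ sum_eq_zero mul_sum sum_insert sum_const_zero sum_add_distrib
  sum_eq_single sum_sub_distrib mem_univ analyticAt_fun_sum mem_inter mem_filter mem_insert_of_mem
  smul_sum sum_mul sum_comm sum_div sum_smul sum_range_succ' sum_subset subset_univ)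
open MvPolynomial (pderiv pderiv_X pderiv_C pderiv_X_of_ne eval eval_X eval_C isHomogeneous_C
  vars_mul)
open ContinuousLinearMap (proj coe_restrictScalars' coe_injective)
open Submodule (smul_mem span mem_sup finrank_sup_add_finrank_inf_eq span_le mem_span_pair
  mem_span_singleton_self finrank_eq_zero add_mem_sup)
open Sum (inl inr swap_inr swap_inl swap_swap)
open Pi (single single_apply single_star single_eq_of_ne single_eq_same)
open List (map_cons sum_cons map_append map_nil sum_nil reverseRecOn foldr_append foldr_cons
  foldr_nil cons_append)
open Set (inter_subset_right inter_subset_left)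
open Prod (fst_sum smul_fst fst_sub fst_add snd_sum)
open Fintype (sum_sum_type)
open Module (finrank finBasisOfFinrankEq)
open AddSubmonoidClass (coe_finsetSum)
open Submodule.Quotient (mk_surjective)

/-! ### Calculus of complexified derivatives -/

/-- Smoothness at a point. -/
notation "SmoothAt" => ContDiffAt ℝ ∞

/-- The index set of the variables `zⱼ` and `z̄ⱼ`. -/
abbrev Idx (n : ℕ) := Fin n ⊕ Fin n

/-- Polynomials in the variables `zⱼ` and `z̄ⱼ`. -/
abbrev CPoly (n : ℕ) := MvPolynomial (Idx n) ℂ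

variable {n : ℕ} {M M' U V W : Set (Cn n)} {ρ : Cn n → ℝ} {x y p : Cn n} {q k m : ℕ} {f g : Cn n → ℂ}
  {s : Idx n} {A : Finset (Idx n)} {X Y v : CVec n} {P : CPoly n} {τ : Tensor4 M p} {ι : Type*}
  {Φ : OpenPartialHomeomorph (Cn n) (Cn n)} {G : Cn n → ℝ}

section calculus

variable {F G : Type*} [NormedAddCommGroup F] [NormedSpace ℂ F] [NormedAddCommGroup G]
    [NormedSpace ℂ G]

/-- The coordinates of a complexified tangent vector in the frame `coordV`. -/
def coordOf (s : Idx n) : CVec n →L[ℂ] ℂ :=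
  Sum.elim (fun j => (proj j).comp (ContinuousLinearMap.fst ℂ _ _))
    (fun j => (proj j).comp (ContinuousLinearMap.snd ℂ _ _)) s

@[simp] lemma coordOf_inl (j : Fin n) (X : CVec n) : coordOf (inl j) X = X.1 j := rfl
@[simp] lemma coordOf_inr (j : Fin n) (X : CVec n) : coordOf (inr j) X = X.2 j := rfl

lemma sum_coordOf (X : CVec n) : ∑ s, coordOf s X • coordV s = X := by
  rw [sum_sum_type]
  refine Prod.ext ?_ ?_ <;> funext i <;>
    simp [coordV, fst_sum, snd_sum, Finset.sum_apply, single_apply]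

lemma coordOf_coordV (s t : Idx n) : coordOf s (coordV t) = if s = t then 1 else 0 := by
  rcases s with s | s <;> rcases t with t | t <;> simp [coordV, single_apply]

/-- `cderiv` as a linear map in the direction. -/
def cderivₗ (f : Cn n → F) (x : Cn n) : CVec n →ₗ[ℂ] F where
  toFun := cderiv f x
  map_add' := cderiv_add_right f x
  map_smul' := cderiv_smul_right f x

@[simp] lemma cderivₗ_apply (f : Cn n → F) (x : Cn n) (X : CVec n) : cderivₗ f x X = cderiv f x X :=
    rfl

lemma cderiv_eq_sum (f : Cn n → F) (x : Cn n) (X : CVec n) : cderiv f x X = ∑ s, coordOf s X •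
    cderiv f x (coordV s) := by
  conv_lhs => rw [← sum_coordOf X, ← cderivₗ_apply, map_sum]
  simp

lemma cderiv_fst_eq_sum (f : Cn n → F) (x a : Cn n) : cderiv f x (a, 0) = ∑ j, a j • cderiv f x
    (coordV (inl j)) := by
  simp [cderiv_eq_sum f x (a, 0), sum_sum_type]

lemma cderiv_snd_eq_sum (f : Cn n → F) (x b : Cn n) : cderiv f x (0, b) = ∑ j, b j • cderiv f x
    (coordV (inr j)) := by
  simp [cderiv_eq_sum f x (0, b), sum_sum_type]

lemma cderiv_sub_right (f : Cn n → F) (x : Cn n) (X Y : CVec n) : cderiv f x (X - Y) = cderiv f x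
    X - cderiv f x Y := by
  simp only [← cderivₗ_apply, map_sub]

lemma cderiv_ofRealV (f : Cn n → F) (x v : Cn n) : cderiv f x (ofRealV v) = fderiv ℝ f x v := by
  simp only [cderiv, ofRealV, star_star]
  module

lemma cderiv_congr {f g : Cn n → F} (h : f =ᶠ[𝓝 x] g) (X : CVec n) : cderiv f x X = cderiv g x
    X := by
  simp only [cderiv, h.fderiv_eq]

@[simp] lemma cderiv_const (c : F) (x : Cn n) (X : CVec n) : cderiv (fun _ => c) x X = 0 := by
  simp [cderiv]

lemma cderiv_fun_add {f g : Cn n → F} (hf : DifferentiableAt ℝ f x) (hg : DifferentiableAt ℝ g x)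
    (X : CVec n) : cderiv (fun y => f y + g y) x X = cderiv f x X + cderiv g x X :=
  cderiv_add_left hf hg X

lemma cderiv_fun_sub {f g : Cn n → F} (hf : DifferentiableAt ℝ f x) (hg : DifferentiableAt ℝ g x)
    (X : CVec n) : cderiv (fun y => f y - g y) x X = cderiv f x X - cderiv g x X := by
  simp only [cderiv, fderiv_fun_sub hf hg, sub_apply]
  module

lemma cderiv_fun_neg {f : Cn n → F} (X : CVec n) : cderiv (fun y => - f y) x X = - cderiv f x
    X := by
  simp only [cderiv, fderiv_fun_neg, neg_apply]
  module

lemma cderiv_fun_sum (s : Finset ι) {f : ι → Cn n → F} (hf : ∀ i ∈ s, DifferentiableAt ℝ (f i) x)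
    (X : CVec n) : cderiv (fun y => ∑ i ∈ s, f i y) x X = ∑ i ∈ s, cderiv (f i) x X := by
  classical
  induction s using Finset.induction_on with
  | empty => simp
  | insert a s ha ih =>
    simp only [sum_insert ha]
    rw [cderiv_fun_add (hf a (by simp)) (DifferentiableAt.fun_sum fun i hi => hf i (by simp [hi])),
      ih fun i hi => hf i (by simp [hi])]

lemma cderiv_fun_smul {c : Cn n → ℂ} {f : Cn n → F} (hc : DifferentiableAt ℝ c x)
    (hf : DifferentiableAt ℝ f x) (X : CVec n) : cderiv (fun y => c y • f y) x X = c x • cderiv f x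
    X + cderiv c x X • f x := by
  simp only [cderiv, fderiv_fun_smul hc hf, add_apply, smul_apply,
    ContinuousLinearMap.smulRight_apply,
    smul_eq_mul]
  module

lemma cderiv_fun_mul (hf : DifferentiableAt ℝ f x) (hg : DifferentiableAt ℝ g x) (X : CVec n) :
    cderiv (fun y => f y * g y) x X = f x * cderiv g x X + cderiv f x X * g x :=
  cderiv_fun_smul hf hg X

lemma cderiv_clm (ℓ : F →L[ℂ] G) {f : Cn n → F} (hf : DifferentiableAt ℝ f x) (X : CVec n) : cderiv
    (fun y => ℓ (f y)) x X = ℓ (cderiv f x X) := by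
  have h : fderiv ℝ (fun y => ℓ (f y)) x = (ℓ.restrictScalars ℝ).comp (fderiv ℝ f x) :=
    ((ℓ.restrictScalars ℝ).hasFDerivAt.comp x hf.hasFDerivAt).fderiv
  simp only [cderiv, h, ContinuousLinearMap.comp_apply, coe_restrictScalars',
    map_smul, map_add, map_sub]

lemma cderiv_const_mul (c : ℂ) (hf : DifferentiableAt ℝ f x) (X : CVec n) : cderiv
    (fun y => c * f y) x X = c * cderiv f x X := by
  rw [cderiv_fun_mul (differentiableAt_const c) hf]; simp

lemma ContDiffAt.diffAt {f : Cn n → F} (hf : SmoothAt f x) : DifferentiableAt ℝ f x :=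
    hf.differentiableAt (by simp)

lemma contDiffAt_clmC (ℓ : F →L[ℂ] G) {f : Cn n → F} (hf : SmoothAt f x) : SmoothAt
    (fun y => ℓ (f y)) x :=
  (ℓ.restrictScalars ℝ).contDiff.contDiffAt.comp x hf

lemma contDiffAt_star {f : Cn n → Cn n} (hf : SmoothAt f x) : SmoothAt (fun y => star (f y)) x :=
  ((starL' ℝ : Cn n ≃L[ℝ] Cn n).contDiff.contDiffAt).comp x hf

lemma contDiffAt_conj (hf : SmoothAt f x) : SmoothAt (fun y => star (f y)) x :=
  ((starL' ℝ : ℂ ≃L[ℝ] ℂ).contDiff.contDiffAt).comp x hf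

lemma contDiffAt_cderiv {f : Cn n → F} {X : Cn n → CVec n} (hf : SmoothAt f x) (hX : SmoothAt X x) :
    SmoothAt (fun y => cderiv f y (X y)) x := by
  have hD : SmoothAt (fderiv ℝ f) x := hf.fderiv_right (by simp)
  have h1 : SmoothAt (fun y => (X y).1) x := contDiff_fst.contDiffAt.comp x hX
  have h2 : SmoothAt (fun y => star (X y).2) x :=
    contDiffAt_star (contDiff_snd.contDiffAt.comp x hX)
  have hI : ∀ {g : Cn n → Cn n}, SmoothAt g x →
      SmoothAt (fun y => I • g y) x := fun hg => hg.const_smul I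
  exact ((hD.clm_apply h1).sub ((hD.clm_apply (hI h1)).const_smul I)).add
    ((hD.clm_apply h2).add ((hD.clm_apply (hI h2)).const_smul I)) |>.const_smul _

lemma contDiffAt_cderiv_const {f : Cn n → F} (X : CVec n) (hf : SmoothAt f x) : SmoothAt
    (fun y => cderiv f y X) x :=
  contDiffAt_cderiv hf contDiffAt_const

lemma two_le_infty : (2 : WithTop ℕ∞) ≤ ((⊤ : ℕ∞) : WithTop ℕ∞) := by
  have : ((2 : ℕ∞) : WithTop ℕ∞) ≤ ((⊤ : ℕ∞) : WithTop ℕ∞) := WithTop.coe_le_coe.2 le_top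
  exact this

lemma cderiv_cderiv_comm {f : Cn n → F} (hf : SmoothAt f x) (X Y : CVec n) : cderiv
    (fun y => cderiv f y X) x Y = cderiv (fun y => cderiv f y Y) x X := by
  have hD : DifferentiableAt ℝ (fderiv ℝ f) x :=
    (hf.fderiv_right (m := ∞) (by simp)).differentiableAt (by simp)
  have hs : IsSymmSndFDerivAt ℝ f x := hf.isSymmSndFDerivAt (by simpa using two_le_infty)
  have key : ∀ Z : CVec n, ∀ v, fderiv ℝ (fun y => cderiv f y Z) x v =
      (1 / 2 : ℂ) • ((fderiv ℝ (fderiv ℝ f) x v Z.1 - I • fderiv ℝ (fderiv ℝ f) x v (I • Z.1)) +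
      (fderiv ℝ (fderiv ℝ f) x v (star Z.2) + I • fderiv ℝ (fderiv ℝ f) x v (I • star Z.2))) := by
    intro Z v
    have h : ∀ w, HasFDerivAt (fun y => fderiv ℝ f y w) ((fderiv ℝ (fderiv ℝ f) x).flip w) x :=
      fun w => by simpa using hD.hasFDerivAt.clm_apply (hasFDerivAt_const w x)
    have := (((h Z.1).sub ((h (I • Z.1)).const_smul I)).add
      ((h (star Z.2)).add ((h (I • star Z.2)).const_smul I))).const_smul
        (1 / 2 : ℂ)
    have h2 : (fun y => cderiv f y Z) = (1 / 2 : ℂ) • (((fun y => fderiv ℝ f y Z.1) -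
        I • fun y => fderiv ℝ f y (I • Z.1)) + ((fun y => fderiv ℝ f y (star Z.2)) +
        I • fun y => fderiv ℝ f y (I • star Z.2))) := rfl
    rw [h2, this.fderiv]
    simp
  rw [cderiv, cderiv]
  simp only [key]
  rw [hs X.1 Y.1, hs X.1 (star Y.2), hs (star X.2) Y.1, hs (star X.2) (star Y.2),
    hs X.1 (I • Y.1), hs X.1 (I • star Y.2), hs (star X.2) (I • Y.1),
    hs (star X.2) (I • star Y.2), hs (I • X.1) Y.1, hs (I • X.1) (star Y.2),
    hs (I • star X.2) Y.1, hs (I • star X.2) (star Y.2),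
    hs (I • X.1) (I • Y.1), hs (I • X.1) (I • star Y.2),
    hs (I • star X.2) (I • Y.1), hs (I • star X.2) (I • star Y.2)]
  module

lemma contDiffAt_coordOf {X : Cn n → CVec n} (hX : SmoothAt X x) (s : Idx n) : SmoothAt
    (fun y => coordOf s (X y)) x :=
  contDiffAt_clmC _ hX

/-- Derivative of `Y f` along `Z`, for a field `Y`. -/
lemma cderiv_cderiv_field {f : Cn n → F} {Y : Cn n → CVec n} (hf : SmoothAt f x) (hY : SmoothAt Y x)
    (Z : CVec n) : cderiv (fun y => cderiv f y (Y y)) x Z = cderiv (fun y => cderiv f y (Y x)) x Z +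
    cderiv f x (cderiv Y x Z) := by
  have h1 : (fun y => cderiv f y (Y y)) =
      fun y => ∑ s, coordOf s (Y y) • cderiv f y (coordV s) := funext fun y => cderiv_eq_sum _ _ _
  have h2 : (fun y => cderiv f y (Y x)) =
      fun y => ∑ s, coordOf s (Y x) • cderiv f y (coordV s) := funext fun y => cderiv_eq_sum _ _ _
  have hc : ∀ s, DifferentiableAt ℝ (fun y => cderiv f y (coordV s)) x := fun s =>
    (contDiffAt_cderiv_const _ hf).diffAt
  have hY' : ∀ s, DifferentiableAt ℝ (fun y => coordOf s (Y y)) x := fun s =>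
    (contDiffAt_coordOf hY s).diffAt
  rw [h1, h2, cderiv_fun_sum _ (fun s _ => (hY' s).fun_smul (hc s)),
    cderiv_fun_sum _ (fun s _ => (hc s).fun_const_smul _), cderiv_eq_sum f x (cderiv Y x Z),
    ← sum_add_distrib]
  refine sum_congr rfl fun s _ => ?_
  rw [cderiv_fun_smul (hY' s) (hc s), cderiv_fun_smul (differentiableAt_const _) (hc s),
    cderiv_clm _ hY.diffAt]
  simp

lemma cderiv_bracket {f : Cn n → F} {X Y : Cn n → CVec n} (hf : SmoothAt f x) (hX : SmoothAt X x)
    (hY : SmoothAt Y x) : cderiv f x (bracket X Y x) = cderiv (fun y => cderiv f y (Y y)) x (X x) -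
    cderiv (fun y => cderiv f y (X y)) x (Y x) := by
  rw [cderiv_cderiv_field hf hX, cderiv_cderiv_field hf hY, bracket, cderiv_sub_right,
    cderiv_cderiv_comm hf (Y x)]
  abel

lemma contDiffAt_bracket {X Y : Cn n → CVec n} (hX : SmoothAt X x) (hY : SmoothAt Y x) : SmoothAt
    (bracket X Y) x :=
  (contDiffAt_cderiv hY hX).sub (contDiffAt_cderiv hX hY)

/-! ### Conjugation -/

@[simp] lemma conjV_conjV (X : CVec n) : conjV (conjV X) = X := by simp [conjV]
@[simp] lemma conjField_conjField (X : Cn n → CVec n) : conjField (conjField X) = X := by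
  funext x; simp [conjField]
lemma conjV_add (X Y : CVec n) : conjV (X + Y) = conjV X + conjV Y := by simp [conjV]
lemma conjV_smul (c : ℂ) (X : CVec n) : conjV (c • X) = star c • conjV X := by simp [conjV]
@[simp] lemma conjV_zero : conjV (0 : CVec n) = 0 := by simp [conjV]
lemma conjV_sum {ι : Type*} (s : Finset ι) (X : ι → CVec n) : conjV (∑ i ∈ s, X i) = ∑ i ∈ s, conjV
    (X i) := by
  classical
  induction s using Finset.induction_on with
  | empty => simp
  | insert a s ha ih => rw [sum_insert ha, conjV_add, ih, sum_insert ha]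
@[simp] lemma conjV_ofRealV (v : Cn n) : conjV (ofRealV v) = ofRealV v := by simp [conjV, ofRealV]

lemma eq_ofRealV_of_conjV_eq (h : conjV X = X) : X = ofRealV X.1 := by
  have := congrArg Prod.snd h
  simp only [conjV] at this
  exact Prod.ext rfl this.symm

lemma contDiffAt_conjField {X : Cn n → CVec n} (hX : SmoothAt X x) : SmoothAt (conjField X) x :=
  (contDiffAt_star (contDiff_snd.contDiffAt.comp x hX)).prodMk
    (contDiffAt_star (contDiff_fst.contDiffAt.comp x hX))

lemma cderiv_conj (hf : DifferentiableAt ℝ f x) (X : CVec n) : cderiv (fun y => star (f y)) x X =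
    star (cderiv f x (conjV X)) := by
  have h : fderiv ℝ (fun y => star (f y)) x =
      ((starL' ℝ : ℂ ≃L[ℝ] ℂ) : ℂ →L[ℝ] ℂ).comp (fderiv ℝ f x) :=
    (((starL' ℝ : ℂ ≃L[ℝ] ℂ) : ℂ →L[ℝ] ℂ).hasFDerivAt.comp x hf.hasFDerivAt).fderiv
  simp only [cderiv, h, ContinuousLinearMap.comp_apply, conjV]
  simp
  ring

lemma coordOf_conjV (s : Idx n) (X : CVec n) : coordOf s (conjV X) = star (coordOf s.swap X) := by
  rcases s with s | s <;> simp [conjV]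

lemma conjV_coordV (s : Idx n) : conjV (coordV s) = (coordV s.swap : CVec n) := by
  rcases s with s | s <;> simp [conjV, coordV, Pi.star_single]

lemma ext_coordOf (h : ∀ s, coordOf s X = coordOf s Y) : X = Y := by
  rw [← sum_coordOf X, ← sum_coordOf Y]; simp [h]

/-! ### Chain rule with holomorphic maps -/

lemma cderiv_comp_holo {f : Cn n → F} {Φ : Cn m → Cn n} {x : Cn m} (hf : DifferentiableAt ℝ f (Φ x))
    (hΦ : DifferentiableAt ℂ Φ x) (X : CVec m) : cderiv (fun y => f (Φ y)) x X = cderiv f (Φ x)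
    (fderiv ℂ Φ x X.1, star (fderiv ℂ Φ x (star X.2))) := by
  have h : fderiv ℝ (fun y => f (Φ y)) x =
      (fderiv ℝ f (Φ x)).comp ((fderiv ℂ Φ x).restrictScalars ℝ) :=
    (hf.hasFDerivAt.comp x (hΦ.hasFDerivAt.restrictScalars ℝ)).fderiv
  simp only [cderiv, h, ContinuousLinearMap.comp_apply, coe_restrictScalars', star_star, map_smul]

lemma cderiv_comp_push {f : Cn n → F} {Φ : Cn n → Cn n} (hf : DifferentiableAt ℝ f (Φ x))
    (hΦ : DifferentiableAt ℂ Φ x) (X : CVec n) : cderiv (fun y => f (Φ y)) x X = cderiv f (Φ x)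
    (pushV Φ x X) :=
  cderiv_comp_holo hf hΦ X

/-- The coordinate function `zⱼ` or `z̄ⱼ`. -/
def coordFn (s : Idx n) (x : Cn n) : ℂ := coordOf s (ofRealV x)

lemma coordOf_ofRealV (s : Idx n) (x : Cn n) : coordOf s (ofRealV x) = Sum.elim x (star x) s := by
  rcases s with s | s <;> rfl

lemma contDiff_ofRealV : ContDiff ℝ ∞ (ofRealV : Cn n → CVec n) :=
  contDiff_id.prodMk (starL' ℝ : Cn n ≃L[ℝ] Cn n).contDiff

lemma contDiff_coordFn (s : Idx n) : ContDiff ℝ ∞ (coordFn (n := n) s) :=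
  ((coordOf s).restrictScalars ℝ).contDiff.comp contDiff_ofRealV

lemma cderiv_coordFn (s : Idx n) (x : Cn n) (X : CVec n) : cderiv (coordFn s) x X = coordOf s
    X := by
  have h : fderiv ℝ (ofRealV : Cn n → CVec n) x =
      (ContinuousLinearMap.id ℝ (Cn n)).prod ((starL' ℝ : Cn n ≃L[ℝ] Cn n) : Cn n →L[ℝ] Cn n) :=
    ((hasFDerivAt_id (𝕜 := ℝ) x).prodMk
      ((starL' ℝ : Cn n ≃L[ℝ] Cn n) : Cn n →L[ℝ] Cn n).hasFDerivAt).fderiv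
  have h2 : cderiv (ofRealV : Cn n → CVec n) x X = X := by
    simp only [cderiv, h]
    refine Prod.ext ?_ ?_
    · simp only [ContinuousLinearMap.prod_apply, ContinuousLinearMap.id_apply, smul_fst,
        fst_add, fst_sub]
      have : ∀ v : Cn n, I • (I • v) = -v := by intro v; rw [smul_smul, I_mul_I, neg_one_smul]
      rw [this, this]; module
    · funext i
      simp
      linear_combination (2⁻¹ * (starRingEnd ℂ) (X.1 i) - 2⁻¹ * X.2 i) * I_mul_I
  have : coordFn (n := n) s = fun y => coordOf s (ofRealV y) := rfl
  rw [this, cderiv_clm _ (contDiff_ofRealV.contDiffAt.differentiableAt (by simp)), h2]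

lemma cderiv_apply_coord (j : Fin n) (x : Cn n) (X : CVec n) : cderiv (fun y : Cn n => y j) x X =
    X.1 j :=
  cderiv_coordFn (inl j) x X

lemma cderiv_add_star [NeZero n] (x : Cn n) (X : CVec n) : cderiv (fun y : Cn n => y 0 + star (y 0))
    x X = X.1 0 + X.2 0 := by
  have h := fun s => (contDiff_coordFn (n := n) s).contDiffAt (x := x) |>.diffAt
  exact (cderiv_fun_add (h (inl 0)) (h (inr 0)) X).trans
    (congrArg₂ _ (cderiv_coordFn _ x X) (cderiv_coordFn _ x X))

end calculus

/-! ### Tangent spaces of level sets -/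

/-- A real function, seen as a complex one. -/
abbrev toC (ρ : Cn n → ℝ) : Cn n → ℂ := fun x => (ρ x : ℂ)

lemma contDiffAt_toC (h : SmoothAt ρ x) : SmoothAt (toC ρ) x :=
  ofRealCLM.contDiff.contDiffAt.comp x h

lemma fderiv_toC (h : DifferentiableAt ℝ ρ x) (v : Cn n) : fderiv ℝ (toC ρ) x v =
    (fderiv ℝ ρ x v : ℂ) := by
  have : fderiv ℝ (toC ρ) x = ofRealCLM.comp (fderiv ℝ ρ x) :=
    (ofRealCLM.hasFDerivAt.comp x h.hasFDerivAt).fderiv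
  rw [this]; rfl

lemma contDiffAt_re {h : Cn n → ℂ} (hh : SmoothAt h x) : SmoothAt (fun y => (h y).re) x :=
  reCLM.contDiff.contDiffAt.comp x hh

lemma contDiffAt_im {h : Cn n → ℂ} (hh : SmoothAt h x) : SmoothAt (fun y => (h y).im) x :=
  Complex.imCLM.contDiff.contDiffAt.comp x hh

lemma cderiv_toC_of_fderiv [Fintype ι] {f : ι → Cn n → ℝ} {k : Cn n → ℝ}
    (hf : ∀ i, DifferentiableAt ℝ (f i) x) (hk : DifferentiableAt ℝ k x) {c : ι → ℝ}
    (h : fderiv ℝ k x = ∑ i, c i • fderiv ℝ (f i) x) (X : CVec n) : cderiv (toC k) x X = ∑ i,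
    (c i : ℂ) * cderiv (toC (f i)) x X := by
  simp only [cderiv, fderiv_toC hk, fderiv_toC (hf _), h, sum_apply, smul_apply,
    smul_eq_mul, ofReal_sum, ofReal_mul, mul_sum, ← sum_sub_distrib, ← sum_add_distrib]
  exact sum_congr rfl fun i _ => by ring

lemma cderiv_re_im {h : Cn n → ℂ} (hh : SmoothAt h x) (X : CVec n) : cderiv h x X = cderiv
    (toC fun y => (h y).re) x X + I * cderiv (toC fun y => (h y).im) x X := by
  rw [← cderiv_const_mul _ (contDiffAt_toC (contDiffAt_im hh)).diffAt,
    ← cderiv_fun_add (contDiffAt_toC (contDiffAt_re hh)).diffAt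
      (((contDiffAt_toC (contDiffAt_im hh)).diffAt).const_mul _)]
  congr 1
  funext y
  rw [mul_comm]
  exact (re_add_im (h y)).symm

/-- The Lagrange multiplier rule for a real function that is constant, or has a local extremum, on a
regular level set. -/
lemma exists_fderiv_eq_of_isLocalExtrOn [Fintype ι] {f : ι → Cn n → ℝ} {k : Cn n → ℝ}
    (hf : ∀ i, SmoothAt (f i) x) (hk : SmoothAt k x)
    (hli : LinearIndependent ℝ fun i => fderiv ℝ (f i) x)
    (hext : IsLocalExtrOn k {y | ∀ i, f i y = f i x} x) : ∃ c : ι → ℝ, fderiv ℝ k x = ∑ i, c i •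
    fderiv ℝ (f i) x := by
  obtain ⟨Λ, Λ₀, hne, hsum⟩ := hext.exists_multipliers_of_hasStrictFDerivAt
    (fun i => (hf i).hasStrictFDerivAt (by simp)) (hk.hasStrictFDerivAt (by simp))
  have h0 : Λ₀ ≠ 0 := by
    rintro rfl
    rw [zero_smul, add_zero] at hsum
    exact hne (Prod.ext (funext fun i => Fintype.linearIndependent_iff.1 hli Λ hsum i) rfl)
  refine ⟨fun i => -(Λ₀⁻¹ * Λ i), ?_⟩
  have h1 : Λ₀ • fderiv ℝ k x = -∑ i, Λ i • fderiv ℝ (f i) x := eq_neg_of_add_eq_zero_right hsum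
  calc fderiv ℝ k x = Λ₀⁻¹ • (Λ₀ • fderiv ℝ k x) := by rw [smul_smul, inv_mul_cancel₀ h0, one_smul]
    _ = _ := by
      rw [h1, smul_neg, smul_sum, ← Finset.sum_neg_distrib]
      exact sum_congr rfl fun i _ => by rw [smul_smul]; module

/-- A complex vector that annihilates the equations of a regular level set annihilates every
function vanishing on it. -/
lemma cderiv_eq_zero_of_level [Fintype ι] {f : ι → Cn n → ℝ} {h : Cn n → ℂ}
    (hf : ∀ i, SmoothAt (f i) x) (hh : SmoothAt h x)
    (hli : LinearIndependent ℝ fun i => fderiv ℝ (f i) x)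
    (hv : ∀ᶠ y in 𝓝 x, (∀ i, f i y = f i x) → h y = 0) (hX : ∀ i, cderiv (toC (f i)) x X = 0) :
    cderiv h x X = 0 := by
  have hx0 : h x = 0 := hv.self_of_nhds fun _ => rfl
  have key : ∀ k : Cn n → ℝ, SmoothAt k x → (∀ y, h y = 0 → k y = 0) → cderiv (toC k) x X = 0 := by
    intro k hk h0
    obtain ⟨c, hc⟩ := exists_fderiv_eq_of_isLocalExtrOn hf hk hli (Or.inl (by
      refine eventually_nhdsWithin_iff.2 (hv.mono fun y hy hy' => ?_)
      rw [h0 y (hy hy'), h0 x hx0]))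
    rw [cderiv_toC_of_fderiv (fun i => (hf i).differentiableAt (by simp))
      (hk.differentiableAt (by simp)) hc]
    simp [hX]
  rw [cderiv_re_im hh, key _ (contDiffAt_re hh) (fun y hy => by simp [hy]),
    key _ (contDiffAt_im hh) (fun y hy => by simp [hy])]
  simp

lemma mem_CT_of_level [Fintype ι] {f : ι → Cn n → ℝ} {S : Set (Cn n)} (hV : IsOpen V) (hxV : x ∈ V)
    (hf : ∀ i, ContDiffOn ℝ ∞ (f i) V) (hli : LinearIndependent ℝ fun i => fderiv ℝ (f i) x)
    (hS : ∀ y ∈ V, y ∈ S ↔ ∀ i, f i y = 0) (hxS : x ∈ S) : X ∈ CT S x ↔ ∀ i, cderiv (toC (f i)) x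
    X = 0 := by
  have hf' : ∀ i, ∀ y ∈ V, SmoothAt (f i) y := fun i y hy => (hf i).contDiffAt (hV.mem_nhds hy)
  constructor
  · intro hX i
    refine hX V _ hV hxV (fun y hy => (contDiffAt_toC (hf' i y hy)).contDiffWithinAt) ?_
    intro y hy
    simp [toC, (hS y hy.2).1 hy.1 i]
  · intro hX W h hW hxW hh h0
    refine cderiv_eq_zero_of_level (fun i => hf' i x hxV) (hh.contDiffAt (hW.mem_nhds hxW))
      hli ?_ hX
    filter_upwards [hV.mem_nhds hxV, hW.mem_nhds hxW] with y hyV hyW hy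
    refine h0 y ⟨(hS y hyV).2 fun i => ?_, hyW⟩
    rw [hy i, (hS x hxV).1 hxS i]

/-! ### Defining functions, the Levi form, and projections -/

section hypersurface

variable (h : IsDefiningFunction M U ρ) (hx : x ∈ M ∩ U)
include h

lemma IsDefiningFunction.contDiffAt (hx : x ∈ U) : SmoothAt ρ x :=
    h.2.1.contDiffAt (h.1.mem_nhds hx)

lemma IsDefiningFunction.contDiffAtC (hx : x ∈ U) : SmoothAt (toC ρ) x :=
    contDiffAt_toC (h.contDiffAt hx)

lemma IsDefiningFunction.mono (hW : IsOpen W) (hWU : W ⊆ U) : IsDefiningFunction M W ρ :=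
  ⟨hW, h.2.1.mono hWU, fun x hx => h.2.2.1 x (hWU hx), fun x hx => h.2.2.2 x (hWU hx)⟩

lemma IsDefiningFunction.linearIndependent (hx : x ∈ U) : LinearIndependent ℝ fun _ : Unit => fderiv
    ℝ ρ x :=
  LinearIndependent.of_subsingleton () (h.2.2.1 x hx)

include hx

lemma mem_CT_iff : X ∈ CT M x ↔ cderiv (toC ρ) x X = 0 := by
  rw [mem_CT_of_level (f := fun _ : Unit => ρ) h.1 hx.2 (fun _ => h.2.1)
    (h.linearIndependent hx.2) (fun y hy => by simpa using h.2.2.2 y hy) hx.1]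
  simp

/-- Tangential derivatives at `x` depend only on the values near `x` on the hypersurface. -/
lemma cderiv_eq_zero_of_eventually (hf : SmoothAt f x) (h0 : ∀ᶠ y in 𝓝 x, y ∈ M → f y = 0)
    (hX : X ∈ CT M x) : cderiv f x X = 0 := by
  refine cderiv_eq_zero_of_level (f := fun _ : Unit => ρ) (fun _ => h.contDiffAt hx.2) hf
    (h.linearIndependent hx.2) ?_ (fun _ => (mem_CT_iff h hx).1 hX)
  filter_upwards [h0, h.1.mem_nhds hx.2] with y hy hyU hy'
  exact hy ((h.2.2.2 y hyU).2 (by rw [hy' (), (h.2.2.2 x hx.2).1 hx.1]))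

lemma cderiv_congr_of_eventually (hf : SmoothAt f x) (hg : SmoothAt g x)
    (h0 : ∀ᶠ y in 𝓝 x, y ∈ M → f y = g y) (hX : X ∈ CT M x) : cderiv f x X = cderiv g x X := by
  rw [← sub_eq_zero, ← cderiv_fun_sub hf.diffAt hg.diffAt]
  exact cderiv_eq_zero_of_eventually h hx (hf.sub hg)
    (h0.mono fun y hy hyM => by rw [hy hyM, sub_self]) hX

omit h hx

/-- `∂ρ/∂zⱼ`. -/
def dzc (ρ : Cn n → ℝ) (j : Fin n) (x : Cn n) : ℂ := cderiv (toC ρ) x (coordV (inl j))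

/-- The `(1,0)` form `∂ρ`. -/
def dz (ρ : Cn n → ℝ) (x a : Cn n) : ℂ := ∑ j, a j * dzc ρ j x

/-- The complex Hessian `∂²ρ/∂zⱼ∂z̄ₖ`. -/
def lvm (ρ : Cn n → ℝ) (j k : Fin n) (x : Cn n) : ℂ := cderiv (dzc ρ j) x (coordV (inr k))

/-- The Levi form of `ρ`, as a complex bilinear form in a `(1,0)` and a `(0,1)` vector. -/
def lev (ρ : Cn n → ℝ) (x a b : Cn n) : ℂ := ∑ j, ∑ k, a j * b k * lvm ρ j k x

lemma dz_add (a b : Cn n) : dz ρ x (a + b) = dz ρ x a + dz ρ x b := by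
  simp [dz, add_mul, sum_add_distrib]
lemma dz_sub (a b : Cn n) : dz ρ x (a - b) = dz ρ x a - dz ρ x b := by
  simp [dz, sub_mul, sum_sub_distrib]
lemma dz_smul (c : ℂ) (a : Cn n) : dz ρ x (c • a) = c * dz ρ x a := by simp [dz, mul_sum, mul_assoc]
@[simp] lemma dz_zero : dz ρ x 0 = 0 := by simp [dz]
lemma dz_sum {ι : Type*} (s : Finset ι) (a : ι → Cn n) : dz ρ x (∑ i ∈ s, a i) = ∑ i ∈ s, dz ρ x
    (a i) := by
  simp only [dz, Finset.sum_apply, sum_mul]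
  exact sum_comm

lemma lev_add_left (a a' b : Cn n) : lev ρ x (a + a') b = lev ρ x a b + lev ρ x a' b := by
  simp [lev, add_mul, sum_add_distrib]
lemma lev_add_right (a b b' : Cn n) : lev ρ x a (b + b') = lev ρ x a b + lev ρ x a b' := by
  simp [lev, add_mul, mul_add, sum_add_distrib]
lemma lev_smul_left (c : ℂ) (a b : Cn n) : lev ρ x (c • a) b = c * lev ρ x a b := by
  simp [lev, mul_sum, mul_assoc]
lemma lev_smul_right (c : ℂ) (a b : Cn n) : lev ρ x a (c • b) = c * lev ρ x a b := by
  simp only [lev, mul_sum, Pi.smul_apply, smul_eq_mul]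
  exact sum_congr rfl fun i _ => sum_congr rfl fun j _ => by ring
@[simp] lemma lev_zero_left (b : Cn n) : lev ρ x 0 b = 0 := by simp [lev]
@[simp] lemma lev_zero_right (a : Cn n) : lev ρ x a 0 = 0 := by simp [lev]
lemma lev_sub_left (a a' b : Cn n) : lev ρ x (a - a') b = lev ρ x a b - lev ρ x a' b := by
  simp [lev, sub_mul, sum_sub_distrib]
lemma lev_sub_right (a b b' : Cn n) : lev ρ x a (b - b') = lev ρ x a b - lev ρ x a b' := by
  simp [lev, sub_mul, mul_sub, sum_sub_distrib]
lemma lev_sum_left {ι : Type*} (s : Finset ι) (a : ι → Cn n) (b : Cn n) : lev ρ x (∑ i ∈ s, a i) b =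
    ∑ i ∈ s, lev ρ x (a i) b := by
  classical
  induction s using Finset.induction_on with
  | empty => simp
  | insert i s hi ih => rw [sum_insert hi, lev_add_left, ih, sum_insert hi]
lemma lev_sum_right {ι : Type*} (s : Finset ι) (a : Cn n) (b : ι → Cn n) : lev ρ x a
    (∑ i ∈ s, b i) = ∑ i ∈ s, lev ρ x a (b i) := by
  classical
  induction s using Finset.induction_on with
  | empty => simp
  | insert i s hi ih => rw [sum_insert hi, lev_add_right, ih, sum_insert hi]

lemma cderiv_conjV_toC (h : SmoothAt ρ x) (X : CVec n) : cderiv (toC ρ) x (conjV X) = star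
    (cderiv (toC ρ) x X) := by
  have := cderiv_conj (contDiffAt_toC h).diffAt (conjV X)
  rw [conjV_conjV] at this
  rw [← this]
  congr 1
  funext y
  simp [toC]

lemma cderiv_toC_eq (h : SmoothAt ρ x) (X : CVec n) : cderiv (toC ρ) x X = dz ρ x X.1 + star
    (dz ρ x (star X.2)) := by
  rw [cderiv_eq_sum, sum_sum_type]
  congr 1
  simp only [dz, star_sum, star_mul', Pi.star_apply, star_star]
  refine sum_congr rfl fun j _ => ?_
  rw [dzc, ← cderiv_conjV_toC h, conjV_coordV]
  rfl

lemma cderiv_toC_fst (h : SmoothAt ρ x) (a : Cn n) : cderiv (toC ρ) x (a, 0) = dz ρ x a := by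
  simp [cderiv_toC_eq h]

lemma contDiffAt_dzc (h : SmoothAt ρ x) (j : Fin n) : SmoothAt (dzc ρ j) x :=
  contDiffAt_cderiv_const _ (contDiffAt_toC h)

lemma contDiffAt_lvm (h : SmoothAt ρ x) (j k : Fin n) : SmoothAt (lvm ρ j k) x :=
  contDiffAt_cderiv_const _ (contDiffAt_dzc h j)

lemma contDiffAt_apply {a : Cn n → Cn n} (ha : SmoothAt a x) (j : Fin n) : SmoothAt (fun y => a y j)
    x := contDiffAt_pi.1 ha j

lemma contDiffAt_dz (h : SmoothAt ρ x) {a : Cn n → Cn n} (ha : SmoothAt a x) : SmoothAt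
    (fun y => dz ρ y (a y)) x :=
  ContDiffAt.sum fun j _ => (contDiffAt_apply ha j).mul (contDiffAt_dzc h j)

lemma contDiffAt_lev (h : SmoothAt ρ x) {a b : Cn n → Cn n} (ha : SmoothAt a x)
    (hb : SmoothAt b x) : SmoothAt (fun y => lev ρ y (a y) (b y)) x :=
  ContDiffAt.sum fun j _ => ContDiffAt.sum fun k _ =>
    ((contDiffAt_apply ha j).mul (contDiffAt_apply hb k)).mul (contDiffAt_lvm h j k)

lemma lvm_conj (h : ∀ᶠ y in 𝓝 x, SmoothAt ρ y) (j k : Fin n) : lvm ρ k j x = star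
    (lvm ρ j k x) := by
  have hx := h.self_of_nhds
  have h1 : star (lvm ρ j k x) = cderiv (fun y => star (dzc ρ j y)) x (coordV (inl k)) := by
    rw [cderiv_conj (contDiffAt_dzc hx j).diffAt, conjV_coordV]; rfl
  have h2 : (fun y => star (dzc ρ j y)) =ᶠ[𝓝 x] fun y => cderiv (toC ρ) y (coordV (inr j)) := by
    filter_upwards [h] with y hy
    rw [dzc, ← cderiv_conjV_toC hy, conjV_coordV]; rfl
  rw [h1, cderiv_congr h2, cderiv_cderiv_comm (contDiffAt_toC hx)]
  rfl

lemma lev_conj (h : ∀ᶠ y in 𝓝 x, SmoothAt ρ y) (a b : Cn n) : lev ρ x b a = star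
    (lev ρ x (star a) (star b)) := by
  simp only [lev, star_sum, star_mul', Pi.star_apply, star_star, ← lvm_conj h]
  rw [sum_comm]
  exact sum_congr rfl fun i _ => sum_congr rfl fun j _ => by ring

include h

lemma IsDefiningFunction.eventually (hx : x ∈ U) : ∀ᶠ y in 𝓝 x, SmoothAt ρ y :=
  (h.1.eventually_mem hx).mono fun _ hy => h.contDiffAt hy

omit h

/-- The `(1,0)` part of the gradient of `ρ`, a vector transverse to the kernel of `∂ρ`. -/
def gradN (ρ : Cn n → ℝ) (x : Cn n) : Cn n := fun j => star (dzc ρ j x)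

/-- The squared length of the `(1,0)` part of the gradient. -/
def nrm (ρ : Cn n → ℝ) (x : Cn n) : ℂ := dz ρ x (gradN ρ x)

lemma nrm_eq (ρ : Cn n → ℝ) (x : Cn n) : nrm ρ x = ((∑ j, ‖dzc ρ j x‖ ^ 2 : ℝ) : ℂ) := by
  simp only [nrm, dz, gradN, ofReal_sum, ofReal_pow]
  exact sum_congr rfl fun j _ => conj_mul' _

include h

lemma dz_ne_zero (hx : x ∈ U) : ∃ j, dzc ρ j x ≠ 0 := by
  by_contra! h0
  apply h.2.2.1 x hx
  ext v
  have h1 := cderiv_ofRealV (toC ρ) x v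
  rw [fderiv_toC ((h.contDiffAt hx).differentiableAt (by simp)), cderiv_toC_eq (h.contDiffAt hx)]
    at h1
  simp only [dz, h0] at h1
  simpa using h1.symm

lemma nrm_ne_zero (hx : x ∈ U) : nrm ρ x ≠ 0 := by
  obtain ⟨j, hj⟩ := dz_ne_zero h hx
  rw [nrm_eq]
  refine Complex.ofReal_ne_zero.2 (ne_of_gt ?_)
  exact Finset.sum_pos' (fun i _ => by positivity) ⟨j, mem_univ _, by positivity⟩

omit h

lemma contDiffAt_gradN (h : SmoothAt ρ x) : SmoothAt (gradN ρ) x :=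
  contDiffAt_pi.2 fun j => contDiffAt_conj (contDiffAt_dzc h j)

lemma contDiffAt_nrm (h : SmoothAt ρ x) : SmoothAt (nrm ρ) x := contDiffAt_dz h (contDiffAt_gradN h)

include h hx

lemma mem_H10_iff : X ∈ H10 M x ↔ dz ρ x X.1 = 0 ∧ X.2 = 0 := by
  rw [H10, Submodule.mem_inf, mem_CT_iff h hx, cderiv_toC_eq (h.contDiffAt hx.2),
    LinearMap.mem_ker, LinearMap.snd_apply]
  constructor
  · rintro ⟨h1, h2⟩; rw [h2] at h1; exact ⟨by simpa using h1, h2⟩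
  · rintro ⟨h1, h2⟩; rw [h1, h2]; simp

lemma conjV_mem_CT (hX : X ∈ CT M x) : conjV X ∈ CT M x := by
  rw [mem_CT_iff h hx] at hX ⊢
  rw [cderiv_conjV_toC (h.contDiffAt hx.2), hX, star_zero]

lemma mem_H01_iff : X ∈ H01 M x ↔ dz ρ x (star X.2) = 0 ∧ X.1 = 0 := by
  rw [H01, Submodule.mem_inf, mem_CT_iff h hx, cderiv_toC_eq (h.contDiffAt hx.2),
    LinearMap.mem_ker, LinearMap.fst_apply]
  constructor
  · rintro ⟨h1, h2⟩; rw [h2] at h1; exact ⟨by simpa using h1, h2⟩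
  · rintro ⟨h1, h2⟩; rw [h1, h2]; simp

lemma mem_CH_iff : X ∈ CH M x ↔ dz ρ x X.1 = 0 ∧ dz ρ x (star X.2) = 0 := by
  rw [CH, mem_sup]
  constructor
  · rintro ⟨Y, hY, Z, hZ, rfl⟩
    rw [mem_H10_iff h hx] at hY
    rw [mem_H01_iff h hx] at hZ
    simp [hY, hZ]
  · rintro ⟨h1, h2⟩
    refine ⟨(X.1, 0), (mem_H10_iff h hx).2 ⟨h1, rfl⟩, (0, X.2), (mem_H01_iff h hx).2 ⟨h2, rfl⟩, ?_⟩
    simp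

lemma mem_CH_iff_of_mem_CT (hX : X ∈ CT M x) : X ∈ CH M x ↔ dz ρ x X.1 = 0 := by
  rw [mem_CH_iff h hx]
  rw [mem_CT_iff h hx, cderiv_toC_eq (h.contDiffAt hx.2)] at hX
  refine ⟨fun h => h.1, fun h1 => ⟨h1, ?_⟩⟩
  rw [h1, zero_add] at hX
  exact star_eq_zero.1 hX

lemma mem_realTangent_iff {v : Cn n} : v ∈ realTangent M x ↔ fderiv ℝ ρ x v = 0 := by
  change ofRealV v ∈ CT M x ↔ _
  rw [mem_CT_iff h hx, cderiv_ofRealV, fderiv_toC ((h.contDiffAt hx.2).differentiableAt (by simp))]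
  simp

omit h hx

/-! ### Projection of constant vectors to tangent fields -/

/-- The projection of the constant vector `a` to a `(1,0)` field tangent to the level sets. -/
def projH (ρ : Cn n → ℝ) (a x : Cn n) : CVec n := (a - (dz ρ x a / nrm ρ x) • gradN ρ x, 0)

/-- The projection of the constant vector `X` to a field tangent to the level sets. -/
def projT (ρ : Cn n → ℝ) (X : CVec n) (x : Cn n) : CVec n :=
  X - (cderiv (toC ρ) x X / nrm ρ x) • (gradN ρ x, 0)

/-- A tangent field transverse to `ℂH`. -/
def transT (ρ : Cn n → ℝ) (x : Cn n) : CVec n := (gradN ρ x, -star (gradN ρ x))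

lemma contDiffAt_divC (hf : SmoothAt f x) (hg : SmoothAt g x) (h0 : g x ≠ 0) : SmoothAt
    (fun y => f y / g y) x := by
  simp only [div_eq_mul_inv]
  exact hf.mul (hg.inv h0)

include h

lemma contDiffAt_projH (hx : x ∈ U) (a : Cn n) : SmoothAt (projH ρ a) x := by
  have hr := h.contDiffAt hx
  exact (contDiffAt_const.sub ((contDiffAt_divC (contDiffAt_dz hr contDiffAt_const)
    (contDiffAt_nrm hr)
    (nrm_ne_zero h hx)).smul (contDiffAt_gradN hr))).prodMk contDiffAt_const

lemma contDiffAt_projT (hx : x ∈ U) (X : CVec n) : SmoothAt (projT ρ X) x := by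
  have hr := h.contDiffAt hx
  exact contDiffAt_const.sub ((contDiffAt_divC (contDiffAt_cderiv_const X (contDiffAt_toC hr))
    (contDiffAt_nrm hr) (nrm_ne_zero h hx)).smul ((contDiffAt_gradN hr).prodMk contDiffAt_const))

lemma contDiffAt_transT (hx : x ∈ U) : SmoothAt (transT ρ) x :=
  (contDiffAt_gradN (h.contDiffAt hx)).prodMk (contDiffAt_star (contDiffAt_gradN (h.contDiffAt
    hx))).neg

lemma dz_projH (hx : x ∈ U) (a : Cn n) : dz ρ x (projH ρ a x).1 = 0 := by
  simp only [projH, dz_sub, dz_smul]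
  rw [← nrm, div_mul_cancel₀ _ (nrm_ne_zero h hx), sub_self]

include hx

lemma projH_mem (a : Cn n) : projH ρ a x ∈ H10 M x :=
  (mem_H10_iff h hx).2 ⟨dz_projH h hx.2 a, rfl⟩

lemma projT_mem (X : CVec n) : projT ρ X x ∈ CT M x := by
  rw [mem_CT_iff h hx, projT, cderiv_sub_right, cderiv_smul_right,
    cderiv_toC_fst (h.contDiffAt hx.2), ← nrm, smul_eq_mul,
    div_mul_cancel₀ _ (nrm_ne_zero h hx.2), sub_self]

omit h hx

lemma star_nrm (ρ : Cn n → ℝ) (x : Cn n) : star (nrm ρ x) = nrm ρ x := by rw [nrm_eq]; simp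

include h hx

lemma transT_mem : transT ρ x ∈ CT M x := by
  rw [mem_CT_iff h hx, cderiv_toC_eq (h.contDiffAt hx.2)]
  have : dz ρ x (-gradN ρ x) = -nrm ρ x := by rw [← neg_one_smul ℂ, dz_smul, nrm]; ring
  simp only [transT, star_neg, star_star, this, star_nrm]
  rw [nrm]; ring

omit hx

lemma isSection_projH (a : Cn n) : IsSection M (H10 M) U (projH ρ a) :=
  ⟨fun _ hx => (contDiffAt_projH h hx a).contDiffWithinAt, fun _ hx => projH_mem h hx a⟩

lemma isSection_projT (X : CVec n) : IsSection M (CT M) U (projT ρ X) :=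
  ⟨fun _ hx => (contDiffAt_projT h hx X).contDiffWithinAt, fun _ hx => projT_mem h hx X⟩

include hx

lemma projT_of_mem (hX : X ∈ CT M x) : projT ρ X x = X := by
  rw [projT, (mem_CT_iff h hx).1 hX]; simp

lemma projH_of_mem (hX : X ∈ H10 M x) : projH ρ X.1 x = X := by
  obtain ⟨h1, h2⟩ := (mem_H10_iff h hx).1 hX
  rw [projH, h1]
  exact Prod.ext (by simp) h2.symm

omit h hx

lemma projH_eq_sum (a : Cn n) : projH ρ a x = ∑ j, a j • projH ρ (single j 1) x := by
  have h1 : ∀ j, dz ρ x (single j 1) = dzc ρ j x := fun j => by simp [dz, single_apply]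
  refine Prod.ext ?_ ?_
  · simp only [projH, fst_sum, smul_fst, smul_sub, sum_sub_distrib, h1]
    congr 1
    · funext i; simp [Finset.sum_apply, single_apply]
    · rw [dz, sum_div, sum_smul]
      exact sum_congr rfl fun j _ => by rw [smul_smul, mul_div_assoc]
  · simp [projH, snd_sum]

lemma projT_eq_sum (X : CVec n) : projT ρ X x = ∑ s, coordOf s X • projT ρ (coordV s) x := by
  simp only [projT, smul_sub, sum_sub_distrib, sum_coordOf]
  congr 1
  rw [cderiv_eq_sum, sum_div, sum_smul]
  exact sum_congr rfl fun j _ => by rw [smul_smul, smul_eq_mul, mul_div_assoc]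

end hypersurface

/-! ### Brackets, contact forms and the Levi form -/

section levi

variable {θ : Cn n → (CVec n →L[ℂ] ℂ)} {X Y : Cn n → CVec n}

/-- The Levi form of two fields, as a function of the base point. -/
notation:max "levF " ρ:max X:max Y:max => fun y => lev ρ y (Prod.fst (X y)) (star (Prod.fst (Y y)))

lemma IsSection.contDiffAt {V : Cn n → Submodule ℂ (CVec n)} (h : IsSection M V W X) (hW : IsOpen W)
    (hx : x ∈ W) : SmoothAt X x := h.1.contDiffAt (hW.mem_nhds hx)

lemma IsSection.mono {V : Cn n → Submodule ℂ (CVec n)} {W' : Set (Cn n)} (h : IsSection M V W X)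
    (hW : W' ⊆ W) : IsSection M V W' X :=
  ⟨h.1.mono hW, fun x hx => h.2 x ⟨hx.1, hW hx.2⟩⟩

lemma IsContactForm.mono {W' : Set (Cn n)} (h : IsContactForm M W θ) (hW : W' ⊆ W) : IsContactForm M
    W' θ :=
  ⟨h.1.mono hW, fun x hx => h.2 x ⟨hx.1, hW hx.2⟩⟩

lemma IsContactForm.contDiffAt (h : IsContactForm M W θ) (hW : IsOpen W) (hx : x ∈ W) : SmoothAt θ
    x := h.1.contDiffAt (hW.mem_nhds hx)

lemma H10_le_CT (M : Set (Cn n)) (x : Cn n) : H10 M x ≤ CT M x := inf_le_left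
lemma H10_le_CH (M : Set (Cn n)) (x : Cn n) : H10 M x ≤ CH M x := le_sup_left
lemma H01_le_CH (M : Set (Cn n)) (x : Cn n) : H01 M x ≤ CH M x := le_sup_right

variable (h : IsDefiningFunction M U ρ) (hW : IsOpen W) (hx : x ∈ M ∩ U) (hxW : x ∈ W)
include h hW hx hxW

/-- The Lie bracket of tangent fields is tangent. -/
lemma bracket_mem_CT (hX : IsSection M (CT M) W X) (hY : IsSection M (CT M) W Y) : bracket X Y x ∈
    CT M x := by
  have hr := h.contDiffAtC hx.2
  have key : ∀ {Z : Cn n → CVec n}, IsSection M (CT M) W Z → ∀ {v}, v ∈ CT M x →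
      cderiv (fun y => cderiv (toC ρ) y (Z y)) x v = 0 := by
    intro Z hZ v hv
    refine cderiv_eq_zero_of_eventually h hx (contDiffAt_cderiv hr (hZ.contDiffAt hW hxW)) ?_ hv
    filter_upwards [hW.mem_nhds hxW, h.1.mem_nhds hx.2] with y hyW hyU hyM
    exact (mem_CT_iff h ⟨hyM, hyU⟩).1 (hZ.2 y ⟨hyM, hyW⟩)
  rw [mem_CT_iff h hx, cderiv_bracket hr (hX.contDiffAt hW hxW) (hY.contDiffAt hW hxW),
    key hY (hX.2 x ⟨hx.1, hxW⟩), key hX (hY.2 x ⟨hx.1, hxW⟩), sub_zero]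

omit h hW hx hxW

lemma IsSection.to_CT (hX : IsSection M (H10 M) W X) : IsSection M (CT M) W X :=
  ⟨hX.1, fun x hx => H10_le_CT M x (hX.2 x hx)⟩

lemma IsSection.conj_to_CT (hr : IsRealHypersurface M) (hW : IsOpen W)
    (hX : IsSection M (CT M) W X) : IsSection M (CT M) W (conjField X) := by
  refine ⟨fun x hx => (contDiffAt_conjField (hX.contDiffAt hW hx)).contDiffWithinAt, ?_⟩
  intro x hx
  obtain ⟨U, ρ, hxU, h⟩ := hr x hx.1
  exact conjV_mem_CT h ⟨hx.1, hxU⟩ (hX.2 x hx)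

lemma cderiv_apply_fst {Z : Cn n → CVec n} (hZ : SmoothAt Z x) (v : CVec n) (j : Fin n) :
    (cderiv Z x v).1 j = cderiv (fun y => (Z y).1 j) x v := by
  have := cderiv_clm (coordOf (inl j)) hZ.diffAt v
  simpa using this.symm

include h hW hx hxW

/-- `∂ρ([X, Y]) = ∂∂̄ρ(X, Y)` for tangent fields `X` of type `(1,0)` and `Y` of type `(0,1)`. -/
lemma dz_bracket (hX : IsSection M (H10 M) W X) (hY : IsSection M (H10 M) W (conjField Y)) : dz ρ x
    (bracket X Y x).1 = lev ρ x (X x).1 (Y x).2 := by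
  have hr := h.contDiffAt hx.2
  have hXs := hX.contDiffAt hW hxW
  have hYs : SmoothAt Y x := by
    have := contDiffAt_conjField (hY.contDiffAt hW hxW)
    rwa [conjField_conjField] at this
  have hY1 : ∀ y ∈ M, y ∈ W → y ∈ U → (Y y).1 = 0 := by
    intro y hyM hyW hyU
    have := ((mem_H10_iff h ⟨hyM, hyU⟩).1 (hY.2 y ⟨hyM, hyW⟩)).2
    simpa [conjField, conjV] using this
  have hev : ∀ᶠ y in 𝓝 x, y ∈ W ∧ y ∈ U := (hW.mem_nhds hxW |> Filter.eventually_mem_set.2).and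
    (h.1.mem_nhds hx.2 |> Filter.eventually_mem_set.2)
  have hYx : Y x ∈ CT M x := by
    have := conjV_mem_CT h hx (H10_le_CT M x (hY.2 x ⟨hx.1, hxW⟩))
    simpa [conjField] using this
  have hXx : X x ∈ CT M x := H10_le_CT M x (hX.2 x ⟨hx.1, hxW⟩)
  have hXj : ∀ j, SmoothAt (fun y => (X y).1 j) x := fun j => contDiffAt_coordOf hXs (inl j)
  have hYj : ∀ j, SmoothAt (fun y => (Y y).1 j) x := fun j => contDiffAt_coordOf hYs (inl j)
  have h1 : cderiv (fun y => dz ρ y (X y).1) x (Y x) = 0 := by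
    refine cderiv_eq_zero_of_eventually h hx (contDiffAt_dz hr (contDiff_fst.contDiffAt.comp x hXs))
      ?_ hYx
    filter_upwards [hev] with y hy hyM
    exact ((mem_H10_iff h ⟨hyM, hy.2⟩).1 (hX.2 y ⟨hyM, hy.1⟩)).1
  have h2 : (bracket X Y x).1 = -(cderiv X x (Y x)).1 := by
    have : (cderiv Y x (X x)).1 = 0 := by
      funext j
      rw [cderiv_apply_fst hYs]
      refine cderiv_eq_zero_of_eventually h hx (hYj j) ?_ hXx
      filter_upwards [hev] with y hy hyM
      rw [hY1 y hyM hy.1 hy.2]; rfl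
    rw [bracket, fst_sub, this, zero_sub]
  have h3 : cderiv (fun y => dz ρ y (X y).1) x (Y x) =
      lev ρ x (X x).1 (Y x).2 + dz ρ x (cderiv X x (Y x)).1 := by
    have hd : ∀ j, DifferentiableAt ℝ (fun y => (X y).1 j * dzc ρ j y) x := fun j =>
      ((hXj j).mul (contDiffAt_dzc hr j)).diffAt
    simp only [dz]
    rw [cderiv_fun_sum _ fun j _ => hd j, lev, ← sum_add_distrib]
    refine sum_congr rfl fun j _ => ?_
    rw [cderiv_fun_mul (hXj j).diffAt (contDiffAt_dzc hr j).diffAt, cderiv_apply_fst hXs]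
    congr 1
    rw [cderiv_eq_sum, sum_sum_type]
    simp [hY1 x hx.1 hxW hx.2, mul_sum, lvm, mul_assoc]
  rw [h1] at h3
  rw [h2, ← neg_one_smul ℂ, dz_smul]
  linear_combination h3

omit h hW hx hxW

/-- The coefficient of a contact form with respect to `∂ρ`. -/
def kap (θ : Cn n → (CVec n →L[ℂ] ℂ)) (ρ : Cn n → ℝ) (x : Cn n) : ℂ := θ x (transT ρ x) / nrm ρ x

lemma contDiffAt_apply_field (hθ : SmoothAt θ x) {Z : Cn n → CVec n} (hZ : SmoothAt Z x) : SmoothAt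
    (fun y => θ y (Z y)) x := by
  have : (fun y => θ y (Z y)) = fun y => ∑ s, coordOf s (Z y) * θ y (coordV s) := by
    funext y
    conv_lhs => rw [← sum_coordOf (Z y), map_sum]
    simp
  rw [this]
  refine ContDiffAt.sum fun s _ => (contDiffAt_coordOf hZ s).mul ?_
  exact contDiffAt_clmC (ContinuousLinearMap.apply ℂ ℂ (coordV s)) hθ

include h

lemma contDiffAt_kap (hx : x ∈ U) (hθ : SmoothAt θ x) : SmoothAt (kap θ ρ) x :=
  contDiffAt_divC (contDiffAt_apply_field hθ (contDiffAt_transT h hx))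
    (contDiffAt_nrm (h.contDiffAt hx)) (nrm_ne_zero h hx)

include hx

lemma contact_eq_kap (hθ : ∀ X ∈ CH M x, θ x X = 0) {Z : CVec n} (hZ : Z ∈ CT M x) : θ x Z = kap θ ρ
    x * dz ρ x Z.1 := by
  have hn := nrm_ne_zero h hx.2
  have hT := transT_mem h hx
  have h1 : Z - (dz ρ x Z.1 / nrm ρ x) • transT ρ x ∈ CH M x := by
    rw [mem_CH_iff_of_mem_CT h hx (sub_mem hZ (smul_mem _ _ hT))]
    simp only [fst_sub, smul_fst, transT, dz_sub, dz_smul]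
    rw [← nrm, div_mul_cancel₀ _ hn, sub_self]
  have := hθ _ h1
  rw [map_sub, map_smul, sub_eq_zero] at this
  rw [this, kap, smul_eq_mul]
  ring

lemma kap_im (hθ : ∀ v ∈ realTangent M x, (θ x (ofRealV v)).im = 0) : (I * kap θ ρ x).im = 0 := by
  have hT : transT ρ x = (-I) • ofRealV (I • gradN ρ x) := by
    refine Prod.ext ?_ ?_ <;> funext i <;> simp [transT, ofRealV]
    · rw [← mul_assoc, I_mul_I]; ring
    · rw [← mul_assoc, I_mul_I]; ring
  have hv : I • gradN ρ x ∈ realTangent M x := by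
    change ofRealV _ ∈ CT M x
    have := smul_mem _ I (transT_mem h hx)
    rw [hT, smul_smul] at this
    simpa using this
  rw [kap, hT, map_smul, smul_eq_mul, nrm_eq, Complex.im_eq_zero_iff_isSelfAdjoint]
  have h2 : θ x (ofRealV (I • gradN ρ x)) = ((θ x (ofRealV (I • gradN ρ x))).re : ℂ) := by
    apply Complex.ext <;> simp [hθ _ hv]
  rw [h2]
  generalize (θ x (ofRealV (I • gradN ρ x))).re = r
  generalize (∑ j, ‖dzc ρ j x‖ ^ 2) = s
  have : I * (-I * (r : ℂ) / (s : ℂ)) = ((r / s : ℝ) : ℂ) := by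
    push_cast
    linear_combination (-(r : ℂ) / s) * I_mul_I
  rw [this]
  simp [IsSelfAdjoint]

include hW hxW

lemma leviFn_eq (hX : IsSection M (H10 M) W X) (hY : IsSection M (H10 M) W (conjField Y))
    (hθ : ∀ X ∈ CH M x, θ x X = 0) : leviFn θ X Y x = kap θ ρ x * lev ρ x (X x).1 (Y x).2 := by
  have hY' : IsSection M (CT M) W Y := by
    have h1 : ContDiffOn ℝ ∞ Y W := by
      intro y hy
      have := contDiffAt_conjField (hY.contDiffAt hW hy)
      rw [conjField_conjField] at this
      exact this.contDiffWithinAt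
    refine ⟨h1.mono (fun y hy => hy), ?_⟩
    intro y hy
    have h2 := H10_le_CT M y (hY.2 y hy)
    -- conjugation preserves tangency: every function vanishing on `M` has a conjugate
    intro V g hV hyV hg h0
    have h3 := h2 V (fun z => star (g z)) hV hyV
      (fun z hz => (contDiffAt_conj (hg.contDiffAt (hV.mem_nhds hz))).contDiffWithinAt)
      (fun z hz => by rw [h0 z hz, star_zero])
    rw [cderiv_conj (hg.contDiffAt (hV.mem_nhds hyV)).diffAt] at h3
    simpa [conjField] using h3
  rw [leviFn, contact_eq_kap h hx hθ (bracket_mem_CT h hW hx hxW hX.to_CT hY'),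
    dz_bracket h hW hx hxW hX hY]

omit h hW hx hxW

lemma contDiffAt_leviFn (hθ : SmoothAt θ x) (hX : SmoothAt X x) (hY : SmoothAt Y x) : SmoothAt
    (leviFn θ X Y) x :=
  contDiffAt_apply_field hθ (contDiffAt_bracket hX hY)

/-- The contact form `-i ∂ρ`. -/
def cForm (ρ : Cn n → ℝ) (x : Cn n) : CVec n →L[ℂ] ℂ := ∑ j, (-I * dzc ρ j x) • coordOf (inl j)

lemma cForm_apply (Z : CVec n) : cForm ρ x Z = -I * dz ρ x Z.1 := by
  simp only [cForm, sum_apply, smul_apply, coordOf_inl, smul_eq_mul, dz, mul_sum]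
  exact sum_congr rfl fun i _ => by ring

lemma contDiffAt_cForm (h : SmoothAt ρ x) : SmoothAt (cForm ρ) x :=
  ContDiffAt.sum fun j _ => (contDiffAt_const.mul (contDiffAt_dzc h j)).smul contDiffAt_const

include h

lemma isContactForm_cForm : IsContactForm M U (cForm ρ) := by
  refine ⟨fun x hx => (contDiffAt_cForm (h.contDiffAt hx)).contDiffWithinAt, fun x hx => ⟨?_, ?_⟩⟩
  · intro X hX
    rw [cForm_apply, ((mem_CH_iff h hx).1 hX).1, mul_zero]
  · intro v hv
    have h1 : cderiv (toC ρ) x (ofRealV v) = 0 := (mem_CT_iff h hx).1 hv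
    rw [cderiv_toC_eq (h.contDiffAt hx.2)] at h1
    have h2 : (dz ρ x v).re = 0 := by
      have := congrArg Complex.re h1
      simp [ofRealV] at this
      linarith
    rw [cForm_apply]
    simp [ofRealV, h2]

lemma kap_cForm (hx : x ∈ U) : kap (cForm ρ) ρ x = -I := by
  rw [kap, cForm_apply, transT, ← nrm, mul_div_assoc, div_self (nrm_ne_zero h hx), mul_one]

include hx

/-- `⟨-i∂ρ, ·⟩` is injective on `ℂQ`. -/
lemma mem_CH_of_cForm_eq_zero {Z : CVec n} (hZ : Z ∈ CT M x) (h0 : cForm ρ x Z = 0) : Z ∈ CH M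
    x := by
  rw [cForm_apply] at h0
  rw [mem_CH_iff_of_mem_CT h hx hZ]
  simpa using h0

/-! ### The Levi kernel -/

lemma mem_K10_iff : v ∈ K10 M x ↔ v ∈ H10 M x ∧ ∀ b, dz ρ x b = 0 → lev ρ x v.1 (star b) = 0 := by
  have key : ∀ {W} {Z V : Cn n → CVec n}, IsOpen W → x ∈ W → IsSection M (H10 M) W Z →
      IsSection M (H10 M) W V →
      (bracket Z (conjField V) x ∈ CH M x ↔ lev ρ x (Z x).1 (star (V x).1) = 0) := by
    intro W Z V hW hxW hZ hV
    have hr : IsSection M (CT M) (W ∩ U) (conjField V) :=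
      ⟨fun y hy => (contDiffAt_conjField (hV.contDiffAt hW hy.1)).contDiffWithinAt,
        fun y hy => conjV_mem_CT h ⟨hy.1, hy.2.2⟩ (H10_le_CT M y (hV.2 y ⟨hy.1, hy.2.1⟩))⟩
    have hWU : IsOpen (W ∩ U) := hW.inter h.1
    rw [mem_CH_iff_of_mem_CT h hx (bracket_mem_CT h hWU hx ⟨hxW, hx.2⟩
      (hZ.to_CT.mono inter_subset_left) hr), dz_bracket h hW hx hxW hZ (by simpa using hV)]
    rfl
  constructor
  · rintro ⟨hv, W, Z, hW, hxW, hZ, hZv, hbr⟩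
    refine ⟨hv, fun b hb => ?_⟩
    have hP : projH ρ b x = (b, 0) := projH_of_mem h hx (X := (b, 0)) ((mem_H10_iff h hx).2 ⟨hb,
      rfl⟩)
    have h1 := hbr (W ∩ U) (projH ρ b) (hW.inter h.1) ⟨hxW, hx.2⟩
      ((isSection_projH h b).mono inter_subset_right)
    rw [key (hW.inter h.1) ⟨hxW, hx.2⟩ (hZ.mono inter_subset_left)
      ((isSection_projH h b).mono inter_subset_right), hP, hZv] at h1
    exact h1
  · rintro ⟨hv, hb⟩
    have hP : projH ρ v.1 x = v := projH_of_mem h hx hv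
    refine ⟨hv, U, projH ρ v.1, h.1, hx.2, isSection_projH h _, hP, ?_⟩
    intro W Y hW hxW hY
    rw [key (h.1.inter hW) ⟨hx.2, hxW⟩ ((isSection_projH h _).mono inter_subset_left)
      (hY.mono inter_subset_right), hP]
    exact hb _ ((mem_H10_iff h hx).1 (hY.2 x ⟨hx.1, hxW⟩)).1

omit h hx

lemma K10_le_H10 (M : Set (Cn n)) (x : Cn n) : K10 M x ≤ H10 M x := fun _ hv => hv.1

/-! ### Pseudoconvexity -/

/-- Pseudoconvexity of `M` near `p`: there is a positive contact form near `p`. -/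
def LocalPsc (M : Set (Cn n)) (p : Cn n) : Prop :=
  ∃ (U : Set (Cn n)) (θ : Cn n → (CVec n →L[ℂ] ℂ)), IsOpen U ∧ p ∈ U ∧
    IsContactForm M U θ ∧ (∀ x ∈ M ∩ U, ∃ X ∈ CT M x, θ x X ≠ 0) ∧ LeviNonneg M U θ

/-- The Levi form of the defining function `ρ` is nonnegative over `M ∩ U`. -/
def LevPsd (M U : Set (Cn n)) (ρ : Cn n → ℝ) : Prop :=
  ∀ x ∈ M ∩ U, ∀ a, dz ρ x a = 0 → 0 ≤ (lev ρ x a (star a)).re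

lemma lev_star_im (h : ∀ᶠ y in 𝓝 x, SmoothAt ρ y) (a : Cn n) : (lev ρ x a (star a)).im = 0 := by
  have := lev_conj h (star a) a
  rw [star_star] at this
  have h2 := congrArg Complex.im this
  simp at h2
  linarith

include h hW hx hxW

lemma I_mul_leviFn_conj (hX : IsSection M (H10 M) W X) (hθ : IsContactForm M W θ) : I * leviFn θ X
    (conjField X) x = (((I * kap θ ρ x).re * (lev ρ x (X x).1 (star (X x).1)).re : ℝ) : ℂ) := by
  have h1 : I * kap θ ρ x = ((I * kap θ ρ x).re : ℂ) := by
    apply Complex.ext <;> simp only [ofReal_re, ofReal_im]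
    exact kap_im h hx (hθ.2 x ⟨hx.1, hxW⟩).2
  have h2 : lev ρ x (X x).1 (star (X x).1) = ((lev ρ x (X x).1 (star (X x).1)).re : ℂ) := by
    apply Complex.ext <;> simp only [ofReal_re, ofReal_im]
    exact lev_star_im (h.eventually hx.2) _
  rw [leviFn_eq h hW hx hxW hX (by simpa using hX) (hθ.2 x ⟨hx.1, hxW⟩).1, ← mul_assoc,
    ofReal_mul, ← h1, ← h2]
  rfl

omit hW hx hxW

lemma neg_isDefiningFunction : IsDefiningFunction M U (fun x => -ρ x) := by
  refine ⟨h.1, h.2.1.neg, fun x hx => ?_, fun x hx => by simp [h.2.2.2 x hx]⟩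
  rw [fderiv_fun_neg]
  exact neg_ne_zero.2 (h.2.2.1 x hx)

omit h

lemma dzc_neg (j : Fin n) : dzc (fun x => -ρ x) j x = -dzc ρ j x := by
  rw [dzc, dzc, ← cderiv_fun_neg]
  congr 1
  funext y; simp [toC]

lemma dz_neg' (a : Cn n) : dz (fun x => -ρ x) x a = -dz ρ x a := by simp [dz, dzc_neg]

lemma lev_neg' (a b : Cn n) : lev (fun x => -ρ x) x a b = -lev ρ x a b := by
  have : ∀ j k, lvm (fun x => -ρ x) j k x = -lvm ρ j k x := by
    intro j k
    rw [lvm, lvm, ← cderiv_fun_neg]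
    congr 1
    funext y; exact dzc_neg j
  simp [lev, this]

include h

/-- Near a point of a pseudoconvex hypersurface, a defining function or its negative has a
nonnegative Levi form. -/
lemma levPsd_or_neg (hp : p ∈ M) (hpU : p ∈ U) (hpsc : LocalPsc M p) : ∃ V ⊆ U, IsOpen V ∧ p ∈ V ∧
    (LevPsd M V ρ ∨ LevPsd M V fun x => -ρ x) := by
  obtain ⟨W, θ, hW, hpW, hθ, hne, hpos⟩ := hpsc
  set s : Cn n → ℝ := fun x => (I * kap θ ρ x).re with hs
  have hsc : ContinuousAt s p := continuous_re.continuousAt.comp (continuousAt_const.mul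
      (contDiffAt_kap h hpU (hθ.contDiffAt hW hpW)).continuousAt)
  have hmul : ∀ x ∈ M ∩ U, x ∈ W → ∀ a, dz ρ x a = 0 → 0 ≤ s x * (lev ρ x a (star a)).re := by
    intro x hx hxW a ha
    have hP : projH ρ a x = (a, 0) := projH_of_mem h hx (X := (a, 0)) ((mem_H10_iff h hx).2 ⟨ha,
      rfl⟩)
    have h1 := hpos x ⟨hx.1, hxW⟩ (W ∩ U) (projH ρ a) (hW.inter h.1) ⟨hxW, hx.2⟩
      ((isSection_projH h a).mono inter_subset_right)
    rw [I_mul_leviFn_conj h (hW.inter h.1) hx ⟨hxW, hx.2⟩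
      ((isSection_projH h a).mono inter_subset_right) (hθ.mono inter_subset_left), hP,
      ofReal_re] at h1
    exact h1
  have hs0 : s p ≠ 0 := by
    intro h0
    obtain ⟨Z, hZ, hZ0⟩ := hne p ⟨hp, hpW⟩
    apply hZ0
    have : I * kap θ ρ p = 0 := by
      apply Complex.ext
      · exact h0
      · exact kap_im h ⟨hp, hpU⟩ (hθ.2 p ⟨hp, hpW⟩).2
    rw [contact_eq_kap h ⟨hp, hpU⟩ (hθ.2 p ⟨hp, hpW⟩).1 hZ]
    simp only [mul_eq_zero, I_ne_zero, false_or] at this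
    rw [this, zero_mul]
  have hnb : ∀ P : Cn n → Prop, (∀ᶠ x in 𝓝 p, P x) →
      ∃ V, IsOpen V ∧ p ∈ V ∧ V ⊆ U ∧ V ⊆ W ∧ ∀ x ∈ V, P x := by
    intro P hP
    obtain ⟨V, hVP, hV, hpV⟩ := eventually_nhds_iff.1 hP
    exact ⟨V ∩ (U ∩ W), hV.inter (h.1.inter hW), ⟨hpV, hpU, hpW⟩, fun y hy => hy.2.1,
      fun y hy => hy.2.2, fun y hy => hVP y hy.1⟩
  rcases lt_or_gt_of_ne hs0 with hneg | hps
  · obtain ⟨V, hV, hpV, hVU, hVW, hVs⟩ := hnb _ (hsc.eventually (gt_mem_nhds hneg))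
    refine ⟨V, hVU, hV, hpV, Or.inr ?_⟩
    intro x hx a ha
    rw [dz_neg', neg_eq_zero] at ha
    have h1 := hmul x ⟨hx.1, hVU hx.2⟩ (hVW hx.2) a ha
    have h2 : s x < 0 := hVs x hx.2
    rw [lev_neg', neg_re]
    nlinarith
  · obtain ⟨V, hV, hpV, hVU, hVW, hVs⟩ := hnb _ (hsc.eventually (lt_mem_nhds hps))
    refine ⟨V, hVU, hV, hpV, Or.inl ?_⟩
    intro x hx a ha
    have h1 := hmul x ⟨hx.1, hVU hx.2⟩ (hVW hx.2) a ha
    have h2 : 0 < s x := hVs x hx.2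
    nlinarith

omit h

/-- A pseudoconvex hypersurface has, near each point, a defining function with nonnegative Levi
form. -/
lemma exists_levPsd (hM : IsRealHypersurface M) (hp : p ∈ M) (hpsc : LocalPsc M p) : ∃ U ρ, p ∈ U ∧
    IsDefiningFunction M U ρ ∧ LevPsd M U ρ := by
  obtain ⟨U, ρ, hpU, h⟩ := hM p hp
  obtain ⟨V, hVU, hV, hpV, h1 | h1⟩ := levPsd_or_neg h hp hpU hpsc
  exacts [⟨V, _, hpV, h.mono hV hVU, h1⟩, ⟨V, _, hpV, (neg_isDefiningFunction h).mono hV hVU, h1⟩]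

end levi

/-! ### Fields in the Levi kernel up to order one -/

section kernel

variable {θ : Cn n → (CVec n →L[ℂ] ℂ)} {X Y L : Cn n → CVec n}

lemma contDiffAt_fst {Z : Cn n → CVec n} (hZ : SmoothAt Z x) : SmoothAt (fun y => (Z y).1) x :=
    contDiff_fst.contDiffAt.comp x hZ

lemma contDiffAt_levConj (h : SmoothAt ρ x) (hX : SmoothAt X x) (hY : SmoothAt Y x) : SmoothAt
    (levF ρ X Y) x :=
  contDiffAt_lev h (contDiffAt_fst hX) (contDiffAt_star (contDiffAt_fst hY))

lemma contDiffAt_smulC {c : Cn n → ℂ} {Z : Cn n → CVec n} (hc : SmoothAt c x) (hZ : SmoothAt Z x) :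
    SmoothAt (fun y => c y • Z y) x := hc.smul hZ

lemma cderiv_mul_eq_zero (hf : SmoothAt f x) (hg : SmoothAt g x) (h0 : g x = 0)
    (h1 : cderiv g x v = 0) : cderiv (fun y => f y * g y) x v = 0 := by
  rw [cderiv_fun_mul hf.diffAt hg.diffAt, h0, h1]; simp

lemma eventually_mem_and (hW : IsOpen W) (h : IsDefiningFunction M U ρ) (hxW : x ∈ W)
    (hxU : x ∈ U) : ∀ᶠ y in 𝓝 x, y ∈ W ∧ y ∈ U :=
  (hW.eventually_mem hxW).and (h.1.eventually_mem hxU)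

variable (h : IsDefiningFunction M U ρ) (hpsd : LevPsd M U ρ) (hp : p ∈ M ∩ U)
include h

lemma lev_eq_sum_projH (hx : x ∈ M ∩ U) (hv : v ∈ H10 M x) (b : Cn n) : lev ρ x v.1 b = ∑ j, v.1 j *
    lev ρ x (projH ρ (single j 1) x).1 b := by
  conv_lhs => rw [← projH_of_mem h hx hv, projH_eq_sum]
  rw [fst_sum, lev_sum_left]
  simp [lev_smul_left]

include hp

lemma inLeviKernelOrderOne_iff (hW : IsOpen W) (hpW : p ∈ W) (hL : IsSection M (H10 M) W L) :
    InLeviKernelOrderOne M p L ↔ ∀ a : Cn n, lev ρ p (projH ρ a p).1 (star (L p).1) = 0 ∧ ∀ v ∈ CT M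
    p, cderiv (levF ρ (projH ρ a) L) p v = 0 := by
  have hr := h.contDiffAt hp.2
  have hLs := hL.contDiffAt hW hpW
  have hWU : IsOpen (W ∩ U) := hW.inter h.1
  constructor
  · intro hK a
    have hP := isSection_projH h a
    have hPs := contDiffAt_projH h hp.2 a
    have heq : ∀ y ∈ M ∩ U, y ∈ W → leviFn (cForm ρ) (projH ρ a) (conjField L) y =
        -I * lev ρ y (projH ρ a y).1 (star (L y).1) := by
      intro y hy hyW
      rw [leviFn_eq h hWU hy ⟨hyW, hy.2⟩ (hP.mono inter_subset_right)
        (by simpa using hL.mono inter_subset_left) ((isContactForm_cForm h).2 y hy).1,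
        kap_cForm h hy.2]
      rfl
    have hK' := fun (v : CVec n) => hK (W ∩ U) (projH ρ a) (projT ρ v) (cForm ρ) hWU ⟨hpW, hp.2⟩
      (hP.mono inter_subset_right) ((isSection_projT h v).mono inter_subset_right)
      ((isContactForm_cForm h).mono inter_subset_right)
    have hl := contDiffAt_levConj hr hPs hLs
    refine ⟨?_, fun v hv => ?_⟩
    · have := (hK' 0).1
      rw [heq p hp hpW] at this
      simpa using this
    · have := (hK' v).2
      rw [projT_of_mem h hp hv, cderiv_congr_of_eventually h hp
        (contDiffAt_leviFn (contDiffAt_cForm hr) hPs (contDiffAt_conjField hLs))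
        (contDiffAt_const.mul hl) ((eventually_mem_and hW h hpW hp.2).mono
          fun y hy hyM => heq y ⟨hyM, hy.2⟩ hy.1) hv,
        cderiv_const_mul _ hl.diffAt] at this
      simpa using this
  · intro hK V L₁ L₂ θ hV hpV hL₁ hL₂ hθ
    have hL₁s := hL₁.contDiffAt hV hpV
    have hVW : IsOpen (V ∩ W) := hV.inter hW
    have heq : ∀ y ∈ M ∩ U, y ∈ V ∩ W → leviFn θ L₁ (conjField L) y =
        ∑ j, (kap θ ρ y * (L₁ y).1 j) * lev ρ y (projH ρ (single j 1) y).1 (star (L y).1) := by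
      intro y hy hyW
      rw [leviFn_eq h hVW hy hyW (hL₁.mono inter_subset_left)
        (by simpa using hL.mono inter_subset_right) (hθ.2 y ⟨hy.1, hyW.1⟩).1,
        lev_eq_sum_projH h hy (hL₁.2 y ⟨hy.1, hyW.1⟩), mul_sum]
      exact sum_congr rfl fun j _ => (mul_assoc _ _ _).symm
    have hc : ∀ j, SmoothAt (fun y => kap θ ρ y * (L₁ y).1 j) p := fun j =>
      (contDiffAt_kap h hp.2 (hθ.contDiffAt hV hpV)).mul (contDiffAt_coordOf hL₁s (inl j))
    have hl : ∀ j, SmoothAt (levF ρ (projH ρ (single j 1)) L) p :=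
      fun j => contDiffAt_levConj hr (contDiffAt_projH h hp.2 _) hLs
    refine ⟨?_, ?_⟩
    · rw [heq p hp ⟨hpV, hpW⟩]
      exact sum_eq_zero fun j _ => by rw [(hK _).1, mul_zero]
    · have hv : L₂ p ∈ CT M p := hL₂.2 p ⟨hp.1, hpV⟩
      rw [cderiv_congr_of_eventually h hp
        (contDiffAt_leviFn (hθ.contDiffAt hV hpV) hL₁s (contDiffAt_conjField hLs))
        (ContDiffAt.sum fun j _ => (hc j).mul (hl j)) ((eventually_mem_and hVW h ⟨hpV, hpW⟩
          hp.2).mono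
          fun y hy hyM => heq y ⟨hyM, hy.2⟩ hy.1) hv,
        cderiv_fun_sum _ fun j _ => ((hc j).mul (hl j)).diffAt]
      exact sum_eq_zero fun j _ => cderiv_mul_eq_zero (hc j) (hl j) (hK _).1 ((hK _).2 _ hv)

lemma mem_K10_of_lev_projH (hv : v ∈ H10 M p) (h0 : ∀ a, lev ρ p (projH ρ a p).1 (star v.1) = 0) :
    v ∈ K10 M p := by
  refine (mem_K10_iff h hp).2 ⟨hv, fun b hb => ?_⟩
  have h1 := h0 b
  rw [projH_of_mem h hp (X := (b, 0)) ((mem_H10_iff h hp).2 ⟨hb, rfl⟩)] at h1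
  rw [lev_conj (h.eventually hp.2), star_star, h1, star_zero]

lemma lev_eq_zero_of_mem_K10 (hv : v ∈ K10 M p) {a : Cn n} (ha : dz ρ p a = 0) : lev ρ p v.1
    (star a) = 0 ∧ lev ρ p a (star v.1) = 0 := by
  have h1 := ((mem_K10_iff h hp).1 hv).2 a ha
  refine ⟨h1, ?_⟩
  rw [lev_conj (h.eventually hp.2), star_star, h1, star_zero]

/-- A section in the Levi kernel up to order one at `p` has its value in the Levi kernel. -/
lemma InLeviKernelOrderOne.mem_K10 (hW : IsOpen W) (hpW : p ∈ W) (hL : IsSection M (H10 M) W L)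
    (hK : InLeviKernelOrderOne M p L) : L p ∈ K10 M p :=
  mem_K10_of_lev_projH h hp (hL.2 p ⟨hp.1, hpW⟩)
    fun a => (((inLeviKernelOrderOne_iff h hp hW hpW hL).1 hK) a).1

/-! ### Consequences of nonnegativity of the Levi form -/

/-- The tangential derivatives of a nonnegative function on `M` vanish where the function does. -/
lemma cderiv_eq_zero_of_nonneg {g : Cn n → ℝ} (hg : SmoothAt g p) (h0 : g p = 0)
    (hpos : ∀ᶠ y in 𝓝 p, y ∈ M → 0 ≤ g y) (hv : v ∈ CT M p) : cderiv (toC g) p v = 0 := by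
  obtain ⟨c, hc⟩ := exists_fderiv_eq_of_isLocalExtrOn (f := fun _ : Unit => ρ)
    (fun _ => h.contDiffAt hp.2) hg (h.linearIndependent hp.2) (Or.inl (by
      refine eventually_nhdsWithin_iff.2 ?_
      filter_upwards [hpos, h.1.mem_nhds hp.2] with y hy hyU hy'
      rw [h0]
      exact hy ((h.2.2.2 y hyU).2 (by rw [hy' (), (h.2.2.2 p hp.2).1 hp.1]))))
  rw [cderiv_toC_of_fderiv (fun _ => (h.contDiffAt hp.2).differentiableAt (by simp))
    (hg.differentiableAt (by simp)) hc]
  simp [(mem_CT_iff h hp).1 hv]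

include hpsd

lemma cderiv_lev_self (hW : IsOpen W) (hpW : p ∈ W) (hX : IsSection M (H10 M) W X)
    (hK : X p ∈ K10 M p) (hv : v ∈ CT M p) : cderiv (levF ρ X X) p v = 0 := by
  have hXs := hX.contDiffAt hW hpW
  have hl := contDiffAt_levConj (h.contDiffAt hp.2) hXs hXs
  have h1 : (levF ρ X X) =ᶠ[𝓝 p]
      toC fun y => (lev ρ y (X y).1 (star (X y).1)).re := by
    filter_upwards [h.1.mem_nhds hp.2] with y hy
    apply Complex.ext <;> simp [toC, lev_star_im (h.eventually hy)]
  rw [cderiv_congr h1]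
  refine cderiv_eq_zero_of_nonneg h hp (contDiffAt_re hl) ?_ ?_ hv
  · have := (lev_eq_zero_of_mem_K10 h hp hK ((mem_H10_iff h hp).1 hK.1).1).1
    rw [this]; rfl
  · filter_upwards [eventually_mem_and hW h hpW hp.2] with y hy hyM
    exact hpsd y ⟨hyM, hy.2⟩ _ ((mem_H10_iff h ⟨hyM, hy.2⟩).1 (hX.2 y ⟨hyM, hy.1⟩)).1

/-- At a point where two `(1,0)` fields have their values in the Levi kernel of a pseudoconvex
hypersurface, the tangential derivatives of their Levi product vanish: by polarization this follows
from the minimality of the Levi form there. -/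
lemma cderiv_lev_eq_zero (hW : IsOpen W) (hpW : p ∈ W) (hX : IsSection M (H10 M) W X)
    (hY : IsSection M (H10 M) W Y) (hXK : X p ∈ K10 M p) (hYK : Y p ∈ K10 M p) (hv : v ∈ CT M p) :
    cderiv (levF ρ X Y) p v = 0 := by
  have hXs := hX.contDiffAt hW hpW
  have hYs := hY.contDiffAt hW hpW
  have hr := h.contDiffAt hp.2
  have hd : ∀ {A B : Cn n → CVec n}, SmoothAt A p → SmoothAt B p →
      DifferentiableAt ℝ (levF ρ A B) p := fun hA hB =>
    (contDiffAt_levConj hr hA hB).diffAt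
  have key : ∀ c : ℂ, star c * cderiv (levF ρ X Y) p v +
      c * cderiv (levF ρ Y X) p v = 0 := by
    intro c
    have hZ : IsSection M (H10 M) W (fun y => X y + c • Y y) :=
      ⟨hX.1.add (hY.1.const_smul c), fun y hy => add_mem (hX.2 y hy) (smul_mem _ c (hY.2 y hy))⟩
    have h1 := cderiv_lev_self h hpsd hp hW hpW hZ
      (add_mem hXK (smul_mem _ c hYK)) hv
    have h2 : (fun y => lev ρ y (X y + c • Y y).1 (star (X y + c • Y y).1)) = fun y =>
        (lev ρ y (X y).1 (star (X y).1) + star c * lev ρ y (X y).1 (star (Y y).1)) +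
        (c * lev ρ y (Y y).1 (star (X y).1) + (c * star c) * lev ρ y (Y y).1 (star (Y y).1)) := by
      funext y
      simp only [fst_add, smul_fst, star_add, star_smul, lev_add_left, lev_add_right,
        lev_smul_left, lev_smul_right]
      ring
    rw [h2, cderiv_fun_add ((hd hXs hXs).fun_add ((hd hXs hYs).const_mul _))
      (((hd hYs hXs).const_mul _).fun_add ((hd hYs hYs).const_mul _)),
      cderiv_fun_add (hd hXs hXs) ((hd hXs hYs).const_mul _),
      cderiv_fun_add ((hd hYs hXs).const_mul _) ((hd hYs hYs).const_mul _),
      cderiv_const_mul _ (hd hXs hYs), cderiv_const_mul _ (hd hYs hXs),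
      cderiv_const_mul _ (hd hYs hYs), cderiv_lev_self h hpsd hp hW hpW hX hXK hv,
      cderiv_lev_self h hpsd hp hW hpW hY hYK hv] at h1
    linear_combination h1
  have h1 := key 1
  have h2 := key I
  simp only [star_one, one_mul, star_def, Complex.conj_I] at h1 h2
  have h3 : I * (2 * cderiv (levF ρ X Y) p v) = 0 := by
    linear_combination I * h1 - h2
  simpa using h3

/-- A null vector of the nonnegative Levi form is in its kernel. -/
lemma mem_K10_of_lev_self (hv : v ∈ H10 M p) (h0 : (lev ρ p v.1 (star v.1)).re = 0) : v ∈ K10 M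
    p := by
  refine (mem_K10_iff h hp).2 ⟨hv, fun b hb => ?_⟩
  have hv1 := ((mem_H10_iff h hp).1 hv).1
  have hsw : lev ρ p b (star v.1) = star (lev ρ p v.1 (star b)) := by
    rw [lev_conj (h.eventually hp.2), star_star]
  set β := lev ρ p v.1 (star b) with hβ
  set c := (lev ρ p b (star b)).re
  -- expand the form at `t β v + b` for real `t`
  have key : ∀ t : ℝ, 0 ≤ 2 * t * ‖β‖ ^ 2 + c := by
    intro t
    have h1 := hpsd p hp ((t * star β : ℂ) • v.1 + b) (by rw [dz_add, dz_smul, hv1, hb]; simp)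
    have h2 : lev ρ p ((t * star β : ℂ) • v.1 + b) (star ((t * star β : ℂ) • v.1 + b)) =
        (t * star β) * (t * β) * lev ρ p v.1 (star v.1) + (t * star β) * β + (t * β) * star β +
          lev ρ p b (star b) := by
      simp only [star_add, star_smul, lev_add_left, lev_add_right, lev_smul_left, lev_smul_right,
        hsw, star_mul', star_star, ← hβ]
      simp
      ring
    have h3 : (t * star β) * (t * β) * lev ρ p v.1 (star v.1) =
        ((t * t * ‖β‖ ^ 2 : ℝ) : ℂ) * lev ρ p v.1 (star v.1) := by
      have : star β * β = ((‖β‖ ^ 2 : ℝ) : ℂ) := by push_cast; exact conj_mul' β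
      push_cast at this ⊢
      linear_combination (t * t * lev ρ p v.1 (star v.1)) * this
    have h4 : (t * star β) * β + (t * β) * star β = ((2 * t * ‖β‖ ^ 2 : ℝ) : ℂ) := by
      have : star β * β = ((‖β‖ ^ 2 : ℝ) : ℂ) := by push_cast; exact conj_mul' β
      push_cast at this ⊢
      linear_combination (2 * t) * this
    rw [h2, h3, add_assoc (((t * t * ‖β‖ ^ 2 : ℝ) : ℂ) * _), h4, add_re, add_re,
      re_ofReal_mul, h0, mul_zero, zero_add, ofReal_re] at h1
    exact h1
  by_contra hne
  have hpos : 0 < ‖β‖ ^ 2 := by positivity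
  have := key (-(c + 1) / (2 * ‖β‖ ^ 2))
  have h5 : 2 * (-(c + 1) / (2 * ‖β‖ ^ 2)) * ‖β‖ ^ 2 = -(c + 1) := by field_simp
  rw [h5] at this
  linarith

omit hpsd hp

/-! ### Levi-nondegenerate frames -/

lemma bracket_conj_mem_CT (hW : IsOpen W) (hx : x ∈ M ∩ U) (hxW : x ∈ W)
    (hX : IsSection M (H10 M) W X) (hY : IsSection M (H10 M) W Y) : bracket X (conjField Y) x ∈ CT M
    x := by
  have hr : IsSection M (CT M) (W ∩ U) (conjField Y) :=
    ⟨fun y hy => (contDiffAt_conjField (hY.contDiffAt hW hy.1)).contDiffWithinAt,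
      fun y hy => conjV_mem_CT h ⟨hy.1, hy.2.2⟩ (H10_le_CT M y (hY.2 y ⟨hy.1, hy.2.1⟩))⟩
  exact bracket_mem_CT h (hW.inter h.1) hx ⟨hxW, hx.2⟩ (hX.to_CT.mono inter_subset_left) hr

lemma bracket_conj_mem_CH_iff (hW : IsOpen W) (hx : x ∈ M ∩ U) (hxW : x ∈ W)
    (hX : IsSection M (H10 M) W X) (hY : IsSection M (H10 M) W Y) : bracket X (conjField Y) x ∈ CH M
    x ↔ lev ρ x (X x).1 (star (Y x).1) = 0 := by
  rw [mem_CH_iff_of_mem_CT h hx (bracket_conj_mem_CT h hW hx hxW hX hY),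
    dz_bracket h hW hx hxW hX (by simpa using hY)]
  rfl

lemma sum_bracket_mem_CH_iff (hW : IsOpen W) (hx : x ∈ M ∩ U) (hxW : x ∈ W)
    {F : Fin k → Cn n → CVec n} (hF : ∀ j, IsSection M (H10 M) W (F j))
    (hY : IsSection M (H10 M) W Y) (c : Fin k → ℂ) : ∑ j, c j • bracket (F j) (conjField Y) x ∈ CH M
    x ↔ ∑ j, c j * lev ρ x (F j x).1 (star (Y x).1) = 0 := by
  rw [mem_CH_iff_of_mem_CT h hx (sum_mem fun j _ => smul_mem _ _
    (bracket_conj_mem_CT h hW hx hxW (hF j) hY)), fst_sum, dz_sum]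
  simp only [smul_fst, dz_smul]
  rw [sum_congr rfl fun j _ => by rw [dz_bracket h hW hx hxW (hF j) (by simpa using hY)]]
  rfl

omit h

instance (M : Set (Cn n)) (x : Cn n) : FiniteDimensional ℂ (H10 M x) := inferInstance

include h

/-- A vector that is Levi-orthogonal to a Levi-nondegenerate family of `q` vectors at a point of
Levi rank at most `q` is in the Levi kernel. -/
lemma mem_K10_of_orthogonal (hx : x ∈ M ∩ U) (hq : leviRank M x ≤ q) {f : Fin q → CVec n}
    (hf : ∀ j, f j ∈ H10 M x)
    (hnd : ∀ c : Fin q → ℂ, (∀ l, ∑ j, c j * lev ρ x (f j).1 (star (f l).1) = 0) → c = 0)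
    (hv : v ∈ H10 M x) (hvf : ∀ l, lev ρ x v.1 (star (f l).1) = 0) : v ∈ K10 M x := by
  have hdz : ∀ l, dz ρ x (f l).1 = 0 := fun l => ((mem_H10_iff h hx).1 (hf l)).1
  have hsum : ∀ (c : Fin q → ℂ) l, lev ρ x (∑ j, c j • f j).1 (star (f l).1) =
      ∑ j, c j * lev ρ x (f j).1 (star (f l).1) := by
    intro c l
    rw [fst_sum, lev_sum_left]
    simp [lev_smul_left]
  have hli : LinearIndependent ℂ f := by
    refine Fintype.linearIndependent_iff.2 fun c hc => ?_
    have := hnd c fun l => by rw [← hsum, hc]; simp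
    exact fun i => congrFun this i
  set V := span ℂ (Set.range f)
  have hV : finrank ℂ V = q := by rw [finrank_span_eq_card hli, Fintype.card_fin]
  have hVH : V ≤ H10 M x := span_le.2 (by rintro _ ⟨j, rfl⟩; exact hf j)
  have hker : ∀ w ∈ V, (∀ l, lev ρ x w.1 (star (f l).1) = 0) → w = 0 := by
    intro w hw hwl
    obtain ⟨c, rfl⟩ := (Submodule.mem_span_range_iff_exists_fun ℂ).1 hw
    have := hnd c fun l => by rw [← hsum]; exact hwl l
    simp [this]
  have hdisj : V ⊓ K10 M x = ⊥ := by
    refine (Submodule.eq_bot_iff _).2 fun w hw => hker w hw.1 fun l => ?_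
    exact (lev_eq_zero_of_mem_K10 h hx hw.2 (hdz l)).1
  have hle : V ⊔ K10 M x ≤ H10 M x := sup_le hVH (K10_le_H10 M x)
  have hfr := finrank_sup_add_finrank_inf_eq V (K10 M x)
  rw [hdisj, finrank_bot, add_zero, hV] at hfr
  have heq : V ⊔ K10 M x = H10 M x := by
    refine Submodule.eq_of_le_of_finrank_le hle ?_
    unfold leviRank at hq
    omega
  rw [← heq] at hv
  obtain ⟨w, hw, k, hk, rfl⟩ := mem_sup.1 hv
  have hw0 : w = 0 := hker w hw fun l => by
    have h1 := hvf l
    rw [fst_add, lev_add_left, (lev_eq_zero_of_mem_K10 h hx hk (hdz l)).1, add_zero] at h1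
    exact h1
  rw [hw0, zero_add]
  exact hk

omit h

lemma contDiffAt_det {A : Cn n → Matrix (Fin k) (Fin k) ℂ}
    (hA : ∀ i j, SmoothAt (fun y => A y i j) x) : SmoothAt (fun y => (A y).det) x := by
  simp only [Matrix.det_apply']
  exact ContDiffAt.sum fun σ _ => contDiffAt_const.mul (contDiffAt_prod fun i _ => hA _ _)

lemma contDiffAt_inv_apply {A : Cn n → Matrix (Fin k) (Fin k) ℂ}
    (hA : ∀ i j, SmoothAt (fun y => A y i j) x) (hd : (A x).det ≠ 0) (i j : Fin k) : SmoothAt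
    (fun y => (A y)⁻¹ i j) x := by
  simp only [Matrix.inv_def, Matrix.smul_apply, Ring.inverse_eq_inv', Matrix.adjugate_apply,
    smul_eq_mul]
  refine ((contDiffAt_det hA).inv hd).mul (contDiffAt_det fun a b => ?_)
  simp only [Matrix.updateRow_apply]
  split_ifs
  · exact contDiffAt_const
  · exact hA a b

/-- The Gram matrix of the Levi form on a family of fields. -/
def gram (ρ : Cn n → ℝ) (F : Fin k → Cn n → CVec n) (y : Cn n) :
    Matrix (Fin k) (Fin k) ℂ := fun j l => lev ρ y (F j y).1 (star (F l y).1)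

/-- The coefficients of the Levi-orthogonal projection of `L` to the span of `F`. -/
def projCoeff (ρ : Cn n → ℝ) (F : Fin k → Cn n → CVec n)
    (L : Cn n → CVec n) (y : Cn n) : Fin k → ℂ :=
  Matrix.vecMul (fun l => lev ρ y (L y).1 (star (F l y).1)) (gram ρ F y)⁻¹

lemma contDiffAt_gram {F : Fin k → Cn n → CVec n} (h : SmoothAt ρ x) (hF : ∀ j, SmoothAt (F j) x)
    (i j : Fin k) : SmoothAt (fun y => gram ρ F y i j) x :=
  contDiffAt_levConj h (hF i) (hF j)

lemma contDiffAt_projCoeff {F : Fin k → Cn n → CVec n} (h : SmoothAt ρ x)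
    (hF : ∀ j, SmoothAt (F j) x) (hL : SmoothAt L x) (hd : (gram ρ F x).det ≠ 0) (j : Fin k) :
    SmoothAt (fun y => projCoeff ρ F L y j) x := by
  simp only [projCoeff, Matrix.vecMul, dotProduct]
  exact ContDiffAt.sum fun l _ => (contDiffAt_levConj h hL (hF l)).mul
    (contDiffAt_inv_apply (contDiffAt_gram h hF) hd l j)

lemma lev_sub_proj {F : Fin k → Cn n → CVec n} (hd : (gram ρ F x).det ≠ 0) (l : Fin k) : lev ρ x
    (L x - ∑ j, projCoeff ρ F L x j • F j x).1 (star (F l x).1) = 0 := by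
  rw [fst_sub, fst_sum, lev_sub_left, lev_sum_left]
  simp only [smul_fst, lev_smul_left]
  have h1 : ∑ j, projCoeff ρ F L x j * lev ρ x (F j x).1 (star (F l x).1) =
      Matrix.vecMul (projCoeff ρ F L x) (gram ρ F x) l := rfl
  rw [h1, projCoeff, Matrix.vecMul_vecMul, Matrix.nonsing_inv_mul _ (isUnit_iff_ne_zero.2 hd),
    Matrix.vecMul_one, sub_self]

lemma projCoeff_eq_zero {F : Fin k → Cn n → CVec n}
    (h0 : ∀ l, lev ρ x (L x).1 (star (F l x).1) = 0) : projCoeff ρ F L x = 0 := by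
  have : (fun l => lev ρ x (L x).1 (star (F l x).1)) = 0 := funext h0
  rw [projCoeff, this, Matrix.zero_vecMul]

lemma gram_det_ne_zero {F : Fin k → Cn n → CVec n}
    (hnd : ∀ c : Fin k → ℂ, (∀ l, ∑ j, c j * lev ρ x (F j x).1 (star (F l x).1) = 0) → c = 0) :
    (gram ρ F x).det ≠ 0 := by
  intro h0
  obtain ⟨c, hc, hc0⟩ := Matrix.exists_vecMul_eq_zero_iff.2 h0
  exact hc (hnd c fun l => congrFun hc0 l)

lemma nondegenerate_of_gram {F : Fin k → Cn n → CVec n} (hd : (gram ρ F x).det ≠ 0) (c : Fin k → ℂ)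
    (hc : ∀ l, ∑ j, c j * lev ρ x (F j x).1 (star (F l x).1) = 0) : c = 0 :=
  Matrix.eq_zero_of_vecMul_eq_zero hd (funext hc)

lemma IsPseudoconvex.localPsc (hpsc : IsPseudoconvex M) (hx : x ∈ M) : LocalPsc M x := hpsc x hx

/-- Fields that are Levi-orthogonal to a Levi-nondegenerate subbundle of rank `q` are sections of
`S¹⁰(q)`. -/
lemma S10_of_isLeviOrthogonal (hM : IsRealHypersurface M) (hpsc : IsPseudoconvex M) (hW : IsOpen W)
    {F : Fin q → Cn n → CVec n} (hF : IsLeviNondegenerateFrame M W F)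
    (hL : IsLeviOrthogonal M W F L) : S10 M q W L := by
  refine ⟨hL.1, fun x hx hq => ?_⟩
  obtain ⟨U, ρ, hxU, h, hpsd⟩ := exists_levPsd hM hx.1 (hpsc.localPsc hx.1)
  have hxx : x ∈ M ∩ U := ⟨hx.1, hxU⟩
  have horth : ∀ y ∈ M ∩ U, y ∈ W → ∀ l, lev ρ y (L y).1 (star (F l y).1) = 0 := fun y hy hyW l =>
    (bracket_conj_mem_CH_iff h hW hy hyW hL.1 (hF.1 l)).1 (hL.2 y ⟨hy.1, hyW⟩ l)
  have hnd : ∀ c : Fin q → ℂ,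
      (∀ l, ∑ j, c j * lev ρ x (F j x).1 (star (F l x).1) = 0) → c = 0 := fun c hc =>
    hF.2.2 x hx c fun l => (sum_bracket_mem_CH_iff h hW hxx hx.2 hF.1 (hF.1 l) c).2 (hc l)
  have hFx : ∀ j, F j x ∈ H10 M x := fun j => (hF.1 j).2 x hx
  have hLK : L x ∈ K10 M x :=
    mem_K10_of_orthogonal h hxx hq hFx hnd (hL.1.2 x hx) (horth x hxx hx.2)
  rw [inLeviKernelOrderOne_iff h hxx hW hx.2 hL.1]
  intro a
  refine ⟨(lev_eq_zero_of_mem_K10 h hxx hLK (dz_projH h hxU a)).2, fun v hv => ?_⟩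
  have hd := gram_det_ne_zero hnd
  have hr := h.contDiffAt hxU
  have hFs : ∀ y ∈ W, ∀ j, SmoothAt (F j) y := fun y hy j => (hF.1 j).contDiffAt hW hy
  have hgc : ContinuousAt (fun y => (gram ρ F y).det) x :=
    (contDiffAt_det (contDiffAt_gram hr (hFs x hx.2))).continuousAt
  obtain ⟨V, hVd, hV, hxV⟩ := eventually_nhds_iff.1 (hgc.eventually_ne hd)
  set V' := V ∩ (W ∩ U) with hV'
  have hV'o : IsOpen V' := hV.inter (hW.inter h.1)
  have hxV' : x ∈ V' := ⟨hxV, hx.2, hxU⟩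
  -- the Levi-orthogonal part of the projection of `a`
  set A : Cn n → CVec n := fun y => projH ρ a y - ∑ j, projCoeff ρ F (projH ρ a) y j • F j y with hA
  have hAs : IsSection M (H10 M) V' A := by
    refine ⟨fun y hy => ?_, fun y hy => ?_⟩
    · refine ((contDiffAt_projH h hy.2.2 a).sub (ContDiffAt.sum fun j _ =>
        contDiffAt_smulC ?_ (hFs y hy.2.1 j))).contDiffWithinAt
      exact contDiffAt_projCoeff (h.contDiffAt hy.2.2) (hFs y hy.2.1) (contDiffAt_projH h hy.2.2 a)
        (hVd y hy.1) j
    · exact sub_mem (projH_mem h ⟨hy.1, hy.2.2.2⟩ a) (sum_mem fun j _ =>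
        smul_mem _ _ ((hF.1 j).2 y ⟨hy.1, hy.2.2.1⟩))
  have hAK : A x ∈ K10 M x := mem_K10_of_orthogonal h hxx hq hFx hnd (hAs.2 x ⟨hx.1, hxV'⟩)
    fun l => lev_sub_proj hd l
  have hLs := hL.1.contDiffAt hW hx.2
  rw [cderiv_congr_of_eventually h hxx (contDiffAt_levConj hr (contDiffAt_projH h hxU a) hLs)
    (contDiffAt_levConj hr (hAs.contDiffAt hV'o hxV') hLs) ?_ hv]
  · exact cderiv_lev_eq_zero h hpsd hxx hV'o hxV' hAs
      (hL.1.mono fun y hy => hy.2.1) hAK hLK hv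
  · filter_upwards [hV'o.mem_nhds hxV'] with y hy hyM
    simp only [hA, fst_sub, fst_sum, lev_sub_left, lev_sum_left, smul_fst, lev_smul_left]
    have : ∀ j, lev ρ y (F j y).1 (star (L y).1) = 0 := fun j => by
      rw [lev_conj (h.eventually hy.2.2), star_star, horth y ⟨hyM, hy.2.2⟩ hy.2.1 j, star_zero]
    simp [this]

include h hpsd hp

/-- Near a point of Levi rank `q` there is a Levi-nondegenerate frame of rank `q` made of
projections of constant vectors. -/
lemma exists_frame (hq : leviRank M p = q) : ∃ (W : Set (Cn n)) (w : Fin q → Cn n), IsOpen W ∧ p ∈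
    W ∧ W ⊆ U ∧ (∀ y ∈ W, (gram ρ (fun j => projH ρ (w j)) y).det ≠ 0) ∧ IsLeviNondegenerateFrame M
    W fun j => projH ρ (w j) := by
  obtain ⟨C, hC⟩ := Submodule.exists_isCompl (K10 M p)
  have hsup : K10 M p ⊔ (C ⊓ H10 M p) = H10 M p := by
    rw [← sup_inf_assoc_of_le C (K10_le_H10 M p), hC.sup_eq_top, top_inf_eq]
  have hinf : K10 M p ⊓ (C ⊓ H10 M p) = ⊥ := by rw [← inf_assoc, hC.inf_eq_bot, bot_inf_eq]
  have hfr : finrank ℂ ↥(C ⊓ H10 M p) = q := by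
    have := finrank_sup_add_finrank_inf_eq (K10 M p) (C ⊓ H10 M p)
    rw [hinf, finrank_bot, hsup, add_zero] at this
    unfold leviRank at hq
    omega
  set b := finBasisOfFinrankEq ℂ _ hfr
  set w : Fin q → Cn n := fun j => (b j : CVec n).1 with hw
  have hb : ∀ j, (b j : CVec n) ∈ H10 M p := fun j => (b j).2.2
  have hPb : ∀ j, projH ρ (w j) p = b j := fun j => projH_of_mem h hp (hb j)
  have hnd : (gram ρ (fun j => projH ρ (w j)) p).det ≠ 0 := by
    refine gram_det_ne_zero fun c hc => ?_
    set v : CVec n := ∑ j, c j • (b j : CVec n) with hv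
    have hvH : v ∈ C ⊓ H10 M p := sum_mem fun j _ => smul_mem _ _ (b j).2
    have hvl : ∀ l, lev ρ p v.1 (star (b l : CVec n).1) = 0 := by
      intro l
      rw [hv, fst_sum, lev_sum_left, ← hc l]
      simp [lev_smul_left, hPb]
    have hvv : lev ρ p v.1 (star v.1) = 0 := by
      have : star v.1 = ∑ j, star (c j) • star (b j : CVec n).1 := by
        rw [hv, fst_sum, star_sum]; simp
      rw [this, lev_sum_right]
      simp [lev_smul_right, hvl]
    have hvK := mem_K10_of_lev_self h hpsd hp hvH.2 (by rw [hvv]; rfl)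
    have hv0 : v = 0 := by
      have : v ∈ K10 M p ⊓ (C ⊓ H10 M p) := ⟨hvK, hvH⟩
      rw [hinf] at this
      exact this
    have h2 : ∑ j, c j • b j = 0 := by
      apply Subtype.ext
      rw [coe_finsetSum]
      simpa [hv] using hv0
    exact funext fun i => Fintype.linearIndependent_iff.1 b.linearIndependent c h2 i
  have hgc : ContinuousAt (fun y => (gram ρ (fun j => projH ρ (w j)) y).det) p :=
    (contDiffAt_det (contDiffAt_gram (h.contDiffAt hp.2)
      fun j => contDiffAt_projH h hp.2 _)).continuousAt
  obtain ⟨V, hVd, hV, hpV⟩ := eventually_nhds_iff.1 (hgc.eventually_ne hnd)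
  have hF : ∀ j, IsSection M (H10 M) (V ∩ U) (projH ρ (w j)) := fun j =>
    (isSection_projH h _).mono inter_subset_right
  refine ⟨V ∩ U, w, hV.inter h.1, ⟨hpV, hp.2⟩, inter_subset_right, fun y hy => hVd y hy.1, hF,
    ?_, ?_⟩
  · intro y hy
    refine Fintype.linearIndependent_iff.2 fun c hc => ?_
    have := nondegenerate_of_gram (hVd y hy.2.1) c fun l => ?_
    · exact fun i => congrFun this i
    · have h3 : lev ρ y (∑ j, c j • projH ρ (w j) y).1 (star (projH ρ (w l) y).1) = 0 := by
        rw [hc]; simp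
      rw [fst_sum, lev_sum_left] at h3
      simpa [lev_smul_left] using h3
  · intro y hy c hc
    refine nondegenerate_of_gram (hVd y hy.2.1) c fun l => ?_
    exact (sum_bracket_mem_CH_iff h (hV.inter h.1) ⟨hy.1, hy.2.2⟩ hy.2 hF (hF l) c).1 (hc l)

omit h hpsd hp

/-- The values at a point of Levi rank `q` of the sections of `S¹⁰(q)` exhaust the Levi kernel. -/
lemma exists_S10_of_mem_K10 (hM : IsRealHypersurface M) (hpsc : IsPseudoconvex M) (hp : p ∈ M)
    (hq : leviRank M p = q) (hv : v ∈ K10 M p) : ∃ W L, IsOpen W ∧ p ∈ W ∧ S10 M q W L ∧ L p =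
    v := by
  obtain ⟨U, ρ, hpU, h, hpsd⟩ := exists_levPsd hM hp (hpsc.localPsc hp)
  obtain ⟨W, w, hW, hpW, hWU, hd, hF⟩ := exists_frame h hpsd ⟨hp, hpU⟩ hq
  set F : Fin q → Cn n → CVec n := fun j => projH ρ (w j)
  set A : Cn n → CVec n := fun y => projH ρ v.1 y - ∑ j, projCoeff ρ F (projH ρ v.1) y j • F j y
    with hA
  have hAs : IsSection M (H10 M) W A := by
    refine ⟨fun y hy => ?_, fun y hy => ?_⟩
    · refine ((contDiffAt_projH h (hWU hy) _).sub (ContDiffAt.sum fun j _ =>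
        contDiffAt_smulC ?_ (contDiffAt_projH h (hWU hy) _))).contDiffWithinAt
      exact contDiffAt_projCoeff (h.contDiffAt (hWU hy)) (fun j => contDiffAt_projH h (hWU hy) _)
        (contDiffAt_projH h (hWU hy) _) (hd y hy) j
    · exact sub_mem (projH_mem h ⟨hy.1, hWU hy.2⟩ _) (sum_mem fun j _ =>
        smul_mem _ _ ((hF.1 j).2 y hy))
  refine ⟨W, A, hW, hpW, S10_of_isLeviOrthogonal hM hpsc hW hF ⟨hAs, fun y hy l => ?_⟩, ?_⟩
  · exact (bracket_conj_mem_CH_iff h hW ⟨hy.1, hWU hy.2⟩ hy.2 hAs (hF.1 l)).2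
      (lev_sub_proj (hd y hy.2) l)
  · have hP : projH ρ v.1 p = v := projH_of_mem h ⟨hp, hpU⟩ hv.1
    have : projCoeff ρ F (projH ρ v.1) p = 0 := by
      refine projCoeff_eq_zero fun l => ?_
      rw [hP]
      exact (lev_eq_zero_of_mem_K10 h ⟨hp, hpU⟩ hv (dz_projH h hpU _)).1
    simp only [hA, this, hP]
    simp

end kernel

/-! ### The sheaves -/

section sheaves

variable {θ : Cn n → (CVec n →L[ℂ] ℂ)} {X Y L L' : Cn n → CVec n}

variable (hM : IsRealHypersurface M) (hW : IsOpen W)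
include hM hW

lemma InLeviKernelOrderOne.congr (hp : p ∈ M) (hpW : p ∈ W) (hL : IsSection M (H10 M) W L)
    (hL' : IsSection M (H10 M) W L') (heq : ∀ y ∈ M ∩ W, L' y = L y)
    (hK : InLeviKernelOrderOne M p L) : InLeviKernelOrderOne M p L' := by
  obtain ⟨U, ρ, hpU, h⟩ := hM p hp
  have hpp : p ∈ M ∩ U := ⟨hp, hpU⟩
  rw [inLeviKernelOrderOne_iff h hpp hW hpW] at hK ⊢ <;> try assumption
  intro a
  refine ⟨by rw [heq p ⟨hp, hpW⟩]; exact (hK a).1, fun v hv => ?_⟩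
  rw [← (hK a).2 v hv]
  refine cderiv_congr_of_eventually h hpp
    (contDiffAt_levConj (h.contDiffAt hpU) (contDiffAt_projH h hpU a) (hL'.contDiffAt hW hpW))
    (contDiffAt_levConj (h.contDiffAt hpU) (contDiffAt_projH h hpU a) (hL.contDiffAt hW hpW)) ?_ hv
  filter_upwards [hW.mem_nhds hpW] with y hy hyM
  rw [heq y ⟨hyM, hy⟩]

lemma InLeviKernelOrderOne.add (hp : p ∈ M) (hpW : p ∈ W) (hL : IsSection M (H10 M) W L)
    (hL' : IsSection M (H10 M) W L') (hK : InLeviKernelOrderOne M p L)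
    (hK' : InLeviKernelOrderOne M p L') : InLeviKernelOrderOne M p (L + L') := by
  obtain ⟨U, ρ, hpU, h⟩ := hM p hp
  have hpp : p ∈ M ∩ U := ⟨hp, hpU⟩
  have hs : IsSection M (H10 M) W (L + L') :=
    ⟨hL.1.add hL'.1, fun y hy => add_mem (hL.2 y hy) (hL'.2 y hy)⟩
  rw [inLeviKernelOrderOne_iff h hpp hW hpW] at hK hK' ⊢ <;> try assumption
  intro a
  have hd : ∀ {Z : Cn n → CVec n}, IsSection M (H10 M) W Z →
      DifferentiableAt ℝ (levF ρ (projH ρ a) Z) p := fun hZ =>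
    (contDiffAt_levConj (h.contDiffAt hpU) (contDiffAt_projH h hpU a) (hZ.contDiffAt hW hpW)).diffAt
  simp only [Pi.add_apply, fst_add, star_add, lev_add_right]
  refine ⟨by rw [(hK a).1, (hK' a).1, add_zero], fun v hv => ?_⟩
  rw [cderiv_fun_add (hd hL) (hd hL'), (hK a).2 v hv, (hK' a).2 v hv, add_zero]

lemma InLeviKernelOrderOne.smul (hp : p ∈ M) (hpW : p ∈ W) (hL : IsSection M (H10 M) W L)
    {a : Cn n → ℂ} (ha : ContDiffOn ℝ ∞ a W) (hK : InLeviKernelOrderOne M p L) :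
    InLeviKernelOrderOne M p (fun y => a y • L y) := by
  obtain ⟨U, ρ, hpU, h⟩ := hM p hp
  have hpp : p ∈ M ∩ U := ⟨hp, hpU⟩
  have hs : IsSection M (H10 M) W (fun y => a y • L y) :=
    ⟨ha.smul hL.1, fun y hy => smul_mem _ _ (hL.2 y hy)⟩
  rw [inLeviKernelOrderOne_iff h hpp hW hpW] at hK ⊢ <;> try assumption
  intro b
  simp only [smul_fst, star_smul, lev_smul_right]
  refine ⟨by rw [(hK b).1, mul_zero], fun v hv => ?_⟩
  exact cderiv_mul_eq_zero (contDiffAt_conj (ha.contDiffAt (hW.mem_nhds hpW)))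
    (contDiffAt_levConj (h.contDiffAt hpU) (contDiffAt_projH h hpU b) (hL.contDiffAt hW hpW))
    (hK b).1 ((hK b).2 v hv)

omit hM hW

lemma isSection_zero (M W : Set (Cn n)) (V : Cn n → Submodule ℂ (CVec n)) : IsSection M V W 0 :=
    ⟨contDiffOn_const, fun _ _ => zero_mem _⟩

include hM

lemma inLeviKernelOrderOne_zero (hp : p ∈ M) : InLeviKernelOrderOne M p 0 := by
  obtain ⟨U, ρ, hpU, h⟩ := hM p hp
  rw [inLeviKernelOrderOne_iff h ⟨hp, hpU⟩ isOpen_univ trivial (isSection_zero M _ _)]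
  intro a
  simp

lemma isSubmoduleSheaf_S10 (q : ℕ) : IsSubmoduleSheaf M (S10 M q) where
  isSection _ _ _ h := h.1
  congr U X Y hU h hY heq := by
    have hs : IsSection M (H10 M) U Y := ⟨hY, fun x hx => by rw [heq x hx]; exact h.1.2 x hx⟩
    exact ⟨hs, fun x hx hq => (h.2 x hx hq).congr hM hU hx.1 hx.2 h.1 hs heq⟩
  restrict U U' X _ _ hUU h := ⟨h.1.mono hUU, fun x hx => h.2 x ⟨hx.1, hUU hx.2⟩⟩
  locality U X _ hX h := by
    refine ⟨⟨hX, fun x hx => ?_⟩, fun x hx hq => ?_⟩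
    · obtain ⟨V, _, _, hxV, hS⟩ := h x hx
      exact hS.1.2 x ⟨hx.1, hxV⟩
    · obtain ⟨V, _, _, hxV, hS⟩ := h x hx
      exact hS.2 x ⟨hx.1, hxV⟩ hq
  zero U _ := ⟨isSection_zero M U _, fun x hx _ => inLeviKernelOrderOne_zero hM hx.1⟩
  add U X Y hU hX hY :=
    ⟨⟨hX.1.1.add hY.1.1, fun y hy => add_mem (hX.1.2 y hy) (hY.1.2 y hy)⟩, fun x hx hq =>
      (hX.2 x hx hq).add hM hU hx.1 hx.2 hX.1 hY.1 (hY.2 x hx hq)⟩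
  smul U a X hU ha hX := ⟨⟨ha.smul hX.1.1, fun y hy => smul_mem _ _ (hX.1.2 y hy)⟩, fun x hx hq =>
      (hX.2 x hx hq).smul hM hU hx.1 hx.2 hX.1 ha⟩

omit hM

lemma S10.mono {U' : Set (Cn n)} (h : S10 M q U X) (hU : U' ⊆ U) : S10 M q U' X :=
  ⟨h.1.mono hU, fun x hx => h.2 x ⟨hx.1, hU hx.2⟩⟩

lemma IsIdealGenerator.mono {U' : Set (Cn n)} (h : IsIdealGenerator M q U g) (hU : U' ⊆ U) :
    IsIdealGenerator M q U' g := by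
  obtain ⟨θ, L₂, L₁, hθ, h2, h1, h⟩ := h
  refine ⟨θ, L₂, L₁, hθ.mono hU, h2.mono hU, h1.mono hU, ?_⟩
  rcases h with rfl | ⟨L₃, h3, rfl⟩
  · exact Or.inl rfl
  · exact Or.inr ⟨L₃, h3.mono hU, rfl⟩

lemma IsIdealGenerator.contDiffOn (hU : IsOpen U) (h : IsIdealGenerator M q U g) : ContDiffOn ℝ ∞ g
    U := by
  obtain ⟨θ, L₂, L₁, hθ, h2, h1, h⟩ := h
  intro x hx
  have hL1 : SmoothAt L₁ x := by
    have := contDiffAt_conjField (h1.1.contDiffAt hU hx)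
    rwa [conjField_conjField] at this
  have hl := contDiffAt_leviFn (hθ.contDiffAt hU hx) (h2.1.contDiffAt hU hx) hL1
  rcases h with rfl | ⟨L₃, h3, rfl⟩
  · exact hl.contDiffWithinAt
  · exact (contDiffAt_cderiv hl (h3.contDiffAt hU hx)).contDiffWithinAt

lemma IsIdealGenerator.eq_zero (hU : IsOpen U) (hM : IsRealHypersurface M)
    (h : IsIdealGenerator M q U g) (hx : x ∈ M ∩ U) (hq : leviRank M x ≤ q) : g x = 0 := by
  obtain ⟨θ, L₂, L₁, hθ, h2, h1, h⟩ := h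
  obtain ⟨V, ρ, hxV, hρ⟩ := hM x hx.1
  rcases h with rfl | ⟨L₃, h3, rfl⟩
  · have := (h1.2 x hx hq U L₂ 0 θ hU hx.2 h2.1 (isSection_zero M U _) hθ).1
    simpa using this
  · have := (h1.2 x hx hq U L₂ L₃ θ hU hx.2 h2.1 h3 hθ).2
    simpa using this

lemma isIdealSheaf_idealSheaf (M : Set (Cn n)) (q : ℕ) : IsIdealSheaf M (idealSheaf M q) where
  smooth _ _ _ h := h.1
  congr U f g _ hf hg heq := by
    refine ⟨hg, fun x hx => ?_⟩
    obtain ⟨V, hVU, hV, hxV, k, a, gg, ha, hgg, hs⟩ := hf.2 x hx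
    exact ⟨V, hVU, hV, hxV, k, a, gg, ha, hgg, fun y hy => by rw [heq y ⟨hy.1, hVU hy.2⟩, hs y hy]⟩
  restrict U U' f _ hU' hUU hf := by
    refine ⟨hf.1.mono hUU, fun x hx => ?_⟩
    obtain ⟨V, hVU, hV, hxV, k, a, gg, ha, hgg, hs⟩ := hf.2 x ⟨hx.1, hUU hx.2⟩
    exact ⟨V ∩ U', inter_subset_right, hV.inter hU', ⟨hxV, hx.2⟩, k, a, gg,
      fun i => (ha i).mono inter_subset_left, fun i => (hgg i).mono inter_subset_left,
      fun y hy => hs y ⟨hy.1, hy.2.1⟩⟩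
  locality U f _ hf h := by
    refine ⟨hf, fun x hx => ?_⟩
    obtain ⟨V, hVU, _, hxV, hfV⟩ := h x hx
    obtain ⟨V', hV'V, hV', hxV', r⟩ := hfV.2 x ⟨hx.1, hxV⟩
    exact ⟨V', hV'V.trans hVU, hV', hxV', r⟩
  zero U hU := ⟨contDiffOn_const, fun x hx => ⟨U, subset_rfl, hU, hx.2, 0, finZeroElim, finZeroElim,
    fun i => i.elim0, fun i => i.elim0, fun y _ => by simp⟩⟩
  add U f g _ hf hg := by
    refine ⟨hf.1.add hg.1, fun x hx => ?_⟩
    obtain ⟨V, hVU, hV, hxV, k, a, ff, ha, hff, hs⟩ := hf.2 x hx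
    obtain ⟨V', hVU', hV', hxV', k', a', gg, ha', hgg, hs'⟩ := hg.2 x hx
    refine ⟨V ∩ V', inter_subset_left.trans hVU, hV.inter hV', ⟨hxV, hxV'⟩, k + k',
      Fin.addCases a a', Fin.addCases ff gg, fun i => ?_, fun i => ?_, fun y hy => ?_⟩
    · induction i using Fin.addCases with
      | left i => simpa using (ha i).mono inter_subset_left
      | right i => simpa using (ha' i).mono inter_subset_right
    · induction i using Fin.addCases with
      | left i => simpa using (hff i).mono inter_subset_left
      | right i => simpa using (hgg i).mono inter_subset_right
    · rw [Pi.add_apply, hs y ⟨hy.1, hy.2.1⟩, hs' y ⟨hy.1, hy.2.2⟩, Fin.sum_univ_add]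
      simp
  mul U b f _ hb hf := by
    refine ⟨hb.mul hf.1, fun x hx => ?_⟩
    obtain ⟨V, hVU, hV, hxV, k, a, gg, ha, hgg, hs⟩ := hf.2 x hx
    refine ⟨V, hVU, hV, hxV, k, fun i => b * a i, gg, fun i => (hb.mono hVU).mul (ha i), hgg,
      fun y hy => ?_⟩
    rw [Pi.mul_apply, hs y hy, mul_sum]
    exact sum_congr rfl fun i _ => (mul_assoc _ _ _).symm

lemma idealSheaf_of_generator (hU : IsOpen U) (h : IsIdealGenerator M q U g) : idealSheaf M q U g :=
  ⟨h.contDiffOn hU, fun _ hx => ⟨U, subset_rfl, hU, hx.2, 1, fun _ _ => 1, fun _ => g,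
    fun _ => contDiffOn_const, fun _ => h, fun y _ => by simp⟩⟩

lemma idealSheaf_minimal {J : Set (Cn n) → (Cn n → ℂ) → Prop} (hJ : IsIdealSheaf M J)
    (hg : ∀ U g, IsOpen U → IsIdealGenerator M q U g → J U g) (hU : IsOpen U)
    (hf : idealSheaf M q U f) : J U f := by
  refine hJ.locality U f hU hf.1 fun x hx => ?_
  obtain ⟨V, hVU, hV, hxV, k, a, gg, ha, hgg, hs⟩ := hf.2 x hx
  refine ⟨V, hVU, hV, hxV, ?_⟩
  have key : ∀ s : Finset (Fin k), J V (∑ i ∈ s, a i * gg i) := by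
    intro s
    classical
    induction s using Finset.induction_on with
    | empty => simpa using hJ.zero V hV
    | insert i s hi ih =>
      rw [sum_insert hi]
      exact hJ.add V _ _ hV (hJ.mul V _ _ hV (ha i) (hg V _ hV (hgg i))) ih
  refine hJ.congr V _ f hV (key univ) (hf.1.mono hVU) fun y hy => ?_
  rw [hs y hy, Finset.sum_apply]
  rfl

include hM

lemma idealSheaf_eq_zero (hf : idealSheaf M q U f) (hx : x ∈ M ∩ U) (hq : leviRank M x ≤ q) : f x =
    0 := by
  obtain ⟨V, hVU, hV, hxV, k, a, gg, ha, hgg, hs⟩ := hf.2 x hx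
  rw [hs x ⟨hx.1, hxV⟩]
  exact sum_eq_zero fun i _ => by rw [(hgg i).eq_zero hV hM ⟨hx.1, hxV⟩ hq, mul_zero]

lemma reIdealSheaf_eq_zero {f : Cn n → ℝ} (hf : reIdealSheaf M q U f) (hx : x ∈ M ∩ U)
    (hq : leviRank M x = q) : f x = 0 := by
  obtain ⟨_, g, hg, hfg⟩ := hf
  rw [hfg x hx, idealSheaf_eq_zero hM hg hx hq.le, zero_re]

end sheaves

/-! ### Invariance under biholomorphic maps -/

section invariance

variable {θ : Cn n → (CVec n →L[ℂ] ℂ)} {X Y L : Cn n → CVec n}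

lemma IsBiholomorphic.symm (h : IsBiholomorphic Φ) : IsBiholomorphic Φ.symm := ⟨h.2, h.1⟩

variable (h : IsCRMap M M' Φ) (hM : IsRealHypersurface M) (hM' : IsRealHypersurface M')
include h

lemma IsCRMap.symm : IsCRMap M' M Φ.symm := by
  refine ⟨h.1.symm, fun y hy => ?_⟩
  rw [← h.2 _ (Φ.map_target hy), Φ.right_inv hy]

omit h

lemma IsBiholomorphic.differentiableAt (h : IsBiholomorphic Φ) (hx : x ∈ Φ.source) :
    DifferentiableAt ℂ Φ x := (h.1 x hx).differentiableAt

lemma IsBiholomorphic.contDiffAt (h : IsBiholomorphic Φ) (hx : x ∈ Φ.source) : SmoothAt Φ x :=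
    ((h.1 x hx).contDiffAt (n := ∞)).restrict_scalars ℝ

lemma pushV_add (f : Cn n → Cn n) (X Y : CVec n) : pushV f x (X + Y) = pushV f x X + pushV f x
    Y := by
  refine Prod.ext ?_ ?_ <;> simp [pushV]

lemma pushV_smul (f : Cn n → Cn n) (c : ℂ) (X : CVec n) : pushV f x (c • X) = c • pushV f x X := by
  refine Prod.ext ?_ ?_ <;> simp [pushV]

/-- The complexified differential as a linear map. -/
def pushVₗ (f : Cn n → Cn n) (x : Cn n) : CVec n →ₗ[ℂ] CVec n where
  toFun := pushV f x
  map_add' := pushV_add f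
  map_smul' := pushV_smul f

@[simp] lemma pushVₗ_apply (f : Cn n → Cn n) (X : CVec n) : pushVₗ f x X = pushV f x X := rfl

lemma conjV_pushV (f : Cn n → Cn n) (X : CVec n) : conjV (pushV f x X) = pushV f x (conjV X) := by
  simp [pushV, conjV]

lemma pushV_ofRealV (f : Cn n → Cn n) (v : Cn n) : pushV f x (ofRealV v) = ofRealV
    (fderiv ℂ f x v) := by
  simp [pushV, ofRealV]

lemma fderiv_symm_fderiv (h : IsBiholomorphic Φ) (hx : x ∈ Φ.source) (v : Cn n) : fderiv ℂ Φ.symm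
    (Φ x) (fderiv ℂ Φ x v) = v := by
  have h1 : (fun y => Φ.symm (Φ y)) =ᶠ[𝓝 x] id := by
    filter_upwards [Φ.open_source.mem_nhds hx] with y hy
    exact Φ.left_inv hy
  have h2 : HasFDerivAt (fun y => Φ.symm (Φ y)) ((fderiv ℂ Φ.symm (Φ x)).comp (fderiv ℂ Φ x)) x :=
    (h.symm.differentiableAt (Φ.map_source hx)).hasFDerivAt.comp x
      (h.differentiableAt hx).hasFDerivAt
  have h3 := h2.unique ((hasFDerivAt_id x).congr_of_eventuallyEq h1)
  simpa using congrArg (fun f => f v) h3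

lemma pushV_symm_pushV (h : IsBiholomorphic Φ) (hx : x ∈ Φ.source) (X : CVec n) : pushV Φ.symm (Φ x)
    (pushV Φ x X) = X := by
  simp [pushV, fderiv_symm_fderiv h hx]

lemma pushV_pushV_symm (h : IsBiholomorphic Φ) (hx : x ∈ Φ.source) (X : CVec n) : pushV Φ x
    (pushV Φ.symm (Φ x) X) = X := by
  have := pushV_symm_pushV h.symm (Φ.map_source hx) X
  simpa [Φ.left_inv hx] using this

include h

lemma pushV_mem_CT (hx : x ∈ Φ.source) (hv : v ∈ CT M x) : pushV Φ x v ∈ CT M' (Φ x) := by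
  intro V g hV hxV hg h0
  have hg' : ∀ y ∈ V, SmoothAt g y := fun y hy => hg.contDiffAt (hV.mem_nhds hy)
  rw [← cderiv_comp_push (hg' _ hxV).diffAt (h.1.differentiableAt hx)]
  have hO : IsOpen (Φ.source ∩ Φ ⁻¹' V) := Φ.isOpen_inter_preimage hV
  refine hv _ _ hO ⟨hx, hxV⟩ (fun y hy => ?_) (fun y hy => ?_)
  · exact ((hg' _ hy.2).comp y (h.1.contDiffAt hy.1)).contDiffWithinAt
  · exact h0 _ ⟨(h.2 y hy.2.1).2 hy.1, hy.2.2⟩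

lemma pushV_mem_H10 (hx : x ∈ Φ.source) (hv : v ∈ H10 M x) : pushV Φ x v ∈ H10 M' (Φ x) := by
  refine ⟨pushV_mem_CT h hx hv.1, ?_⟩
  have : v.2 = 0 := hv.2
  simp [pushV, this]

lemma pushV_mem_H01 (hx : x ∈ Φ.source) (hv : v ∈ H01 M x) : pushV Φ x v ∈ H01 M' (Φ x) := by
  refine ⟨pushV_mem_CT h hx hv.1, ?_⟩
  have : v.1 = 0 := hv.2
  simp [pushV, this]

lemma pushV_mem_CH (hx : x ∈ Φ.source) (hv : v ∈ CH M x) : pushV Φ x v ∈ CH M' (Φ x) := by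
  obtain ⟨a, ha, b, hb, rfl⟩ := mem_sup.1 hv
  rw [pushV_add]
  exact add_mem (H10_le_CH M' _ (pushV_mem_H10 h hx ha)) (H01_le_CH M' _ (pushV_mem_H01 h hx hb))

omit h

lemma pushField_apply (hx : x ∈ Φ.source) : pushField Φ X (Φ x) = pushV Φ x (X x) := by
  simp [pushField, Φ.left_inv hx]

lemma conjField_pushField : conjField (pushField Φ X) = pushField Φ (conjField X) := by
  funext y
  simp [conjField, pushField, conjV_pushV]

lemma contDiffAt_pushV (h : IsBiholomorphic Φ) (hx : x ∈ Φ.source) (hX : SmoothAt X x) : SmoothAt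
    (fun y => pushV Φ y (X y)) x := by
  have hD : SmoothAt (fderiv ℂ Φ) x :=
    (((h.1 x hx).contDiffAt (n := ∞)).fderiv_right (m := ∞) (by simp)).restrict_scalars ℝ
  have key : ∀ {a : Cn n → Cn n}, SmoothAt a x → SmoothAt (fun y => fderiv ℂ Φ y (a y)) x := by
    intro a ha
    have hb : IsBoundedBilinearMap ℝ fun q : (Cn n →L[ℂ] Cn n) × Cn n => q.1 q.2 :=
      { add_left := fun _ _ _ => rfl
        smul_left := fun _ _ _ => rfl
        add_right := fun f _ _ => map_add f _ _
        smul_right := fun c f v => by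
          change f (c • v) = c • f v
          rw [← coe_smul, map_smul, coe_smul]
        bound := ⟨1, one_pos, fun f v => by rw [one_mul]; exact f.le_opNorm v⟩ }
    exact hb.contDiff.contDiffAt.comp x (hD.prodMk ha)
  exact (key (contDiffAt_fst hX)).prodMk
    (contDiffAt_star (key (contDiffAt_star (contDiff_snd.contDiffAt.comp x hX))))

lemma contDiffAt_pushField (h : IsBiholomorphic Φ) (hx : x ∈ Φ.source) (hX : SmoothAt X x) :
    SmoothAt (pushField Φ X) (Φ x) := by
  have h1 := h.symm.contDiffAt (Φ.map_source hx)
  refine ContDiffAt.comp (g := fun y => pushV Φ y (X y)) (Φ x) ?_ h1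
  rw [Φ.left_inv hx]
  exact contDiffAt_pushV h hx hX

lemma cderiv_pushField (h : IsBiholomorphic Φ) (hx : x ∈ Φ.source) (hf : SmoothAt f (Φ x)) : cderiv
    f (Φ x) (pushField Φ X (Φ x)) = cderiv (fun y => f (Φ y)) x (X x) := by
  rw [pushField_apply hx, cderiv_comp_push hf.diffAt (h.differentiableAt hx)]

lemma bracket_pushField (h : IsBiholomorphic Φ) (hx : x ∈ Φ.source) (hX : SmoothAt X x)
    (hY : SmoothAt Y x) : bracket (pushField Φ X) (pushField Φ Y) (Φ x) = pushV Φ x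
    (bracket X Y x) := by
  have hs : ∀ {A B : Cn n → CVec n}, SmoothAt A x → SmoothAt B x →
      ∀ s, cderiv (fun y => cderiv (coordFn s) y (pushField Φ B y)) (Φ x) (pushField Φ A (Φ x)) =
        cderiv (fun y => cderiv (fun z => coordFn s (Φ z)) y (B y)) x (A x) := by
    intro A B hA hB s
    rw [cderiv_pushField h hx (contDiffAt_cderiv (contDiff_coordFn s).contDiffAt
      (contDiffAt_pushField h hx hB))]
    refine cderiv_congr ?_ _
    filter_upwards [Φ.open_source.mem_nhds hx] with y hy
    exact cderiv_pushField h hy (contDiff_coordFn s).contDiffAt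
  refine ext_coordOf fun s => ?_
  have hc : SmoothAt (fun z => coordFn s (Φ z)) x :=
    (contDiff_coordFn s).contDiffAt.comp x (h.contDiffAt hx)
  rw [← cderiv_coordFn s (Φ x), ← cderiv_coordFn s (Φ x), cderiv_bracket
    (contDiff_coordFn s).contDiffAt (contDiffAt_pushField h hx hX) (contDiffAt_pushField h hx hY),
    hs hX hY, hs hY hX, ← cderiv_bracket hc hX hY,
    cderiv_comp_push (contDiff_coordFn s).contDiffAt.diffAt (h.differentiableAt hx)]

lemma isOpen_image (hU : IsOpen U) (hUs : U ⊆ Φ.source) : IsOpen (Φ '' U) :=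
  Φ.isOpen_image_of_subset_source hU hUs

include h

lemma isSection_pushField (hU : IsOpen U) (hUs : U ⊆ Φ.source) {V V' : Cn n → Submodule ℂ (CVec n)}
    (hV : ∀ y ∈ Φ.source, ∀ v ∈ V y, pushV Φ y v ∈ V' (Φ y)) (hX : IsSection M V U X) : IsSection M'
    V' (Φ '' U) (pushField Φ X) := by
  constructor
  · rintro _ ⟨y, hy, rfl⟩
    exact (contDiffAt_pushField h.1 (hUs hy) (hX.contDiffAt hU hy)).contDiffWithinAt
  · rintro _ ⟨hM', y, hy, rfl⟩
    rw [pushField_apply (hUs hy)]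
    exact hV y (hUs hy) _ (hX.2 y ⟨(h.2 y (hUs hy)).1 hM', hy⟩)

omit h

/-- The push-forward of a form under a biholomorphic map. -/
def pushForm (Φ : OpenPartialHomeomorph (Cn n) (Cn n))
    (θ : Cn n → (CVec n →L[ℂ] ℂ)) (y : Cn n) : CVec n →L[ℂ] ℂ :=
  ∑ s, θ (Φ.symm y) (pushV Φ.symm y (coordV s)) • coordOf s

lemma pushForm_apply (y : Cn n) (v : CVec n) : pushForm Φ θ y v = θ (Φ.symm y)
    (pushV Φ.symm y v) := by
  simp only [pushForm, sum_apply, smul_apply, smul_eq_mul]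
  conv_rhs => rw [← sum_coordOf v, ← pushVₗ_apply, map_sum, map_sum]
  simp [mul_comm]

lemma pushForm_pushV (h : IsBiholomorphic Φ) (hx : x ∈ Φ.source) (v : CVec n) : pushForm Φ θ (Φ x)
    (pushV Φ x v) = θ x v := by
  rw [pushForm_apply, pushV_symm_pushV h hx, Φ.left_inv hx]

include h

lemma isContactForm_pushForm (hU : IsOpen U) (hUs : U ⊆ Φ.source) (hθ : IsContactForm M U θ) :
    IsContactForm M' (Φ '' U) (pushForm Φ θ) := by
  constructor
  · rintro _ ⟨y, hy, rfl⟩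
    refine ContDiffAt.contDiffWithinAt ?_
    refine ContDiffAt.sum fun s _ => ?_
    have hy' := Φ.map_source (hUs hy)
    have h1 : SmoothAt (fun z => θ (Φ.symm z)) (Φ y) := by
      refine ContDiffAt.comp (g := θ) (Φ y) ?_ (h.1.symm.contDiffAt hy')
      rw [Φ.left_inv (hUs hy)]
      exact hθ.contDiffAt hU hy
    exact (contDiffAt_apply_field h1 (contDiffAt_pushV h.1.symm hy' contDiffAt_const)).smul
      contDiffAt_const
  · rintro _ ⟨hM', y, hy, rfl⟩
    have hyM := (h.2 y (hUs hy)).1 hM'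
    have hy' := Φ.map_source (hUs hy)
    refine ⟨fun v hv => ?_, fun v hv => ?_⟩
    · rw [pushForm_apply, Φ.left_inv (hUs hy)]
      refine (hθ.2 y ⟨hyM, hy⟩).1 _ ?_
      have := pushV_mem_CH h.symm hy' hv
      rwa [Φ.left_inv (hUs hy)] at this
    · rw [pushForm_apply, Φ.left_inv (hUs hy), pushV_ofRealV]
      refine (hθ.2 y ⟨hyM, hy⟩).2 _ ?_
      have := pushV_mem_CT h.symm hy' hv
      rwa [Φ.left_inv (hUs hy), pushV_ofRealV] at this

omit h

lemma leviFn_push (h : IsBiholomorphic Φ) (hx : x ∈ Φ.source) (hX : SmoothAt X x)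
    (hY : SmoothAt Y x) : leviFn (pushForm Φ θ) (pushField Φ X) (pushField Φ Y) (Φ x) = leviFn θ X Y
    x := by
  rw [leviFn, bracket_pushField h hx hX hY, pushForm_pushV h hx]
  rfl

lemma contDiffAt_symm_comp (h : IsBiholomorphic Φ) (hx : x ∈ Φ.source) (hf : SmoothAt f x) :
    SmoothAt (fun y => f (Φ.symm y)) (Φ x) := by
  refine ContDiffAt.comp (g := f) (Φ x) ?_ (h.symm.contDiffAt (Φ.map_source hx))
  rwa [Φ.left_inv hx]

/-- Derivatives along a pushed field. -/
lemma cderiv_symm_pushField (h : IsBiholomorphic Φ) (hx : x ∈ Φ.source) (hf : SmoothAt f x) : cderiv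
    (fun y => f (Φ.symm y)) (Φ x) (pushField Φ X (Φ x)) = cderiv f x (X x) := by
  rw [cderiv_pushField h hx (contDiffAt_symm_comp h hx hf)]
  refine cderiv_congr ?_ _
  filter_upwards [Φ.open_source.mem_nhds hx] with y hy
  rw [Φ.left_inv hy]

lemma leviFn_push_eventually (h : IsBiholomorphic Φ) (hUs : U ⊆ Φ.source)
    (hX : ∀ y ∈ U, SmoothAt X y) (hY : ∀ y ∈ U, SmoothAt Y y) : ∀ z ∈ Φ '' U, leviFn (pushForm Φ θ)
    (pushField Φ X) (pushField Φ Y) z = leviFn θ X Y (Φ.symm z) := by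
  rintro _ ⟨y, hy, rfl⟩
  rw [leviFn_push h (hUs hy) (hX y hy) (hY y hy), Φ.left_inv (hUs hy)]

include h

lemma InLeviKernelOrderOne.push (hU : IsOpen U) (hUs : U ⊆ Φ.source) (hM' : IsRealHypersurface M')
    (hp : p ∈ M ∩ U) (hL : IsSection M (H10 M) U L) (hK : InLeviKernelOrderOne M p L) :
    InLeviKernelOrderOne M' (Φ p) (pushField Φ L) := by
  obtain ⟨V, ρ, hpV, hρ⟩ := hM' (Φ p) ((h.2 p (hUs hp.2)).2 hp.1)
  have hps := hUs hp.2
  intro V L₁ L₂ θ hV hpV hL₁ hL₂ hθ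
  -- pull everything back to `M`
  set V' := Φ '' U ∩ V with hV'
  have hV'o : IsOpen V' := (isOpen_image hU hUs).inter hV
  have hV't : V' ⊆ Φ.symm.source := by rintro _ ⟨⟨y, hy, rfl⟩, _⟩; exact Φ.map_source (hUs hy)
  have hpV' : Φ p ∈ V' := ⟨⟨p, hp.2, rfl⟩, hpV⟩
  set O := Φ.symm '' V' with hO
  have hOo : IsOpen O := isOpen_image hV'o hV't
  have hOU : O ⊆ U := by rintro _ ⟨_, ⟨⟨y, hy, rfl⟩, _⟩, rfl⟩; rwa [Φ.left_inv (hUs hy)]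
  have hpO : p ∈ O := ⟨Φ p, hpV', Φ.left_inv hps⟩
  have hVO : ∀ z ∈ V', ∃ y ∈ O, Φ y = z := fun z hz =>
    ⟨Φ.symm z, ⟨z, hz, rfl⟩, Φ.right_inv (hV't hz)⟩
  have s1 := isSection_pushField h.symm hV'o hV't
    (fun y hy v hv => pushV_mem_H10 h.symm hy hv) (hL₁.mono inter_subset_right)
  have s2 := isSection_pushField h.symm hV'o hV't
    (fun y hy v hv => pushV_mem_CT h.symm hy hv) (hL₂.mono inter_subset_right)
  have sθ := isContactForm_pushForm h.symm hV'o hV't (hθ.mono inter_subset_right)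
  have hk := hK O _ _ _ hOo hpO s1 s2 sθ
  have hLs : ∀ y ∈ U, SmoothAt L y := fun y hy => hL.contDiffAt hU hy
  have e1 : conjField (pushField Φ L) = pushField Φ (conjField L) := conjField_pushField
  have hLL : ∀ y ∈ U, pushField Φ.symm (pushField Φ (conjField L)) y = conjField L y := by
    intro y hy
    have : pushField Φ.symm (pushField Φ (conjField L)) y =
        pushV Φ.symm (Φ y) (pushField Φ (conjField L) (Φ y)) := rfl
    rw [this, pushField_apply (hUs hy), pushV_symm_pushV h.1 (hUs hy)]
  have key : ∀ z ∈ V', leviFn θ L₁ (conjField (pushField Φ L)) z =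
      leviFn (pushForm Φ.symm θ) (pushField Φ.symm L₁) (conjField L) (Φ.symm z) := by
    intro z hz
    obtain ⟨y, hy, rfl⟩ := hVO z hz
    have hz' := hV't hz
    have hys := hUs (hOU hy)
    rw [e1, ← leviFn_push h.1.symm hz' (hL₁.contDiffAt hV hz.2)
      (contDiffAt_pushField h.1 hys (contDiffAt_conjField (hLs y (hOU hy))))]
    have hbr : bracket (pushField Φ.symm L₁) (pushField Φ.symm (pushField Φ (conjField L)))
        (Φ.symm (Φ y)) = bracket (pushField Φ.symm L₁) (conjField L) (Φ.symm (Φ y)) := by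
      rw [Φ.left_inv hys]
      have hev : pushField Φ.symm (pushField Φ (conjField L)) =ᶠ[𝓝 y] conjField L := by
        filter_upwards [hU.mem_nhds (hOU hy)] with w hw using hLL w hw
      simp only [bracket, hev.self_of_nhds, cderiv_congr hev]
    simp only [leviFn, hbr]
  have hleft : Φ.symm (Φ p) = p := Φ.left_inv hps
  have hls : SmoothAt (leviFn (pushForm Φ.symm θ) (pushField Φ.symm L₁) (conjField L)) p :=
    contDiffAt_leviFn (sθ.contDiffAt hOo hpO) (s1.contDiffAt hOo hpO)
      (contDiffAt_conjField (hLs p hp.2))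
  refine ⟨by rw [key _ hpV', hleft]; exact hk.1, ?_⟩
  have hev : leviFn θ L₁ (conjField (pushField Φ L)) =ᶠ[𝓝 (Φ p)] fun z =>
      leviFn (pushForm Φ.symm θ) (pushField Φ.symm L₁) (conjField L) (Φ.symm z) := by
    filter_upwards [hV'o.mem_nhds hpV'] with z hz using key z hz
  have h2 : L₂ (Φ p) = pushField Φ (pushField Φ.symm L₂) (Φ p) := by
    rw [pushField_apply hps]
    have : pushField Φ.symm L₂ p = pushV Φ.symm (Φ p) (L₂ (Φ p)) := rfl
    rw [this, pushV_pushV_symm h.1 hps]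
  rw [cderiv_congr hev, h2, cderiv_symm_pushField h.1 hps hls]
  exact hk.2

omit h

lemma pushV_injective (h : IsBiholomorphic Φ) (hx : x ∈ Φ.source) : Function.Injective
    (pushV Φ x) :=
  Function.LeftInverse.injective (g := pushV Φ.symm (Φ x)) fun v => pushV_symm_pushV h hx v

include h hM hM'

lemma pushV_mem_K10 (hx : x ∈ Φ.source) (hxM : x ∈ M) (hv : v ∈ K10 M x) : pushV Φ x v ∈ K10 M'
    (Φ x) := by
  obtain ⟨U, ρ, hxU, hρ⟩ := hM x hxM
  obtain ⟨U', ρ', hxU', hρ'⟩ := hM' (Φ x) ((h.2 x hx).2 hxM)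
  refine (mem_K10_iff hρ' ⟨(h.2 x hx).2 hxM, hxU'⟩).2 ⟨pushV_mem_H10 h hx hv.1, fun b hb => ?_⟩
  -- realize both vectors by pushed fields
  have hw : (b, (0 : Cn n)) ∈ H10 M' (Φ x) := (mem_H10_iff hρ' ⟨(h.2 x hx).2 hxM, hxU'⟩).2 ⟨hb, rfl⟩
  have hw' := pushV_mem_H10 h.symm (Φ.map_source hx) hw
  rw [Φ.left_inv hx] at hw'
  set w := pushV Φ.symm (Φ x) (b, (0 : Cn n)) with hwdef
  have hO : IsOpen (Φ.source ∩ U) := Φ.open_source.inter hρ.1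
  have hsv := (isSection_projH hρ v.1).mono (inter_subset_right (s := Φ.source))
  have hsw := (isSection_projH hρ w.1).mono (inter_subset_right (s := Φ.source))
  have hbr : bracket (projH ρ v.1) (conjField (projH ρ w.1)) x ∈ CH M x := by
    rw [bracket_conj_mem_CH_iff hρ hO ⟨hxM, hxU⟩ ⟨hx, hxU⟩ hsv hsw,
      projH_of_mem hρ ⟨hxM, hxU⟩ hv.1, projH_of_mem hρ ⟨hxM, hxU⟩ hw']
    exact ((mem_K10_iff hρ ⟨hxM, hxU⟩).1 hv).2 _ ((mem_H10_iff hρ ⟨hxM, hxU⟩).1 hw').1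
  have h2 := pushV_mem_CH h hx hbr
  rw [← bracket_pushField h.1 hx (contDiffAt_projH hρ hxU _)
    (contDiffAt_conjField (contDiffAt_projH hρ hxU _)), ← conjField_pushField,
    bracket_conj_mem_CH_iff hρ' (isOpen_image hO inter_subset_left) ⟨(h.2 x hx).2 hxM, hxU'⟩
      ⟨x, ⟨hx, hxU⟩, rfl⟩ (isSection_pushField h hO inter_subset_left
        (fun y hy v hv => pushV_mem_H10 h hy hv) hsv)
      (isSection_pushField h hO inter_subset_left
        (fun y hy v hv => pushV_mem_H10 h hy hv) hsw), pushField_apply hx, pushField_apply hx,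
    projH_of_mem hρ ⟨hxM, hxU⟩ hv.1, projH_of_mem hρ ⟨hxM, hxU⟩ hw', hwdef,
    pushV_pushV_symm h.1 hx] at h2
  exact h2

omit h hM hM'

lemma finrank_le_of_pushV (h : IsBiholomorphic Φ) (hx : x ∈ Φ.source) {V V' : Submodule ℂ (CVec n)}
    (hV : ∀ v ∈ V, pushV Φ x v ∈ V') : finrank ℂ V ≤ finrank ℂ V' := by
  refine LinearMap.finrank_le_finrank_of_injective (f := (pushVₗ Φ x).restrict hV) ?_
  intro a b hab
  exact Subtype.ext (pushV_injective h hx (congrArg Subtype.val hab))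

include h hM hM'

lemma leviRank_push (hx : x ∈ Φ.source) (hxM : x ∈ M) : leviRank M' (Φ x) = leviRank M x := by
  have hx' := Φ.map_source hx
  have hxM' := (h.2 x hx).2 hxM
  have e1 : finrank ℂ (H10 M' (Φ x)) = finrank ℂ (H10 M x) := by
    refine le_antisymm (finrank_le_of_pushV h.1.symm hx' fun v hv => ?_)
      (finrank_le_of_pushV h.1 hx fun v hv => pushV_mem_H10 h hx hv)
    have := pushV_mem_H10 h.symm hx' hv
    rwa [Φ.left_inv hx] at this
  have e2 : finrank ℂ (K10 M' (Φ x)) = finrank ℂ (K10 M x) := by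
    refine le_antisymm (finrank_le_of_pushV h.1.symm hx' fun v hv => ?_)
      (finrank_le_of_pushV h.1 hx fun v hv => pushV_mem_K10 h hM hM' hx hxM hv)
    have := pushV_mem_K10 h.symm hM' hM hx' hxM' hv
    rwa [Φ.left_inv hx] at this
  rw [leviRank, leviRank, e1, e2]

lemma S10_push (hU : IsOpen U) (hUs : U ⊆ Φ.source) (hX : S10 M q U X) : S10 M' q (Φ '' U)
    (pushField Φ X) := by
  refine ⟨isSection_pushField h hU hUs (fun y hy v hv => pushV_mem_H10 h hy hv) hX.1, ?_⟩
  rintro _ ⟨hyM', y, hy, rfl⟩ hq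
  have hyM := (h.2 y (hUs hy)).1 hyM'
  rw [leviRank_push h hM hM' (hUs hy) hyM] at hq
  exact (hX.2 y ⟨hyM, hy⟩ hq).push h hU hUs hM' ⟨hyM, hy⟩ hX.1

lemma generator_push (hU : IsOpen U) (hUs : U ⊆ Φ.source) (hg : IsIdealGenerator M q U g) : ∃ g',
    IsIdealGenerator M' q (Φ '' U) g' ∧ ∀ y ∈ Φ '' U, g' y = g (Φ.symm y) := by
  obtain ⟨θ, L₂, L₁, hθ, h2, h1, hg⟩ := hg
  have hθ' := isContactForm_pushForm h hU hUs hθ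
  have h2' := S10_push h hM hM' hU hUs h2
  have h1' := S10_push h hM hM' hU hUs h1
  rw [← conjField_pushField] at h1'
  have s2 : ∀ y ∈ U, SmoothAt L₂ y := fun y hy => h2.1.contDiffAt hU hy
  have s1 : ∀ y ∈ U, SmoothAt L₁ y := fun y hy => by
    have := contDiffAt_conjField (h1.1.contDiffAt hU hy)
    rwa [conjField_conjField] at this
  have hl := leviFn_push_eventually (θ := θ) h.1 hUs s2 s1
  rcases hg with rfl | ⟨L₃, h3, rfl⟩
  · exact ⟨_, ⟨_, _, _, hθ', h2', h1', Or.inl rfl⟩, hl⟩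
  · have h3' := isSection_pushField h hU hUs (fun y hy v hv => pushV_mem_CT h hy hv) h3
    refine ⟨_, ⟨_, _, _, hθ', h2', h1', Or.inr ⟨_, h3', rfl⟩⟩, ?_⟩
    rintro _ ⟨y, hy, rfl⟩
    have hev : leviFn (pushForm Φ θ) (pushField Φ L₂) (pushField Φ L₁) =ᶠ[𝓝 (Φ y)]
        fun z => leviFn θ L₂ L₁ (Φ.symm z) := by
      filter_upwards [(isOpen_image hU hUs).mem_nhds ⟨y, hy, rfl⟩] with z hz using hl z hz
    simp only [cderiv_congr hev, Φ.left_inv (hUs hy)]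
    exact cderiv_symm_pushField h.1 (hUs hy)
      (contDiffAt_leviFn (hθ.contDiffAt hU hy) (s2 y hy) (s1 y hy))

lemma idealSheaf_push (hU : IsOpen U) (hUs : U ⊆ Φ.source) (hf : idealSheaf M q U f) : idealSheaf M'
    q (Φ '' U) (fun y => f (Φ.symm y)) := by
  have hcomp : ∀ {V : Set (Cn n)} {g : Cn n → ℂ}, IsOpen V → V ⊆ Φ.source → ContDiffOn ℝ ∞ g V →
      ContDiffOn ℝ ∞ (fun y => g (Φ.symm y)) (Φ '' V) := by
    rintro V g hV hVs hg _ ⟨y, hy, rfl⟩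
    exact (contDiffAt_symm_comp h.1 (hVs hy) (hg.contDiffAt (hV.mem_nhds hy))).contDiffWithinAt
  refine ⟨hcomp hU hUs hf.1, ?_⟩
  rintro _ ⟨hyM', y, hy, rfl⟩
  have hyM := (h.2 y (hUs hy)).1 hyM'
  obtain ⟨V, hVU, hV, hyV, k, a, gg, ha, hgg, hs⟩ := hf.2 y ⟨hyM, hy⟩
  have hVs := hVU.trans hUs
  choose g' hg' hgeq using fun i => generator_push h hM hM' hV hVs (hgg i)
  refine ⟨Φ '' V, Set.image_mono hVU, isOpen_image hV hVs, ⟨y, hyV, rfl⟩, k,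
    fun i z => a i (Φ.symm z), g', fun i => hcomp hV hVs (ha i), hg', ?_⟩
  rintro _ ⟨hzM', z, hz, rfl⟩
  simp only [hgeq _ _ ⟨z, hz, rfl⟩, Φ.left_inv (hVs hz)]
  exact hs z ⟨(h.2 z (hVs hz)).1 hzM', hz⟩

omit hM hM'

lemma leviNonneg_push (hUs : U ⊆ Φ.source) (hθ : LeviNonneg M U θ) : LeviNonneg M' (Φ '' U)
    (pushForm Φ θ) := by
  rintro _ ⟨hyM', y, hy, rfl⟩ V L hV hyV hL
  have hyM := (h.2 y (hUs hy)).1 hyM'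
  set V' := V ∩ Φ.target
  have hV'o : IsOpen V' := hV.inter Φ.open_target
  have hV's : V' ⊆ Φ.symm.source := inter_subset_right
  have hyV' : Φ y ∈ V' := ⟨hyV, Φ.map_source (hUs hy)⟩
  have hL' := isSection_pushField h.symm hV'o hV's (fun y hy v hv => pushV_mem_H10 h.symm hy hv)
    (hL.mono inter_subset_left)
  have h1 := hθ y ⟨hyM, hy⟩ _ _ (isOpen_image hV'o hV's) ⟨Φ y, hyV', Φ.left_inv (hUs hy)⟩ hL'
  have hLs := hL.contDiffAt hV hyV
  have hLs' : SmoothAt (pushField Φ.symm L) y := by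
    have := contDiffAt_pushField h.1.symm (Φ.map_source (hUs hy)) hLs
    rwa [Φ.left_inv (hUs hy)] at this
  rw [← leviFn_push h.1 (hUs hy) hLs' (contDiffAt_conjField hLs'), ← conjField_pushField] at h1
  have hev : pushField Φ (pushField Φ.symm L) =ᶠ[𝓝 (Φ y)] L := by
    filter_upwards [hV'o.mem_nhds hyV'] with z hz
    have hz2 : Φ.symm z ∈ Φ.source := Φ.map_target hz.2
    have e1 : pushField Φ.symm L (Φ.symm z) = pushV Φ.symm (Φ (Φ.symm z)) (L (Φ (Φ.symm z))) := rfl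
    have e2 : pushField Φ (pushField Φ.symm L) z =
      pushV Φ (Φ.symm z) (pushField Φ.symm L (Φ.symm z)) := rfl
    rw [e2, e1, pushV_pushV_symm h.1 hz2, Φ.right_inv hz.2]
  have hev' : conjField (pushField Φ (pushField Φ.symm L)) =ᶠ[𝓝 (Φ y)] conjField L :=
    hev.mono fun z hz => by simp only [conjField, hz]
  have hbr : leviFn (pushForm Φ θ) (pushField Φ (pushField Φ.symm L))
      (conjField (pushField Φ (pushField Φ.symm L))) (Φ y) =
      leviFn (pushForm Φ θ) L (conjField L) (Φ y) := by
    simp only [leviFn, bracket, hev.self_of_nhds, hev'.self_of_nhds, cderiv_congr hev,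
      cderiv_congr hev']
  rw [hbr] at h1
  exact h1

/-- A hypersurface all of whose points are images of points of `M` under `Φ` is pseudoconvex. -/
lemma isPseudoconvex_push (hpsc : IsPseudoconvex M) (hM' : M' ⊆ Φ.target) : IsPseudoconvex M' := by
  intro y hy
  obtain ⟨x, hx, rfl⟩ : ∃ x ∈ Φ.source, Φ x = y :=
    ⟨Φ.symm y, Φ.map_target (hM' hy), Φ.right_inv (hM' hy)⟩
  obtain ⟨U, θ, hU, hxU, hθ, hne, hpos⟩ := hpsc x ((h.2 x hx).1 hy)
  have hO : IsOpen (U ∩ Φ.source) := hU.inter Φ.open_source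
  refine ⟨_, pushForm Φ θ, isOpen_image hO inter_subset_right, ⟨x, ⟨hxU, hx⟩, rfl⟩,
    isContactForm_pushForm h hO inter_subset_right (hθ.mono inter_subset_left), ?_,
    leviNonneg_push h inter_subset_right fun z hz => hpos z ⟨hz.1, hz.2.1⟩⟩
  rintro _ ⟨hzM', z, hz, rfl⟩
  obtain ⟨v, hv, hv0⟩ := hne z ⟨(h.2 z hz.2).1 hzM', hz.1⟩
  exact ⟨pushV Φ z v, pushV_mem_CT h hz.2 hv, by rwa [pushForm_pushV h.1 hz.2]⟩

end invariance

/-! ### Second tangential derivatives -/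

section second

variable {θ : Cn n → (CVec n →L[ℂ] ℂ)} {X Y L L₃ L₃' : Cn n → CVec n}

/-- `f` is smooth at all points near `p`. -/
def SmoothNear (f : Cn n → ℂ) (p : Cn n) : Prop := ∀ᶠ x in 𝓝 p, SmoothAt f x

lemma SmoothNear.at (h : SmoothNear f p) : SmoothAt f p := h.self_of_nhds

lemma SmoothNear.sub (hf : SmoothNear f p) (hg : SmoothNear g p) : SmoothNear (fun y => f y - g y)
    p := by
  filter_upwards [hf, hg] with x h1 h2 using h1.sub h2

lemma SmoothNear.mul (hf : SmoothNear f p) (hg : SmoothNear g p) : SmoothNear (fun y => f y * g y)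
    p := by
  filter_upwards [hf, hg] with x h1 h2 using h1.mul h2

lemma SmoothNear.conj (hf : SmoothNear f p) : SmoothNear (fun y => star (f y)) p := by
  filter_upwards [hf] with x h1 using contDiffAt_conj h1

lemma SmoothNear.const (c : ℂ) (p : Cn n) : SmoothNear (fun _ => c) p :=
  Filter.Eventually.of_forall fun _ => contDiffAt_const

lemma SmoothNear.sum {s : Finset ι} {f : ι → Cn n → ℂ} (hf : ∀ i ∈ s, SmoothNear (f i) p) :
    SmoothNear (fun y => ∑ i ∈ s, f i y) p := by
  have : ∀ᶠ x in 𝓝 p, ∀ i ∈ s, SmoothAt (f i) x := (Filter.eventually_all_finset s).2 hf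
  filter_upwards [this] with x h1 using ContDiffAt.sum h1

lemma smoothNear_of_forall (hW : IsOpen W) (hp : p ∈ W) (h : ∀ y ∈ W, SmoothAt f y) : SmoothNear f
    p := (hW.eventually_mem hp).mono h

lemma SmoothNear.cderiv_field (hf : SmoothNear f p) (hW : IsOpen W) (hp : p ∈ W)
    (hL : ∀ y ∈ W, SmoothAt L y) : SmoothNear (fun y => cderiv f y (L y)) p := by
  filter_upwards [hf, hW.eventually_mem hp] with x h1 h2 using contDiffAt_cderiv h1 (hL x h2)

/-- The iterated derivative `v (L f)` at `p`. -/
def D2 (f : Cn n → ℂ) (L : Cn n → CVec n) (p : Cn n) (v : CVec n) : ℂ :=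
  cderiv (fun x => cderiv f x (L x)) p v

lemma D2_add (hf : SmoothNear f p) (hg : SmoothNear g p) (hL : SmoothAt L p) : D2
    (fun y => f y + g y) L p v = D2 f L p v + D2 g L p v := by
  rw [D2, D2, D2, ← cderiv_fun_add (contDiffAt_cderiv hf.at hL).diffAt
    (contDiffAt_cderiv hg.at hL).diffAt]
  refine cderiv_congr ?_ _
  filter_upwards [hf, hg] with x h1 h2
  exact cderiv_fun_add h1.diffAt h2.diffAt _

lemma D2_sub (hf : SmoothNear f p) (hg : SmoothNear g p) (hL : SmoothAt L p) : D2
    (fun y => f y - g y) L p v = D2 f L p v - D2 g L p v := by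
  rw [D2, D2, D2, ← cderiv_fun_sub (contDiffAt_cderiv hf.at hL).diffAt
    (contDiffAt_cderiv hg.at hL).diffAt]
  refine cderiv_congr ?_ _
  filter_upwards [hf, hg] with x h1 h2
  exact cderiv_fun_sub h1.diffAt h2.diffAt _

lemma D2_const_mul (c : ℂ) (hf : SmoothNear f p) (hL : SmoothAt L p) : D2 (fun y => c * f y) L p v =
    c * D2 f L p v := by
  rw [D2, D2, ← cderiv_const_mul _ (contDiffAt_cderiv hf.at hL).diffAt]
  refine cderiv_congr ?_ _
  filter_upwards [hf] with x h1
  exact cderiv_const_mul _ h1.diffAt _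

lemma D2_sum {s : Finset ι} {f : ι → Cn n → ℂ} (hf : ∀ i ∈ s, SmoothNear (f i) p)
    (hL : SmoothAt L p) : D2 (fun y => ∑ i ∈ s, f i y) L p v = ∑ i ∈ s, D2 (f i) L p v := by
  classical
  induction s using Finset.induction_on with
  | empty => simp [D2]
  | insert i s hi ih =>
    simp only [sum_insert hi]
    rw [D2_add (hf i (by simp)) (SmoothNear.sum fun j hj => hf j (by simp [hj])) hL,
      ih fun j hj => hf j (by simp [hj])]

/-- If `g` vanishes to first order at `p`, then `v L (f g) = f (v L g)` there. -/
lemma D2_mul (hf : SmoothNear f p) (hg : SmoothNear g p) (hL : SmoothAt L p) (h0 : g p = 0)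
    (h1 : cderiv g p (L p) = 0) (h2 : cderiv g p v = 0) : D2 (fun y => f y * g y) L p v = f p * D2 g
    L p v := by
  have hev : (fun x => cderiv (fun y => f y * g y) x (L x)) =ᶠ[𝓝 p]
      fun x => f x * cderiv g x (L x) + cderiv f x (L x) * g x := by
    filter_upwards [hf, hg] with x h1 h2
    exact cderiv_fun_mul h1.diffAt h2.diffAt _
  have s1 := contDiffAt_cderiv hf.at hL
  have s2 := contDiffAt_cderiv hg.at hL
  rw [D2, cderiv_congr hev, cderiv_fun_add (hf.at.mul s2).diffAt
    (s1.mul hg.at).diffAt, cderiv_fun_mul hf.at.diffAt s2.diffAt,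
    cderiv_mul_eq_zero s1 hg.at h0 h2, h1, D2]
  ring

variable (h : IsDefiningFunction M U ρ) (hp : p ∈ M ∩ U) (hW : IsOpen W) (hpW : p ∈ W)
include h hp

lemma D2_congr_of_eventually (hf : SmoothNear f p) (hg : SmoothNear g p) (hW : IsOpen W)
    (hpW : p ∈ W) (hL : IsSection M (CT M) W L) (heq : ∀ᶠ y in 𝓝 p, y ∈ M → f y = g y)
    (hv : v ∈ CT M p) : D2 f L p v = D2 g L p v := by
  have hLs := hL.contDiffAt hW hpW
  refine cderiv_congr_of_eventually h hp (contDiffAt_cderiv hf.at hLs)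
    (contDiffAt_cderiv hg.at hLs) ?_ hv
  filter_upwards [heq.eventually_nhds, hf, hg, eventually_mem_and hW h hpW hp.2]
    with y h1 h2 h3 h4 hyM
  exact cderiv_congr_of_eventually h ⟨hyM, h4.2⟩ h2 h3 h1 (hL.2 y ⟨hyM, h4.1⟩)

/-- If `f` vanishes to first order at `p` along `M`, then `L₄ L₃ f` at `p` depends only on the
values of the tangent fields at `p`, since it is symmetric. -/
lemma D2_congr_field (hf : SmoothNear f p) (hW : IsOpen W) (hpW : p ∈ W)
    (h0 : ∀ v ∈ CT M p, cderiv f p v = 0) (hL : IsSection M (CT M) W L₃)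
    (hL' : IsSection M (CT M) W L₃') (heq : L₃ p = L₃' p) (hv : v ∈ CT M p) : D2 f L₃ p v = D2 f L₃'
    p v := by
  have hWU := hW.inter h.1
  have hvT := (isSection_projT h v).mono (inter_subset_right (s := W))
  have hvv := projT_of_mem h hp hv
  have key : ∀ {Z : Cn n → CVec n}, IsSection M (CT M) W Z →
      D2 f Z p v = D2 f (projT ρ v) p (Z p) := by
    intro Z hZ
    have h1 := bracket_mem_CT h hWU hp ⟨hpW, hp.2⟩ hvT (hZ.mono inter_subset_left)
    have h2 := cderiv_bracket hf.at (hvT.contDiffAt hWU ⟨hpW, hp.2⟩) (hZ.contDiffAt hW hpW)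
    rw [h0 _ h1, hvv] at h2
    exact (sub_eq_zero.1 h2.symm)
  rw [key hL, key hL', heq]

omit hp

lemma smoothNear_lev (hp : p ∈ U) (hW : IsOpen W) (hpW : p ∈ W) (hX : IsSection M (H10 M) W X)
    (hY : IsSection M (H10 M) W Y) : SmoothNear (levF ρ X Y) p := by
  filter_upwards [eventually_mem_and hW h hpW hp] with y hy
  exact contDiffAt_levConj (h.contDiffAt hy.2) (hX.contDiffAt hW hy.1) (hY.contDiffAt hW hy.1)

include hp hW hpW

/-- The Levi product of a `(1,0)` field with one in the Levi kernel up to order one vanishes to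
first order along `M`. -/
lemma lev_vanishes (hX : IsSection M (H10 M) W X) (hY : IsSection M (H10 M) W Y)
    (hK : InLeviKernelOrderOne M p Y) : lev ρ p (X p).1 (star (Y p).1) = 0 ∧ ∀ v ∈ CT M p, cderiv
    (fun y => lev ρ y (X y).1 (star (Y y).1)) p v = 0 := by
  rw [inLeviKernelOrderOne_iff h hp hW hpW hY] at hK
  have hXs := hX.contDiffAt hW hpW
  have hYs := hY.contDiffAt hW hpW
  have hl : ∀ j, SmoothAt (levF ρ (projH ρ (single j 1)) Y) p :=
    fun j => contDiffAt_levConj (h.contDiffAt hp.2) (contDiffAt_projH h hp.2 _) hYs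
  have hc : ∀ j, SmoothAt (fun y => (X y).1 j) p := fun j => contDiffAt_coordOf hXs (inl j)
  constructor
  · rw [lev_eq_sum_projH h hp (hX.2 p ⟨hp.1, hpW⟩)]
    exact sum_eq_zero fun j _ => by rw [(hK _).1, mul_zero]
  · intro v hv
    rw [cderiv_congr_of_eventually h hp (contDiffAt_levConj (h.contDiffAt hp.2) hXs hYs)
      (ContDiffAt.sum fun j _ => (hc j).mul (hl j)) ((eventually_mem_and hW h hpW hp.2).mono
        fun y hy hyM => lev_eq_sum_projH h ⟨hyM, hy.2⟩ (hX.2 y ⟨hyM, hy.1⟩) _) hv,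
      cderiv_fun_sum _ fun j _ => ((hc j).mul (hl j)).diffAt]
    exact sum_eq_zero fun j _ => cderiv_mul_eq_zero (hc j) (hl j) (hK _).1 ((hK _).2 _ hv)

/-- The second derivatives of the Levi product of fields in the Levi kernel up to order one vanish
if one of the fields vanishes at the point. -/
lemma D2_lev_eq_zero_left (hX : IsSection M (H10 M) W X) (hY : IsSection M (H10 M) W Y)
    (hL : IsSection M (CT M) W L) (hK : InLeviKernelOrderOne M p Y) (h0 : X p = 0)
    (hv : v ∈ CT M p) : D2 (levF ρ X Y) L p v = 0 := by
  have hWU := hW.inter h.1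
  have hP : ∀ j : Fin n, IsSection M (H10 M) (W ∩ U) (projH ρ (single j 1)) := fun j =>
    (isSection_projH h _).mono inter_subset_right
  have hY' := hY.mono (inter_subset_left (t := U))
  have hsX : ∀ j, SmoothNear (fun y => (X y).1 j) p := fun j =>
    smoothNear_of_forall hW hpW fun y hy => contDiffAt_coordOf (hX.contDiffAt hW hy) (inl j)
  have hsl : ∀ j : Fin n, SmoothNear
      (levF ρ (projH ρ (single j 1)) Y) p := fun j =>
    smoothNear_lev h hp.2 hWU ⟨hpW, hp.2⟩ (hP j) hY'
  have hLs := hL.contDiffAt hW hpW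
  rw [D2_congr_of_eventually h hp (smoothNear_lev h hp.2 hW hpW hX hY)
    (SmoothNear.sum fun j _ => (hsX j).mul (hsl j)) hW hpW hL
    ((eventually_mem_and hW h hpW hp.2).mono
        fun y hy hyM => lev_eq_sum_projH h ⟨hyM, hy.2⟩ (hX.2 y ⟨hyM, hy.1⟩) _) hv,
    D2_sum (fun j _ => (hsX j).mul (hsl j)) hLs]
  refine sum_eq_zero fun j _ => ?_
  obtain ⟨e1, e2⟩ := lev_vanishes h hp hWU ⟨hpW, hp.2⟩ (hP j) hY' hK
  rw [D2_mul (hsX j) (hsl j) hLs e1 (e2 _ (hL.2 p ⟨hp.1, hpW⟩)) (e2 _ hv), h0]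
  simp

omit h hp hW hpW

lemma D2_conj (hf : SmoothNear f p) (hL : SmoothAt L p) : D2 (fun y => star (f y)) L p v = star
    (D2 f (conjField L) p (conjV v)) := by
  rw [D2, D2, ← cderiv_conj (contDiffAt_cderiv hf.at (contDiffAt_conjField hL)).diffAt]
  refine cderiv_congr ?_ _
  filter_upwards [hf] with x hx
  rw [cderiv_conj hx.diffAt]
  rfl

lemma D2_lev_eq_zero_right (hM : IsRealHypersurface M) (h : IsDefiningFunction M U ρ)
    (hp : p ∈ M ∩ U) (hW : IsOpen W) (hpW : p ∈ W) (hX : IsSection M (H10 M) W X)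
    (hY : IsSection M (H10 M) W Y) (hL : IsSection M (CT M) W L) (hK : InLeviKernelOrderOne M p X)
    (h0 : Y p = 0) (hv : v ∈ CT M p) : D2 (levF ρ X Y) L p v = 0 := by
  have hev : (fun x => cderiv (levF ρ X Y) x (L x)) =ᶠ[𝓝 p]
      fun x => cderiv (fun y => star (lev ρ y (Y y).1 (star (X y).1))) x (L x) := by
    filter_upwards [h.1.mem_nhds hp.2] with y hy
    refine cderiv_congr ?_ _
    filter_upwards [h.1.mem_nhds hy] with z hz
    rw [lev_conj (h.eventually hz), star_star]
  rw [D2, cderiv_congr hev, ← D2, D2_conj (smoothNear_lev h hp.2 hW hpW hY hX)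
    (hL.contDiffAt hW hpW), D2_lev_eq_zero_left h hp hW hpW hY hX (hL.conj_to_CT hM hW) hK h0
      (conjV_mem_CT h hp hv), star_zero]

include h hp hW hpW

/-- The value at `p` of `L₄ L₃ ⟨θ, [L₂, L₁]⟩` in terms of the Levi form of a defining function. -/
lemma D2_leviFn (hθ : IsContactForm M W θ) (hX : IsSection M (H10 M) W X)
    (hY : IsSection M (H10 M) W Y) (hL : IsSection M (CT M) W L) (hK : InLeviKernelOrderOne M p Y)
    (hv : v ∈ CT M p) : D2 (leviFn θ X (conjField Y)) L p v = kap θ ρ p * D2 (levF ρ X Y) L p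
    v := by
  have hκ : SmoothNear (kap θ ρ) p := by
    filter_upwards [eventually_mem_and hW h hpW hp.2] with y hy
    exact contDiffAt_kap h hy.2 (hθ.contDiffAt hW hy.1)
  have hl := smoothNear_lev h hp.2 hW hpW hX hY
  have hlf : SmoothNear (leviFn θ X (conjField Y)) p :=
    smoothNear_of_forall hW hpW fun y hy => contDiffAt_leviFn (hθ.contDiffAt hW hy)
      (hX.contDiffAt hW hy) (contDiffAt_conjField (hY.contDiffAt hW hy))
  obtain ⟨e1, e2⟩ := lev_vanishes h hp hW hpW hX hY hK
  rw [D2_congr_of_eventually h hp hlf (hκ.mul hl) hW hpW hL ?_ hv,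
    D2_mul hκ hl (hL.contDiffAt hW hpW) e1 (e2 _ (hL.2 p ⟨hp.1, hpW⟩)) (e2 _ hv)]
  filter_upwards [eventually_mem_and hW h hpW hp.2] with y hy hyM
  exact leviFn_eq h hW ⟨hyM, hy.2⟩ hy.1 hX (by simpa using hY) (hθ.2 y ⟨hyM, hy.1⟩).1

lemma D2_lev_congr_left {X' : Cn n → CVec n} (hX : IsSection M (H10 M) W X)
    (hX' : IsSection M (H10 M) W X') (hY : IsSection M (H10 M) W Y) (hL : IsSection M (CT M) W L)
    (hK : InLeviKernelOrderOne M p Y) (h0 : X p = X' p) (hv : v ∈ CT M p) : D2 (levF ρ X Y) L p v =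
    D2 (levF ρ X' Y) L p v := by
  have hD : IsSection M (H10 M) W (fun y => X y - X' y) :=
    ⟨hX.1.sub hX'.1, fun y hy => sub_mem (hX.2 y hy) (hX'.2 y hy)⟩
  have := D2_lev_eq_zero_left h hp hW hpW hD hY hL hK (by simp [h0]) hv
  simp only [fst_sub, lev_sub_left] at this
  rw [D2_sub (smoothNear_lev h hp.2 hW hpW hX hY) (smoothNear_lev h hp.2 hW hpW hX' hY)
    (hL.contDiffAt hW hpW)] at this
  exact sub_eq_zero.1 this

omit h hp hW hpW

lemma D2_lev_congr_right (hM : IsRealHypersurface M) (h : IsDefiningFunction M U ρ) (hp : p ∈ M ∩ U)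
    (hW : IsOpen W) (hpW : p ∈ W) {Y' : Cn n → CVec n} (hX : IsSection M (H10 M) W X)
    (hY : IsSection M (H10 M) W Y) (hY' : IsSection M (H10 M) W Y') (hL : IsSection M (CT M) W L)
    (hK : InLeviKernelOrderOne M p X) (h0 : Y p = Y' p) (hv : v ∈ CT M p) : D2 (levF ρ X Y) L p v =
    D2 (levF ρ X Y') L p v := by
  have hD : IsSection M (H10 M) W (fun y => Y y - Y' y) :=
    ⟨hY.1.sub hY'.1, fun y hy => sub_mem (hY.2 y hy) (hY'.2 y hy)⟩
  have := D2_lev_eq_zero_right hM h hp hW hpW hX hD hL hK (by simp [h0]) hv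
  simp only [fst_sub, star_sub, lev_sub_right] at this
  rw [D2_sub (smoothNear_lev h hp.2 hW hpW hX hY) (smoothNear_lev h hp.2 hW hpW hX hY')
    (hL.contDiffAt hW hpW)] at this
  exact sub_eq_zero.1 this

/-! ### Second-order minima -/

include h hp

/-- Every real tangent vector of a hypersurface is the velocity of a curve in it. -/
lemma exists_curve {v : Cn n} (hv : fderiv ℝ ρ p v = 0) : ∃ γ : ℝ → Cn n, γ 0 = p ∧ HasDerivAt γ v
    0 ∧ ∀ᶠ t in 𝓝 0, γ t ∈ M := by
  have hs : HasStrictFDerivAt ρ (fderiv ℝ ρ p) p := (h.contDiffAt hp.2).hasStrictFDerivAt (by simp)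
  have hr : (fderiv ℝ ρ p).range = ⊤ := by
    refine LinearMap.range_eq_top.2 (LinearMap.surjective_of_ne_zero ?_)
    intro h0
    exact h.2.2.1 p hp.2 (coe_injective h0)
  set w : (fderiv ℝ ρ p).ker := ⟨v, hv⟩ with hw
  set γ : ℝ → Cn n := fun t => hs.implicitFunction ρ (fderiv ℝ ρ p) hr (ρ p) (t • w) with hγ
  have hd := (hs.to_implicitFunction hr).hasFDerivAt
  have hline : HasDerivAt (fun t : ℝ => t • w) w 0 := by
    simpa using (hasDerivAt_id (0 : ℝ)).smul_const w
  have hd' : HasDerivAt γ v 0 := by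
    have h1 : HasFDerivAt (hs.implicitFunction ρ (fderiv ℝ ρ p) hr (ρ p))
      ((fderiv ℝ ρ p).ker).subtypeL ((0 : ℝ) • w) := by rw [zero_smul]; exact hd
    exact h1.comp_hasDerivAt (0 : ℝ) hline
  have h0 : γ 0 = p := by
    simp only [hγ, zero_smul]
    exact hs.implicitFunction_apply_image hr
  refine ⟨γ, h0, hd', ?_⟩
  have hmap := hs.map_implicitFunction_eq hr
  have ht : Filter.Tendsto (fun t : ℝ => (ρ p, t • w)) (𝓝 0) (𝓝 (ρ p, 0)) := by
    refine Continuous.tendsto' (by fun_prop) _ _ (by simp)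
  have hc : Filter.Tendsto γ (𝓝 0) (𝓝 p) := by
    have := hd'.continuousAt.tendsto
    rwa [h0] at this
  filter_upwards [ht.eventually hmap, hc.eventually (h.1.mem_nhds hp.2)] with t h1 h2
  refine (h.2.2.2 _ h2).2 ?_
  have h3 : ρ (γ t) = ρ p := h1
  rw [h3, (h.2.2.2 p hp.2).1 hp.1]

omit h hp

/-- Second-order necessary condition for a minimum along a curve, at a critical point. -/
lemma second_deriv_nonneg {H : Cn n → ℝ} (hH : SmoothAt H p) (h0 : H p = 0) (h1 : fderiv ℝ H p = 0)
    {γ : ℝ → Cn n} {v : Cn n} (hγ0 : γ 0 = p) (hγ : HasDerivAt γ v 0)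
    (hpos : ∀ᶠ t in 𝓝 0, 0 ≤ H (γ t)) : 0 ≤ fderiv ℝ (fderiv ℝ H) p v v := by
  set D := fderiv ℝ (fderiv ℝ H) p
  have hD : HasFDerivAt (fderiv ℝ H) D p :=
    ((hH.fderiv_right (m := ∞) (by simp)).differentiableAt (by simp)).hasFDerivAt
  have hs : IsSymmSndFDerivAt ℝ H p := hH.isSymmSndFDerivAt (by simpa using two_le_infty)
  obtain ⟨δ, hδ, hball⟩ := Metric.eventually_nhds_iff_ball.1
    ((hH.of_le (m := 1) (by simp)).eventually (by simp))
  have hT : (fun y => H y - 2⁻¹ * D (y - p) (y - p)) =o[𝓝 p] fun y => ‖y - p‖ ^ 2 := by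
    have := (convex_ball p δ).isLittleO_pow_succ (f := fun y => H y - 2⁻¹ * D (y - p) (y - p))
      (f' := fun y => fderiv ℝ H y - D (y - p)) (n := 1) (Metric.mem_ball_self hδ) (fun y hy =>
        ?_) ?_
    · rw [nhdsWithin_eq_nhds.2 (Metric.ball_mem_nhds p hδ)] at this
      simpa [h0] using this
    · have e := (hasFDerivAt_id (𝕜 := ℝ) y).sub_const p
      refine ((((hball y hy).differentiableAt (by simp)).hasFDerivAt.sub
        (((D.hasFDerivAt.comp y e).clm_apply e).const_mul 2⁻¹)).congr_fderiv ?_).hasFDerivWithinAt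
      ext v
      have e1 : D v (y - p) = D (y - p) v := hs v (y - p)
      simp [e1, -map_sub]
      ring
    · simpa [h1] using (hD.isLittleO.mono nhdsWithin_le_nhds).norm_right
  have hγc : Filter.Tendsto γ (𝓝[≠] 0) (𝓝 p) :=
    hγ0 ▸ hγ.continuousAt.tendsto.mono_left nhdsWithin_le_nhds
  have hγO : (fun t => ‖γ t - p‖) =O[𝓝[≠] 0] fun t : ℝ => t := by
    simpa [hγ0] using (hγ.isBigO_sub.mono nhdsWithin_le_nhds).norm_left
  have hu : Filter.Tendsto (fun t : ℝ => t⁻¹ • (γ t - p)) (𝓝[≠] 0) (𝓝 v) := by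
    simpa [hγ0] using hasDerivAt_iff_tendsto_slope_zero.1 hγ
  have hc : Continuous fun w : Cn n => 2⁻¹ * D w w := by fun_prop
  -- divide the Taylor expansion along the curve by `t ^ 2`
  have hlim := ((hT.comp_tendsto hγc).trans_isBigO (hγO.pow 2)).tendsto_div_nhds_zero.add
    ((hc.tendsto v).comp hu)
  rw [zero_add] at hlim
  have := ge_of_tendsto hlim (b := 0) (by
    filter_upwards [hpos.filter_mono nhdsWithin_le_nhds] with t ht
    refine (show 0 ≤ H (γ t) / t ^ 2 by positivity).trans_eq ?_
    simp only [Function.comp_apply, map_smul, smul_apply, smul_eq_mul]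
    ring)
  linarith

include h hp

/-- The second derivative of a nonnegative function on `M` along a real field is nonnegative at its
zeros. -/
lemma D2_nonneg (hG : ∀ᶠ y in 𝓝 p, SmoothAt G y) (h0 : G p = 0)
    (hpos : ∀ᶠ y in 𝓝 p, y ∈ M → 0 ≤ G y) (hW : IsOpen W) (hpW : p ∈ W)
    (hL : IsSection M (CT M) W L) (hreal : conjV (L p) = L p) : ∃ c : ℝ, 0 ≤ c ∧ D2 (toC G) L p
    (L p) = c := by
  have hGp := hG.self_of_nhds
  have hr := h.contDiffAt hp.2
  obtain ⟨c, hc⟩ := exists_fderiv_eq_of_isLocalExtrOn (f := fun _ : Unit => ρ)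
    (fun _ => hr) hGp (h.linearIndependent hp.2) (Or.inl (by
      refine eventually_nhdsWithin_iff.2 ?_
      filter_upwards [hpos, h.1.mem_nhds hp.2] with y hy hyU hy'
      rw [h0]
      exact hy ((h.2.2.2 y hyU).2 (by rw [hy' (), (h.2.2.2 p hp.2).1 hp.1]))))
  simp only [Finset.univ_unique, Finset.sum_singleton] at hc
  set c₀ := c default
  -- subtract a multiple of `ρ` to get a critical point in the ambient space
  set H : Cn n → ℝ := fun y => G y - c₀ * ρ y with hH
  have hHs : ∀ᶠ y in 𝓝 p, SmoothAt H y := by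
    filter_upwards [hG, h.eventually hp.2] with y h1 h2
    exact h1.sub (contDiffAt_const.mul h2)
  have hHp := hHs.self_of_nhds
  have hρ0 : ∀ y ∈ M ∩ U, ρ y = 0 := fun y hy => (h.2.2.2 y hy.2).1 hy.1
  have hdH : fderiv ℝ H p = 0 := by
    rw [hH, fderiv_fun_sub (hGp.differentiableAt (by simp))
      ((hr.differentiableAt (by simp)).const_mul _), fderiv_const_mul (hr.differentiableAt (by
        simp)),
      hc, sub_self]
  have hLp := eq_ofRealV_of_conjV_eq hreal
  have hLT : L p ∈ CT M p := hL.2 p ⟨hp.1, hpW⟩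
  set v := (L p).1 with hv
  obtain ⟨γ, hγ0, hγ, hγM⟩ := exists_curve h hp (v := v)
    ((mem_realTangent_iff h hp).1 (by change ofRealV v ∈ CT M p; rw [← hLp]; exact hLT))
  have hγc : Filter.Tendsto γ (𝓝 0) (𝓝 p) := by
    have := hγ.continuousAt.tendsto
    rwa [hγ0] at this
  have hnn := second_deriv_nonneg hHp (by simp [hH, h0, hρ0 p hp]) hdH hγ0 hγ (by
    filter_upwards [hγM, hγc.eventually hpos, hγc.eventually (h.1.mem_nhds hp.2)] with t h1 h2 h3
    simpa [hH, hρ0 _ ⟨h1, h3⟩] using h2 h1)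
  refine ⟨_, hnn, ?_⟩
  have s1 : SmoothNear (toC G) p := hG.mono fun y hy => contDiffAt_toC hy
  have s2 : SmoothNear (toC H) p := hHs.mono fun y hy => contDiffAt_toC hy
  rw [D2_congr_of_eventually h hp s1 s2 hW hpW hL ((h.1.eventually_mem hp.2).mono fun y hy hyM => by
    simp [toC, hH, hρ0 y ⟨hyM, hy⟩]) hLT, D2, cderiv_cderiv_field s2.at (hL.contDiffAt hW hpW)]
  have e1 : cderiv (toC H) p (cderiv L p (L p)) = 0 := by
    have : fderiv ℝ (toC H) p = 0 := by
      ext w; rw [fderiv_toC (hHp.differentiableAt (by simp)), hdH]; simp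
    simp [cderiv, this]
  have e2 : (fun y => cderiv (toC H) y (L p)) =ᶠ[𝓝 p] toC fun y => fderiv ℝ H y v := by
    filter_upwards [hHs] with y hy
    rw [hLp, cderiv_ofRealV, fderiv_toC (hy.differentiableAt (by simp))]
  have hD : DifferentiableAt ℝ (fderiv ℝ H) p :=
    (hHp.fderiv_right (m := ∞) (by simp)).differentiableAt (by simp)
  have e3 : HasFDerivAt (fun y => fderiv ℝ H y v) ((fderiv ℝ (fderiv ℝ H) p).flip v) p := by
    simpa using hD.hasFDerivAt.clm_apply (hasFDerivAt_const v p)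
  rw [e1, add_zero, cderiv_congr e2]
  conv_lhs => rw [hLp]
  rw [cderiv_ofRealV, fderiv_toC e3.differentiableAt, e3.fderiv]
  rfl

end second

/-! ### The quartic tensor -/

section tensor

variable {θ : Cn n → (CVec n →L[ℂ] ℂ)} {A A' B B' : Cn n → CVec n} {v₃ v₃' v₄ v₄' : CVec n}

/-- `A` is, near `p`, a `(1,0)` field in the Levi kernel up to order `1` at `p`. -/
def IsKernelField (M : Set (Cn n)) (p : Cn n) (A : Cn n → CVec n) : Prop :=
  InLeviKernelOrderOne M p A ∧ ∃ W, IsOpen W ∧ p ∈ W ∧ IsSection M (H10 M) W A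

lemma IsKernelField.add (hM : IsRealHypersurface M) (hp : p ∈ M) (hA : IsKernelField M p A)
    (hB : IsKernelField M p B) : IsKernelField M p (A + B) := by
  obtain ⟨hK, W, hW, hpW, hA⟩ := hA
  obtain ⟨hK', W', hW', hpW', hB⟩ := hB
  have h1 := hA.mono (W' := W ∩ W') inter_subset_left
  have h2 := hB.mono (W' := W ∩ W') inter_subset_right
  exact ⟨hK.add hM (hW.inter hW') hp ⟨hpW, hpW'⟩ h1 h2 hK', _, hW.inter hW', ⟨hpW, hpW'⟩,
    h1.1.add h2.1, fun y hy => add_mem (h1.2 y hy) (h2.2 y hy)⟩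

lemma IsKernelField.smul (hM : IsRealHypersurface M) (hp : p ∈ M) (c : ℂ)
    (hA : IsKernelField M p A) : IsKernelField M p (c • A) := by
  obtain ⟨hK, W, hW, hpW, hA⟩ := hA
  exact ⟨hK.smul hM hW hp hpW hA (a := fun _ => c) contDiffOn_const, W, hW, hpW,
    hA.1.const_smul c, fun y hy => smul_mem _ c (hA.2 y hy)⟩

/-- The second derivative `v₄ L₃ (lev ρ A B̄)` at `p`, where `L₃` is the tangential field
extending `v₃`. -/
def quarticVal (ρ : Cn n → ℝ) (p : Cn n) (A B : Cn n → CVec n) (v₃ v₄ : CVec n) : ℂ :=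
  D2 (levF ρ A B) (projT ρ v₃) p v₄

variable (h : IsDefiningFunction M U ρ) (hp : p ∈ M ∩ U) (hA : IsKernelField M p A)
    (hB : IsKernelField M p B)
include h hp hA hB

lemma IsKernelField.smoothNear : SmoothNear (levF ρ A B) p := by
  obtain ⟨hK, W, hW, hpW, hA⟩ := hA
  obtain ⟨hK', W', hW', hpW', hB⟩ := hB
  exact smoothNear_lev h hp.2 (hW.inter hW') ⟨hpW, hpW'⟩ (hA.mono inter_subset_left)
    (hB.mono inter_subset_right)

omit h hp hA hB

lemma quarticVal_congr (hM : IsRealHypersurface M) (h : IsDefiningFunction M U ρ) (hp : p ∈ M ∩ U)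
    (hA : IsKernelField M p A) (hA' : IsKernelField M p A') (hB : IsKernelField M p B)
    (hB' : IsKernelField M p B') (hAA : A p = A' p) (hBB : B p = B' p) (hv : v₄ ∈ CT M p) :
    quarticVal ρ p A B v₃ v₄ = quarticVal ρ p A' B' v₃ v₄ := by
  obtain ⟨hKA, W₁, hW₁, hpW₁, hA⟩ := hA
  obtain ⟨hKA', W₂, hW₂, hpW₂, hA'⟩ := hA'
  obtain ⟨hKB, W₃, hW₃, hpW₃, hB⟩ := hB
  obtain ⟨hKB', W₄, hW₄, hpW₄, hB'⟩ := hB'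
  have hW : IsOpen (W₁ ∩ W₂ ∩ W₃ ∩ W₄ ∩ U) := (((hW₁.inter hW₂).inter hW₃).inter hW₄).inter h.1
  have hpW : p ∈ W₁ ∩ W₂ ∩ W₃ ∩ W₄ ∩ U := ⟨⟨⟨⟨hpW₁, hpW₂⟩, hpW₃⟩, hpW₄⟩, hp.2⟩
  have i1 := hA.mono (W' := W₁ ∩ W₂ ∩ W₃ ∩ W₄ ∩ U) fun y hy => hy.1.1.1.1
  have i2 := hA'.mono (W' := W₁ ∩ W₂ ∩ W₃ ∩ W₄ ∩ U) fun y hy => hy.1.1.1.2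
  have i3 := hB.mono (W' := W₁ ∩ W₂ ∩ W₃ ∩ W₄ ∩ U) fun y hy => hy.1.1.2
  have i4 := hB'.mono (W' := W₁ ∩ W₂ ∩ W₃ ∩ W₄ ∩ U) fun y hy => hy.1.2
  have i5 := (isSection_projT h v₃).mono (W' := W₁ ∩ W₂ ∩ W₃ ∩ W₄ ∩ U) fun y hy => hy.2
  exact (D2_lev_congr_left h hp hW hpW i1 i2 i3 i5 hKB hAA hv).trans
    (D2_lev_congr_right hM h hp hW hpW i2 i3 i4 i5 hKA' hBB hv)

include h hp hA hB

lemma quarticVal_add_field : quarticVal ρ p A B (v₃ + v₃') v₄ = quarticVal ρ p A B v₃ v₄ +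
    quarticVal ρ p A B v₃' v₄ := by
  have hs := hA.smoothNear h hp hB
  have e : (fun y => cderiv (levF ρ A B) y (projT ρ (v₃ + v₃') y)) =
      fun y => cderiv (levF ρ A B) y (projT ρ v₃ y) +
        cderiv (levF ρ A B) y (projT ρ v₃' y) := by
    funext y
    rw [← cderiv_add_right]
    congr 1
    rw [projT_eq_sum, projT_eq_sum v₃, projT_eq_sum v₃', ← sum_add_distrib]
    simp only [map_add, add_smul]
  have hsm : ∀ v, DifferentiableAt ℝ
      (fun y => cderiv (levF ρ A B) y (projT ρ v y)) p := fun v =>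
    (hs.cderiv_field h.1 hp.2 fun y hy => contDiffAt_projT h hy v).at.diffAt
  simp only [quarticVal, D2, e]
  exact cderiv_fun_add (hsm v₃) (hsm v₃') _

lemma quarticVal_smul_field (c : ℂ) : quarticVal ρ p A B (c • v₃) v₄ = c * quarticVal ρ p A B v₃
    v₄ := by
  have hs := hA.smoothNear h hp hB
  have e : (fun y => cderiv (levF ρ A B) y (projT ρ (c • v₃) y)) =
      fun y => c * cderiv (levF ρ A B) y (projT ρ v₃ y) := by
    funext y
    rw [← smul_eq_mul, ← cderiv_smul_right]
    congr 1
    rw [projT_eq_sum, projT_eq_sum v₃, smul_sum]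
    simp only [map_smul, smul_smul, smul_eq_mul]
  simp only [quarticVal, D2, e]
  exact cderiv_const_mul c
    (hs.cderiv_field h.1 hp.2 fun y hy => contDiffAt_projT h hy v₃).at.diffAt _

omit hB

lemma quarticVal_add_left (hA' : IsKernelField M p A') (hB : IsKernelField M p B) : quarticVal ρ p
    (A + A') B v₃ v₄ = quarticVal ρ p A B v₃ v₄ + quarticVal ρ p A' B v₃ v₄ := by
  simp only [quarticVal, Pi.add_apply, fst_add, lev_add_left]
  exact D2_add (hA.smoothNear h hp hB) (hA'.smoothNear h hp hB) (contDiffAt_projT h hp.2 v₃)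

include hB

lemma quarticVal_add_right (hB' : IsKernelField M p B') : quarticVal ρ p A (B + B') v₃ v₄ =
    quarticVal ρ p A B v₃ v₄ + quarticVal ρ p A B' v₃ v₄ := by
  simp only [quarticVal, Pi.add_apply, fst_add, star_add, lev_add_right]
  exact D2_add (hA.smoothNear h hp hB) (hA.smoothNear h hp hB') (contDiffAt_projT h hp.2 v₃)

lemma quarticVal_smul_left (c : ℂ) : quarticVal ρ p (c • A) B v₃ v₄ = c * quarticVal ρ p A B v₃
    v₄ := by
  simp only [quarticVal, Pi.smul_apply, smul_fst, lev_smul_left]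
  exact D2_const_mul c (hA.smoothNear h hp hB) (contDiffAt_projT h hp.2 v₃)

lemma quarticVal_smul_right (c : ℂ) : quarticVal ρ p A (c • B) v₃ v₄ = star c * quarticVal ρ p A B
    v₃ v₄ := by
  simp only [quarticVal, Pi.smul_apply, smul_fst, star_smul, lev_smul_right]
  exact D2_const_mul _ (hA.smoothNear h hp hB) (contDiffAt_projT h hp.2 v₃)

omit h hp hA hB

lemma exists_isKernelField (hM : IsRealHypersurface M) (hpsc : IsPseudoconvex M) (hp : p ∈ M)
    (hv : v ∈ K10 M p) : ∃ A, IsKernelField M p A ∧ A p = v := by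
  obtain ⟨W, L, hW, hpW, hL, rfl⟩ := exists_S10_of_mem_K10 hM hpsc hp rfl hv
  exact ⟨L, ⟨hL.2 p ⟨hp, hpW⟩ le_rfl, W, hW, hpW, hL.1⟩, rfl⟩

include h hp

/-- The value of the second derivative `L₄ L₃ ⟨θ, [L₂, L₁]⟩` at `p` in terms of the Levi form of a
defining function. -/
lemma cderiv_cderiv_leviFn (hW : IsOpen W) (hpW : p ∈ W) (hθ : IsContactForm M W θ)
    {L₃ : Cn n → CVec n} (hL : IsSection M (CT M) W L₃) (hA : IsSection M (H10 M) W A)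
    (hB : IsSection M (H10 M) W B) (hKB : InLeviKernelOrderOne M p B) (hv : v₄ ∈ CT M p) : cderiv
    (fun x => cderiv (leviFn θ A (conjField B)) x (L₃ x)) p v₄ = kap θ ρ p * quarticVal ρ p A B
    (L₃ p) v₄ := by
  have hWU := hW.inter h.1
  have e1 := D2_leviFn h hp hW hpW hθ hA hB hL hKB hv
  have e2 := D2_congr_field h hp (smoothNear_lev h hp.2 hW hpW hA hB) hWU ⟨hpW, hp.2⟩
    (lev_vanishes h hp hW hpW hA hB hKB).2 (hL.mono inter_subset_left)
    ((isSection_projT h (L₃ p)).mono inter_subset_right)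
    (projT_of_mem h hp (hL.2 p ⟨hp.1, hpW⟩)).symm hv
  rw [quarticVal, ← e2]
  exact e1

omit h hp

/-- The tensor is built from one kernel field through each vector of the Levi kernel; by
tensoriality other fields give the same values. -/
lemma exists_isQuarticTensor (hM : IsRealHypersurface M) (hpsc : IsPseudoconvex M) (hp : p ∈ M) :
    ∃ τ, IsQuarticTensor M p τ := by
  obtain ⟨U, ρ, hpU, h⟩ := hM p hp
  have hp' : p ∈ M ∩ U := ⟨hp, hpU⟩
  choose F hF hFp using fun v : K10 M p => exists_isKernelField hM hpsc hp v.2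
  let cj : K01 M p → K10 M p := fun v => ⟨conjV v, v.2⟩
  have cj_add : ∀ v w, cj (v + w) = cj v + cj w := fun v w => Subtype.ext (conjV_add _ _)
  have cj_smul : ∀ (c : ℂ) v, cj (c • v) = star c • cj v := fun c v => Subtype.ext (conjV_smul _ _)
  have f_add : ∀ v w, F (v + w) p = (F v + F w) p := fun v w => by simp [hFp]
  have f_smul : ∀ (c : ℂ) v, F (c • v) p = (c • F v) p := fun c v => by simp [hFp]
  let t₀ : CT M p := ⟨(I / nrm ρ p) • transT ρ p, smul_mem _ _ (transT_mem h hp')⟩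
  let T : CT M p →ₗ[ℂ] CT M p →ₗ[ℂ] K10 M p →ₗ[ℂ] K01 M p →ₗ[ℂ] ℂ :=
    LinearMap.mk₂ ℂ (fun v₄ v₃ => LinearMap.mk₂ ℂ
      (fun v₂ v₁ => quarticVal ρ p (F v₂) (F (cj v₁)) v₃ v₄)
      (fun v v' w => by
        rw [quarticVal_congr hM h hp' (hF _) ((hF v).add hM hp (hF v')) (hF _) (hF _)
          (f_add v v') rfl v₄.2, quarticVal_add_left h hp' (hF _) (hF _) (hF _)])
      (fun c v w => by
        rw [quarticVal_congr hM h hp' (hF _) ((hF v).smul hM hp c) (hF _) (hF _)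
          (f_smul c v) rfl v₄.2, quarticVal_smul_left h hp' (hF _) (hF _), smul_eq_mul])
      (fun v w w' => by
        rw [cj_add, quarticVal_congr hM h hp' (hF _) (hF _) (hF _) ((hF _).add hM hp (hF _)) rfl
          (f_add _ _) v₄.2, quarticVal_add_right h hp' (hF _) (hF _) (hF _)])
      (fun c v w => by
        rw [cj_smul, quarticVal_congr hM h hp' (hF _) (hF _) (hF _) ((hF _).smul hM hp _) rfl
          (f_smul _ _) v₄.2, quarticVal_smul_right h hp' (hF _) (hF _), smul_eq_mul, star_star]))
      (fun v v' w => by ext v₂ v₁; exact cderiv_add_right _ _ _ _)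
      (fun c v w => by ext v₂ v₁; exact cderiv_smul_right _ _ _ _)
      (fun v w w' => by ext v₂ v₁; exact quarticVal_add_field h hp' (hF _) (hF _))
      (fun c v w => by ext v₂ v₁; exact quarticVal_smul_field h hp' (hF _) (hF _) c)
  let mul₀ : ℂ →ₗ[ℂ] CQ M p := LinearMap.toSpanSingleton ℂ (CQ M p) (Submodule.Quotient.mk t₀)
  refine ⟨LinearMap.mk₂ ℂ (fun v₄ v₃ => (T v₄ v₃).compr₂ mul₀)
    (fun _ _ _ => by ext; simp) (fun _ _ _ => by ext; simp [-smul_eq_mul])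
    (fun _ _ _ => by ext; simp) (fun _ _ _ => by ext; simp [-smul_eq_mul]), ?_⟩
  intro U' θ L₄ L₃ L₂ L₁ hU' hpU' hθ hL₄ hL₃ hL₂ hK₂ hL₁ hK₁ v₄ v₃ v₂ v₁ e₄ e₃ e₂ e₁ t ht
  have ht' : Submodule.Quotient.mk t = quarticVal ρ p (F v₂) (F (cj v₁)) v₃ v₄ •
      (Submodule.Quotient.mk t₀ : CQ M p) := ht
  have hmem : (t : CVec n) - quarticVal ρ p (F v₂) (F (cj v₁)) v₃ v₄ • (t₀ : CVec n) ∈ CH M p := by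
    rw [← Submodule.Quotient.mk_smul, Submodule.Quotient.eq] at ht'
    exact ht'
  have h0 := (hθ.2 p ⟨hp, hpU'⟩).1 _ hmem
  rw [map_sub, map_smul, sub_eq_zero, contact_eq_kap h hp' (hθ.2 p ⟨hp, hpU'⟩).1 t₀.2] at h0
  have hdz : dz ρ p (t₀ : CVec n).1 = I := by
    change dz ρ p ((I / nrm ρ p) • gradN ρ p) = _
    rw [dz_smul]
    exact div_mul_cancel₀ _ (nrm_ne_zero h hpU)
  have hk := cderiv_cderiv_leviFn h hp' hU' hpU' hθ hL₃ hL₂ hL₁ hK₁ (e₄ ▸ v₄.2)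
  rw [conjField_conjField] at hk
  rw [hk, h0, hdz, ← e₃, ← e₄, smul_eq_mul, quarticVal_congr hM h hp' (hF v₂) ⟨hK₂, U', hU', hpU',
    hL₂⟩
    (hF (cj v₁)) ⟨hK₁, U', hU', hpU', hL₁⟩ ((hFp v₂).trans e₂)
    ((hFp _).trans (congrArg conjV e₁)) v₄.2]
  ring

/-- Any tensor of the given type is determined by its values on fields over a neighbourhood, and
suitable fields exist. -/
lemma exists_fields (hM : IsRealHypersurface M) (hpsc : IsPseudoconvex M) (hp : p ∈ M)
    {U₀ : Set (Cn n)} (hU₀ : IsOpen U₀) (hpU₀ : p ∈ U₀) (v₄ v₃ : CT M p) (v₂ : K10 M p)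
    (v₁ : K01 M p) : ∃ (U : Set (Cn n)) (L₄ L₃ L₂ L₁ : Cn n → CVec n), U ⊆ U₀ ∧ IsOpen U ∧ p ∈ U ∧
    IsSection M (CT M) U L₄ ∧ IsSection M (CT M) U L₃ ∧ IsSection M (H10 M) U L₂ ∧
    InLeviKernelOrderOne M p L₂ ∧ IsSection M (H10 M) U (conjField L₁) ∧ InLeviKernelOrderOne M p
    (conjField L₁) ∧ (v₄ : CVec n) = L₄ p ∧ (v₃ : CVec n) = L₃ p ∧ (v₂ : CVec n) = L₂ p ∧
    (v₁ : CVec n) = L₁ p := by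
  obtain ⟨U, ρ, hpU, h⟩ := hM p hp
  obtain ⟨A, ⟨hKA, W, hW, hpW, hA⟩, hAp⟩ := exists_isKernelField hM hpsc hp v₂.2
  obtain ⟨B, ⟨hKB, W', hW', hpW', hB⟩, hBp⟩ := exists_isKernelField hM hpsc hp v₁.2
  refine ⟨W ∩ W' ∩ U ∩ U₀, projT ρ v₄, projT ρ v₃, A, conjField B, fun y hy => hy.2,
    ((hW.inter hW').inter h.1).inter hU₀, ⟨⟨⟨hpW, hpW'⟩, hpU⟩, hpU₀⟩,
    (isSection_projT h _).mono fun y hy => hy.1.2, (isSection_projT h _).mono fun y hy => hy.1.2,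
    hA.mono fun y hy => hy.1.1.1, hKA, ?_, ?_, (projT_of_mem h ⟨hp, hpU⟩ v₄.2).symm,
    (projT_of_mem h ⟨hp, hpU⟩ v₃.2).symm, hAp.symm, ?_⟩
  · rw [conjField_conjField]; exact hB.mono fun y hy => hy.1.1.2
  · rw [conjField_conjField]; exact hKB
  · rw [conjField, hBp, conjV_conjV]

lemma IsQuarticTensor.unique (hM : IsRealHypersurface M) (hpsc : IsPseudoconvex M) (hp : p ∈ M)
    {τ' : Tensor4 M p} (hτ : IsQuarticTensor M p τ) (hτ' : IsQuarticTensor M p τ') : τ' = τ := by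
  obtain ⟨U₀, ρ, hpU, h⟩ := hM p hp
  ext v₄ v₃ v₂ v₁
  obtain ⟨U, L₄, L₃, L₂, L₁, hUU, hU, hpU', h4, h3, h2, hK2, h1, hK1, e4, e3, e2, e1⟩ :=
    exists_fields hM hpsc hp h.1 hpU v₄ v₃ v₂ v₁
  have hθ := (isContactForm_cForm h).mono hUU
  have a := hτ U _ L₄ L₃ L₂ L₁ hU hpU' hθ h4 h3 h2 hK2 h1 hK1 v₄ v₃ v₂ v₁ e4 e3 e2 e1
  have b := hτ' U _ L₄ L₃ L₂ L₁ hU hpU' hθ h4 h3 h2 hK2 h1 hK1 v₄ v₃ v₂ v₁ e4 e3 e2 e1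
  obtain ⟨t, ht⟩ := mk_surjective _ (τ v₄ v₃ v₂ v₁)
  obtain ⟨t', ht'⟩ := mk_surjective _ (τ' v₄ v₃ v₂ v₁)
  rw [← ht, ← ht', Submodule.Quotient.eq]
  refine mem_CH_of_cForm_eq_zero h ⟨hp, hpU⟩ (t' - t).2 ?_
  change cForm ρ p ((t' : CVec n) - t) = 0
  rw [map_sub, a t ht, b t' ht', sub_self]

/-- The second derivative that defines the quartic tensor does not change under push-forward. -/
lemma cderiv_cderiv_push (h : IsBiholomorphic Φ) (hU : IsOpen U) (hUs : U ⊆ Φ.source) (hp : p ∈ U)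
    {L₄ L₃ L₂ L₁ : Cn n → CVec n} (hθ : ∀ y ∈ U, SmoothAt θ y) (h₃ : ∀ y ∈ U, SmoothAt L₃ y)
    (h₂ : ∀ y ∈ U, SmoothAt L₂ y) (h₁ : ∀ y ∈ U, SmoothAt L₁ y) : cderiv (fun z => cderiv
    (leviFn (pushForm Φ θ) (pushField Φ L₂) (pushField Φ L₁)) z (pushField Φ L₃ z)) (Φ p)
    (pushField Φ L₄ (Φ p)) = cderiv (fun x => cderiv (leviFn θ L₂ L₁) x (L₃ x)) p (L₄ p) := by
  have ho : IsOpen (Φ '' U) := isOpen_image hU hUs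
  have hf : ∀ y ∈ U, SmoothAt (leviFn θ L₂ L₁) y := fun y hy =>
    contDiffAt_leviFn (hθ y hy) (h₂ y hy) (h₁ y hy)
  have e : ∀ z ∈ Φ '' U, cderiv (leviFn (pushForm Φ θ) (pushField Φ L₂) (pushField Φ L₁)) z
      (pushField Φ L₃ z) = cderiv (leviFn θ L₂ L₁) (Φ.symm z) (L₃ (Φ.symm z)) := by
    rintro _ ⟨y, hy, rfl⟩
    rw [cderiv_congr ((ho.eventually_mem ⟨y, hy, rfl⟩).mono
      (leviFn_push_eventually h hUs h₂ h₁)), cderiv_symm_pushField h (hUs hy) (hf y hy),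
      Φ.left_inv (hUs hy)]
  rw [cderiv_congr ((ho.eventually_mem ⟨p, hp, rfl⟩).mono e)]
  exact cderiv_symm_pushField h (hUs hp)
    (f := fun x => cderiv (leviFn θ L₂ L₁) x (L₃ x)) (contDiffAt_cderiv (hf p hp) (h₃ p hp))

lemma IsQuarticTensor.push (hM : IsRealHypersurface M) (hpsc : IsPseudoconvex M) (hp : p ∈ M)
    (hτ : IsQuarticTensor M p τ) (hM' : IsRealHypersurface M') (h : IsCRMap M M' Φ)
    (hps : p ∈ Φ.source) {τ' : Tensor4 M' (Φ p)} (hτ' : IsQuarticTensor M' (Φ p) τ')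
    {v₄ v₃ t : CT M p} {v₂ : K10 M p} {v₁ : K01 M p} {w₄ w₃ s : CT M' (Φ p)} {w₂ : K10 M' (Φ p)}
    {w₁ : K01 M' (Φ p)} (e₄ : (w₄ : CVec n) = pushV Φ p v₄) (e₃ : (w₃ : CVec n) = pushV Φ p v₃)
    (e₂ : (w₂ : CVec n) = pushV Φ p v₂) (e₁ : (w₁ : CVec n) = pushV Φ p v₁)
    (es : (s : CVec n) = pushV Φ p t) (ht : Submodule.Quotient.mk t = τ v₄ v₃ v₂ v₁) :
    Submodule.Quotient.mk s = τ' w₄ w₃ w₂ w₁ := by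
  obtain ⟨U₀, ρ, hpU, hρ⟩ := hM p hp
  obtain ⟨U, L₄, L₃, L₂, L₁, hUU, hU, hpU', h4, h3, h2, hK2, h1, hK1, f4, f3, f2, f1⟩ :=
    exists_fields hM hpsc hp (hρ.1.inter Φ.open_source) ⟨hpU, hps⟩ v₄ v₃ v₂ v₁
  have hUs : U ⊆ Φ.source := fun y hy => (hUU hy).2
  have hθ := (isContactForm_cForm hρ).mono fun y hy => (hUU hy).1
  have hL1 : ∀ y ∈ U, SmoothAt L₁ y := fun y hy => by
    have := contDiffAt_conjField (h1.contDiffAt hU hy)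
    rwa [conjField_conjField] at this
  have a := hτ U _ L₄ L₃ L₂ L₁ hU hpU' hθ h4 h3 h2 hK2 h1 hK1 v₄ v₃ v₂ v₁ f4 f3 f2 f1 t ht
  have p4 := isSection_pushField h hU hUs (V' := CT M') (fun y hy v hv => pushV_mem_CT h hy hv) h4
  have p3 := isSection_pushField h hU hUs (V' := CT M') (fun y hy v hv => pushV_mem_CT h hy hv) h3
  have p2 := isSection_pushField h hU hUs (V' := H10 M') (fun y hy v hv => pushV_mem_H10 h hy hv) h2
  have p1 := isSection_pushField h hU hUs (V' := H10 M') (fun y hy v hv => pushV_mem_H10 h hy hv) h1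
  have k2 := hK2.push h hU hUs hM' ⟨hp, hpU'⟩ h2
  have k1 := hK1.push h hU hUs hM' ⟨hp, hpU'⟩ h1
  rw [← conjField_pushField] at p1 k1
  have b := hτ' (Φ '' U) _ _ _ _ (pushField Φ L₁) (isOpen_image hU hUs) ⟨p, hpU', rfl⟩
    (isContactForm_pushForm h hU hUs hθ) p4 p3 p2 k2 p1 k1 w₄ w₃ w₂ w₁
    (by rw [e₄, f4, pushField_apply hps]) (by rw [e₃, f3, pushField_apply hps])
    (by rw [e₂, f2, pushField_apply hps]) (by rw [e₁, f1, pushField_apply hps])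
  rw [cderiv_cderiv_push h.1 hU hUs hpU' (fun y hy => hθ.contDiffAt hU hy)
    (fun y hy => h3.contDiffAt hU hy) (fun y hy => h2.contDiffAt hU hy) hL1] at b
  obtain ⟨s', hs'⟩ := mk_surjective _ (τ' w₄ w₃ w₂ w₁)
  have b' := b s' hs'
  rw [← a, ← pushForm_pushV h.1 hps, ← es, ← sub_eq_zero, ← map_sub] at b'
  rw [← hs', Submodule.Quotient.eq]
  change ((s - s' : CT M' (Φ p)) : CVec n) ∈ CH M' (Φ p)
  have hmem : pushV Φ.symm (Φ p) ((s' : CVec n) - s) ∈ CT M p := by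
    have := pushV_mem_CT h.symm (Φ.map_source hps) (s' - s).2
    rwa [Φ.left_inv hps] at this
  rw [← pushV_pushV_symm h.1 hps ((s' : CVec n) - s), pushForm_pushV h.1 hps] at b'
  have hc := pushV_mem_CH h hps (mem_CH_of_cForm_eq_zero hρ ⟨hp, hpU⟩ hmem b')
  rw [pushV_pushV_symm h.1 hps] at hc
  have := neg_mem hc
  rwa [neg_sub] at this

lemma IsQuarticTensor.nonneg (hM : IsRealHypersurface M) (hpsc : IsPseudoconvex M) (hp : p ∈ M)
    (hτ : IsQuarticTensor M p τ) (hU : IsOpen U) (hpU : p ∈ U) (hθ : IsContactForm M U θ)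
    (hpos : LeviNonneg M U θ) {v₂ : CT M p} {v₁ : K10 M p} {w₁ : K01 M p}
    (hv₂ : conjV (v₂ : CVec n) = v₂) (hw₁ : (w₁ : CVec n) = conjV (v₁ : CVec n)) : ∃ c : ℝ, 0 ≤ c ∧
    PairsTo (θ p) (τ v₂ v₂ v₁ w₁) c := by
  obtain ⟨U₀, ρ, hpU₀, h⟩ := hM p hp
  obtain ⟨A, ⟨hKA, W, hW, hpW, hA⟩, hAp⟩ := exists_isKernelField hM hpsc hp v₁.2
  have hp' : p ∈ M ∩ U₀ := ⟨hp, hpU₀⟩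
  set V := W ∩ U₀ ∩ U with hV
  have hVo : IsOpen V := (hW.inter h.1).inter hU
  have hpV : p ∈ V := ⟨⟨hpW, hpU₀⟩, hpU⟩
  have hAV := hA.mono (W' := V) fun y hy => hy.1.1
  have hθV := hθ.mono (W' := V) fun y hy => hy.2
  have hLV := (isSection_projT h v₂).mono (W' := V) fun y hy => hy.1.2
  have hLp : projT ρ v₂ p = v₂ := projT_of_mem h hp' v₂.2
  have hsm : ∀ y ∈ V, SmoothAt (leviFn θ A (conjField A)) y := fun y hy =>
    contDiffAt_leviFn (hθV.contDiffAt hVo hy) (hAV.contDiffAt hVo hy)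
      (contDiffAt_conjField (hAV.contDiffAt hVo hy))
  set G : Cn n → ℝ := fun y => (I * leviFn θ A (conjField A) y).re with hG
  have hGs : ∀ y ∈ V, SmoothAt G y := fun y hy => contDiffAt_re (contDiffAt_const.mul (hsm y hy))
  have heq : ∀ y ∈ M ∩ V, toC G y = I * leviFn θ A (conjField A) y := fun y hy => by
    have := I_mul_leviFn_conj h hVo ⟨hy.1, hy.2.1.2⟩ hy.2 hAV hθV
    simp only [toC, hG, this, ofReal_re]
  have hev : ∀ᶠ y in 𝓝 p, y ∈ V := hVo.eventually_mem hpV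
  have hKp : A p ∈ K10 M p := hAp ▸ v₁.2
  obtain ⟨c, hc, hce⟩ := D2_nonneg h hp' (hev.mono hGs) (by
      have h1 := I_mul_leviFn_conj h hVo hp' hpV hAV hθV
      have h2 := (lev_eq_zero_of_mem_K10 h hp' hKp (a := (A p).1) ((mem_H10_iff h hp').1 hKp.1).1).1
      simp only [hG, h1, h2, zero_re, mul_zero, ofReal_zero])
    (hev.mono fun y hy hyM => hpos y ⟨hyM, hy.2⟩ V A hVo hy hAV) hVo hpV hLV
    (by rw [hLp, hv₂])
  refine ⟨c, hc, ?_⟩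
  have key := hτ V θ (projT ρ v₂) (projT ρ v₂) A (conjField A) hVo hpV hθV hLV hLV hAV hKA
    (by rwa [conjField_conjField]) (by rwa [conjField_conjField]) v₂ v₂ v₁ w₁ hLp.symm hLp.symm
    hAp.symm (by rw [hw₁, conjField, hAp])
  have e := D2_congr_of_eventually h hp' (hev.mono fun y hy => contDiffAt_toC (hGs y hy))
    (hev.mono fun y hy => contDiffAt_const.mul (hsm y hy)) hVo hpV hLV
    (hev.mono fun y hy hyM => heq y ⟨hyM, hy⟩) (v := projT ρ v₂ p) (hLV.2 p ⟨hp, hpV⟩)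
  rw [D2_const_mul _ (hev.mono hsm) (hLV.contDiffAt hVo hpV), hce] at e
  rw [e]
  exact key

end tensor

/-! ### The submanifold defined by the ideal sheaf -/

/-- Independence of functionals on the kernel of `r` amounts to independence together with `r`. -/
lemma linearIndependent_option_iff {E : Type*} [AddCommGroup E] [Module ℝ E] {r : E →ₗ[ℝ] ℝ}
    (hr : r ≠ 0) (φ : Fin m → E →ₗ[ℝ] ℝ) {T : Submodule ℝ E} (hT : ∀ v, v ∈ T ↔ r v = 0) :
    LinearIndependent ℝ (fun i : Option (Fin m) => i.elim r φ) ↔ LinearIndependent ℝ fun j =>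
    (φ j).domRestrict T := by
  rw [Fintype.linearIndependent_iff, Fintype.linearIndependent_iff]
  constructor
  · intro h c hc i
    have hr' := mem_span_of_iInf_ker_le_ker (L := fun _ : Unit => r) (K := ∑ j, c j • φ j)
      fun v hv =>
      by simpa using LinearMap.congr_fun hc ⟨v, (hT v).2 (by simpa using hv)⟩
    rw [Set.range_const] at hr'
    obtain ⟨d, e⟩ := Submodule.mem_span_singleton.1 hr'
    exact h (fun i => i.elim (-d) c) (by rw [Fintype.sum_option]; simp [← e]) (some i)
  · intro h c hc
    rw [Fintype.sum_option] at hc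
    have h1 : ∀ i, c (some i) = 0 := h _ (LinearMap.ext fun v => by
      simpa [(hT v.1).1 v.2] using LinearMap.congr_fun hc v.1)
    rintro (_ | i)
    exacts [by simpa [h1, hr] using hc, h1 i]

lemma cderiv_eq_zero_iff_re_im (hg : SmoothAt g p) (v : Cn n) : cderiv g p (ofRealV v) = 0 ↔ fderiv
    ℝ (fun y => (g y).re) p v = 0 ∧ fderiv ℝ (fun y => (g y).im) p v = 0 := by
  rw [cderiv_re_im hg, cderiv_ofRealV, cderiv_ofRealV,
    fderiv_toC ((contDiffAt_re hg).differentiableAt (by simp)),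
    fderiv_toC ((contDiffAt_im hg).differentiableAt (by simp)), Complex.ext_iff]
  simp

lemma conjV_mem_K01 (hv : v ∈ K10 M p) : conjV v ∈ K01 M p := by
  change conjV (conjV v) ∈ K10 M p
  rwa [conjV_conjV]

/-- The tensor kills its first argument as soon as it does so on a basis of the last two arguments
and on a spanning set of the second. -/
lemma tensor_eq_zero_of_basis (h : IsDefiningFunction M U ρ) (hp : p ∈ M ∩ U)
    (b : Module.Basis (Fin k) ℂ (K10 M p)) {V : CT M p}
    (h0 : ∀ s i j (w : K01 M p), (w : CVec n) = conjV (b j : CVec n) → τ V ⟨projT ρ (coordV s) p,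
      projT_mem h hp _⟩ (b i) w = 0) :
    τ V = 0 := by
  ext v₃ v₂ v₁
  have e3 : v₃ = ∑ s, coordOf s (v₃ : CVec n) •
      (⟨projT ρ (coordV s) p, projT_mem h hp _⟩ : CT M p) := by
    apply Subtype.ext
    rw [coe_finsetSum]
    conv_lhs => rw [← projT_of_mem h hp v₃.2, projT_eq_sum]
    rfl
  have e1 : v₁ = ∑ j, star (b.repr ⟨conjV v₁, v₁.2⟩ j) •
      (⟨conjV (b j), conjV_mem_K01 (b j).2⟩ : K01 M p) := by
    apply Subtype.ext
    rw [coe_finsetSum]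
    have := congrArg (fun w : K10 M p => conjV (w : CVec n)) (b.sum_repr ⟨conjV v₁, v₁.2⟩)
    simp only [conjV_conjV, coe_finsetSum, conjV_sum] at this
    exact this.symm.trans (sum_congr rfl fun j _ => conjV_smul _ _)
  rw [e3, ← b.sum_repr v₂, e1]
  simp only [map_sum, map_smul, LinearMap.sum_apply, LinearMap.smul_apply]
  have h1 : ∀ s i j, τ V ⟨projT ρ (coordV s) p, projT_mem h hp _⟩ (b i)
      ⟨conjV (b j), conjV_mem_K01 (b j).2⟩ = 0 := fun s i j => h0 s i j _ rfl
  simp only [h1, smul_zero, sum_const_zero]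
  simp only [LinearMap.zero_apply, smul_zero, sum_const_zero]

lemma reIdealSheaf_re (hU : IsOpen U) (hg : idealSheaf M q U g) : reIdealSheaf M q U fun y =>
    (g y).re :=
  ⟨fun _ hy => (contDiffAt_re (hg.1.contDiffAt (hU.mem_nhds hy))).contDiffWithinAt, g, hg,
    fun _ _ => rfl⟩

lemma reIdealSheaf_im (hU : IsOpen U) (hg : idealSheaf M q U g) : reIdealSheaf M q U fun y =>
    (g y).im :=
  ⟨fun _ hy => (contDiffAt_im (hg.1.contDiffAt (hU.mem_nhds hy))).contDiffWithinAt, _,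
    (isIdealSheaf_idealSheaf M q).mul U (fun _ => -I) g hU contDiffOn_const hg, fun _ _ => by simp⟩

lemma reIdealSheaf.mono {f : Cn n → ℝ} (hU : IsOpen U) (hW : IsOpen W) (hWU : W ⊆ U)
    (hf : reIdealSheaf M q U f) : reIdealSheaf M q W f := by
  obtain ⟨h1, h, h2, h3⟩ := hf
  exact ⟨h1.mono hWU, h, (isIdealSheaf_idealSheaf M q).restrict U W h hU hW hWU h2,
    fun x hx => h3 x ⟨hx.1, hWU hx.2⟩⟩

/-- The functions `f` are a maximal family, with independent differentials on the tangent space at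
`p`, among the real and imaginary parts of the first derivatives of Levi products. -/
lemma exists_submanifold (hM : IsRealHypersurface M) (hpsc : IsPseudoconvex M) (hp : p ∈ M)
    (hq : leviRank M p = q) (hτ : IsQuarticTensor M p τ) : ∃ (S U : Set (Cn n)) (m : ℕ)
    (f : Fin m → Cn n → ℝ), IsOpen U ∧ p ∈ U ∧ p ∈ S ∧ S = {x | x ∈ M ∩ U ∧ ∀ j, f j x = 0} ∧
    (∀ j, reIdealSheaf M q U (f j)) ∧ (∀ x ∈ M ∩ U, LinearIndependent ℝ fun j =>
    (fderiv ℝ (f j) x).toLinearMap.domRestrict (realTangent M x)) ∧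
    (∀ x ∈ M ∩ U, leviRank M x = q → x ∈ S) ∧ (∀ v : Cn n, v ∈ realTangent S p ↔ ∃ V : CT M p,
    (V : CVec n) = ofRealV v ∧ ∀ v₃ v₂ v₁, τ V v₃ v₂ v₁ = 0) := by
  obtain ⟨U₀, ρ, hpU₀, h⟩ := hM p hp
  have hp' : p ∈ M ∩ U₀ := ⟨hp, hpU₀⟩
  obtain ⟨k, ⟨b⟩⟩ : ∃ k, Nonempty (Module.Basis (Fin k) ℂ (K10 M p)) :=
    ⟨_, ⟨Module.finBasis ℂ (K10 M p)⟩⟩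
  choose W₀ B hW₀ hpW₀ hB hBp using fun i => exists_S10_of_mem_K10 hM hpsc hp hq (b i).2
  set W := (⋂ i, W₀ i) ∩ U₀
  have hW : IsOpen W := (isOpen_iInter_of_finite hW₀).inter h.1
  have hpW : p ∈ W := ⟨Set.mem_iInter.2 hpW₀, hpU₀⟩
  have hBW : ∀ i, S10 M q W (B i) := fun i => (hB i).mono fun y hy => Set.mem_iInter.1 hy.1 i
  have hhW := h.mono hW inter_subset_right
  have hθ := isContactForm_cForm hhW
  -- the generators of the ideal sheaf given by the frame of `K¹⁰` and all coordinate directions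
  set g : (Idx n) × Fin k × Fin k → Cn n → ℂ := fun a y =>
    cderiv (leviFn (cForm ρ) (B a.2.1) (conjField (B a.2.2))) y (projT ρ (coordV a.1) y)
  have hgen : ∀ a, IsIdealGenerator M q W (g a) := fun a =>
    ⟨cForm ρ, B a.2.1, conjField (B a.2.2), hθ, hBW _,
      by rw [conjField_conjField]; exact hBW _, Or.inr ⟨_, isSection_projT hhW _, rfl⟩⟩
  have hgs : ∀ a, SmoothAt (g a) p := fun a => ((hgen a).contDiffOn hW).contDiffAt (hW.mem_nhds hpW)
  set F : ((Idx n) × Fin k × Fin k) × Bool → Cn n → ℝ := fun a =>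
    if a.2 then fun y => (g a.1 y).re else fun y => (g a.1 y).im
  have hFI : ∀ a, reIdealSheaf M q W (F a) := by
    rintro ⟨a, _ | _⟩
    · exact reIdealSheaf_im hW (idealSheaf_of_generator hW (hgen a))
    · exact reIdealSheaf_re hW (idealSheaf_of_generator hW (hgen a))
  -- a maximal subfamily with independent differentials on the tangent space
  obtain ⟨κ, a, hainj, hspan, hli⟩ := exists_linearIndependent' ℝ
    fun i => (fderiv ℝ (F i) p).toLinearMap.domRestrict (realTangent M p)
  have : Finite κ := Finite.of_injective a hainj
  obtain ⟨m, ⟨e⟩⟩ := Finite.exists_equiv_fin κ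
  set f : Fin m → Cn n → ℝ := fun j => F (a (e.symm j))
  have hfs : ∀ j, ContDiffOn ℝ ∞ (f j) W := fun j => (hFI _).1
  have hlif : LinearIndependent ℝ fun j =>
      (fderiv ℝ (f j) p).toLinearMap.domRestrict (realTangent M p) :=
    hli.comp e.symm e.symm.injective
  set fo : Option (Fin m) → Cn n → ℝ := fun i => i.elim ρ f
  have hfos : ∀ i, ContDiffOn ℝ ∞ (fo i) W := by
    rintro (_ | j)
    exacts [hhW.2.1, hfs j]
  have hopt : ∀ x ∈ M ∩ W, LinearIndependent ℝ (fun i => fderiv ℝ (fo i) x) ↔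
      LinearIndependent ℝ fun j =>
        (fderiv ℝ (f j) x).toLinearMap.domRestrict (realTangent M x) := by
    intro x hx
    rw [← linearIndependent_option_iff (r := (fderiv ℝ ρ x).toLinearMap)
      (fun h0 => hhW.2.2.1 x hx.2 (coe_injective h0))
      (fun j => (fderiv ℝ (f j) x).toLinearMap) fun v => mem_realTangent_iff hhW hx,
      ← LinearMap.linearIndependent_iff (ContinuousLinearMap.coeLM ℝ)
        (LinearMap.ker_eq_bot.2 coe_injective)]
    have : (fun i : Option (Fin m) => i.elim (fderiv ℝ ρ x).toLinearMap
        fun j => (fderiv ℝ (f j) x).toLinearMap) =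
        (ContinuousLinearMap.coeLM ℝ : (Cn n →L[ℝ] ℝ) →ₗ[ℝ] _) ∘ fun i => fderiv ℝ (fo i) x := by
      funext i
      cases i <;> rfl
    rw [this]
  have hcont : ContinuousAt (fun x i => fderiv ℝ (fo i) x) p :=
    continuousAt_pi.2 fun i => (((hfos i).contDiffAt (hW.mem_nhds hpW)).fderiv_right
      (m := 0) (by simp)).continuousAt
  obtain ⟨V, hVli, hV, hpV⟩ := eventually_nhds_iff.1 (hcont.eventually
    (isOpen_setOfPred_linearIndependent.mem_nhds ((hopt p ⟨hp, hpW⟩).2 hlif)))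
  set U := V ∩ W
  have hUo : IsOpen U := hV.inter hW
  have hpU : p ∈ U := ⟨hpV, hpW⟩
  have hfU : ∀ j, reIdealSheaf M q U (f j) := fun j => (hFI _).mono hW hUo inter_subset_right
  have hS1 : ∀ x ∈ M ∩ U, leviRank M x = q → x ∈ {x | x ∈ M ∩ U ∧ ∀ j, f j x = 0} :=
    fun x hx hxq => ⟨hx, fun j => reIdealSheaf_eq_zero hM (hfU j) hx hxq⟩
  refine ⟨{x | x ∈ M ∩ U ∧ ∀ j, f j x = 0}, U, m, f, hUo, hpU, hS1 p ⟨hp, hpU⟩ hq, rfl, hfU,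
    fun x hx => (hopt x ⟨hx.1, hx.2.2⟩).1 (hVli x hx.2.1), hS1, fun v => ?_⟩
  have hlevel : v ∈ realTangent {x | x ∈ M ∩ U ∧ ∀ j, f j x = 0} p ↔
      ∀ i, cderiv (toC (fo i)) p (ofRealV v) = 0 :=
    mem_CT_of_level hUo hpU (fun i => (hfos i).mono inter_subset_right) (hVli p hpV)
      (fun y hy => ⟨fun hyS => by
          rintro (_ | j)
          exacts [(hhW.2.2.2 y hy.2).1 hyS.1.1, hyS.2 j],
        fun h0 => show _ ∧ _ from ⟨⟨(hhW.2.2.2 y hy.2).2 (h0 none), hy⟩, fun j => h0 (some j)⟩⟩)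
      (hS1 p ⟨hp, hpU⟩ hq)
  have hfd : ∀ i, cderiv (toC (fo i)) p (ofRealV v) = 0 ↔ fderiv ℝ (fo i) p v = 0 := fun i => by
    rw [cderiv_ofRealV, fderiv_toC (((hfos i).contDiffAt (hW.mem_nhds hpW)).differentiableAt
      (by simp)), ofReal_eq_zero]
  rw [hlevel]
  simp only [hfd, Option.forall]
  -- the tensor in terms of the differentials of the generators
  have hval : ∀ (V : CT M p) s i j (w : K01 M p), (w : CVec n) = conjV (b j : CVec n) →
      (τ V ⟨projT ρ (coordV s) p, projT_mem h hp' _⟩ (b i) w = 0 ↔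
        cderiv (g (s, i, j)) p (V : CVec n) = 0) := by
    intro V s i j w hw
    have key := hτ W (cForm ρ) (projT ρ V) (projT ρ (coordV s)) (B i) (conjField (B j)) hW hpW hθ
      (isSection_projT hhW _) (isSection_projT hhW _) (hBW i).1
      ((hBW i).2 p ⟨hp, hpW⟩ hq.le) (by rw [conjField_conjField]; exact (hBW j).1)
      (by rw [conjField_conjField]; exact (hBW j).2 p ⟨hp, hpW⟩ hq.le) V
      ⟨projT ρ (coordV s) p, projT_mem h hp' _⟩ (b i) w (projT_of_mem h hp' V.2).symm rfl
      (hBp i).symm (by rw [hw, conjField, hBp])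
    obtain ⟨t, ht⟩ := mk_surjective _ (τ V ⟨projT ρ (coordV s) p, projT_mem h hp' _⟩ (b i) w)
    have key := key t ht
    rw [projT_of_mem h hp' V.2] at key
    have e : cForm ρ p t = 0 ↔ cderiv (g (s, i, j)) p (V : CVec n) = 0 := by
      rw [key]
      exact mul_eq_zero_iff_left I_ne_zero
    rw [← ht, Submodule.Quotient.mk_eq_zero, ← e]
    exact ⟨(hθ.2 p ⟨hp, hpW⟩).1 _, mem_CH_of_cForm_eq_zero h hp' t.2⟩
  constructor
  · rintro ⟨h0, h1⟩
    have hv : v ∈ realTangent M p := (mem_realTangent_iff h hp').2 h0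
    have hall : ∀ i, fderiv ℝ (F i) p v = 0 := fun i => by
      refine LinearMap.eqOn_span (f := LinearMap.applyₗ (⟨v, hv⟩ : realTangent M p)) (g := 0) ?_
        (hspan.ge (Submodule.subset_span ⟨i, rfl⟩))
      rintro _ ⟨c, rfl⟩
      simpa [fo, f] using h1 (e c)
    refine ⟨⟨ofRealV v, hv⟩, rfl, fun v₃ v₂ v₁ => ?_⟩
    rw [tensor_eq_zero_of_basis h hp' b (V := ⟨ofRealV v, hv⟩) fun s i j w hw =>
      (hval _ s i j w hw).2 ((cderiv_eq_zero_iff_re_im (hgs _) v).2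
        ⟨hall ((s, i, j), true), hall ((s, i, j), false)⟩)]
    rfl
  · rintro ⟨V, hV, h0⟩
    have hv : v ∈ realTangent M p := show ofRealV v ∈ CT M p from hV ▸ V.2
    refine ⟨(mem_realTangent_iff h hp').1 hv, fun j => ?_⟩
    have hgz : ∀ a, fderiv ℝ (fun y => (g a y).re) p v = 0 ∧
        fderiv ℝ (fun y => (g a y).im) p v = 0 := by
      rintro ⟨s, i, j⟩
      refine (cderiv_eq_zero_iff_re_im (hgs _) v).1 ?_
      rw [← hV]
      exact (hval V s i j ⟨conjV (b j), conjV_mem_K01 (b j).2⟩ rfl).1 (h0 _ _ _)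
    change fderiv ℝ (F (a (e.symm j))) p v = 0
    rcases a (e.symm j) with ⟨c, _ | _⟩
    exacts [(hgz c).2, (hgz c).1]

lemma mem_K10_of_mem_CK (hX : X ∈ CK M p) : ((X.1, 0) : CVec n) ∈ K10 M p := by
  obtain ⟨a, ha, c, hc, rfl⟩ := mem_sup.1 hX
  have h2 : a.2 = 0 := ha.1.2
  have h1 : c.1 = 0 := by
    have : (conjV c).2 = 0 := (K10_le_H10 M p hc).2
    simpa [conjV] using this
  have : ((a + c).1, (0 : Cn n)) = a := Prod.ext (by simp [h1]) h2.symm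
  rw [this]
  exact ha

/-- If the quartic tensor is nontrivial on every complex line of the Levi kernel, then the real
vectors in its kernel and in the Levi kernel form a totally real space. -/
lemma isTotallyReal_inf {T : Submodule ℝ (Cn n)}
    (hT : ∀ v : Cn n, v ∈ T ↔ ∃ V : CT M p, (V : CVec n) = ofRealV v ∧ ∀ v₃ v₂ v₁, τ V v₃ v₂ v₁ = 0)
    (hne : ∀ v : K10 M p, v ≠ 0 → ∃ (a b : CT M p) (c : K10 M p) (d : K01 M p), (a : CVec n)
      ∈ span ℂ {(v : CVec n), conjV (v : CVec n)} ∧ τ a b c d ≠ 0) :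
    IsTotallyReal (T ⊓ realVectors (CK M p)) := by
  rintro v ⟨hv, hvK⟩ ⟨hIv, -⟩
  by_contra hv0
  have hK := mem_K10_of_mem_CK (X := ofRealV v) hvK
  obtain ⟨a, b, c, d, ha, hτ⟩ := hne ⟨((ofRealV v).1, 0), hK⟩ (fun h0 => hv0 (by
    have := congrArg (fun w : K10 M p => (w : CVec n).1) h0
    exact this))
  obtain ⟨V, hV, hV0⟩ := (hT v).1 hv
  obtain ⟨V', hV', hV0'⟩ := (hT _).1 hIv
  obtain ⟨α, β, hαβ⟩ := mem_span_pair.1 ha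
  have e : a = (α / 2) • (V + (-I) • V') + (β / 2) • (V + I • V') := by
    apply Subtype.ext
    rw [← hαβ]
    simp only [Submodule.coe_add, Submodule.coe_smul, hV, hV']
    refine Prod.ext ?_ ?_ <;> funext i <;> simp [ofRealV, conjV] <;> ring_nf <;>
      simp only [Complex.I_sq] <;> ring
  apply hτ
  rw [e]
  simp [hV0, hV0']

/-! ### Vanishing of partial jets and partial Taylor polynomials -/

/-- The partial derivative of `f` with respect to the variable `z_j` or `z̄_j`. -/
noncomputable abbrev pd (s : Idx n) (f : Cn n → ℂ) : Cn n → ℂ := fun x => cderiv f x (coordV s)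

/-- All partial derivatives of `f` at `p` of order at most `k` in the directions of `A` vanish. -/
def Flat (A : Finset (Idx n)) : ℕ → (Cn n → ℂ) → Cn n → Prop
  | 0, f, p => f p = 0
  | k + 1, f, p => f p = 0 ∧ ∀ s ∈ A, Flat A k (pd s f) p

lemma SmoothNear.pd (hf : SmoothNear f p) (s : Idx n) : SmoothNear (pd s f) p :=
  hf.mono fun _ h => contDiffAt_cderiv_const _ h

lemma SmoothNear.diff (hf : SmoothNear f p) : ∀ᶠ x in 𝓝 p, DifferentiableAt ℝ f x :=
  hf.mono fun _ h => h.diffAt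

lemma pd_congr (h : f =ᶠ[𝓝 p] g) (s : Idx n) : pd s f =ᶠ[𝓝 p] pd s g :=
  h.eventuallyEq_nhds.mono fun _ hx => cderiv_congr hx _

lemma pd_comm (hf : SmoothNear f p) (s t : Idx n) : pd s (pd t f) =ᶠ[𝓝 p] pd t (pd s f) :=
  hf.mono fun _ hx => cderiv_cderiv_comm hx _ _

lemma SmoothNear.congr (hf : SmoothNear f p) (h : f =ᶠ[𝓝 p] g) : SmoothNear g p := by
  filter_upwards [hf, h.eventuallyEq_nhds] with x h1 h2 using h1.congr_of_eventuallyEq h2.symm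

lemma Flat.zero_apply (h : Flat A k f p) : f p = 0 := by
  cases k
  exacts [h, h.1]

lemma Flat.congr (h : Flat A k f p) (e : f =ᶠ[𝓝 p] g) : Flat A k g p := by
  induction k generalizing f g with
  | zero => exact e.eq_of_nhds.symm.trans h
  | succ k ih => exact ⟨e.eq_of_nhds.symm.trans h.1, fun s hs => ih (h.2 s hs) (pd_congr e s)⟩

lemma Flat.mono {B : Finset (Idx n)} {l : ℕ} (h : Flat A k f p) (hB : B ⊆ A) (hl : l ≤ k) : Flat B l
    f p := by
  induction l generalizing f k with
  | zero => exact h.zero_apply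
  | succ l ih =>
    cases k with
    | zero => omega
    | succ k => exact ⟨h.1, fun s hs => ih (h.2 s (hB hs)) (by omega)⟩

lemma Flat.zero (A : Finset (Idx n)) (k : ℕ) (p : Cn n) : Flat A k (fun _ => 0) p := by
  induction k with
  | zero => rfl
  | succ k ih =>
    refine ⟨rfl, fun s _ => ?_⟩
    have : pd s (fun _ : Cn n => (0 : ℂ)) = fun _ => 0 := by funext x; simp [pd, cderiv]
    rw [this]; exact ih

lemma Flat.add (hf : Flat A k f p) (hg : Flat A k g p) (sf : SmoothNear f p) (sg : SmoothNear g p) :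
    Flat A k (fun x => f x + g x) p := by
  induction k generalizing f g with
  | zero => exact (congrArg₂ (· + ·) hf hg).trans (add_zero 0)
  | succ k ih =>
    refine ⟨(congrArg₂ (· + ·) hf.1 hg.1).trans (add_zero 0), fun s hs => ?_⟩
    refine (ih (hf.2 s hs) (hg.2 s hs) (sf.pd s) (sg.pd s)).congr ?_
    filter_upwards [sf.diff, sg.diff] with x h1 h2 using (cderiv_fun_add h1 h2 _).symm

/-- Functions with a vanishing partial jet form an ideal. -/
lemma Flat.mul_left (hf : Flat A k f p) (sf : SmoothNear f p) (sg : SmoothNear g p) : Flat A k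
    (fun x => g x * f x) p := by
  induction k generalizing f g with
  | zero => exact (congrArg (g p * ·) hf).trans (mul_zero _)
  | succ k ih =>
    refine ⟨(congrArg (g p * ·) hf.1).trans (mul_zero _), fun s hs => ?_⟩
    refine ((ih (hf.2 s hs) (sf.pd s) sg).add (ih (hf.mono subset_rfl k.le_succ) sf (sg.pd s))
      (sg.mul (sf.pd s)) ((sg.pd s).mul sf)).congr ?_
    filter_upwards [sf.diff, sg.diff] with x h1 h2 using (cderiv_fun_mul h2 h1 _).symm

lemma Flat.neg (hf : Flat A k f p) (sf : SmoothNear f p) : Flat A k (fun x => -f x) p := by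
  simpa using hf.mul_left sf (SmoothNear.const (-1) p)

lemma Flat.sub (hf : Flat A k f p) (hg : Flat A k g p) (sf : SmoothNear f p) (sg : SmoothNear g p) :
    Flat A k (fun x => f x - g x) p := by
  have sg' : SmoothNear (fun x => -g x) p := sg.mono fun _ h => h.neg
  simpa [sub_eq_add_neg] using hf.add (hg.neg sg) sf sg'

lemma Flat.sum {s : Finset ι} {f : ι → Cn n → ℂ} (hf : ∀ i ∈ s, Flat A k (f i) p)
    (sf : ∀ i ∈ s, SmoothNear (f i) p) : Flat A k (fun x => ∑ i ∈ s, f i x) p := by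
  classical
  induction s using Finset.induction_on with
  | empty => simpa using Flat.zero A k p
  | insert i s hi ih =>
    simp only [sum_insert hi]
    exact (hf i (Finset.mem_insert_self i s)).add
      (ih (fun j hj => hf j (mem_insert_of_mem hj)) fun j hj => sf j (mem_insert_of_mem hj))
      (sf i (Finset.mem_insert_self i s))
      (SmoothNear.sum fun j hj => sf j (mem_insert_of_mem hj))

lemma pd_conj (hf : SmoothNear f p) (s : Idx n) : pd s (fun x => star (f x)) =ᶠ[𝓝 p] fun x => star
    (pd s.swap f x) := by
  filter_upwards [hf.diff] with x hx
  rw [pd, cderiv_conj hx, conjV_coordV]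

lemma Flat.conj {B : Finset (Idx n)} (hf : Flat A k f p) (sf : SmoothNear f p)
    (hB : ∀ s ∈ B, s.swap ∈ A) : Flat B k (fun x => star (f x)) p := by
  induction k generalizing f with
  | zero => exact (congrArg star hf).trans (star_zero ℂ)
  | succ k ih =>
    exact ⟨(congrArg star hf.1).trans (star_zero ℂ), fun s hs =>
      (ih (hf.2 _ (hB s hs)) (sf.pd _)).congr (pd_conj sf s).symm⟩

/-- The variables `z_j`. -/
def holVars (n : ℕ) : Finset (Idx n) := univ.image inl

lemma inl_mem_holVars (j : Fin n) : inl j ∈ holVars n := Finset.mem_image_of_mem _ (mem_univ j)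

lemma mem_holVars : s ∈ holVars n ↔ ∃ j, inl j = s := by simp [holVars]

lemma AnalyticAt.contDiffAtR {l : ℕ} {f : Cn m → Cn l} {x : Cn m} (h : AnalyticAt ℂ f x) : SmoothAt
    f x := (h.contDiffAt (n := ∞)).restrict_scalars ℝ

lemma analyticAt_contDiffAtC (h : AnalyticAt ℂ f x) : SmoothAt f x := (h.contDiffAt (n :=
    ∞)).restrict_scalars ℝ

lemma smoothNear_of_analyticAt (h : AnalyticAt ℂ f p) : SmoothNear f p :=
  h.eventually_analyticAt.mono fun _ hx => analyticAt_contDiffAtC hx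

lemma cderiv_of_analyticAt (h : DifferentiableAt ℂ f x) (X : CVec n) : cderiv f x X = fderiv ℂ f x
    X.1 := by
  have e : fderiv ℝ f x = (fderiv ℂ f x).restrictScalars ℝ := h.fderiv_restrictScalars ℝ
  have hI : ∀ z : ℂ, I * (I * z) = -z := fun z => by rw [← mul_assoc, I_mul_I, neg_one_mul]
  simp only [cderiv, e, coe_restrictScalars', map_smul, smul_eq_mul, hI]
  ring

/-- The conjugate of a holomorphic function vanishing at `p` is killed by all holomorphic
derivatives. -/
lemma flat_conj_of_analyticAt (h : AnalyticAt ℂ f p) (h0 : f p = 0) (k : ℕ) : Flat (holVars n) k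
    (fun x => star (f x)) p := by
  cases k with
  | zero => exact (congrArg star h0).trans (star_zero ℂ)
  | succ k =>
    refine ⟨(congrArg star h0).trans (star_zero ℂ), fun s hs => ?_⟩
    obtain ⟨j, rfl⟩ := mem_holVars.1 hs
    refine (Flat.zero _ k p).congr ?_
    filter_upwards [pd_conj (smoothNear_of_analyticAt h) (inl j), h.eventually_analyticAt]
      with x h1 h2
    rw [h1, swap_inl, pd, cderiv_of_analyticAt h2.differentiableAt]
    simp [coordV]

lemma cderiv_comp_analyticAt {Ψ : Cn n → Cn n} (hΨ : AnalyticAt ℂ Ψ x)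
    (hf : DifferentiableAt ℝ f (Ψ x)) (j : Fin n) : pd (inl j) (fun y => f (Ψ y)) x = ∑ m, pd
    (inl j) (fun y => Ψ y m) x * pd (inl m) f (Ψ x) := by
  have e : ∀ m, pd (inl j) (fun y => Ψ y m) x = fderiv ℂ Ψ x (single j 1) m := fun m => by
    rw [pd, cderiv_of_analyticAt ((analyticAt_pi_iff.1 hΨ m).differentiableAt)]
    exact congrArg (fun D : Cn n →L[ℂ] ℂ => D (single j 1))
      (fderiv_apply (𝕜 := ℂ) hΨ.differentiableAt m)
  rw [pd, cderiv_comp_push hf hΨ.differentiableAt, cderiv_eq_sum, sum_sum_type]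
  have h2 : ∀ m, coordOf (inr m) (pushV Ψ x (coordV (inl j))) = 0 := fun m => by
    change (pushV Ψ x (coordV (inl j))).2 m = 0
    simp [pushV, coordV]
  simp only [h2, zero_smul, sum_const_zero, add_zero]
  refine sum_congr rfl fun m _ => ?_
  rw [e, smul_eq_mul]
  rfl

/-- The vanishing of the holomorphic jet does not depend on the holomorphic coordinates. -/
lemma Flat.comp_holo {Ψ : Cn n → Cn n} (hΨ : AnalyticAt ℂ Ψ x) (hf : Flat (holVars n) k f (Ψ x))
    (sf : SmoothNear f (Ψ x)) : Flat (holVars n) k (fun y => f (Ψ y)) x := by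
  induction k generalizing f with
  | zero => exact hf
  | succ k ih =>
    refine ⟨hf.1, fun s hs => ?_⟩
    obtain ⟨j, rfl⟩ := mem_holVars.1 hs
    have sc : ∀ g, SmoothNear g (Ψ x) → SmoothNear (fun y => g (Ψ y)) x := fun g hg => by
      filter_upwards [hΨ.eventually_analyticAt, hΨ.continuousAt.eventually hg] with y h1 h2
      exact h2.comp y (AnalyticAt.contDiffAtR h1)
    have sΨ : ∀ m, SmoothNear (fun y => Ψ y m) x := fun m =>
      smoothNear_of_analyticAt (analyticAt_pi_iff.1 hΨ m)
    refine (Flat.sum (s := univ)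
      (f := fun m y => pd (inl j) (fun y => Ψ y m) y * pd (inl m) f (Ψ y))
      (fun m _ => (ih (hf.2 _ (inl_mem_holVars m)) (sf.pd _)).mul_left (sc _ (sf.pd _))
        ((sΨ m).pd _)) fun m _ => ((sΨ m).pd _).mul (sc _ (sf.pd _))).congr ?_
    filter_upwards [hΨ.eventually_analyticAt, hΨ.continuousAt.eventually sf.diff] with y h1 h2
    exact (cderiv_comp_analyticAt h1 h2 j).symm

/-! Taylor polynomials -/

/-- The homogeneous part of degree `k` of the Taylor expansion of `f` at `p` in the variables of
`A`. -/
def taylorHom (A : Finset (Idx n)) (p : Cn n) : ℕ → (Cn n → ℂ) → CPoly n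
  | 0, f => MvPolynomial.C (f p)
  | k + 1, f => MvPolynomial.C ((k + 1 : ℂ)⁻¹) *
      ∑ s ∈ A, MvPolynomial.X s * taylorHom A p k (pd s f)

/-- The value of a polynomial in `z_j, z̄_j`. -/
def evalC (P : CPoly n) (x : Cn n) : ℂ := eval (Sum.elim x (star x)) P

lemma evalC_eq (P : CPoly n) (x : Cn n) : evalC P x = eval (fun s => coordFn s x) P := by
  rw [evalC]
  congr 1
  congr 1
  funext s
  exact (coordOf_ofRealV s x).symm

lemma contDiff_evalC (P : CPoly n) : ContDiff ℝ ∞ (evalC P) := by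
  rw [show evalC P = fun x => eval (fun s => coordFn s x) P from funext (evalC_eq P)]
  induction P using MvPolynomial.induction_on with
  | C a => simpa using contDiff_const
  | add P Q hP hQ => simpa using hP.add hQ
  | mul_X P s hP => simpa using hP.mul (contDiff_coordFn s)

lemma smoothNear_evalC (P : CPoly n) (p : Cn n) : SmoothNear (evalC P) p :=
  Filter.Eventually.of_forall fun _ => (contDiff_evalC P).contDiffAt

lemma pd_evalC (P : CPoly n) (s : Idx n) : pd s (evalC P) = evalC (pderiv s P) := by
  classical
  funext x
  have hd : ∀ Q : CPoly n, DifferentiableAt ℝ (evalC Q) x := fun Q =>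
    (contDiff_evalC Q).contDiffAt.differentiableAt (by simp)
  induction P using MvPolynomial.induction_on with
  | C a =>
    have : evalC (MvPolynomial.C a : CPoly n) = fun _ : Cn n => a := by funext x; simp [evalC]
    rw [pd, this]
    simp [cderiv, evalC]
  | add P Q hP hQ =>
    have : evalC (P + Q) = fun x => evalC P x + evalC Q x := by funext x; simp [evalC]
    rw [pd, this, cderiv_fun_add (hd P) (hd Q), map_add]
    simp only [evalC, map_add] at hP hQ ⊢
    rw [← hP, ← hQ]
  | mul_X P t hP =>
    have : evalC (P * MvPolynomial.X t) = fun x => evalC P x * coordFn t x := by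
      funext x; rw [evalC_eq, evalC_eq]; simp
    rw [pd, this, cderiv_fun_mul (hd P) ((contDiff_coordFn t).contDiffAt.differentiableAt (by
      simp)),
      cderiv_coordFn, coordOf_coordV, Derivation.leibniz, pderiv_X]
    simp only [evalC_eq, map_add, smul_eq_mul, map_mul, eval_X] at hP ⊢
    have hP' : cderiv (evalC P) x (coordV s) = _ := hP
    rw [hP']
    by_cases hts : t = s
    · subst hts; simp; ring
    · simp [hts]; ring

lemma taylorHom_congr (h : f =ᶠ[𝓝 p] g) : taylorHom A p k f = taylorHom A p k g := by
  induction k generalizing f g with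
  | zero => rw [taylorHom, taylorHom, h.eq_of_nhds]
  | succ k ih =>
    rw [taylorHom, taylorHom]
    congr 1
    exact sum_congr rfl fun s _ => by rw [ih (pd_congr h s)]

lemma pderiv_taylorHom_of_notMem (hs : s ∉ A) (k : ℕ) (f : Cn n → ℂ) : pderiv s
    (taylorHom A p k f) = 0 := by
  classical
  induction k generalizing f with
  | zero => simp [taylorHom]
  | succ k ih =>
    rw [taylorHom, Derivation.leibniz, pderiv_C, smul_zero, add_zero, map_sum]
    refine smul_eq_zero_of_right _ (sum_eq_zero fun t ht => ?_)
    have hst : t ≠ s := fun h => hs (h ▸ ht)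
    rw [Derivation.leibniz, ih, pderiv_X_of_ne hst]
    simp

lemma pderiv_taylorHom (hs : s ∈ A) (k : ℕ) (hf : SmoothNear f p) : pderiv s
    (taylorHom A p (k + 1) f) = taylorHom A p k (pd s f) := by
  classical
  induction k generalizing f with
  | zero =>
    change pderiv s (MvPolynomial.C (((0 : ℕ) : ℂ) + 1)⁻¹ *
      ∑ t ∈ A, MvPolynomial.X t * MvPolynomial.C (pd t f p)) = MvPolynomial.C (pd s f p)
    rw [Derivation.leibniz, pderiv_C, smul_zero, add_zero, map_sum,
      Finset.sum_eq_single_of_mem s hs]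
    · simp [Derivation.leibniz]
    · intro t _ hts
      simp [Derivation.leibniz, pderiv_X_of_ne hts]
  | succ k ih =>
    rw [taylorHom, Derivation.leibniz, pderiv_C, smul_zero, add_zero, map_sum]
    have h1 : ∀ t ∈ A, pderiv s (MvPolynomial.X t * taylorHom A p (k + 1) (pd t f)) =
        MvPolynomial.X t * taylorHom A p k (pd t (pd s f)) +
          (if t = s then taylorHom A p (k + 1) (pd s f) else 0) := by
      intro t _
      rw [Derivation.leibniz, ih (hf.pd t), taylorHom_congr (pd_comm hf s t), smul_eq_mul,
        smul_eq_mul]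
      by_cases hts : t = s
      · subst hts; simp
      · simp [hts, pderiv_X_of_ne hts]
    rw [sum_congr rfl h1, sum_add_distrib, Finset.sum_ite_eq' A s, if_pos hs]
    have h2 : ∑ t ∈ A, MvPolynomial.X t * taylorHom A p k (pd t (pd s f)) =
        MvPolynomial.C (k + 1 : ℂ) * taylorHom A p (k + 1) (pd s f) := by
      have hk : ((k : ℂ) + 1) ≠ 0 := Nat.cast_add_one_ne_zero k
      rw [taylorHom, ← mul_assoc, ← map_mul, mul_inv_cancel₀ hk, map_one, one_mul]
    have hk : ((k : ℂ) + 1 + 1) ≠ 0 := by exact_mod_cast Nat.succ_ne_zero (k + 1)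
    rw [h2, smul_eq_mul, ← one_mul (taylorHom A p (k + 1) (pd s f)), ← mul_assoc, ← add_mul,
      ← mul_assoc, mul_one]
    congr 1
    rw [← map_one MvPolynomial.C, ← map_add, ← map_mul]
    push_cast
    rw [inv_mul_cancel₀ hk]

lemma isHomogeneous_taylorHom (k : ℕ) (f : Cn n → ℂ) : (taylorHom A p k f).IsHomogeneous k := by
  induction k generalizing f with
  | zero => exact isHomogeneous_C _ _
  | succ k ih =>
    rw [taylorHom, ← zero_add (k + 1)]
    refine (isHomogeneous_C _ _).mul (MvPolynomial.IsHomogeneous.sum _ _ _ fun s _ => ?_)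
    rw [add_comm k 1]
    exact (MvPolynomial.isHomogeneous_X _ _).mul (ih _)

lemma vars_taylorHom (k : ℕ) (f : Cn n → ℂ) : (taylorHom A p k f).vars ⊆ A := by
  classical
  induction k generalizing f with
  | zero => simp [taylorHom]
  | succ k ih =>
    rw [taylorHom]
    refine (vars_mul _ _).trans ?_
    rw [MvPolynomial.vars_C, Finset.empty_union]
    refine (MvPolynomial.vars_sum_subset _ _).trans (Finset.biUnion_subset.2 fun s hs => ?_)
    refine (vars_mul _ _).trans (Finset.union_subset ?_ (ih _))
    rw [MvPolynomial.vars_X]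
    exact Finset.singleton_subset_iff.2 hs

lemma evalC_taylorHom_succ (k : ℕ) (f : Cn n → ℂ) (x : Cn n) : evalC (taylorHom A p (k + 1) f) x =
    (k + 1 : ℂ)⁻¹ * ∑ s ∈ A, Sum.elim x (star x) s * evalC (taylorHom A p k (pd s f)) x := by
  simp [evalC, taylorHom]

lemma analyticAt_evalC_taylorHom (k : ℕ) (f : Cn n → ℂ) (x : Cn n) : AnalyticAt ℂ
    (evalC (taylorHom (holVars n) p k f)) x := by
  induction k generalizing f with
  | zero =>
    have : evalC (taylorHom (holVars n) p 0 f) = fun _ => f p := by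
      funext x; simp [evalC, taylorHom]
    rw [this]; exact analyticAt_const
  | succ k ih =>
    rw [show evalC (taylorHom (holVars n) p (k + 1) f) = _ from
      funext fun x => evalC_taylorHom_succ k f x]
    refine analyticAt_const.mul (analyticAt_fun_sum _ fun s hs => AnalyticAt.mul ?_ (ih _))
    obtain ⟨j, rfl⟩ := mem_holVars.1 hs
    exact (proj (R := ℂ) (φ := fun _ : Fin n => ℂ) j).analyticAt x

/-- Real-valuedness of the Taylor polynomials of a real function in a conjugation-invariant set of
variables. -/
lemma star_evalC_taylorHom (hA : ∀ s ∈ A, s.swap ∈ A) (k : ℕ) (hf : SmoothNear f p) (x : Cn n) :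
    star (evalC (taylorHom A p k f) x) = evalC (taylorHom A p k fun y => star (f y)) x := by
  induction k generalizing f with
  | zero => simp [evalC, taylorHom]
  | succ k ih =>
    rw [evalC_taylorHom_succ, evalC_taylorHom_succ, star_mul', star_sum]
    congr 1
    · simp
    · refine Finset.sum_nbij' Sum.swap Sum.swap hA hA (by simp) (by simp) fun s _ => ?_
      rw [star_mul', ih (hf.pd s)]
      congr 1
      · cases s <;> simp
      · rw [taylorHom_congr (pd_conj hf s.swap), swap_swap]

/-- The Taylor polynomial of degree `k` in the variables of `A`. -/
def taylorPoly (A : Finset (Idx n)) (p : Cn n) (k : ℕ) (f : Cn n → ℂ) : CPoly n :=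
  ∑ i ∈ Finset.range (k + 1), taylorHom A p i f

lemma evalC_zero_taylorHom_succ (k : ℕ) (f : Cn n → ℂ) : evalC (taylorHom A p (k + 1) f) 0 = 0 := by
  rw [evalC_taylorHom_succ]
  refine mul_eq_zero_of_right _ (sum_eq_zero fun s _ => ?_)
  cases s <;> simp

lemma evalC_zero_taylorPoly (k : ℕ) (f : Cn n → ℂ) : evalC (taylorPoly A p k f) 0 = f p := by
  have : evalC (taylorPoly A p k f) 0 = ∑ i ∈ Finset.range (k + 1), evalC (taylorHom A p i f)
    0 := by
    simp [evalC, taylorPoly]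
  rw [this, sum_range_succ']
  simp [evalC_zero_taylorHom_succ]
  simp [evalC, taylorHom]

lemma pderiv_taylorPoly (hs : s ∈ A) (k : ℕ) (hf : SmoothNear f p) : pderiv s
    (taylorPoly A p (k + 1) f) = taylorPoly A p k (pd s f) := by
  rw [taylorPoly, map_sum, sum_range_succ']
  simp only [pderiv_taylorHom hs _ hf]
  rw [taylorHom, pderiv_C, add_zero, taylorPoly]

lemma analyticAt_evalC_taylorPoly (k : ℕ) (f : Cn n → ℂ) (x : Cn n) : AnalyticAt ℂ
    (evalC (taylorPoly (holVars n) p k f)) x := by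
  have : evalC (taylorPoly (holVars n) p k f) =
      fun x => ∑ i ∈ Finset.range (k + 1), evalC (taylorHom (holVars n) p i f) x := by
    funext x; simp [evalC, taylorPoly]
  rw [this]
  exact analyticAt_fun_sum _ fun i _ => analyticAt_evalC_taylorHom i f x

lemma cderiv_comp_sub (f : Cn n → ℂ) (p x : Cn n) (X : CVec n) : cderiv (fun y => f (y - p)) x X =
    cderiv f (x - p) X := by
  simp only [cderiv, fderiv_comp_sub]

lemma smoothNear_evalC_sub (P : CPoly n) (p x : Cn n) : SmoothNear (fun y => evalC P (y - p)) x :=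
  Filter.Eventually.of_forall fun _ =>
    ((contDiff_evalC P).comp (contDiff_id.sub contDiff_const)).contDiffAt

lemma flat_sub_taylorPoly (k : ℕ) (hf : SmoothNear f p) : Flat A k
    (fun x => f x - evalC (taylorPoly A p k f) (x - p)) p := by
  induction k generalizing f with
  | zero =>
    change f p - evalC (taylorPoly A p 0 f) (p - p) = 0
    rw [sub_self, evalC_zero_taylorPoly, sub_self]
  | succ k ih =>
    refine ⟨?_, fun s hs => ?_⟩
    · change f p - evalC (taylorPoly A p (k + 1) f) (p - p) = 0
      rw [sub_self, evalC_zero_taylorPoly, sub_self]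
    · refine (ih (hf.pd s)).congr (Filter.EventuallyEq.symm ?_)
      filter_upwards [hf.diff] with x hx
      rw [pd, cderiv_fun_sub hx (smoothNear_evalC_sub _ p x).at.diffAt, cderiv_comp_sub]
      congr 1
      rw [← pderiv_taylorPoly hs k hf, ← pd_evalC]

/-! ### A basis adapted to the Levi form -/

/-- A positive definite Hermitian form has an orthonormal basis. -/
lemma exists_orthonormal_basis {V : Type*} [AddCommGroup V] [Module ℂ V] [FiniteDimensional ℂ V]
    (B : V → V → ℂ) (hadd : ∀ x y z, B (x + y) z = B x z + B y z)
    (hsmul : ∀ (c : ℂ) x y, B (c • x) y = c * B x y) (hconj : ∀ x y, B y x = star (B x y))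
    (hpos : ∀ x, 0 ≤ (B x x).re) (hdef : ∀ x, B x x = 0 → x = 0) (hq : finrank ℂ V = q) : ∃ b :
    Module.Basis (Fin q) ℂ V, ∀ i j, B (b i) (b j) = if i = j then 1 else 0 := by
  subst hq
  let core : InnerProductSpace.Core ℂ V :=
    { inner := fun x y => B y x
      conj_inner_symm := fun x y => (hconj x y).symm
      re_inner_nonneg := hpos
      add_left := fun x y z => by
        change B z (x + y) = B z x + B z y
        rw [hconj (x + y), hadd, star_add, ← hconj, ← hconj]
      smul_left := fun x y r => by
        change B y (r • x) = star r * B y x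
        rw [hconj (r • x), hsmul, star_mul', ← hconj]
      definite := hdef }
  let _ := core.toNormedAddCommGroup
  let _ := InnerProductSpace.ofCore core.toCore
  refine ⟨(stdOrthonormalBasis ℂ V).toBasis, fun i j => ?_⟩
  have := orthonormal_iff_ite.1 (stdOrthonormalBasis ℂ V).orthonormal j i
  rw [OrthonormalBasis.coe_toBasis]
  change B (stdOrthonormalBasis ℂ V i) (stdOrthonormalBasis ℂ V j) = _ at this
  rw [this]
  simp [eq_comm]

lemma finrank_H10 (h : IsDefiningFunction M U ρ) (hp : p ∈ M ∩ U) : finrank ℂ (H10 M p) + 1 =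
    n := by
  let D : Cn n →ₗ[ℂ] ℂ :=
    { toFun := dz ρ p, map_add' := dz_add, map_smul' := fun c a => dz_smul c a }
  have hD : Function.Surjective D := fun c => ⟨(c / nrm ρ p) • gradN ρ p, by
    change dz ρ p _ = c
    rw [dz_smul]
    exact div_mul_cancel₀ _ (nrm_ne_zero h hp.2)⟩
  have h1 := D.finrank_range_add_finrank_ker
  rw [LinearMap.range_eq_top.2 hD, finrank_top, Module.finrank_self, Module.finrank_fin_fun] at h1
  have e : H10 M p = (LinearMap.ker D).map (LinearMap.inl ℂ (Cn n) (Cn n)) := by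
    ext v
    rw [mem_H10_iff h hp, Submodule.mem_map]
    constructor
    · rintro ⟨h1, h2⟩
      exact ⟨v.1, h1, Prod.ext rfl h2.symm⟩
    · rintro ⟨a, ha, rfl⟩
      exact ⟨ha, rfl⟩
  rw [e, ← (Submodule.equivMapOfInjective _ LinearMap.inl_injective (LinearMap.ker D)).finrank_eq]
  omega

/-- A basis of `ℂⁿ` consisting of a normal vector, a Levi-orthonormal basis of a complement of the
Levi kernel, and a basis of the Levi kernel. -/
lemma exists_adapted_basis [NeZero n] (h : IsDefiningFunction M U ρ) (hpsd : LevPsd M U ρ)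
    (hp : p ∈ M ∩ U) (hq : leviRank M p = q) : ∃ e : Module.Basis (Fin n) ℂ (Cn n), dz ρ p (e 0) =
    -1 ∧ (∀ j, j ≠ 0 → dz ρ p (e j) = 0) ∧
    (∀ j : Fin n, q < (j : ℕ) → ((e j, 0) : CVec n) ∈ K10 M p) ∧ ∀ j i : Fin n, j ≠ 0 → (j : ℕ) ≤
    q → lev ρ p (e i) (star (e j)) = if i = j then 1 else 0 := by
  obtain ⟨C, hC⟩ := Submodule.exists_isCompl (K10 M p)
  have hsup : K10 M p ⊔ (C ⊓ H10 M p) = H10 M p := by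
    rw [← sup_inf_assoc_of_le C (K10_le_H10 M p), hC.sup_eq_top, top_inf_eq]
  have hinf : K10 M p ⊓ (C ⊓ H10 M p) = ⊥ := by
    rw [← inf_assoc, hC.inf_eq_bot, bot_inf_eq]
  have hH := finrank_H10 h hp
  have hfs := finrank_sup_add_finrank_inf_eq (K10 M p) (C ⊓ H10 M p)
  rw [hinf, finrank_bot, hsup, add_zero] at hfs
  have hfr : finrank ℂ ↥(C ⊓ H10 M p) = q := by
    unfold leviRank at hq
    omega
  obtain ⟨r, hr⟩ : ∃ r, 1 + (q + r) = n := ⟨n - 1 - q, by omega⟩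
  have hfK : finrank ℂ (K10 M p) = r := by omega
  have hev := h.eventually hp.2
  obtain ⟨c, hc⟩ := exists_orthonormal_basis (V := ↥(C ⊓ H10 M p))
    (fun x y => lev ρ p (x : CVec n).1 (star (y : CVec n).1))
    (fun x y z => lev_add_left _ _ _) (fun c x y => lev_smul_left _ _ _)
    (fun x y => by rw [lev_conj hev, star_star])
    (fun x => hpsd p hp _ ((mem_H10_iff h hp).1 x.2.2).1)
    (fun x hx => by
      have hK := mem_K10_of_lev_self h hpsd hp x.2.2 (by rw [hx]; rfl)
      have : (x : CVec n) ∈ K10 M p ⊓ (C ⊓ H10 M p) := ⟨hK, x.2⟩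
      rw [hinf] at this
      exact Subtype.ext this) hfr
  let k := finBasisOfFinrankEq ℂ _ hfK
  -- the normal vector, made Levi-orthogonal to the complement
  set N₀ : Cn n := (-(nrm ρ p)⁻¹) • gradN ρ p with hN₀
  set N : Cn n := N₀ - ∑ i, lev ρ p N₀ (star (c i : CVec n).1) • (c i : CVec n).1 with hN
  have hcH : ∀ i, dz ρ p (c i : CVec n).1 = 0 := fun i => ((mem_H10_iff h hp).1 (c i).2.2).1
  have hkH : ∀ i, dz ρ p (k i : CVec n).1 = 0 := fun i => ((mem_H10_iff h hp).1 (k i).2.1).1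
  have hk2 : ∀ i, (k i : CVec n).2 = 0 := fun i => (K10_le_H10 M p (k i).2).2
  have hdN : dz ρ p N = -1 := by
    rw [hN, dz_sub, dz_sum]
    simp only [dz_smul, hcH, mul_zero, sum_const_zero, sub_zero]
    rw [hN₀, dz_smul, neg_mul, ← nrm, inv_mul_cancel₀ (nrm_ne_zero h hp.2)]
  have hlN : ∀ j, lev ρ p N (star (c j : CVec n).1) = 0 := fun j => by
    rw [hN, lev_sub_left, lev_sum_left]
    simp only [lev_smul_left, hc]
    simp
  have hlk : ∀ i j, lev ρ p (k i : CVec n).1 (star (c j : CVec n).1) = 0 := fun i j =>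
    (lev_eq_zero_of_mem_K10 h hp (k i).2 (hcH j)).1
  let E : Fin 1 ⊕ Fin q ⊕ Fin r → Cn n :=
    Sum.elim (fun _ => N) (Sum.elim (fun i => (c i : CVec n).1) fun i => (k i : CVec n).1)
  let σ := (((Equiv.refl (Fin 1)).sumCongr (finSumFinEquiv (m := q) (n := r))).trans
    finSumFinEquiv).trans (finCongr hr)
  have hli : LinearIndependent ℂ E := by
    rw [Fintype.linearIndependent_iff]
    intro g hg
    simp only [sum_sum_type, Finset.univ_unique, Finset.sum_singleton, E, Sum.elim_inl,
      Sum.elim_inr] at hg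
    have g0 : g (inl 0) = 0 := by
      simpa [dz_add, dz_sum, dz_smul, hcH, hkH, hdN] using congrArg (dz ρ p) hg
    have gc : ∀ j, g (inr (inl j)) = 0 := fun j => by
      simpa [lev_add_left, lev_sum_left, lev_smul_left, hlN, hc, hlk] using
        congrArg (fun v => lev ρ p v (star (c j : CVec n).1)) hg
    have gk := Fintype.linearIndependent_iff.1 k.linearIndependent (fun i => g (inr (inr i)))
      (Subtype.ext (Prod.ext (by simpa [g0, gc, fst_sum] using hg) (by
        rw [coe_finsetSum, snd_sum]
        exact sum_eq_zero fun i _ => by simp [hk2])))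
    rintro (i | j | j)
    exacts [Subsingleton.elim i 0 ▸ g0, gc j, gk j]
  have h0 : σ (inl 0) = 0 := by simp [σ, Fin.ext_iff]
  have h1 : ∀ i, (σ (inr (inl i)) : ℕ) = 1 + i := fun i => by simp [σ]
  have h2 : ∀ i, (σ (inr (inr i)) : ℕ) = 1 + (q + i) := fun i => by simp [σ]
  refine ⟨(basisOfLinearIndependentOfCardEqFinrank hli (by simp [hr])).reindex σ, ?_, ?_, ?_, ?_⟩
  · rw [← h0]
    simp [E, hdN]
  · intro j
    obtain ⟨i | i | i, rfl⟩ := σ.surjective j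
    · simp [Subsingleton.elim i 0, h0]
    · simp [E, hcH]
    · simp [E, hkH]
  · intro j hj
    obtain ⟨i | i | i, rfl⟩ := σ.surjective j
    · simp [Subsingleton.elim i 0, h0] at hj
    · have := h1 i; have := i.2; omega
    · have e : ((k i : CVec n).1, (0 : Cn n)) = k i := Prod.ext rfl (hk2 i).symm
      simp [E, e]
  · intro j l
    obtain ⟨i | i | i, rfl⟩ := σ.surjective j
    · simp [Subsingleton.elim i 0, h0]
    · intro _ _
      obtain ⟨i' | i' | i', rfl⟩ := σ.surjective l <;> simp [E, hlN, hc, hlk]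
    · intro _ hj; have := h2 i; omega

/-! ### Holomorphic coordinates adapted to the Levi form -/

lemma cderiv_eq_of_pd (h : ∀ j, pd (inl j) f p = pd (inl j) g p) (v : Cn n) : cderiv f p
    ((v, 0) : CVec n) = cderiv g p (v, 0) := by
  rw [cderiv_fst_eq_sum, cderiv_fst_eq_sum]
  exact sum_congr rfl fun j _ => congrArg (_ • ·) (h j)

lemma cderiv_evalC_taylorPoly (hf : SmoothNear f p) (k : ℕ) (v : Cn n) : cderiv
    (fun x => evalC (taylorPoly (holVars n) p (k + 1) f) (x - p)) p ((v, 0) : CVec n) = cderiv f p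
    (v, 0) := by
  refine cderiv_eq_of_pd (fun j => ?_) v
  have h := ((flat_sub_taylorPoly (A := holVars n) (k + 1) hf).2 _ (inl_mem_holVars j)).zero_apply
  rw [pd, cderiv_fun_sub hf.at.diffAt
    (smoothNear_evalC_sub _ p p).at.diffAt, sub_eq_zero] at h
  exact h.symm

lemma cderiv_cderiv_eq_lev (h : ∀ᶠ y in 𝓝 p, SmoothAt ρ y) (a b : Cn n) : cderiv
    (fun y => cderiv (toC ρ) y ((0, b) : CVec n)) p ((a, 0) : CVec n) = lev ρ p a b := by
  have hp := contDiffAt_toC h.self_of_nhds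
  rw [cderiv_cderiv_comm hp]
  have e : (fun y => cderiv (toC ρ) y ((a, 0) : CVec n)) =ᶠ[𝓝 p] fun y => ∑ j, a j * dzc ρ j y :=
    h.mono fun y hy => cderiv_toC_fst hy a
  have hd := fun j => (contDiffAt_dzc h.self_of_nhds j).diffAt
  rw [cderiv_congr e, cderiv_fun_sum _ (fun j _ => (hd j).const_mul (a j)), lev]
  refine sum_congr rfl fun j _ => ?_
  rw [cderiv_const_mul _ (hd j), cderiv_snd_eq_sum, mul_sum]
  exact sum_congr rfl fun k _ => (mul_assoc _ _ _).symm

/-- Holomorphic functions vanishing at `p` whose differentials are the coordinates in a basis are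
the components of a chart. -/
lemma exists_chart_of_components (hU : IsOpen U) (hp : p ∈ U) (e : Module.Basis (Fin n) ℂ (Cn n))
    (F : Fin n → Cn n → ℂ) (hF : ∀ j x, AnalyticAt ℂ (F j) x) (hF0 : ∀ j, F j p = 0)
    (hd : ∀ i j, fderiv ℂ (F j) p (e i) = if i = j then 1 else 0) : ∃ Φ : OpenPartialHomeomorph
    (Cn n) (Cn n), IsBiholomorphic Φ ∧ p ∈ Φ.source ∧ Φ.source ⊆ U ∧ Φ p = 0 ∧
    (∀ y ∈ Φ.target, ∀ j, y j = F j (Φ.symm y)) ∧ ∀ j, fderiv ℂ Φ.symm 0 (single j 1) = e j := by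
  set Φ₀ : Cn n → Cn n := fun x j => F j x
  have hana : ∀ x, AnalyticAt ℂ Φ₀ x := fun x => analyticAt_pi_iff.2 fun j => hF j x
  have hDe : ∀ i, fderiv ℂ Φ₀ p (e i) = single i 1 := fun i => funext fun j => by
    rw [single_apply]
    exact ((congrArg (fun D : Cn n →L[ℂ] ℂ => D (e i))
      (fderiv_apply (𝕜 := ℂ) (hana p).differentiableAt j)).symm.trans (hd i j)).trans
      (by simp [eq_comm])
  have hD : fderiv ℂ Φ₀ p = (e.equivFunL : Cn n →L[ℂ] Cn n) :=
    coe_injective (e.ext fun i => (hDe i).trans (by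
      ext; simp [Finsupp.single_apply, single_apply, eq_comm]))
  have hstrict : HasStrictFDerivAt Φ₀ (e.equivFunL : Cn n →L[ℂ] Cn n) p :=
    hD ▸ (hana p).hasStrictFDerivAt
  have hcd : ContDiff ℂ 1 Φ₀ := contDiff_iff_contDiffAt.2 fun x => (hana x).contDiffAt
  set Φ := (hstrict.toOpenPartialHomeomorph Φ₀).restrOpen _
    (hU.inter (ContinuousLinearEquiv.isOpen.preimage (hcd.continuous_fderiv (by simp))))
  have hps : p ∈ Φ.source :=
    ⟨hstrict.mem_toOpenPartialHomeomorph_source, hp, ⟨e.equivFunL, hD.symm⟩⟩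
  have hbi : IsBiholomorphic Φ := by
    refine ⟨fun x _ => hana x, fun y hy => ?_⟩
    obtain ⟨i, hi⟩ := (Φ.map_target hy).2.2
    exact Φ.analyticAt_symm hy (hana _) hi.symm
  have hΦp : Φ p = 0 := funext hF0
  refine ⟨Φ, hbi, hps, fun x hx => hx.2.1, hΦp,
    fun y hy j => congrFun (Φ.right_inv hy).symm j, fun j => ?_⟩
  have h1 := fderiv_symm_fderiv hbi hps (e j)
  rwa [hΦp, show fderiv ℂ Φ p (e j) = _ from hDe j] at h1

/-- Near a point of Levi rank `q` there are holomorphic coordinates in which the holomorphic `3`-jet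
of the defining function is that of `-2 Re w`, the holomorphic `2`-jets of its derivatives along
`∂/∂z̄_j`, `1 ≤ j ≤ q`, are those of `z_j`, and the last coordinate vectors span the Levi kernel.
The coordinates are Taylor polynomials of the defining function and of its derivatives. -/
lemma exists_chart [NeZero n] (h : IsDefiningFunction M U ρ) (hpsd : LevPsd M U ρ) (hp : p ∈ M ∩ U)
    (hq : leviRank M p = q) : ∃ Φ : OpenPartialHomeomorph (Cn n) (Cn n), IsBiholomorphic Φ ∧ p ∈
    Φ.source ∧ Φ.source ⊆ U ∧ Φ p = 0 ∧ (∀ j, dz ρ p (fderiv ℂ Φ.symm 0 (single j 1)) = if j = 0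
    then -1 else 0) ∧ Flat (holVars n) 3 (fun y => toC ρ (Φ.symm y) + (y 0 + star (y 0))) 0 ∧ (∀ j :
    Fin n, j ≠ 0 → (j : ℕ) ≤ q → Flat (holVars n) 2
    (fun y => pd (inr j) (fun y => toC ρ (Φ.symm y) + (y 0 + star (y 0))) y - y j) 0) ∧ ∀ j : Fin n,
    q < (j : ℕ) → pushV Φ.symm 0 (coordV (inl j)) ∈ K10 M p := by
  obtain ⟨e, he0, hez, heK, hel⟩ := exists_adapted_basis h hpsd hp hq
  have hev := h.eventually hp.2
  have hρ : SmoothNear (toC ρ) p := hev.mono fun _ hy => contDiffAt_toC hy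
  set P := taylorPoly (holVars n) p 3 (toC ρ) with hP
  set g : Fin n → Cn n → ℂ := fun j x => cderiv (toC ρ) x ((0, star (e j)) : CVec n) with hg
  have hgs : ∀ j, SmoothNear (g j) p := fun j => hρ.mono fun _ hy => contDiffAt_cderiv_const _ hy
  set T := fun j => taylorPoly (holVars n) p 2 (g j) with hT
  have hsub : ∀ x, AnalyticAt ℂ (fun x : Cn n => x - p) x := fun x =>
    analyticAt_id.sub analyticAt_const
  have hPa : ∀ x, AnalyticAt ℂ (fun x => evalC P (x - p)) x := fun x =>
    (analyticAt_evalC_taylorPoly 3 (toC ρ) _).comp (hsub x)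
  have hTa : ∀ j x, AnalyticAt ℂ (fun x => evalC (T j) (x - p)) x := fun j x =>
    (analyticAt_evalC_taylorPoly 2 (g j) _).comp (hsub x)
  have hρp : toC ρ p = 0 := by simp only [toC, (h.2.2.2 p hp.2).1 hp.1, ofReal_zero]
  let F : Fin n → Cn n → ℂ := fun j x => if j = 0 then -evalC P (x - p) else
    if (j : ℕ) ≤ q then evalC (T j) (x - p) else e.coord j (x - p)
  have hF : ∀ j, (∀ x, AnalyticAt ℂ (F j) x) ∧ F j p = 0 ∧
      ∀ i, fderiv ℂ (F j) p (e i) = if i = j then 1 else 0 := fun j => by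
    simp only [F]
    split_ifs with h0 hj
    · have hn : AnalyticAt ℂ (fun x => -evalC P (x - p)) p := (hPa p).neg
      refine ⟨fun x => (hPa x).neg, by rw [sub_self, hP, evalC_zero_taylorPoly, hρp, neg_zero],
        fun i => ?_⟩
      rw [← cderiv_of_analyticAt hn.differentiableAt ((e i, 0) : CVec n), cderiv_fun_neg,
        cderiv_evalC_taylorPoly hρ 2, cderiv_toC_fst hev.self_of_nhds, h0]
      split_ifs with hi
      · rw [hi, he0, neg_neg]
      · rw [hez i hi, neg_zero]
    · refine ⟨hTa j, ?_, fun i => ?_⟩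
      · simp only [hT, sub_self, evalC_zero_taylorPoly, hg]
        rw [cderiv_toC_eq hev.self_of_nhds, star_star, hez j h0]
        simp [dz]
      · rw [← cderiv_of_analyticAt (hTa j p).differentiableAt ((e i, 0) : CVec n),
          cderiv_evalC_taylorPoly (hgs j) 1, cderiv_cderiv_eq_lev hev, hel j i h0 hj]
    · let l : Cn n →L[ℂ] ℂ := (e.coord j).toContinuousLinearMap
      refine ⟨fun x => (l.analyticAt _).comp (hsub x), by simp, fun i => ?_⟩
      rw [show fderiv ℂ (fun x => e.coord j (x - p)) p = l from
        (fderiv_comp_sub p).trans l.fderiv]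
      simp [l, Finsupp.single_apply]
  obtain ⟨Φ, hbi, hps, hsU, hΦp, hyF, hΨe⟩ := exists_chart_of_components h.1 hp.2 e F
    (fun j => (hF j).1) (fun j => (hF j).2.1) fun i j => (hF j).2.2 i
  have h0t : (0 : Cn n) ∈ Φ.target := hΦp ▸ Φ.map_source hps
  have hs0 : Φ.symm 0 = p := by rw [← hΦp, Φ.left_inv hps]
  have hΨ : AnalyticAt ℂ Φ.symm 0 := hbi.2 0 h0t
  have htar : ∀ᶠ y in 𝓝 (0 : Cn n), y ∈ Φ.target := Φ.open_target.eventually_mem h0t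
  have hlim : Filter.Tendsto Φ.symm (𝓝 0) (𝓝 p) := hs0 ▸ hΨ.continuousAt
  refine ⟨Φ, hbi, hps, hsU, hΦp, fun j => ?_, ?_, fun j h0 hj => ?_, fun j hj => ?_⟩
  · rw [hΨe]
    split_ifs with hj
    exacts [hj ▸ he0, hez j hj]
  · have hPs : SmoothNear (fun x => evalC P (x - p)) p := smoothNear_evalC_sub P p p
    have h1 := (flat_sub_taylorPoly (A := holVars n) 3 hρ).sub
      (flat_conj_of_analyticAt (hPa p) (by rw [sub_self, hP, evalC_zero_taylorPoly, hρp]) 3)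
      (hρ.sub hPs) hPs.conj
    rw [← hs0] at h1
    refine (Flat.comp_holo hΨ h1 (by rw [hs0]; exact (hρ.sub hPs).sub hPs.conj)).congr ?_
    filter_upwards [htar] with y hy
    simp only [hyF y hy 0, F, if_true, hs0, star_neg]
    ring
  · -- `∂̄_j` of the defining function in the new coordinates
    set c : Fin n → Cn n → ℂ := fun k y => fderiv ℂ Φ.symm y (single j 1) k with hc
    have hca : ∀ k, AnalyticAt ℂ (fun y => c k y - c k 0) 0 := fun k =>
      (analyticAt_pi_iff.1 (((ContinuousLinearMap.apply ℂ (Cn n)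
        (single j (1 : ℂ) : Cn n)).analyticAt _).comp hΨ.fderiv) k).sub analyticAt_const
    have sc : ∀ f, SmoothNear f p → SmoothNear (fun y => f (Φ.symm y)) 0 := fun f hf => by
      filter_upwards [hΨ.eventually_analyticAt, hlim.eventually hf] with y h1 h2
      exact h2.comp y (AnalyticAt.contDiffAtR h1)
    have hcs : ∀ k, SmoothNear (fun y => c k y - c k 0) 0 := fun k =>
      smoothNear_of_analyticAt (hca k)
    have hTs : SmoothNear (fun x => evalC (T j) (x - p)) p := smoothNear_evalC_sub _ p p
    have h1 : Flat (holVars n) 2 (fun y => ∑ k, pd (inr k) (toC ρ) (Φ.symm y) *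
        star (c k y - c k 0)) 0 :=
      Flat.sum (fun k _ => (flat_conj_of_analyticAt (hca k) (sub_self _) 2).mul_left (hcs k).conj
        (sc _ (hρ.pd _))) fun k _ => (sc _ (hρ.pd _)).mul (hcs k).conj
    have h2 := flat_sub_taylorPoly (A := holVars n) 2 (hgs j)
    rw [← hs0] at h2
    have h2 := Flat.comp_holo hΨ h2 (by rw [hs0]; exact (hgs j).sub hTs)
    refine (h1.add h2 (SmoothNear.sum fun k _ => (sc _ (hρ.pd _)).mul (hcs k).conj)
      (by rw [hs0]; exact sc _ ((hgs j).sub hTs))).congr ?_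
    filter_upwards [htar, hlim.eventually hρ.diff, hΨ.eventually_analyticAt] with y hy h3 h4
    have hst : ∀ y, pushV Φ.symm y (coordV (inr j)) = (0, star fun k => c k y) := fun y => by
      simp [pushV, coordV, hc]
    have hd0 : ∀ k, DifferentiableAt ℝ (fun y : Cn n => y k) y := fun k =>
      differentiableAt_apply k y
    have hA : DifferentiableAt ℝ (fun y => toC ρ (Φ.symm y)) y :=
      h3.comp y (h4.differentiableAt.restrictScalars ℝ)
    have hB : DifferentiableAt ℝ (fun y : Cn n => y 0 + star (y 0)) y := (hd0 0).add (hd0 0).star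
    have hyT : y j = evalC (T j) (Φ.symm y - p) := by rw [hyF y hy j]; simp only [F, h0, hj,
      if_true, if_false]
    rw [hs0, ← hyT, pd, cderiv_fun_add hA hB, cderiv_add_star,
      cderiv_comp_push h3 h4.differentiableAt, hst, cderiv_snd_eq_sum]
    simp only [hg, ← hΨe, cderiv_snd_eq_sum]
    rw [show (coordV (inr j) : CVec n).1 0 + (coordV (inr j) : CVec n).2 0 = 0 by
      simp [coordV, h0.symm], add_zero, ← add_sub_assoc, ← sum_add_distrib]
    congr 1
    refine sum_congr rfl fun k _ => ?_
    simp only [hc, Pi.star_apply, star_sub, smul_eq_mul]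
    ring
  · have : pushV Φ.symm 0 (coordV (inl j)) = (e j, 0) :=
      Prod.ext (hΨe j) (by simp [pushV, coordV])
    rw [this]
    exact heK j hj

/-! ### The hypersurface as a graph -/

section graph

variable [NeZero n] {E : Cn n → ℝ}

/-- The point `y` moved in the direction of `Re y₀` so that twice this coordinate becomes `G y`. -/
def graphPt (G : Cn n → ℝ) (y : Cn n) : Cn n := y + ((G y / 2 - (y 0).re : ℝ) : ℂ) • single 0 1

lemma graphPt_zero (G : Cn n → ℝ) (y : Cn n) : graphPt G y 0 = y 0 +
    ((G y / 2 - (y 0).re : ℝ) : ℂ) := by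
  simp [graphPt]

lemma graphPt_of_ne (G : Cn n → ℝ) (y : Cn n) {j : Fin n} (hj : j ≠ 0) : graphPt G y j = y j := by
  simp [graphPt, hj]

lemma graphPt_eq_self (h : G y = 2 * (y 0).re) : graphPt G y = y := by simp [graphPt, h]

/-- A real equation `2 Re y₀ = E y` with `dE = 0` at the origin can be solved for `Re y₀`. -/
lemma exists_graph (hV : IsOpen V) (h0 : (0 : Cn n) ∈ V) (hE : ContDiffOn ℝ ∞ E V) (hE0 : E 0 = 0)
    (hE1 : fderiv ℝ E 0 = 0) : ∃ (W : Set (Cn n)) (G : Cn n → ℝ), W ⊆ V ∧ IsOpen W ∧ 0 ∈ W ∧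
    ContDiffOn ℝ ∞ G W ∧ (∀ y y' : Cn n, (y 0).im = (y' 0).im → (∀ j, j ≠ 0 → y j = y' j) → G y = G
    y') ∧ (∀ y ∈ W, graphPt G y ∈ V ∧ G y = E (graphPt G y)) ∧ ∀ y ∈ W,
    (E y = 2 * (y 0).re ↔ G y = 2 * (y 0).re) := by
  set F : Cn n → Cn n := fun y => y - (2⁻¹ * E y) • (single 0 1 : Cn n)
  have hFc : ∀ x ∈ V, SmoothAt F x := fun x hx => contDiffAt_id.sub
    ((contDiffAt_const.mul (hE.contDiffAt (hV.mem_nhds hx))).smul contDiffAt_const)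
  have hF0 : HasFDerivAt F (.id ℝ (Cn n)) 0 := by
    have h1 := ((hE.contDiffAt (hV.mem_nhds h0)).differentiableAt (by simp)).hasFDerivAt
    rw [hE1] at h1
    simpa [F] using (hasFDerivAt_id (𝕜 := ℝ) (0 : Cn n)).sub
      ((h1.const_mul 2⁻¹).smul_const (single 0 1 : Cn n))
  have hFs : HasStrictFDerivAt F
      ((ContinuousLinearEquiv.refl ℝ (Cn n) : Cn n ≃L[ℝ] Cn n) : Cn n →L[ℝ] Cn n) 0 :=
    (hFc 0 h0).hasStrictFDerivAt' hF0 (by simp)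
  have hopen : IsOpen (V ∩ fderiv ℝ F ⁻¹'
      Set.range ((↑) : (Cn n ≃L[ℝ] Cn n) → Cn n →L[ℝ] Cn n)) := by
    have hc : ContinuousOn (fderiv ℝ F) V := fun x hx =>
      (((hFc x hx).fderiv_right (m := ∞) (by simp)).continuousAt).continuousWithinAt
    exact hc.isOpen_inter_preimage hV ContinuousLinearEquiv.isOpen
  set e := (hFs.toOpenPartialHomeomorph F).restrOpen _ hopen with he
  have hcoe : ∀ x, e x = F x := fun x => rfl
  have hsrc : ∀ x ∈ e.source, x ∈ V ∧
      x ∈ fderiv ℝ F ⁻¹' Set.range ((↑) : (Cn n ≃L[ℝ] Cn n) → Cn n →L[ℝ] Cn n) :=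
    fun x hx => hx.2
  have h0s : (0 : Cn n) ∈ e.source := ⟨hFs.mem_toOpenPartialHomeomorph_source, h0,
    ⟨ContinuousLinearEquiv.refl ℝ (Cn n), hF0.fderiv.symm⟩⟩
  have hsm : ∀ z ∈ e.target, SmoothAt e.symm z := fun z hz => by
    have h1 := hsrc _ (e.map_target hz)
    obtain ⟨i, hi⟩ := h1.2
    refine e.contDiffAt_symm (f₀' := i) hz ?_ (hFc _ h1.1)
    rw [hi]
    exact ((hFc _ h1.1).differentiableAt (by simp)).hasFDerivAt
  set P : Cn n → Cn n := fun y => y - (y 0).re • (single 0 1 : Cn n)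
  have hPc : ContDiff ℝ ∞ P := contDiff_id.sub
    ((reCLM.contDiff.comp (contDiff_apply ℝ ℂ (0 : Fin n))).smul contDiff_const)
  have hPj : ∀ y (j : Fin n), j ≠ 0 → P y j = y j := fun y j hj => by simp [P, hj]
  set G : Cn n → ℝ := fun y => 2 * (e.symm (P y) 0).re
  have hF0v : F 0 = 0 := by simp [F, hE0]
  -- the inverse of `F` moves points only in the direction of `Re y₀`
  have hkey : ∀ y, P y ∈ e.target → e.symm (P y) = graphPt G y ∧ G y = E (graphPt G y) := by
    intro y hy
    set x := e.symm (P y) with hx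
    have h1 : F x = P y := e.right_inv hy
    have h3 := congrFun h1 0
    have h4 : (x 0).re = 2⁻¹ * E x := by simpa [F, P, sub_eq_zero] using congrArg Complex.re h3
    have h5 : (x 0).im = (y 0).im := by simpa [F, P] using congrArg Complex.im h3
    have h6 : x = graphPt G y := by
      funext j
      by_cases hj : j = 0
      · rw [hj, graphPt_zero]
        apply Complex.ext <;> simp [G, ← hx, h5]
      · rw [graphPt_of_ne G y hj, ← hPj y j hj, ← h1]
        simp [F, hj]
    exact ⟨h6, by rw [← h6]; simp [G, ← hx, h4]⟩
  have hWo : IsOpen (e.source ∩ P ⁻¹' e.target) :=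
    e.open_source.inter (e.open_target.preimage hPc.continuous)
  have h0t : P 0 ∈ e.target := by
    rw [show P 0 = F 0 by simp [P, hF0v]]
    exact e.map_source h0s
  refine ⟨e.source ∩ P ⁻¹' e.target, G, fun x hx => (hsrc x hx.1).1, hWo, ⟨h0s, h0t⟩, ?_, ?_, ?_,
    ?_⟩
  · intro y hy
    refine ContDiffAt.contDiffWithinAt ?_
    have h1 : SmoothAt (fun y => e.symm (P y)) y := (hsm _ hy.2).comp y hPc.contDiffAt
    have h2 : SmoothAt (fun y => (e.symm (P y) 0).re) y :=
      reCLM.contDiff.contDiffAt.comp y (contDiffAt_apply h1 0)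
    exact contDiffAt_const.mul h2
  · intro y y' h1 h2
    have : P y = P y' := by
      funext j
      by_cases hj : j = 0
      · apply Complex.ext <;> simp [P, hj, h1]
      · rw [hPj y j hj, hPj y' j hj, h2 j hj]
    simp only [G, this]
  · intro y hy
    obtain ⟨h1, h2⟩ := hkey y hy.2
    exact ⟨h1 ▸ (hsrc _ (e.map_target hy.2)).1, h2⟩
  · intro y hy
    obtain ⟨h1, h2⟩ := hkey y hy.2
    constructor
    · intro h3
      have h4 : F y = P y := by simp [F, P, h3]
      have h5 : e.symm (P y) = y := h4 ▸ e.left_inv hy.1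
      simp only [G, h5]
    · intro h3
      rw [graphPt_eq_self h3] at h2
      rw [← h2, h3]

end graph

section graphJets

variable [NeZero n] {E : Cn n → ℝ}

lemma graphPt_origin (hG : G 0 = 0) : graphPt G 0 = 0 := by simp [graphPt, hG]

lemma contDiffAt_graphPt (hG : SmoothAt G y) : SmoothAt (graphPt G) y := by
  have h1 : SmoothAt (toC fun y : Cn n => G y / 2 - (y 0).re) y :=
    contDiffAt_toC ((hG.div_const 2).sub
      (reCLM.contDiff.contDiffAt.comp y (contDiff_apply ℝ ℂ (0 : Fin n)).contDiffAt))
  exact contDiffAt_id.add (h1.smul contDiffAt_const)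

lemma smoothNear_comp_graphPt (hGr : ∀ᶠ y in 𝓝 0, SmoothAt G y) (hG0 : G 0 = 0)
    (hf : SmoothNear f 0) : SmoothNear (fun y => f (graphPt G y)) 0 := by
  have h1 : ContinuousAt (graphPt G) 0 := (contDiffAt_graphPt hGr.self_of_nhds).continuousAt
  have h2 : ∀ᶠ y in 𝓝 (0 : Cn n), SmoothAt f (graphPt G y) := by
    refine h1.eventually ?_
    rwa [graphPt_origin hG0]
  filter_upwards [h2, hGr] with y h3 h4
  exact h3.comp y (contDiffAt_graphPt h4)

lemma cderiv_comp_graphPt (hG : SmoothAt G y) (hf : DifferentiableAt ℝ f (graphPt G y))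
    (X : CVec n) : cderiv (fun y => f (graphPt G y)) y X = cderiv f (graphPt G y) X + cderiv
    (fun y => ((G y / 2 - (y 0).re : ℝ) : ℂ)) y X * cderiv f (graphPt G y)
    (ofRealV (single 0 1)) := by
  set r : Cn n → ℝ := fun y => G y / 2 - (y 0).re with hr
  have hrd : DifferentiableAt ℝ r y := (by simpa only [div_eq_mul_inv] using
      (hG.differentiableAt (by simp)).mul_const (2⁻¹ : ℝ) : DifferentiableAt ℝ _ y).sub
      (reCLM.differentiableAt.comp y (differentiableAt_apply (𝕜 := ℝ) (0 : Fin n) y))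
  have hd : ∀ v, fderiv ℝ (graphPt G) y v = v + ((fderiv ℝ r y v : ℝ) : ℂ) • single 0 1 := by
    intro v
    have h1 : HasFDerivAt (fun y => ((r y : ℝ) : ℂ)) (ofRealCLM.comp (fderiv ℝ r y)) y :=
      ofRealCLM.hasFDerivAt.comp y hrd.hasFDerivAt
    have h2 : HasFDerivAt (graphPt G) _ y :=
      (hasFDerivAt_id (𝕜 := ℝ) y).add (h1.smul_const (single 0 1 : Cn n))
    rw [h2.fderiv]
    rfl
  have hv : ∀ v, fderiv ℝ (fun y => f (graphPt G y)) y v = fderiv ℝ f (graphPt G y) v +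
      ((fderiv ℝ r y v : ℝ) : ℂ) * fderiv ℝ f (graphPt G y) (single 0 1) := by
    intro v
    have h1 := fderiv_comp (𝕜 := ℝ) y hf (contDiffAt_graphPt hG).diffAt
    have h2 : fderiv ℝ (fun y => f (graphPt G y)) y v =
        fderiv ℝ f (graphPt G y) (fderiv ℝ (graphPt G) y v) :=
      congrArg (fun D : Cn n →L[ℝ] ℂ => D v) h1
    rw [h2, hd, map_add, coe_smul, map_smul, Complex.real_smul]
  have hrt : ∀ v, fderiv ℝ (fun y : Cn n => ((G y / 2 - (y 0).re : ℝ) : ℂ)) y v =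
      ((fderiv ℝ r y v : ℝ) : ℂ) := fun v => fderiv_toC hrd v
  rw [cderiv_ofRealV]
  simp only [cderiv, hv, hrt, smul_eq_mul]
  ring

lemma pd_comp_graphPt (hG : SmoothAt G y) (hf : DifferentiableAt ℝ f (graphPt G y))
    (hs : varIndex s ≠ 0) : pd s (fun y => f (graphPt G y)) y = pd s f (graphPt G y) + 1 / 2 *
    cderiv f (graphPt G y) (ofRealV (single 0 1)) * pd s (toC G) y := by
  rw [pd, cderiv_comp_graphPt hG hf]
  have e1 : (fun y : Cn n => ((G y / 2 - (y 0).re : ℝ) : ℂ)) =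
      fun y => 1 / 2 * toC G y - 1 / 2 * (y 0 + star (y 0)) := by
    funext y
    rw [star_def, add_conj]
    push_cast
    simp only [toC]
    ring
  have hd := (contDiffAt_toC hG).diffAt
  have hd0 : DifferentiableAt ℝ (fun y : Cn n => y 0) y := differentiableAt_apply (0 : Fin n) y
  have hB : DifferentiableAt ℝ (fun y : Cn n => y 0 + star (y 0)) y := hd0.add hd0.star
  have e2 : (coordV s : CVec n).1 0 + (coordV s : CVec n).2 0 = 0 := by
    rcases s with j | j <;> simp [coordV, Ne.symm (show j ≠ 0 from hs)]
  rw [e1, cderiv_fun_sub (hd.const_mul _) (hB.const_mul _), cderiv_const_mul _ hd,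
    cderiv_const_mul _ hB, cderiv_add_star, e2]
  ring

lemma Flat.comp_graphPt (hGr : ∀ᶠ y in 𝓝 0, SmoothAt G y) (hG0 : G 0 = 0)
    (hA : ∀ s ∈ A, varIndex s ≠ 0) :
    ∀ {k : ℕ} {f : Cn n → ℂ}, Flat A k (toC G) 0 → SmoothNear f 0 → Flat A k f 0 →
      Flat A k (fun y => f (graphPt G y)) 0
  | 0, f, _, _, hf => by
    simp only [Flat] at hf ⊢
    rw [graphPt_origin hG0, hf]
  | k + 1, f, hG, sf, hf => by
    refine ⟨by change f _ = 0; rw [graphPt_origin hG0, hf.1], fun s hs => ?_⟩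
    have sG : SmoothNear (toC G) 0 := hGr.mono fun _ h => contDiffAt_toC h
    have sD : SmoothNear (fun y => cderiv f (graphPt G y) (ofRealV (single 0 1))) 0 :=
      smoothNear_comp_graphPt (f := fun y => cderiv f y (ofRealV (single 0 1))) hGr hG0
        (sf.mono fun _ h => contDiffAt_cderiv_const _ h)
    have sD' := (SmoothNear.const (n := n) (1 / 2) 0).mul sD
    have h1 := Flat.comp_graphPt hGr hG0 hA (hG.mono subset_rfl k.le_succ) (sf.pd s) (hf.2 s hs)
    refine (h1.add ((hG.2 s hs).mul_left (sG.pd s) sD')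
      (smoothNear_comp_graphPt hGr hG0 (sf.pd s)) (sD'.mul (sG.pd s))).congr ?_
    have h2 : ∀ᶠ y in 𝓝 (0 : Cn n), DifferentiableAt ℝ f (graphPt G y) := by
      refine (contDiffAt_graphPt hGr.self_of_nhds).continuousAt.eventually ?_
      rw [graphPt_origin hG0]
      exact sf.diff
    filter_upwards [h2, hGr] with y h3 h4
    exact (pd_comp_graphPt h4 h3 (hA s hs)).symm

/-- Along the coordinates other than the first, the derivative of the solution `G` of
`2 Re y₀ = E y` is a smooth multiple of that of `E`, the factor being `1` at the origin. -/
lemma exists_pd_graph (hGr : ∀ᶠ y in 𝓝 0, SmoothAt G y) (hG0 : G 0 = 0) (sE : SmoothNear (toC E) 0)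
    (hE1 : fderiv ℝ E 0 = 0) (hGE : ∀ᶠ y in 𝓝 0, G y = E (graphPt G y)) : ∃ u : Cn n → ℂ, SmoothNear
    u 0 ∧ u 0 = 1 ∧ ∀ s, varIndex s ≠ 0 → pd s (toC G) =ᶠ[𝓝 0] fun y => u y * pd s (toC E)
    (graphPt G y) := by
  set D : Cn n → ℂ := fun y => cderiv (toC E) (graphPt G y) (ofRealV (single 0 1)) with hD
  have sD : SmoothNear D 0 :=
    smoothNear_comp_graphPt (f := fun y => cderiv (toC E) y (ofRealV (single 0 1))) hGr hG0
      (sE.mono fun _ h => contDiffAt_cderiv_const _ h)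
  have hEd : DifferentiableAt ℝ E 0 := by
    have h1 := (contDiffAt_re sE.at).differentiableAt (by simp)
    simpa [toC] using h1
  have hD0 : D 0 = 0 := by
    simp only [hD]
    rw [graphPt_origin hG0, cderiv_ofRealV, fderiv_toC hEd, hE1]
    simp
  set d : Cn n → ℂ := fun y => 1 - 1 / 2 * D y with hd
  have sd : SmoothNear d 0 := (SmoothNear.const 1 0).sub ((SmoothNear.const (1 / 2) 0).mul sD)
  have hd0 : d 0 = 1 := by simp [hd, hD0]
  have hdne : ∀ᶠ y in 𝓝 (0 : Cn n), d y ≠ 0 :=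
    sd.at.continuousAt.eventually_ne (by rw [hd0]; exact one_ne_zero)
  refine ⟨fun y => 1 / d y, ?_, by simp [hd0], fun s hs => ?_⟩
  · filter_upwards [sd, hdne] with y h1 h2 using contDiffAt_divC contDiffAt_const h1 h2
  · have h2 : ∀ᶠ y in 𝓝 (0 : Cn n), DifferentiableAt ℝ (toC E) (graphPt G y) := by
      refine (contDiffAt_graphPt hGr.self_of_nhds).continuousAt.eventually ?_
      rw [graphPt_origin hG0]
      exact sE.diff
    have e1 : toC G =ᶠ[𝓝 0] fun y => toC E (graphPt G y) :=
      hGE.mono fun y hy => congrArg Complex.ofReal hy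
    filter_upwards [pd_congr e1 s, h2, hGr, hdne] with y h3 h4 h5 h6
    rw [pd_comp_graphPt h5 h4 hs] at h3
    have h7 : d y * pd s (toC G) y = pd s (toC E) (graphPt G y) := by
      simp only [hd, hD]
      linear_combination h3
    rw [← h7]
    field_simp

lemma flat_graph (hGr : ∀ᶠ y in 𝓝 0, SmoothAt G y) (hG0 : G 0 = 0)
    (sE : SmoothNear (toC E) 0) (hE1 : fderiv ℝ E 0 = 0)
    (hGE : ∀ᶠ y in 𝓝 0, G y = E (graphPt G y)) (hA : ∀ s ∈ A, varIndex s ≠ 0) :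
    ∀ {k : ℕ}, Flat A k (toC E) 0 → Flat A k (toC G) 0
  | 0, _ => by simp [Flat, toC, hG0]
  | k + 1, h => by
    have hk := flat_graph hGr hG0 sE hE1 hGE hA (h.mono subset_rfl k.le_succ)
    obtain ⟨u, su, -, hu⟩ := exists_pd_graph hGr hG0 sE hE1 hGE
    refine ⟨by simp [toC, hG0], fun s hs => ?_⟩
    exact ((Flat.comp_graphPt hGr hG0 hA hk (sE.pd s) (h.2 s hs)).mul_left
      (smoothNear_comp_graphPt hGr hG0 (sE.pd s)) su).congr (hu s (hA s hs)).symm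

end graphJets

/-! ### Graph charts -/

section graphChart

variable [NeZero n]

/-- The variables `z_j`, `z̄_j` other than `w`, `w̄`. -/
def zVars (n : ℕ) [NeZero n] : Finset (Idx n) := univ.filter fun s => varIndex s ≠ 0

/-- The variables `z_j`, `z̄_j` with `j > q`, which are those of the Levi kernel. -/
def kerVars (n q : ℕ) : Finset (Idx n) := univ.filter fun s => q < (varIndex s : ℕ)

lemma mem_zVars : s ∈ zVars n ↔ varIndex s ≠ 0 := by simp [zVars]

lemma mem_kerVars : s ∈ kerVars n q ↔ q < (varIndex s : ℕ) := by simp [kerVars]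

lemma ne_zero_of_lt {j : Fin n} (h : q < (j : ℕ)) : j ≠ 0 := by
  rintro rfl
  simp at h

lemma kerVars_subset_zVars : kerVars n q ⊆ zVars n := fun _ hs =>
  mem_zVars.2 (ne_zero_of_lt (mem_kerVars.1 hs))

lemma varIndex_swap (s : Idx n) : varIndex s.swap = varIndex s := by
  cases s <;> rfl

/-- The image of `M` in the chart `Φ`. -/
def chartImage (M : Set (Cn n)) (Φ : OpenPartialHomeomorph (Cn n) (Cn n)) : Set (Cn n) :=
  Φ.symm ⁻¹' M ∩ Φ.target

/-- The defining function `G - 2 Re w` of the graph `2 Re w = G`. -/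
def graphFn (G : Cn n → ℝ) (y : Cn n) : ℝ := G y - 2 * (y 0).re

/-- `Φ` is a holomorphic chart at `p` in which `M` is the graph `2 Re w = G(z, Im w)` and in which
`G` has, to the order that its quartic part can be seen, no holomorphic terms. -/
structure IsGraphChart (M : Set (Cn n)) (p : Cn n) (q : ℕ)
    (Φ : OpenPartialHomeomorph (Cn n) (Cn n)) (G : Cn n → ℝ) : Prop where
  isBiholomorphic : IsBiholomorphic Φ
  mem_source : p ∈ Φ.source
  map_eq : Φ p = 0
  contDiffOn : ContDiffOn ℝ ∞ G Φ.target
  indep : ∀ y y' : Cn n, (y 0).im = (y' 0).im → (∀ j, j ≠ 0 → y j = y' j) → G y = G y'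
  mem_iff : ∀ y ∈ Φ.target, Φ.symm y ∈ M ↔ 2 * (y 0).re = G y
  map_zero : G 0 = 0
  pd_eq_zero : ∀ s, pd s (toC G) 0 = 0
  flat : Flat (holVars n ∩ zVars n) 3 (toC G) 0
  flat_pd : ∀ j : Fin n, j ≠ 0 → (j : ℕ) ≤ q →
    Flat (holVars n ∩ kerVars n q) 2 (pd (inr j) (toC G)) 0
  pd_pd : ∀ j : Fin n, j ≠ 0 → (j : ℕ) ≤ q → ∀ a : Fin n, a ≠ 0 →
    pd (inl a) (pd (inr j) (toC G)) 0 = if a = j then 1 else 0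
  kernel : ∀ j : Fin n, q < (j : ℕ) → pushV Φ.symm 0 (coordV (inl j)) ∈ K10 M p
  hypersurface : IsRealHypersurface M

lemma pd_inr_of_real {E : Cn n → ℝ} (sE : SmoothNear (toC E) p) (j : Fin n) : pd (inr j) (toC E) p =
    star (pd (inl j) (toC E) p) := by
  have h := (pd_conj sE (inr j)).self_of_nhds
  have e : (fun x => star (toC E x)) = toC E := by
    funext x
    simp [toC]
  rw [e] at h
  exact h

/-- Solving the equation of `M` for `Re w` in the coordinates of `exists_chart` keeps the vanishing
of holomorphic terms. -/
lemma exists_isGraphChart (hM : IsRealHypersurface M) (h : IsDefiningFunction M U ρ)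
    (hpsd : LevPsd M U ρ) (hp : p ∈ M ∩ U) (hq : leviRank M p = q) : ∃ Φ G, IsGraphChart M p q Φ G ∧
    Φ.source ⊆ U ∧ (∀ j, dz ρ p (fderiv ℂ Φ.symm 0 (single j 1)) = if j = 0 then -1 else 0) := by
  obtain ⟨Φ₀, hbi, hps, hsU, hΦp, hdz, hfl, hfl2, hker⟩ := exists_chart h hpsd hp hq
  set E : Cn n → ℝ := fun y => ρ (Φ₀.symm y) + 2 * (y 0).re with hE
  have hEC : toC E = fun y => toC ρ (Φ₀.symm y) + (y 0 + star (y 0)) := by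
    funext y
    simp only [toC, hE]
    rw [star_def, add_conj]
    push_cast
    ring
  have h0t : (0 : Cn n) ∈ Φ₀.target := hΦp ▸ Φ₀.map_source hps
  have hs0 : Φ₀.symm 0 = p := by rw [← hΦp, Φ₀.left_inv hps]
  rw [← hEC] at hfl hfl2
  have hsymm : ∀ y ∈ Φ₀.target, SmoothAt Φ₀.symm y := fun y hy => hbi.symm.contDiffAt hy
  have hEc : ∀ y ∈ Φ₀.target, SmoothAt E y := fun y hy => by
    have h1 : SmoothAt (fun y => ρ (Φ₀.symm y)) y :=
      (h.contDiffAt (hsU (Φ₀.map_target hy))).comp y (hsymm y hy)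
    exact h1.add (contDiffAt_const.mul (reCLM.contDiff.contDiffAt.comp y
      (contDiff_apply ℝ ℂ (0 : Fin n)).contDiffAt))
  have sE : SmoothNear (toC E) 0 := smoothNear_of_forall Φ₀.open_target h0t fun y hy =>
    contDiffAt_toC (hEc y hy)
  have hE0 : E 0 = 0 := by
    have := hfl.zero_apply
    exact ofReal_eq_zero.1 this
  have hpd : ∀ s, pd s (toC E) 0 = 0 := by
    have h1 : ∀ j, pd (inl j) (toC E) 0 = 0 := fun j => (hfl.2 _ (inl_mem_holVars j)).zero_apply
    rintro (j | j)
    · exact h1 j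
    · rw [pd_inr_of_real sE, h1, star_zero]
  have hcd : ∀ X, cderiv (toC E) 0 X = 0 := fun X => by
    rw [cderiv_eq_sum]
    exact sum_eq_zero fun s _ => by rw [show cderiv (toC E) 0 (coordV s) = 0 from hpd s, smul_zero]
  have hEd := (hEc 0 h0t).differentiableAt (by simp)
  have hE1 : fderiv ℝ E 0 = 0 := by
    ext v
    have := hcd (ofRealV v)
    rw [cderiv_ofRealV, fderiv_toC hEd] at this
    simpa using this
  obtain ⟨W, G, hWV, hW, h0W, hGc, hind, hgr, hiff⟩ := exists_graph Φ₀.open_target h0t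
    (fun y hy => (hEc y hy).contDiffWithinAt) hE0 hE1
  set Φ := (Φ₀.symm.restrOpen W hW).symm with hΦ
  have hsrc : Φ.source ⊆ Φ₀.source := fun x hx => hx.1
  have hG0 : G 0 = 0 := by
    have := (hiff 0 h0W).1 (by simp [hE0])
    simpa using this
  have hGr : ∀ᶠ y in 𝓝 (0 : Cn n), SmoothAt G y :=
    (hW.eventually_mem h0W).mono fun y hy => hGc.contDiffAt (hW.mem_nhds hy)
  have hGE : ∀ᶠ y in 𝓝 (0 : Cn n), G y = E (graphPt G y) :=
    (hW.eventually_mem h0W).mono fun y hy => (hgr y hy).2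
  have hz : ∀ s ∈ holVars n ∩ zVars n, varIndex s ≠ 0 := fun s hs => mem_zVars.1 (mem_inter.1 hs).2
  have hk : ∀ s ∈ holVars n ∩ kerVars n q, varIndex s ≠ 0 := fun s hs =>
    mem_zVars.1 (kerVars_subset_zVars (mem_inter.1 hs).2)
  have hGfl := flat_graph hGr hG0 sE hE1 hGE hz (hfl.mono Finset.inter_subset_left le_rfl)
  obtain ⟨u, su, hu0, hu⟩ := exists_pd_graph hGr hG0 sE hE1 hGE
  have hyd : ∀ (j a : Fin n) (y : Cn n), pd (inl a) (fun y : Cn n => y j) y =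
      if a = j then 1 else 0 := fun j a y => by
    rw [pd, cderiv_apply_coord]
    simp [coordV, single_apply, eq_comm]
  have hys : ∀ j : Fin n, SmoothNear (fun y : Cn n => y j) 0 := fun j =>
    Filter.Eventually.of_forall fun y => (contDiff_apply ℝ ℂ j).contDiffAt
  have hcG : ∀ s, pd s (toC G) 0 = 0 := fun s => by
    have e1 : toC G =ᶠ[𝓝 0] fun y => toC E (graphPt G y) :=
      hGE.mono fun y hy => congrArg Complex.ofReal hy
    rw [(pd_congr e1 s).self_of_nhds, pd, cderiv_comp_graphPt hGr.self_of_nhds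
      (by rw [graphPt_origin hG0]; exact sE.at.diffAt), graphPt_origin hG0, hcd, hcd,
      mul_zero, add_zero]
  refine ⟨Φ, G, ⟨⟨fun x hx => hbi.1 x (hsrc hx), fun y hy => hbi.2 y hy.1⟩, ⟨hps, ?_⟩, hΦp,
    hGc.mono fun y hy => hy.2, hind, ?_, hG0, hcG, hGfl, ?_, ?_, hker, hM⟩, fun x hx =>
      hsU (hsrc hx), hdz⟩
  · change Φ₀ p ∈ W
    rw [hΦp]; exact h0W
  · intro y hy
    rw [eq_comm, ← hiff y hy.2]
    refine (h.2.2.2 _ (hsU (Φ₀.map_target hy.1))).trans ?_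
    simp only [hE]
    constructor <;> intro h1 <;> linarith
  · intro j h0 hj
    have h1 : Flat (holVars n ∩ kerVars n q) 2 (fun y : Cn n => y j) 0 := by
      refine ⟨rfl, fun s hs => ?_⟩
      obtain ⟨a, rfl⟩ := mem_holVars.1 (mem_inter.1 hs).1
      have ha : a ≠ j := by
        rintro rfl
        exact absurd (mem_kerVars.1 (mem_inter.1 hs).2) (not_lt.2 hj)
      have : pd (inl a) (fun y : Cn n => y j) = fun _ => 0 := by
        funext y
        rw [hyd, if_neg ha]
      rw [this]
      exact Flat.zero _ _ _
    have h2 := (h1.add ((hfl2 j h0 hj).mono Finset.inter_subset_left le_rfl) (hys j)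
      ((sE.pd _).sub (hys j))).congr (g := pd (inr j) (toC E))
      (Filter.Eventually.of_forall fun y => by ring)
    have hsub : holVars n ∩ kerVars n q ⊆ holVars n ∩ zVars n :=
      Finset.inter_subset_inter_left kerVars_subset_zVars
    exact ((Flat.comp_graphPt hGr hG0 hk (hGfl.mono hsub (by norm_num)) (sE.pd _) h2).mul_left
      (smoothNear_comp_graphPt hGr hG0 (sE.pd _)) su).congr (hu (inr j) h0).symm
  · intro j h0 hj a ha
    have sP := smoothNear_comp_graphPt hGr hG0 (sE.pd (inr j))
    rw [(pd_congr (hu (inr j) h0) (inl a)).self_of_nhds, pd, cderiv_fun_mul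
      su.at.diffAt sP.at.diffAt, hu0, graphPt_origin hG0, hpd, mul_zero, add_zero, one_mul]
    have h1 := pd_comp_graphPt (f := pd (inr j) (toC E)) (y := 0) hGr.self_of_nhds
      (by rw [graphPt_origin hG0]; exact (sE.pd _).at.diffAt) (s := inl a) ha
    rw [pd, graphPt_origin hG0, hcG, mul_zero, add_zero] at h1
    rw [h1]
    have h2 := ((hfl2 j h0 hj).2 _ (inl_mem_holVars a)).zero_apply
    have h3 : pd (inl a) (fun y => pd (inr j) (toC E) y - y j) 0 =
        pd (inl a) (pd (inr j) (toC E)) 0 - if a = j then 1 else 0 := by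
      rw [← hyd j a 0]
      exact cderiv_fun_sub (sE.pd _).at.diffAt (hys j).at.diffAt _
    rw [h3, sub_eq_zero] at h2
    exact h2

end graphChart

/-! ### The Levi form in a graph chart -/

section graphChartLevi

variable [NeZero n]

lemma single_apply_zero {j : Fin n} (hj : j ≠ 0) : (single j (1 : ℂ) : Cn n) 0 = 0 :=
  single_eq_of_ne (fun h : (0 : Fin n) = j => hj h.symm) _

namespace IsGraphChart

variable (h : IsGraphChart M p q Φ G)
include h

lemma zero_target : (0 : Cn n) ∈ Φ.target :=
  h.map_eq ▸ Φ.map_source h.mem_source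

lemma symm_zero : Φ.symm 0 = p := by
  rw [← h.map_eq, Φ.left_inv h.mem_source]

lemma contDiffAt (hy : y ∈ Φ.target) : SmoothAt G y := h.contDiffOn.contDiffAt
    (Φ.open_target.mem_nhds hy)

lemma smoothNear : SmoothNear (toC G) 0 :=
  smoothNear_of_forall Φ.open_target h.zero_target fun _ hy => contDiffAt_toC (h.contDiffAt hy)

lemma isCRMap : IsCRMap M (chartImage M Φ) Φ := by
  refine ⟨h.isBiholomorphic, fun x hx => ?_⟩
  constructor
  · intro hm
    have := hm.1
    rwa [Set.mem_preimage, Φ.left_inv hx] at this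
  · intro hm
    refine ⟨?_, Φ.map_source hx⟩
    rwa [Set.mem_preimage, Φ.left_inv hx]

omit h

lemma contDiff_re : ContDiff ℝ ∞ fun y : Cn n => 2 * (y 0).re :=
  contDiff_const.mul (reCLM.contDiff.comp (contDiff_apply ℝ ℂ (0 : Fin n)))

include h

lemma contDiffAt_graphFn (hy : y ∈ Φ.target) : SmoothAt (graphFn G) y :=
    (h.contDiffAt hy).sub contDiff_re.contDiffAt

lemma isDefiningFunction : IsDefiningFunction (chartImage M Φ) Φ.target (graphFn G) := by
  refine ⟨Φ.open_target, fun y hy => (h.contDiffAt_graphFn hy).contDiffWithinAt, fun y hy h0 => ?_,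
    fun y hy => ?_⟩
  · -- the derivative in the direction of `Re w` is `-2`
    have h1 : HasFDerivAt (graphFn G) (0 : Cn n →L[ℝ] ℝ) y :=
      h0 ▸ ((h.contDiffAt_graphFn hy).differentiableAt (by simp)).hasFDerivAt
    have h2 : HasDerivAt (fun t : ℝ => y + t • (single 0 1 : Cn n)) (single 0 1) 0 := by
      simpa using ((hasDerivAt_id (0 : ℝ)).smul_const (single 0 1 : Cn n)).const_add y
    have h3 : HasDerivAt (fun t : ℝ => graphFn G (y + t • (single 0 1 : Cn n))) 0 0 := by
      have h4 : HasFDerivAt (graphFn G) (0 : Cn n →L[ℝ] ℝ) (y + (0 : ℝ) • (single 0 1 : Cn n)) := by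
        rwa [zero_smul, add_zero]
      exact h4.comp_hasDerivAt (0 : ℝ) h2
    have e : (fun t : ℝ => graphFn G (y + t • (single 0 1 : Cn n))) =
        fun t => graphFn G y - 2 * t := by
      funext t
      have hG : G (y + t • (single 0 1 : Cn n)) = G y :=
        h.indep _ _ (by simp) fun j hj => by simp [hj]
      simp only [graphFn, hG]
      simp
      ring
    rw [e] at h3
    have h5 : HasDerivAt (fun t : ℝ => graphFn G y - 2 * t) (-2) 0 := by
      simpa using ((hasDerivAt_id (0 : ℝ)).const_mul 2).const_sub (graphFn G y)
    have := h3.unique h5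
    norm_num at this
  · rw [chartImage, Set.mem_inter_iff, Set.mem_preimage, h.mem_iff y hy, graphFn, sub_eq_zero,
      eq_comm]
    exact ⟨fun h1 => h1.1, fun h1 => ⟨h1, hy⟩⟩

lemma isRealHypersurface : IsRealHypersurface (chartImage M Φ) :=
  fun _ hy => ⟨Φ.target, graphFn G, hy.2, h.isDefiningFunction⟩

lemma zero_mem : (0 : Cn n) ∈ chartImage M Φ ∩ Φ.target :=
  ⟨(h.isDefiningFunction.2.2.2 _ h.zero_target).2 (by simp [graphFn, h.map_zero]), h.zero_target⟩

lemma pd_graphFn (hy : y ∈ Φ.target) (s : Idx n) : pd s (toC (graphFn G)) y = pd s (toC G) y - if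
    varIndex s = 0 then 1 else 0 := by
  have e : toC (graphFn G) = fun y => toC G y - (y 0 + star (y 0)) := by
    funext y
    simp only [toC, graphFn]
    rw [star_def, add_conj]
    push_cast
    ring
  have hd : DifferentiableAt ℝ (fun y : Cn n => y 0) y := differentiableAt_apply (0 : Fin n) y
  have hB : DifferentiableAt ℝ (fun y : Cn n => y 0 + star (y 0)) y := hd.add hd.star
  rw [e, pd, cderiv_fun_sub (contDiffAt_toC (h.contDiffAt hy)).diffAt hB, cderiv_add_star]
  refine congrArg (cderiv (toC G) y (coordV s) - ·) ?_
  rcases s with j | j <;> by_cases hj : j = 0 <;> simp [coordV, varIndex, hj]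

lemma dzc_graphFn (j : Fin n) : dzc (graphFn G) j =ᶠ[𝓝 0] fun y => pd (inl j) (toC G) y - if j = 0
    then 1 else 0 :=
  (Φ.open_target.eventually_mem h.zero_target).mono fun _ hy => h.pd_graphFn hy (inl j)

lemma lvm_graphFn (j k : Fin n) : lvm (graphFn G) j k =ᶠ[𝓝 0] pd (inr k) (pd (inl j) (toC G)) := by
  refine (pd_congr (h.dzc_graphFn j) (inr k)).trans ?_
  filter_upwards [(h.smoothNear.pd (inl j)).diff] with y hy
  rw [pd, cderiv_fun_sub hy (differentiableAt_const _)]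
  have : cderiv (fun _ : Cn n => (if j = 0 then 1 else 0 : ℂ)) y (coordV (inr k)) = 0 := by
    simp [cderiv]
  rw [this, sub_zero]

lemma dzc_zero (j : Fin n) : dzc (graphFn G) j 0 = if j = 0 then -1 else 0 := by
  rw [(h.dzc_graphFn j).self_of_nhds]
  simp only [h.pd_eq_zero]
  split_ifs <;> simp

lemma dz_zero (a : Cn n) : dz (graphFn G) 0 a = -a 0 := by
  simp [dz, h.dzc_zero]

lemma gradN_zero : gradN (graphFn G) 0 = -single 0 1 := by
  funext j
  simp only [gradN, h.dzc_zero, Pi.neg_apply, single_apply]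
  split_ifs <;> simp

lemma nrm_zero : nrm (graphFn G) 0 = 1 := by
  simp [nrm, h.gradN_zero, h.dz_zero]

lemma mem_CT : X ∈ CT (chartImage M Φ) 0 ↔ X.1 0 + X.2 0 = 0 := by
  rw [mem_CT_iff h.isDefiningFunction h.zero_mem,
    cderiv_toC_eq (h.contDiffAt_graphFn h.zero_target), h.dz_zero, h.dz_zero]
  simp only [Pi.star_apply, star_neg, star_star, ← neg_add, neg_eq_zero]

lemma coordV_mem_CT (hs : s ∈ zVars n) : coordV s ∈ CT (chartImage M Φ) 0 := by
  rw [h.mem_CT]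
  have hs' := mem_zVars.1 hs
  cases s with
  | inl j => simpa [coordV] using single_apply_zero (j := j) hs'
  | inr j => simpa [coordV] using single_apply_zero (j := j) hs'

lemma mem : p ∈ M :=
  (h.isCRMap.2 p h.mem_source).1 (by rw [h.map_eq]; exact h.zero_mem.1)

lemma coordV_mem_K10 {j : Fin n} (hj : q < (j : ℕ)) : coordV (inl j) ∈ K10 (chartImage M Φ) 0 := by
  have h1 := pushV_mem_K10 h.isCRMap h.hypersurface h.isRealHypersurface h.mem_source h.mem
    (h.kernel j hj)
  have h2 := pushV_pushV_symm h.isBiholomorphic h.mem_source (coordV (inl j))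
  rw [h.map_eq] at h2
  rwa [h2, h.map_eq] at h1

lemma mem_K10 : X ∈ K10 (chartImage M Φ) 0 ↔ X.2 = 0 ∧ ∀ j : Fin n, (j : ℕ) ≤ q → X.1 j = 0 := by
  constructor
  · intro hX
    have h1 := (mem_H10_iff h.isDefiningFunction h.zero_mem).1 (K10_le_H10 _ _ hX)
    have hX0 : X.1 0 = 0 := by
      have := h1.1
      rwa [h.dz_zero, neg_eq_zero] at this
    refine ⟨h1.2, fun j hj => ?_⟩
    by_cases h0 : j = 0
    · rw [h0, hX0]
    · have h2 := ((mem_K10_iff h.isDefiningFunction h.zero_mem).1 hX).2 (single j 1) (by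
        rw [h.dz_zero, single_apply_zero h0, neg_zero])
      have h3 : lev (graphFn G) 0 X.1 (star (single j 1)) = X.1 j := by
        rw [← single_star, star_one, lev]
        have h4 : ∀ a, ∑ k, X.1 a * (single j 1 : Cn n) k * lvm (graphFn G) a k 0 =
            X.1 a * lvm (graphFn G) a j 0 := fun a => by
          rw [sum_eq_single j (fun k _ hk => by simp [hk]) (by simp)]
          simp
        simp only [h4]
        have h5 : ∀ a, X.1 a * lvm (graphFn G) a j 0 = if a = j then X.1 j else 0 := fun a => by
          by_cases ha : a = 0
          · rw [ha, hX0, zero_mul, if_neg fun h => h0 h.symm]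
          · rw [(h.lvm_graphFn a j).self_of_nhds,
              (pd_comm h.smoothNear (inr j) (inl a)).self_of_nhds, h.pd_pd j h0 hj a ha]
            split_ifs with haj
            · rw [haj, mul_one]
            · rw [mul_zero]
        simp [h5]
      rwa [h3] at h2
  · rintro ⟨h2, h1⟩
    have : X = ∑ j, X.1 j • coordV (inl j) := by
      conv_lhs => rw [← sum_coordOf X, sum_sum_type]
      have h3 : ∀ m, coordOf (inr m) X = 0 := fun m => congrFun h2 m
      simp only [h3, zero_smul, sum_const_zero, add_zero]
      rfl
    rw [this]
    refine sum_mem fun j _ => ?_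
    by_cases hj : q < (j : ℕ)
    · exact smul_mem _ _ (h.coordV_mem_K10 hj)
    · rw [h1 j (not_lt.1 hj), zero_smul]
      exact Submodule.zero_mem _

/-- The defining function of the graph is plurisubharmonic on complex tangent vectors: the contact
form of `M` goes over into a positive multiple of the contact form of the graph. -/
lemma exists_levPsd (hρ : IsDefiningFunction M U ρ) (hpsd : LevPsd M U ρ) (hU : Φ.source ⊆ U)
    (hdz : ∀ j, dz ρ p (fderiv ℂ Φ.symm 0 (single j 1)) = if j = 0 then -1 else 0) : ∃ V ⊆ Φ.target,
    IsOpen V ∧ 0 ∈ V ∧ LevPsd (chartImage M Φ) V (graphFn G) := by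
  have hcf := (isContactForm_cForm hρ).mono hU
  have hnn : LeviNonneg M Φ.source (cForm ρ) := by
    intro x hx U' L hU' hxU' hL
    have hx' : x ∈ M ∩ U := ⟨hx.1, hU hx.2⟩
    rw [I_mul_leviFn_conj hρ (hU'.inter hρ.1) hx' ⟨hxU', hx'.2⟩ (hL.mono inter_subset_left)
      ((isContactForm_cForm hρ).mono inter_subset_right), kap_cForm hρ hx'.2, ofReal_re]
    have : (I * -I).re = 1 := by simp
    rw [this, one_mul]
    exact hpsd x hx' _ ((mem_H10_iff hρ hx').1 (hL.2 x ⟨hx.1, hxU'⟩)).1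
  set θ := pushForm Φ (cForm ρ) with hθ
  have himg : Φ '' Φ.source = Φ.target := Φ.image_source_eq_target
  have hθc : IsContactForm (chartImage M Φ) Φ.target θ := by
    rw [← himg]
    exact isContactForm_pushForm h.isCRMap Φ.open_source subset_rfl hcf
  have hθn : LeviNonneg (chartImage M Φ) Φ.target θ := by
    rw [← himg]
    exact leviNonneg_push h.isCRMap subset_rfl hnn
  have hdef := h.isDefiningFunction
  have hk0 : kap θ (graphFn G) 0 = -I := by
    have hZ : ((single 0 1, -single 0 1) : CVec n) ∈ CT (chartImage M Φ) 0 := by rw [h.mem_CT]; simp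
    have h1 := contact_eq_kap hdef h.zero_mem (hθc.2 0 h.zero_mem).1 hZ
    rw [hθ, pushForm_apply, h.symm_zero, cForm_apply, h.dz_zero] at h1
    have h2 : dz ρ p (pushV Φ.symm 0 (single 0 1, -single 0 1)).1 = -1 := by
      have := hdz 0
      rwa [if_pos rfl] at this
    rw [h2] at h1
    simp only [single_eq_same, mul_neg, mul_one, neg_neg] at h1
    rw [hθ, h1, neg_neg]
  have hkc : ContinuousAt (fun y => (I * kap θ (graphFn G) y).re) 0 := by
    have h1 := (contDiffAt_kap hdef h.zero_target
      (hθc.contDiffAt Φ.open_target h.zero_target)).continuousAt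
    exact continuous_re.continuousAt.comp (continuousAt_const.mul h1)
  have hpos : ∀ᶠ y in 𝓝 (0 : Cn n), 0 < (I * kap θ (graphFn G) y).re :=
    hkc.eventually (lt_mem_nhds (by simp [hk0]))
  obtain ⟨V, hV, hVo, h0V⟩ := eventually_nhds_iff.1
    (hpos.and (Φ.open_target.eventually_mem h.zero_target))
  refine ⟨V, fun y hy => (hV y hy).2, hVo, h0V, fun y hy a ha => ?_⟩
  have hyt := (hV y hy.2).2
  have hy' : y ∈ chartImage M Φ ∩ Φ.target := ⟨hy.1, hyt⟩
  have hsec := isSection_projH hdef a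
  have h1 := hθn y hy' Φ.target (projH (graphFn G) a) Φ.open_target hyt hsec
  rw [I_mul_leviFn_conj hdef Φ.open_target hy' hyt hsec hθc, ofReal_re] at h1
  have h2 := nonneg_of_mul_nonneg_right h1 (hV y hy.2).1
  have h3 : (projH (graphFn G) a y).1 = a := by simp [projH, ha]
  rwa [h3] at h2

/-- The image of the chart may be made smaller. -/
lemma restr (hV : IsOpen V) (h0 : (0 : Cn n) ∈ V) : IsGraphChart M p q
    (Φ.symm.restrOpen V hV).symm G where
  __ := h
  isBiholomorphic := ⟨h.isBiholomorphic.1.mono fun _ hx => by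
    simp at hx; exact hx.1, h.isBiholomorphic.2.mono fun _ hx => hx.1⟩
  mem_source := by simpa [h.map_eq] using ⟨h.mem_source, h0⟩
  contDiffOn := h.contDiffOn.mono inter_subset_left
  mem_iff y hy := h.mem_iff y hy.1

end IsGraphChart

/-- A graph chart of a pseudoconvex hypersurface in which the Levi form is nonnegative. -/
structure IsPscChart (M : Set (Cn n)) (p : Cn n) (q : ℕ)
    (Φ : OpenPartialHomeomorph (Cn n) (Cn n)) (G : Cn n → ℝ) : Prop
    extends IsGraphChart M p q Φ G where
  levPsd : LevPsd (chartImage M Φ) Φ.target (graphFn G)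
  pseudoconvex : IsPseudoconvex M

lemma IsPscChart.isPseudoconvex (h : IsPscChart M p q Φ G) : IsPseudoconvex (chartImage M Φ) :=
  isPseudoconvex_push h.isCRMap h.pseudoconvex fun _ hy => hy.2

end graphChartLevi

/-! ### Third-order jets of graph charts and the quartic tensor -/

lemma D2_lev_eq_zero_of_vanishes (h : IsDefiningFunction M U ρ) (hp : p ∈ M ∩ U) (hW : IsOpen W)
    (hpW : p ∈ W) {X Z L : Cn n → CVec n} (hX : IsSection M (H10 M) W X)
    (hZ : IsSection M (H10 M) W Z) (hL : IsSection M (CT M) W L) (h0 : Z p = 0)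
    (hg : ∀ j : Fin n, lev ρ p (X p).1 (star (projH ρ (single j 1) p).1) = 0 ∧ ∀ u,
      u = L p ∨ u = v → cderiv (levF ρ X (projH ρ (single j 1))) p u = 0)
    (hv : v ∈ CT M p) : D2 (levF ρ X Z) L p v = 0 := by
  have hWU := hW.inter h.1
  have hP : ∀ j : Fin n, IsSection M (H10 M) (W ∩ U) (projH ρ (single j 1)) := fun j =>
    (isSection_projH h _).mono inter_subset_right
  have hX' := hX.mono (inter_subset_left (t := U))
  have hsZ : ∀ j, SmoothNear (fun y => star ((Z y).1 j)) p := fun j =>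
    (smoothNear_of_forall hW hpW fun y hy => contDiffAt_coordOf (hZ.contDiffAt hW hy) (inl j)).conj
  have hsl : ∀ j : Fin n, SmoothNear
      (levF ρ X (projH ρ (single j 1))) p := fun j =>
    smoothNear_lev h hp.2 hWU ⟨hpW, hp.2⟩ hX' (hP j)
  have hLs := hL.contDiffAt hW hpW
  have key : ∀ y ∈ M ∩ (W ∩ U), lev ρ y (X y).1 (star (Z y).1) =
      ∑ j, star ((Z y).1 j) * lev ρ y (X y).1 (star (projH ρ (single j 1) y).1) := by
    intro y hy
    have e1 : (Z y).1 = ∑ j, (Z y).1 j • (projH ρ (single j 1) y).1 := by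
      conv_lhs => rw [← projH_of_mem h ⟨hy.1, hy.2.2⟩ (hZ.2 y ⟨hy.1, hy.2.1⟩), projH_eq_sum]
      rw [fst_sum]
      rfl
    conv_lhs => rw [e1, star_sum]
    rw [lev_sum_right]
    exact sum_congr rfl fun j _ => by rw [star_smul, lev_smul_right]
  rw [D2_congr_of_eventually h hp (smoothNear_lev h hp.2 hW hpW hX hZ)
    (SmoothNear.sum fun j _ => (hsZ j).mul (hsl j)) hW hpW hL
    ((eventually_mem_and hW h hpW hp.2).mono fun y hy hyM => key y ⟨hyM, hy⟩) hv,
    D2_sum (fun j _ => (hsZ j).mul (hsl j)) hLs]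
  refine sum_eq_zero fun j _ => ?_
  rw [D2_mul (hsZ j) (hsl j) hLs (hg j).1 ((hg j).2 _ (Or.inl rfl)) ((hg j).2 _ (Or.inr rfl)), h0]
  simp

/-- Replacing constant vectors by their projections to `H¹⁰` does not change the jets of their Levi
product, to the order to which these vectors are tangent. -/
lemma flat_lev_projH_sub (h : IsDefiningFunction M U ρ) (hp : p ∈ U) (hA : ∀ s ∈ A, s.swap ∈ A)
    {a b : Cn n} (ha : Flat A k (fun y => dz ρ y a) p) (hb : Flat A k (fun y => dz ρ y b) p) : Flat
    A k (fun y => lev ρ y (projH ρ a y).1 (star (projH ρ b y).1) - lev ρ y a (star b)) p := by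
  have sU : ∀ {f : Cn n → ℂ}, (∀ y ∈ U, SmoothAt f y) → SmoothNear f p := fun hf =>
    smoothNear_of_forall h.1 hp hf
  have hN : ∀ y ∈ U, SmoothAt (gradN ρ) y := fun y hy => contDiffAt_gradN (h.contDiffAt hy)
  have hNs : ∀ y ∈ U, SmoothAt (fun y => star (gradN ρ y)) y := fun y hy =>
    contDiffAt_star (hN y hy)
  have sd : ∀ c, SmoothNear (fun y => dz ρ y c) p := fun c => sU fun y hy =>
    contDiffAt_dz (h.contDiffAt hy) contDiffAt_const
  have si : SmoothNear (fun y => 1 / nrm ρ y) p := sU fun y hy =>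
    contDiffAt_divC contDiffAt_const (contDiffAt_nrm (h.contDiffAt hy)) (nrm_ne_zero h hy)
  have s1 : SmoothNear (fun y => lev ρ y (gradN ρ y) (star b)) p := sU fun y hy =>
    contDiffAt_lev (h.contDiffAt hy) (hN y hy) contDiffAt_const
  have s2 : SmoothNear (fun y => lev ρ y a (star (gradN ρ y))) p := sU fun y hy =>
    contDiffAt_lev (h.contDiffAt hy) contDiffAt_const (hNs y hy)
  have s3 : SmoothNear (fun y => lev ρ y (gradN ρ y) (star (gradN ρ y))) p := sU fun y hy =>
    contDiffAt_lev (h.contDiffAt hy) (hN y hy) (hNs y hy)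
  have t1 := (si.mul ((si.mul ((sd b).conj)).mul s3)).sub (si.mul s1)
  have t2 := (SmoothNear.const (0 : ℂ) p).sub (si.mul s2)
  have f1 := ha.mul_left (sd a) t1
  have f2 := (hb.conj (sd b) hA).mul_left (sd b).conj t2
  refine (f1.add f2 (t1.mul (sd a)) (t2.mul (sd b).conj)).congr ?_
  refine Filter.Eventually.of_forall fun y => ?_
  simp only [projH, star_sub, star_smul, lev_sub_left, lev_sub_right, lev_smul_left,
    lev_smul_right, star_div₀, star_nrm]
  ring

section graphJets

variable [NeZero n]

namespace IsPscChart

variable (h : IsPscChart M p q Φ G)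
include h

lemma pd_conj (s : Idx n) : pd s (toC G) =ᶠ[𝓝 0] fun x => star (pd s.swap (toC G) x) := by
  have e : (fun x => star (toC G x)) = toC G := by
    funext x
    simp [toC]
  have := LeviGeom.pd_conj h.smoothNear s
  rwa [e] at this

lemma pd_pd_conj (s t : Idx n) : pd s (pd t (toC G)) =ᶠ[𝓝 0] fun x => star
    (pd s.swap (pd t.swap (toC G)) x) :=
  (pd_congr (h.pd_conj t) s).trans (LeviGeom.pd_conj (h.smoothNear.pd _) s)

lemma pd_pd_pd_conj (s t u : Idx n) : pd s (pd t (pd u (toC G))) 0 = star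
    (pd s.swap (pd t.swap (pd u.swap (toC G))) 0) :=
  ((pd_congr (h.pd_pd_conj t u) s).trans
    (LeviGeom.pd_conj ((h.smoothNear.pd _).pd _) s)).self_of_nhds

lemma pd_pd_pd_swap_left (s t u : Idx n) : pd s (pd t (pd u (toC G))) 0 = pd t (pd s (pd u (toC G)))
    0 :=
  (pd_comm (h.smoothNear.pd u) s t).self_of_nhds

lemma pd_pd_pd_swap_right (s t u : Idx n) : pd s (pd t (pd u (toC G))) 0 = pd s
    (pd u (pd t (toC G))) 0 :=
  (pd_congr (pd_comm h.smoothNear t u) s).self_of_nhds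

omit h

lemma inl_mem (a : Fin n) (ha : a ≠ 0) : inl a ∈ holVars n ∩ zVars n :=
  mem_inter.2 ⟨inl_mem_holVars a, mem_zVars.2 ha⟩

include h

/-- The second derivatives of `G` at the origin in the variables other than `w`. -/
lemma pd_pd_eq {t : Idx n} (hs : s ∈ zVars n) (ht : t ∈ zVars n) : pd s (pd t (toC G)) 0 = if t =
    s.swap ∧ (varIndex s : ℕ) ≤ q then 1 else 0 := by
  have hmix : ∀ a b : Fin n, a ≠ 0 → b ≠ 0 → pd (inl a) (pd (inr b) (toC G)) 0 =
      if b = a ∧ (a : ℕ) ≤ q then 1 else 0 := by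
    intro a b ha hb
    by_cases hbq : (b : ℕ) ≤ q
    · rw [h.pd_pd b hb hbq a ha]
      by_cases hab : a = b
      · subst hab; simp [hbq]
      · rw [if_neg hab, if_neg fun h => hab h.1.symm]
    · have h1 := (h.coordV_mem_K10 (not_le.1 hbq))
      have h2 := ((mem_K10_iff h.isDefiningFunction h.zero_mem).1 h1).2 (single a 1) (by
        rw [h.dz_zero, single_apply_zero ha, neg_zero])
      have h3 : lev (graphFn G) 0 (coordV (inl b) : CVec n).1 (star (single a 1)) =
          lvm (graphFn G) b a 0 := by
        rw [← single_star, star_one, lev]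
        simp only [coordV]
        rw [sum_eq_single b (fun j _ hj => by simp [hj]) (by simp),
          sum_eq_single a (fun j _ hj => by simp [hj]) (by simp)]
        simp
      rw [h3, (h.lvm_graphFn b a).self_of_nhds] at h2
      rw [(h.pd_pd_conj _ _).self_of_nhds]
      simp only [swap_inl, swap_inr, h2, star_zero]
      rw [if_neg]
      rintro ⟨rfl, h4⟩
      exact hbq h4
  have hs' := mem_zVars.1 hs
  have ht' := mem_zVars.1 ht
  have hpure : ∀ a b : Fin n, a ≠ 0 → b ≠ 0 →
      pd (inl a) (pd (inl b) (toC G)) 0 = 0 := fun a b ha hb =>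
    ((h.flat.2 _ (inl_mem b hb)).2 _ (inl_mem a ha)).zero_apply
  rcases s with a | a <;> rcases t with b | b
  · rw [hpure a b hs' ht', if_neg fun h => by simpa using h.1]
  · rw [hmix a b hs' ht']
    simp [varIndex]
  · rw [(pd_comm h.smoothNear (inr a) (inl b)).self_of_nhds, hmix b a ht' hs']
    by_cases hab : a = b
    · subst hab; simp [varIndex]
    · rw [if_neg fun h => hab h.1, if_neg fun h => hab (Sum.inl_injective h.1).symm]
  · rw [if_neg fun h => by simpa using h.1, (h.pd_pd_conj _ _).self_of_nhds]
    simp only [swap_inr, hpure a b hs' ht', star_zero]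

lemma dz_single {a : Fin n} (ha : a ≠ 0) : (fun y => dz (graphFn G) y (single a 1)) =ᶠ[𝓝 0] pd
    (inl a) (toC G) := by
  filter_upwards [h.dzc_graphFn a] with y hy
  rw [if_neg ha, sub_zero] at hy
  rw [← hy]
  simp [dz, single_apply]

lemma lev_single (a b : Fin n) : (fun y => lev (graphFn G) y (single a 1) (star (single b 1)))
    =ᶠ[𝓝 0] pd (inr b) (pd (inl a) (toC G)) := by
  filter_upwards [h.lvm_graphFn a b] with y hy
  rw [← hy, ← single_star, star_one]
  simp only [lev]
  rw [sum_eq_single a (fun j _ hj => by simp [hj]) (by simp),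
    sum_eq_single b (fun j _ hj => by simp [hj]) (by simp)]
  simp

omit h

lemma swap_mem_zVars (hs : s ∈ zVars n) : s.swap ∈ zVars n := by
  rw [mem_zVars, varIndex_swap]; exact mem_zVars.1 hs

lemma swap_mem_kerVars (hs : s ∈ kerVars n q) : s.swap ∈ kerVars n q := by
  rw [mem_kerVars, varIndex_swap]; exact mem_kerVars.1 hs

include h

lemma projH_mem_K10 {a : Fin n} (ha : q < (a : ℕ)) : projH (graphFn G) (single a 1) 0 ∈ K10
    (chartImage M Φ) 0 := by
  have h1 := h.coordV_mem_K10 ha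
  have h2 := projH_of_mem h.isDefiningFunction h.zero_mem (K10_le_H10 _ _ h1)
  rw [← h2] at h1
  exact h1

lemma pd_pd_pd_mixed (hs : s ∈ zVars n) {a b : Fin n} (ha : q < (a : ℕ)) (hb : q < (b : ℕ)) : pd s
    (pd (inr b) (pd (inl a) (toC G))) 0 = 0 := by
  have hdef := h.isDefiningFunction
  have hz : (0 : Cn n) ∈ chartImage M Φ ∩ Φ.target := h.zero_mem
  have h1 := cderiv_lev_eq_zero hdef h.levPsd hz Φ.open_target h.zero_target (isSection_projH hdef
    (single a 1))
    (isSection_projH hdef (single b 1)) (h.projH_mem_K10 ha) (h.projH_mem_K10 hb)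
    (h.coordV_mem_CT hs)
  have hfl : ∀ {c : Fin n}, q < (c : ℕ) →
      Flat (zVars n) 1 (fun y => dz (graphFn G) y (single c 1)) 0 := fun {c} hc => by
    have hc0 := ne_zero_of_lt hc
    refine Flat.congr (f := pd (inl c) (toC G)) ⟨h.pd_eq_zero _, fun t ht => ?_⟩
      (h.dz_single hc0).symm
    change pd t (pd (inl c) (toC G)) 0 = 0
    rw [h.pd_pd_eq ht ((mem_zVars (s := inl c)).2 hc0), if_neg]
    rintro ⟨h2, h3⟩
    rw [← varIndex_swap, ← h2] at h3
    exact absurd h3 (not_le.2 hc)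
  have h2 := (flat_lev_projH_sub hdef h.zero_target (fun _ => swap_mem_zVars) (hfl ha)
    (hfl hb)).2 s hs
  have h3 : SmoothNear (pd (inr b) (pd (inl a) (toC G))) 0 := (h.smoothNear.pd _).pd _
  have h4 : SmoothNear (levF (graphFn G) (projH (graphFn G) (single a 1)) (projH (graphFn G)
    (single b 1))) 0 :=
    smoothNear_lev hdef h.zero_target Φ.open_target h.zero_target (isSection_projH hdef _)
      (isSection_projH hdef _)
  have h5 : pd s (fun y => lev (graphFn G) y (projH (graphFn G) (single a 1) y).1
      (star (projH (graphFn G) (single b 1) y).1) - pd (inr b) (pd (inl a) (toC G)) y) 0 = 0 := by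
    have h6 := h2.zero_apply
    rw [← h6]
    refine (pd_congr ?_ s).self_of_nhds
    filter_upwards [h.lev_single a b] with y hy
    rw [hy]
  rw [pd, cderiv_fun_sub h4.at.diffAt h3.at.diffAt, h1, zero_sub, neg_eq_zero] at h5
  exact h5

/-- The third derivatives of `G` at the origin vanish if at most one of the variables does not
belong to the Levi kernel. -/
lemma pd_pd_pd_eq_zero {t u : Idx n} (hs : s ∈ zVars n) (ht : t ∈ kerVars n q)
    (hu : u ∈ kerVars n q) : pd s (pd t (pd u (toC G))) 0 = 0 := by
  have hhol : ∀ {s : Idx n} (_ : s ∈ zVars n) {a b : Fin n}, q < (a : ℕ) → q < (b : ℕ) →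
      pd s (pd (inl a) (pd (inl b) (toC G))) 0 = 0 := by
    intro s hs a b ha hb
    rcases s with j | j
    · exact (((h.flat.2 _ (inl_mem b (ne_zero_of_lt hb))).2 _
        (inl_mem a (ne_zero_of_lt ha))).2 _ (inl_mem j (mem_zVars.1 hs))).zero_apply
    · by_cases hj : (j : ℕ) ≤ q
      · have hk : ∀ {c : Fin n}, q < (c : ℕ) → inl c ∈ holVars n ∩ kerVars n q := fun hc =>
          mem_inter.2 ⟨inl_mem_holVars _, mem_kerVars.2 hc⟩
        rw [h.pd_pd_pd_swap_left, h.pd_pd_pd_swap_right]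
        exact (((h.flat_pd j (mem_zVars.1 hs) hj).2 _ (hk hb)).2 _ (hk ha)).zero_apply
      · rw [h.pd_pd_pd_swap_left]
        exact h.pd_pd_pd_mixed (mem_zVars.2 (ne_zero_of_lt ha)) hb (not_le.1 hj)
  have ht' := mem_kerVars.1 ht
  have hu' := mem_kerVars.1 hu
  rcases t with a | a <;> rcases u with b | b
  · exact hhol hs ht' hu'
  · rw [h.pd_pd_pd_swap_right]
    exact h.pd_pd_pd_mixed hs ht' hu'
  · exact h.pd_pd_pd_mixed hs hu' ht'
  · rw [h.pd_pd_pd_conj, swap_inr, swap_inr, hhol (a := a) (b := b) (swap_mem_zVars hs) ht' hu',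
      star_zero]

end IsPscChart

end graphJets

/-! ### Iterated derivatives -/

lemma iterCderiv_append (l m : List (CVec n)) (f : Cn n → ℂ) : iterCderiv (l ++ m) f = iterCderiv l
    (iterCderiv m f) := by
  simp [iterCderiv, foldr_append]

lemma SmoothNear.iterCderiv (hf : SmoothNear f p) (l : List (CVec n)) : SmoothNear (iterCderiv l f)
    p := by
  induction l with
  | nil => exact hf
  | cons X l ih => exact ih.mono fun _ h => contDiffAt_cderiv_const X h

lemma iterCderiv_congr (h : f =ᶠ[𝓝 p] g) (l : List (CVec n)) : iterCderiv l f =ᶠ[𝓝 p] iterCderiv l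
    g := by
  induction l with
  | nil => exact h
  | cons X l ih =>
    filter_upwards [ih.eventually_nhds] with x hx
    exact cderiv_congr hx X

lemma iterCderiv_sub (hf : SmoothNear f p) (hg : SmoothNear g p) (l : List (CVec n)) : iterCderiv l
    (fun y => f y - g y) =ᶠ[𝓝 p] fun y => iterCderiv l f y - iterCderiv l g y := by
  induction l with
  | nil => rfl
  | cons X l ih =>
    filter_upwards [ih.eventually_nhds, (hf.iterCderiv l).diff, (hg.iterCderiv l).diff] with x hx
      h1 h2
    exact (cderiv_congr hx X).trans (cderiv_fun_sub h1 h2 X)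

lemma iterCderiv_sum (s : Finset ι) (c : ι → ℂ) {f : ι → Cn n → ℂ}
    (hf : ∀ i ∈ s, SmoothNear (f i) p) (l : List (CVec n)) : iterCderiv l
    (fun y => ∑ i ∈ s, c i * f i y) =ᶠ[𝓝 p] fun y => ∑ i ∈ s, c i * iterCderiv l (f i) y := by
  induction l with
  | nil => rfl
  | cons X l ih =>
    have h1 : ∀ᶠ x in 𝓝 p, ∀ i ∈ s, DifferentiableAt ℝ (iterCderiv l (f i)) x :=
      (Filter.eventually_all_finset s).2 fun i hi => ((hf i hi).iterCderiv l).diff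
    filter_upwards [ih.eventually_nhds, h1] with x hx h2
    refine (cderiv_congr hx X).trans ?_
    rw [cderiv_fun_sum _ fun i hi => (h2 i hi).const_mul (c i)]
    exact sum_congr rfl fun i hi => cderiv_const_mul _ (h2 i hi) X

/-- Iterated derivatives along vectors in the span of some coordinate vectors are determined by the
partial derivatives in these coordinates. -/
lemma iterCderiv_eq_of_coord (l : List (CVec n)) (hl : ∀ X ∈ l, ∀ s ∉ A, coordOf s X = 0)
    (hf : SmoothNear f p) (hg : SmoothNear g p)
    (h : ∀ m : List (Idx n), (∀ s ∈ m, s ∈ A) → m.length = l.length → iterCderiv (m.map coordV)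
      f p = iterCderiv (m.map coordV) g p) :
    iterCderiv l f p = iterCderiv l g p := by
  induction l using reverseRecOn generalizing f g with
  | nil => exact h [] (by simp) rfl
  | append_singleton l X ih =>
    have hexp : ∀ {f : Cn n → ℂ}, SmoothNear f p → iterCderiv (l ++ [X]) f p =
        ∑ s ∈ A, coordOf s X * iterCderiv l (pd s f) p := by
      intro f hf
      rw [iterCderiv_append]
      have e : iterCderiv [X] f = fun y => ∑ s ∈ A, coordOf s X * pd s f y := by
        funext y
        change cderiv f y X = _
        rw [cderiv_eq_sum]
        refine (sum_subset (subset_univ A) fun s _ hs => ?_).symm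
        rw [hl X (by simp) s hs, zero_smul]
      rw [e]
      exact (iterCderiv_sum A _ (fun s _ => hf.pd s) l).self_of_nhds
    rw [hexp hf, hexp hg]
    refine sum_congr rfl fun s hs => ?_
    rw [ih (fun Y hY => hl Y (by simp [hY])) (hf.pd s) (hg.pd s) fun m hm hml => ?_]
    have h1 := h (m ++ [s]) (fun t ht => by
      rcases List.mem_append.1 ht with h2 | h2
      · exact hm t h2
      · rw [List.mem_singleton.1 h2]; exact hs) (by simp [hml])
    rw [map_append, iterCderiv_append, iterCderiv_append] at h1
    exact h1

lemma iterCderiv_evalC (l : List (Idx n)) (P : CPoly n) : iterCderiv (l.map coordV) (evalC P) =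
    evalC (l.foldr (fun s Q => pderiv s Q) P) := by
  induction l with
  | nil => rfl
  | cons s l ih =>
    change pd s (iterCderiv (l.map coordV) (evalC P)) = _
    rw [ih, pd_evalC]
    rfl

lemma foldr_pderiv_zero (l : List (Idx n)) : l.foldr (fun s Q => pderiv s Q) (0 : CPoly n) = 0 := by
  induction l with
  | nil => rfl
  | cons s l ih => rw [foldr_cons, ih, map_zero]

lemma foldr_pderiv_taylorHom (l : List (Idx n)) (hl : ∀ s ∈ l, s ∈ A) (hf : SmoothNear f p)
    (m : ℕ) : l.foldr (fun s Q => pderiv s Q) (taylorHom A p (m + l.length) f) = taylorHom A p m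
    (iterCderiv (l.map coordV) f) := by
  induction l using reverseRecOn generalizing f with
  | nil => rfl
  | append_singleton l s ih =>
    rw [foldr_append, List.length_append, List.length_singleton, ← add_assoc]
    simp only [foldr_cons, foldr_nil]
    rw [pderiv_taylorHom (hl s (by simp)) _ hf, ih (fun t ht => hl t (by simp [ht])) (hf.pd s),
      map_append, iterCderiv_append]
    rfl

lemma foldr_pderiv_taylorHom_of_notMem (l : List (Idx n)) (hl : ∃ s ∈ l, s ∉ A)
    (hf : SmoothNear f p) (k : ℕ) : l.foldr (fun s Q => pderiv s Q) (taylorHom A p k f) = 0 := by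
  induction l using reverseRecOn generalizing f k with
  | nil => simp at hl
  | append_singleton l s ih =>
    rw [foldr_append]
    simp only [foldr_cons, foldr_nil]
    by_cases hs : s ∈ A
    · cases k with
      | zero => rw [taylorHom, pderiv_C, foldr_pderiv_zero]
      | succ k =>
        rw [pderiv_taylorHom hs _ hf]
        refine ih ?_ (hf.pd s) k
        obtain ⟨t, ht, htA⟩ := hl
        rcases List.mem_append.1 ht with h2 | h2
        · exact ⟨t, h2, htA⟩
        · rw [List.mem_singleton.1 h2] at htA; exact absurd hs htA
    · rw [pderiv_taylorHom_of_notMem hs, foldr_pderiv_zero]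

/-- The derivatives of the homogeneous Taylor polynomial of degree `k` in some of the variables. -/
lemma iterCderiv_taylorHom (hf : SmoothNear f p) (l : List (Idx n)) (hk : l.length ≤ k) : iterCderiv
    (l.map coordV) (evalC (taylorHom A p k f)) 0 = if l.length = k ∧ ∀ s ∈ l, s ∈ A then iterCderiv
    (l.map coordV) f p else 0 := by
  rw [iterCderiv_evalC]
  by_cases hl : ∀ s ∈ l, s ∈ A
  · obtain ⟨m, rfl⟩ := Nat.exists_eq_add_of_le' hk
    rw [foldr_pderiv_taylorHom l hl hf]
    cases m with
    | zero =>
      rw [if_pos ⟨by simp, hl⟩]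
      simp [taylorHom, evalC]
    | succ m =>
      rw [evalC_zero_taylorHom_succ, if_neg]
      rintro ⟨h1, -⟩
      omega
  · rw [if_neg fun h => hl h.2]
    push Not at hl
    rw [foldr_pderiv_taylorHom_of_notMem l hl hf]
    simp [evalC]

/-! ### The weighted normal form -/

section normalForm

variable [NeZero n]

/-- The quadratic form `∑ |z_j|²`, `1 ≤ j ≤ q`. -/
def levelTwo (n q : ℕ) [NeZero n] : CPoly n := ∑ j : Fin n, if j ≠ 0 ∧ (j : ℕ) ≤ q then
    MvPolynomial.X (inl j) * MvPolynomial.X (inr j) else 0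

lemma evalC_levelTwo (x : Cn n) : evalC (levelTwo n q) x =
    ((∑ j : Fin n, if j ≠ 0 ∧ (j : ℕ) ≤ q then ‖x j‖ ^ 2 else 0 : ℝ) : ℂ) := by
  rw [levelTwo, evalC, map_sum, ofReal_sum]
  refine sum_congr rfl fun j _ => ?_
  split_ifs
  · simp [← Complex.mul_conj']
  · simp

lemma pderiv_levelTwo (s : Idx n) : pderiv s (levelTwo n q) = if varIndex s ≠ 0 ∧ (varIndex s : ℕ) ≤
    q then MvPolynomial.X s.swap else 0 := by
  rw [levelTwo, map_sum]
  have h : ∀ j : Fin n, pderiv s (if j ≠ 0 ∧ (j : ℕ) ≤ q then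
      MvPolynomial.X (inl j) * MvPolynomial.X (inr j) else
        (0 : CPoly n)) =
      if j = varIndex s then
        (if varIndex s ≠ 0 ∧ (varIndex s : ℕ) ≤ q then MvPolynomial.X s.swap else 0) else 0 := by
    intro j
    by_cases hj : j = varIndex s
    · rw [if_pos hj, ← hj, apply_ite (pderiv s), map_zero]
      refine if_congr Iff.rfl ?_ rfl
      rcases s with a | a <;> obtain rfl : j = a := hj <;> simp [pderiv_X]
    · rw [if_neg hj]
      rcases s with a | a <;> have hj' : ¬ j = a := hj <;> split_ifs <;>
        simp [pderiv_X, hj']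
  rw [sum_congr rfl fun j _ => h j]
  simp

/-- The part of `G` that is homogeneous of degree `4` in the variables of the Levi kernel. -/
def quarticPart (q : ℕ) (G : Cn n → ℝ) (x : Cn n) : ℝ :=
  (evalC (taylorHom (kerVars n q) 0 4 (toC G)) x).re

/-- The remainder of `G` after its terms of weight at most `1`. -/
def remainder (q : ℕ) (G : Cn n → ℝ) (x : Cn n) : ℝ :=
  G x - (∑ j : Fin n, if j ≠ 0 ∧ (j : ℕ) ≤ q then ‖x j‖ ^ 2 else 0) - quarticPart q G x

/-- Four times the inverse of the weight of a variable. -/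
def blockWt (q : ℕ) (j : Fin n) : ℕ := if (j : ℕ) = 0 then 4 else if (j : ℕ) ≤ q then 2 else 1

lemma weight_blockWeights (l : List (Idx n)) : weight (blockWeights n q) l =
    ((l.map fun s => blockWt q (varIndex s)).sum : ℕ) * (4 : ℝ≥0∞)⁻¹ := by
  have h1 : ∀ j : Fin n, (blockWeights n q j)⁻¹ = (blockWt q j : ℕ) * (4 : ℝ≥0∞)⁻¹ := by
    intro j
    rw [blockWeights, blockWt]
    split_ifs
    · push_cast
      rw [ENNReal.mul_inv_cancel (by norm_num) (by norm_num), inv_one]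
    · have : (4 : ℝ≥0∞) = 2 * 2 := by norm_num
      push_cast
      rw [this, ENNReal.mul_inv (by norm_num) (by norm_num), ← mul_assoc,
        ENNReal.mul_inv_cancel (by norm_num) (by norm_num), one_mul]
    · simp
  induction l with
  | nil => simp [weight]
  | cons s l ih =>
    rw [weight, map_cons, sum_cons, map_cons, sum_cons]
    rw [weight] at ih
    rw [ih, h1, Nat.cast_add, add_mul]

lemma weight_blockWeights_le {l : List (Idx n)} : weight (blockWeights n q) l ≤ m * (4 : ℝ≥0∞)⁻¹ ↔
    (l.map fun s => blockWt q (varIndex s)).sum ≤ m := by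
  rw [weight_blockWeights, ENNReal.mul_le_mul_iff_left (by norm_num) (by norm_num), Nat.cast_le]

namespace IsPscChart

variable (h : IsPscChart M p q Φ G)
include h

lemma toC_quarticPart : toC (quarticPart q G) = evalC (taylorHom (kerVars n q) 0 4 (toC G)) := by
  funext x
  have h1 := star_evalC_taylorHom (A := kerVars n q) (fun _ => swap_mem_kerVars) 4 h.smoothNear x
  have e : (fun y => star (toC G y)) = toC G := by funext y; simp [toC]
  rw [e] at h1
  exact Complex.conj_eq_iff_re.1 h1

lemma toC_remainder : toC (remainder q G) = fun x => (toC G x - evalC (levelTwo n q) x) - evalC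
    (taylorHom (kerVars n q) 0 4 (toC G)) x := by
  rw [← h.toC_quarticPart]
  funext x
  simp only [toC, remainder, evalC_levelTwo]
  push_cast
  ring

lemma iterCderiv_remainder (l : List (CVec n)) : iterCderiv l (toC (remainder q G)) 0 = iterCderiv l
    (toC G) 0 - iterCderiv l (evalC (levelTwo n q)) 0 - iterCderiv l
    (evalC (taylorHom (kerVars n q) 0 4 (toC G))) 0 := by
  have s1 := smoothNear_evalC (levelTwo n q) 0
  have s2 := smoothNear_evalC (taylorHom (kerVars n q) 0 4 (toC G)) 0
  rw [h.toC_remainder, (iterCderiv_sub (h.smoothNear.sub s1) s2 l).self_of_nhds]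
  exact congrArg (· - _) (iterCderiv_sub h.smoothNear s1 l).self_of_nhds

/-- The Taylor terms of weight at most `1` of the graph are the squares and the quartic part. -/
lemma iterCderiv_remainder_eq_zero (l : List (Idx n))
    (hl : (l.map fun s => blockWt q (varIndex s)).sum ≤ 4) : iterCderiv (l.map coordV)
    (toC (remainder q G)) 0 = 0 := by
  have hpos : ∀ s : Idx n, 1 ≤ blockWt q (varIndex s) := fun s => by
    rw [blockWt]; split_ifs <;> norm_num
  have hz : ∀ s : Idx n, blockWt q (varIndex s) < 4 → s ∈ zVars n := fun s hs => by
    rw [mem_zVars]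
    intro h0
    rw [blockWt, if_pos (by simp [h0])] at hs
    omega
  have hk : ∀ s : Idx n, blockWt q (varIndex s) < 2 → s ∈ kerVars n q := fun s hs => by
    rw [mem_kerVars]
    by_contra h0
    rw [blockWt] at hs
    split_ifs at hs with h1 h2 <;> omega
  have hT : ∀ l : List (Idx n), l.length < 4 →
      iterCderiv (l.map coordV) (evalC (taylorHom (kerVars n q) 0 4 (toC G))) 0 = 0 :=
        fun l hl => by
    rw [iterCderiv_taylorHom h.smoothNear l hl.le, if_neg fun h1 => hl.ne h1.1]
  rw [h.iterCderiv_remainder]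
  rcases l with _ | ⟨a, _ | ⟨b, _ | ⟨c, _ | ⟨d, _ | ⟨e, l⟩⟩⟩⟩⟩
  · rw [hT _ (by simp)]
    simp [iterCderiv, toC, h.map_zero, evalC_levelTwo]
  · rw [hT _ (by simp), iterCderiv_evalC]
    change pd a (toC G) 0 - evalC (pderiv a (levelTwo n q)) 0 - 0 = 0
    rw [h.pd_eq_zero, pderiv_levelTwo]
    split_ifs <;> simp [evalC]
  · simp only [map_cons, map_nil, sum_cons, sum_nil] at hl
    have ha := hz a (by have := hpos b; omega)
    have hb := hz b (by have := hpos a; omega)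
    rw [hT _ (by simp), iterCderiv_evalC]
    change pd a (pd b (toC G)) 0 - evalC (pderiv a (pderiv b (levelTwo n q))) 0 - 0 = 0
    rw [h.pd_pd_eq ha hb, pderiv_levelTwo, sub_zero, sub_eq_zero]
    have hb0 := mem_zVars.1 hb
    by_cases hab : b = a.swap
    · subst hab
      rw [varIndex_swap] at hb0 ⊢
      by_cases haq : (varIndex a : ℕ) ≤ q
      · rw [if_pos ⟨rfl, haq⟩, if_pos ⟨hb0, haq⟩, swap_swap]
        simp [evalC]
      · rw [if_neg fun h => haq h.2, if_neg fun h => haq h.2]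
        simp [evalC]
    · rw [if_neg fun h => hab h.1]
      have hne : b.swap ≠ a := fun h => hab (by rw [← h, swap_swap])
      split_ifs <;> simp [evalC, pderiv_X, hne]
  · simp only [map_cons, map_nil, sum_cons, sum_nil] at hl
    have h1a := hpos a
    have h1b := hpos b
    have h1c := hpos c
    have hG : pd a (pd b (pd c (toC G))) 0 = 0 := by
      by_cases hA : blockWt q (varIndex a) < 2
      · by_cases hB : blockWt q (varIndex b) < 2
        · rw [h.pd_pd_pd_swap_right, h.pd_pd_pd_swap_left]
          exact h.pd_pd_pd_eq_zero (hz c (by omega)) (hk a hA) (hk b hB)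
        · rw [h.pd_pd_pd_swap_left]
          exact h.pd_pd_pd_eq_zero (hz b (by omega)) (hk a hA) (hk c (by omega))
      · exact h.pd_pd_pd_eq_zero (hz a (by omega)) (hk b (by omega)) (hk c (by omega))
    rw [hT _ (by simp), iterCderiv_evalC]
    change pd a (pd b (pd c (toC G))) 0 - evalC (pderiv a (pderiv b
      (pderiv c (levelTwo n q)))) 0 - 0 = 0
    rw [hG, pderiv_levelTwo]
    split_ifs <;> simp [evalC, pderiv_X, single_apply]
    split_ifs <;> simp
  · simp only [map_cons, map_nil, sum_cons, sum_nil] at hl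
    have h1a := hpos a
    have h1b := hpos b
    have h1c := hpos c
    have h1d := hpos d
    have hmem : ∀ s ∈ [a, b, c, d], s ∈ kerVars n q := by
      intro s hs
      apply hk
      simp only [List.mem_cons, List.not_mem_nil, or_false] at hs
      rcases hs with rfl | rfl | rfl | rfl <;> omega
    rw [iterCderiv_taylorHom h.smoothNear _ (by simp), if_pos ⟨rfl, hmem⟩, iterCderiv_evalC]
    change _ - evalC (pderiv a (pderiv b (pderiv c
      (pderiv d (levelTwo n q))))) 0 - _ = 0
    have hd : ¬(varIndex d ≠ 0 ∧ (varIndex d : ℕ) ≤ q) := fun h1 =>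
      absurd h1.2 (not_le.2 (mem_kerVars.1 (hmem d (by simp))))
    rw [pderiv_levelTwo, if_neg hd]
    simp [evalC]
  · simp only [map_cons, sum_cons] at hl
    have h1a := hpos a
    have h1b := hpos b
    have h1c := hpos c
    have h1d := hpos d
    have h1e := hpos e
    omega

end IsPscChart

end normalForm

/-! ### The quartic tensor in the weighted normal form -/

section quarticChart

variable [NeZero n]

/-- The vector has components only along the variables of the Levi kernel. -/
def IsKerVec (q : ℕ) (X : CVec n) : Prop := ∀ s ∉ kerVars n q, coordOf s X = 0

namespace IsPscChart

variable (h : IsPscChart M p q Φ G)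
include h

lemma isKerVec_of_mem_K10 (hX : X ∈ K10 (chartImage M Φ) 0) : IsKerVec q X := by
  have hX := h.mem_K10.1 hX
  rintro (j | j) hj
  · exact hX.2 j (not_lt.1 fun h1 => hj (mem_kerVars.2 h1))
  · simp [hX.1]

omit h

lemma isKerVec_conjV (hX : IsKerVec q X) : IsKerVec q (conjV X) := fun s hs => by
  rw [coordOf_conjV, hX _ fun h => hs (by simpa using swap_mem_kerVars h), star_zero]

include h

lemma isKerVec_of_mem_CK (hX : X ∈ CK (chartImage M Φ) 0) : IsKerVec q X := by
  obtain ⟨a, ha, c, hc, rfl⟩ := mem_sup.1 hX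
  have h1 := h.isKerVec_of_mem_K10 ha
  have h2 := isKerVec_conjV (h.isKerVec_of_mem_K10 (show conjV c ∈ _ from hc))
  rw [conjV_conjV] at h2
  intro s hs
  have e : coordOf s (a + c) = coordOf s a + coordOf s c := by rcases s with j | j <;> rfl
  rw [e, h1 s hs, h2 s hs, add_zero]

lemma mem_CT_of_isKerVec (hX : IsKerVec q X) : X ∈ CT (chartImage M Φ) 0 := by
  have h0 : ∀ s : Idx n, varIndex s = 0 → coordOf s X = 0 := fun s hs => hX s fun h1 => by
    simpa [hs] using mem_kerVars.1 h1
  have h1 : X.1 0 = 0 := h0 (inl 0) rfl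
  have h2 : X.2 0 = 0 := h0 (inr 0) rfl
  rw [h.mem_CT, h1, h2, add_zero]

lemma dz_kerVec {a : Cn n} (ha : ∀ j : Fin n, (j : ℕ) ≤ q → a j = 0) : (fun y => dz (graphFn G) y a)
    =ᶠ[𝓝 0] fun y => ∑ j, a j * pd (inl j) (toC G) y := by
  filter_upwards [(Filter.eventually_all.2 fun j => h.dzc_graphFn j)] with y hy
  refine sum_congr rfl fun j _ => ?_
  by_cases hj : j = 0
  · rw [ha j (by simp [hj]), zero_mul, zero_mul]
  · rw [hy j, if_neg hj, sub_zero]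

/-- The complex gradient of `G` along the Levi kernel is flat along the Levi kernel. -/
lemma flat_dz_kerVec {a : Cn n} (ha : ∀ j : Fin n, (j : ℕ) ≤ q → a j = 0) : Flat (kerVars n q) 2
    (fun y => dz (graphFn G) y a) 0 := by
  refine (Flat.sum (fun j _ => ?_) fun j _ => (SmoothNear.const (a j) 0).mul
    (h.smoothNear.pd _)).congr (h.dz_kerVec ha).symm
  by_cases hj : (j : ℕ) ≤ q
  · simpa [ha j hj] using Flat.zero _ _ _
  have hjk : inl j ∈ kerVars n q := mem_kerVars.2 (not_le.1 hj)
  refine Flat.mul_left ⟨h.pd_eq_zero _, fun s hs => ⟨?_, fun t ht => ?_⟩⟩ (h.smoothNear.pd _)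
    (SmoothNear.const _ _)
  · rw [h.pd_pd_eq (kerVars_subset_zVars hs) (kerVars_subset_zVars hjk), if_neg]
    exact fun h1 => absurd h1.2 (not_le.2 (mem_kerVars.1 hs))
  · exact h.pd_pd_pd_eq_zero (kerVars_subset_zVars ht) hs hjk

lemma flat_dz_single {j : Fin n} (hj : j ≠ 0) : Flat (kerVars n q) 1
    (fun y => dz (graphFn G) y (single j 1)) 0 := by
  refine Flat.congr (f := pd (inl j) (toC G)) ⟨h.pd_eq_zero _, fun s hs => ?_⟩ (h.dz_single hj).symm
  change pd s (pd (inl j) (toC G)) 0 = 0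
  rw [h.pd_pd_eq (kerVars_subset_zVars hs) ((mem_zVars (s := inl j)).2 hj), if_neg]
  exact fun h1 => absurd h1.2 (not_le.2 (mem_kerVars.1 hs))

omit h

lemma iterCderiv_flat (hf : SmoothNear f p) (hg : SmoothNear g p)
    (h : Flat A 2 (fun y => f y - g y) p) {w : CVec n} (hv : ∀ s ∉ A, coordOf s v = 0)
    (hw : ∀ s ∉ A, coordOf s w = 0) : iterCderiv [w, v] f p = iterCderiv [w, v] g p := by
  refine iterCderiv_eq_of_coord (A := A) _ (List.forall_mem_cons.2 ⟨hw,
    List.forall_mem_singleton.2 hv⟩) hf hg fun m hm hl => ?_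
  rcases m with _ | ⟨s, _ | ⟨t, _ | _⟩⟩ <;> simp at hl
  have h1 : pd s (pd t fun y => f y - g y) p = 0 := (h.2 t (hm t (by simp))).2 s (hm s (by simp))
  have h2 := (iterCderiv_sub hf hg [coordV s, coordV t]).self_of_nhds
  rw [show iterCderiv [coordV s, coordV t] (fun y => f y - g y) p = 0 from h1] at h2
  exact sub_eq_zero.1 h2.symm

include h

lemma cderiv_graphFn (hX : IsKerVec q X) : (fun y => cderiv (toC (graphFn G)) y X) =ᶠ[𝓝 0] fun y =>
    cderiv (toC G) y X := by
  filter_upwards [Φ.open_target.mem_nhds h.zero_target] with y hy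
  rw [cderiv_eq_sum, cderiv_eq_sum (toC G)]
  refine sum_congr rfl fun s _ => ?_
  by_cases hs : s ∈ kerVars n q
  · congr 1
    refine (h.pd_graphFn hy s).trans ?_
    rw [if_neg (mem_zVars.1 (kerVars_subset_zVars hs)), sub_zero, pd]
  · rw [hX s hs, zero_smul, zero_smul]

/-- The first order part of the Levi form of two projected fields vanishes along the Levi kernel,
if one of them has its value in the Levi kernel. -/
lemma cderiv_lev_projH {a : Cn n} (ha : ((a, 0) : CVec n) ∈ K10 (chartImage M Φ) 0) (j : Fin n)
    (hv : IsKerVec q v) : cderiv (fun y => lev (graphFn G) y (projH (graphFn G) a y).1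
    (star (projH (graphFn G) (single j 1) y).1)) 0 v = 0 := by
  have hdef := h.isDefiningFunction
  have hz : (0 : Cn n) ∈ chartImage M Φ ∩ Φ.target := h.zero_mem
  have hPa := projH_of_mem hdef hz (K10_le_H10 _ _ ha)
  have ha' : ∀ j : Fin n, (j : ℕ) ≤ q → a j = 0 := (h.mem_K10.1 ha).2
  by_cases hj : j = 0
  · have h0 : projH (graphFn G) (single j 1) 0 = 0 := by
      rw [projH, h.dz_zero, h.nrm_zero, h.gradN_zero, hj]
      simp
    refine cderiv_lev_eq_zero hdef h.levPsd hz Φ.open_target h.zero_target (isSection_projH hdef _)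
      (isSection_projH hdef _)
      ?_ (h0 ▸ Submodule.zero_mem _) (h.mem_CT_of_isKerVec hv)
    rw [hPa]; exact ha
  have s4 : SmoothNear (levF (graphFn G) (projH (graphFn G) a) (projH (graphFn G) (single j 1)))
    0 :=
    smoothNear_lev hdef h.zero_target Φ.open_target h.zero_target (isSection_projH hdef _)
      (isSection_projH hdef _)
  have e2 : (fun y => lev (graphFn G) y a (star (single j 1))) =ᶠ[𝓝 0]
      fun y => ∑ k, a k * pd (inr j) (pd (inl k) (toC G)) y := by
    filter_upwards [(Filter.eventually_all.2 fun k => h.lev_single k j)] with y hy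
    have : a = ∑ k, a k • (single k 1 : Cn n) := by funext i; simp [Finset.sum_apply, single_apply]
    conv_lhs => rw [this, lev_sum_left]
    refine sum_congr rfl fun k _ => ?_
    rw [lev_smul_left, hy k]
  have s5' : ∀ k, SmoothNear (fun y => a k * pd (inr j) (pd (inl k) (toC G)) y) 0 :=
    fun k => (SmoothNear.const _ _).mul ((h.smoothNear.pd _).pd _)
  have s5 : SmoothNear (fun y => lev (graphFn G) y a (star (single j 1))) 0 :=
    (SmoothNear.sum fun k _ => s5' k).congr e2.symm
  rw [cderiv_eq_sum]
  refine sum_eq_zero fun s _ => ?_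
  by_cases hs : s ∈ kerVars n q
  swap
  · rw [hv s hs, zero_smul]
  have hfl := (flat_lev_projH_sub hdef h.zero_target (fun _ => swap_mem_kerVars)
    ((h.flat_dz_kerVec ha').mono le_rfl one_le_two)
    (h.flat_dz_single hj)).2 s hs
  have h1 := hfl.zero_apply
  rw [pd, cderiv_fun_sub s4.at.diffAt s5.at.diffAt, sub_eq_zero] at h1
  rw [h1, cderiv_congr e2, cderiv_fun_sum _ fun k _ => (s5' k).at.diffAt, sum_eq_zero, smul_zero]
  intro k _
  rw [cderiv_const_mul _ ((h.smoothNear.pd _).pd _).at.diffAt]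
  by_cases hk : (k : ℕ) ≤ q
  · rw [ha' k hk, zero_mul]
  · change _ * pd s (pd (inr j) (pd (inl k) (toC G))) 0 = 0
    rw [h.pd_pd_pd_swap_left, h.pd_pd_pd_eq_zero
      ((mem_zVars (s := inr j)).2 hj) hs ((mem_kerVars (s := inl k)).2 (not_le.1 hk)), mul_zero]

/-- The derivatives of order four of `G` along the Levi kernel are those of its quartic part. -/
lemma iterCderiv_graphFn {l : List (CVec n)} (hl : l.length = 4) (hk : ∀ X ∈ l, IsKerVec q X) :
    iterCderiv l (toC (graphFn G)) 0 = iterCderiv l (toC (quarticPart q G)) 0 := by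
  have s1 : SmoothNear (toC (graphFn G)) 0 := by
    filter_upwards [Φ.open_target.mem_nhds h.zero_target] with y hy
    exact contDiffAt_toC (h.contDiffAt_graphFn hy)
  rw [h.toC_quarticPart]
  refine iterCderiv_eq_of_coord (A := kerVars n q) l hk s1
    (smoothNear_evalC _ _) fun m hm hml => ?_
  rw [iterCderiv_taylorHom h.smoothNear _ (by omega), if_pos ⟨by omega, hm⟩]
  obtain rfl | ⟨m, s, rfl⟩ := List.eq_nil_or_concat' m
  · simp at hml; omega
  rw [map_append, iterCderiv_append, iterCderiv_append]
  refine (iterCderiv_congr (h.cderiv_graphFn fun t ht => ?_) _).self_of_nhds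
  rw [coordOf_coordV, if_neg]
  rintro rfl
  exact ht (hm _ (by simp))

/-- Along the Levi kernel, the quartic tensor is given by the fourth derivatives of the quartic
part of `G`: up to terms that do not contribute, the kernel fields may be replaced by projections of
constant fields, and the Levi form of these by the complex Hessian. -/
lemma quarticVal_eq {A B : Cn n → CVec n} (hA : IsKernelField (chartImage M Φ) 0 A)
    (hB : IsKernelField (chartImage M Φ) 0 B) {v₃ v₄ : CVec n} (h₃ : IsKerVec q v₃)
    (h₄ : IsKerVec q v₄) : quarticVal (graphFn G) 0 A B v₃ v₄ = iterCderiv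
    [v₄, v₃, A 0, conjV (B 0)] (toC (quarticPart q G)) 0 := by
  set H := graphFn G
  have hdef := h.isDefiningFunction
  have hz : (0 : Cn n) ∈ chartImage M Φ ∩ Φ.target := h.zero_mem
  obtain ⟨hKA, W₁, hW₁, h0W₁, hA⟩ := hA
  obtain ⟨hKB, W₂, hW₂, h0W₂, hB⟩ := hB
  have hAK := hKA.mem_K10 hdef hz hW₁ h0W₁ hA
  have hBK := hKB.mem_K10 hdef hz hW₂ h0W₂ hB
  have hA2 := (h.mem_K10.1 hAK).1
  have hB2 := (h.mem_K10.1 hBK).1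
  set a := (A 0).1
  set b := (B 0).1
  have eA : A 0 = (a, 0) := Prod.ext rfl hA2
  have eB : B 0 = (b, 0) := Prod.ext rfl hB2
  have hPa : projH H a 0 = A 0 := projH_of_mem hdef hz (K10_le_H10 _ _ hAK)
  have hPb : projH H b 0 = B 0 := projH_of_mem hdef hz (K10_le_H10 _ _ hBK)
  set W := (W₁ ∩ W₂) ∩ Φ.target
  have hW : IsOpen W := (hW₁.inter hW₂).inter Φ.open_target
  have h0W : (0 : Cn n) ∈ W := ⟨⟨h0W₁, h0W₂⟩, h.zero_target⟩
  have hA' := hA.mono (W' := W) fun y hy => hy.1.1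
  have hB' := hB.mono (W' := W) fun y hy => hy.1.2
  have hP : ∀ c, IsSection (chartImage M Φ) (H10 (chartImage M Φ)) W (projH H c) := fun c =>
    (isSection_projH hdef c).mono fun y hy => hy.2
  have hL : IsSection (chartImage M Φ) (CT (chartImage M Φ)) W (projT H v₃) :=
    (isSection_projT hdef v₃).mono fun y hy => hy.2
  have c3 := h.mem_CT_of_isKerVec h₃
  have c4 := h.mem_CT_of_isKerVec h₄
  have hL0 : projT H v₃ 0 = v₃ := projT_of_mem hdef hz c3
  have hZ : IsSection (chartImage M Φ) (H10 (chartImage M Φ)) W (fun y => B y - projH H b y) :=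
    ⟨hB'.1.sub (hP b).1, fun y hy => sub_mem (hB'.2 y hy) ((hP b).2 y hy)⟩
  have hLs : SmoothAt (projT H v₃) 0 := contDiffAt_projT hdef h.zero_target v₃
  set F : Cn n → ℂ := fun y => lev H y (projH H a y).1 (star (projH H b y).1)
  have sF : SmoothNear F 0 := smoothNear_lev hdef h.zero_target hW h0W (hP a) (hP b)
  have e1 : quarticVal H 0 A B v₃ v₄ = D2 F (projT H v₃) 0 v₄ := by
    rw [quarticVal, D2_lev_congr_left hdef hz hW h0W hA' (hP a) hB' hL hKB hPa.symm c4]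
    have e2 := D2_lev_eq_zero_of_vanishes hdef hz hW h0W (v := v₄) (hP a) hZ hL
      (by change B 0 - projH H b 0 = 0; rw [hPb, sub_self]) (fun j => ⟨?_, ?_⟩) c4
    · have e3 : (fun y => lev H y (projH H a y).1 (star (B y - projH H b y).1)) =
          fun y => lev H y (projH H a y).1 (star (B y).1) - F y := by
        funext y
        rw [fst_sub, star_sub, lev_sub_right]
      rw [e3, D2_sub (smoothNear_lev hdef h.zero_target hW h0W (hP a) hB') sF hLs] at e2
      exact sub_eq_zero.1 e2
    · rw [hPa]
      exact (lev_eq_zero_of_mem_K10 hdef hz hAK (dz_projH hdef h.zero_target _)).1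
    · rintro u (rfl | rfl)
      · rw [hL0]
        exact h.cderiv_lev_projH (eA ▸ hAK) j h₃
      · exact h.cderiv_lev_projH (eA ▸ hAK) j h₄
  -- the derivative of the projected field along the Levi kernel is tangent to the hypersurface
  have hw : cderiv (projT H v₃) 0 v₄ ∈ CT (chartImage M Φ) 0 := by
    have s1 := hdef.contDiffAtC h.zero_target
    have e2 : (fun y => cderiv (toC H) y (projT H v₃ y)) =ᶠ[𝓝 0] fun _ => 0 := by
      filter_upwards [Φ.open_target.mem_nhds h.zero_target] with y hy
      rw [projT, cderiv_sub_right, cderiv_smul_right, cderiv_toC_fst (hdef.contDiffAt hy), ← nrm,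
        smul_eq_mul, div_mul_cancel₀ _ (nrm_ne_zero hdef hy), sub_self]
    have e3 := cderiv_cderiv_field s1 hLs v₄
    rw [cderiv_congr e2, hL0, cderiv_congr (h.cderiv_graphFn h₃)] at e3
    have e4 : cderiv (fun y => cderiv (toC G) y v₃) 0 v₄ = 0 := by
      have e5 := iterCderiv_flat (f := toC G) (g := fun _ => (0 : ℂ)) (A := kerVars n q)
        h.smoothNear (SmoothNear.const 0 0) ?_ h₃ h₄
      · refine e5.trans ?_
        simp [iterCderiv, cderiv]
      · simp only [sub_zero]
        refine ⟨by simp [toC, h.map_zero], fun s hs => ⟨h.pd_eq_zero _, fun t ht => ?_⟩⟩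
        change pd t (pd s (toC G)) 0 = 0
        rw [h.pd_pd_eq (kerVars_subset_zVars ht) (kerVars_subset_zVars hs), if_neg]
        exact fun h1 => absurd h1.2 (not_le.2 (mem_kerVars.1 ht))
    rw [e4, zero_add] at e3
    rw [mem_CT_iff hdef hz, ← e3]
    simp [cderiv]
  have e2 : D2 F (projT H v₃) 0 v₄ = iterCderiv [v₄, v₃] F 0 := by
    rw [D2, cderiv_cderiv_field sF.at hLs, hL0, cderiv_lev_eq_zero hdef h.levPsd hz Φ.open_target
      h.zero_target
      (isSection_projH hdef a) (isSection_projH hdef b) (hPa ▸ hAK) (hPb ▸ hBK) hw, add_zero]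
    rfl
  have e3 : (fun y => lev H y a (star b)) =ᶠ[𝓝 0]
      iterCderiv [((a, 0) : CVec n), ((0, star b) : CVec n)] (toC H) := by
    filter_upwards [Φ.open_target.mem_nhds h.zero_target] with y hy
    exact (cderiv_cderiv_eq_lev (hdef.eventually hy) a (star b)).symm
  have sH : SmoothNear (toC H) 0 :=
    smoothNear_of_forall Φ.open_target h.zero_target fun y hy => hdef.contDiffAtC hy
  have hfl := flat_lev_projH_sub hdef h.zero_target (fun _ => swap_mem_kerVars)
    (h.flat_dz_kerVec (h.mem_K10.1 hAK).2)
    (h.flat_dz_kerVec (h.mem_K10.1 hBK).2)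
  rw [e1, e2, iterCderiv_flat sF ((sH.iterCderiv _).congr e3.symm) hfl h₃ h₄,
    (iterCderiv_congr e3 _).self_of_nhds, ← iterCderiv_append, eA, eB]
  have e4 : conjV ((b, 0) : CVec n) = (0, star b) := by simp [conjV]
  rw [e4]
  refine h.iterCderiv_graphFn rfl ?_
  have k1 := h.isKerVec_of_mem_K10 hAK
  have k2 := isKerVec_conjV (h.isKerVec_of_mem_K10 hBK)
  rw [eA] at k1
  rw [eB, e4] at k2
  simp [h₃, h₄, k1, k2]

end IsPscChart

end quarticChart

/-! ### Directional derivatives of homogeneous polynomials -/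

lemma pderiv_comm {σ : Type*} (s t : σ) (P : MvPolynomial σ ℂ) : pderiv s (pderiv t P) = pderiv t
    (pderiv s P) := by
  classical
  have h : ⁅pderiv (R := ℂ) s, pderiv t⁆ = 0 := MvPolynomial.derivation_ext fun i => by
      rw [Derivation.commutator_apply, pderiv_X, pderiv_X, single_apply, single_apply]
      split_ifs <;> simp
  have h1 := congrArg (fun D => D P) h
  exact sub_eq_zero.1 (by simpa [Derivation.commutator_apply] using h1)

/-- The directional derivative of a polynomial. -/
def dirDeriv (X : CVec n) (P : CPoly n) : CPoly n := ∑ s, MvPolynomial.C (coordOf s X) * pderiv s P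

lemma cderiv_evalC (X : CVec n) (P : CPoly n) (x : Cn n) : cderiv (evalC P) x X = evalC
    (dirDeriv X P) x := by
  rw [cderiv_eq_sum, dirDeriv, evalC, map_sum]
  refine sum_congr rfl fun s _ => ?_
  have h1 : cderiv (evalC P) x (coordV s) = evalC (pderiv s P) x := congrFun (pd_evalC P s) x
  rw [h1, smul_eq_mul, map_mul, eval_C]
  rfl

lemma isHomogeneous_dirDeriv (hP : P.IsHomogeneous k) (X : CVec n) : (dirDeriv X P).IsHomogeneous
    (k - 1) :=
  MvPolynomial.IsHomogeneous.sum _ _ _ fun _ _ => hP.pderiv.C_mul _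

/-- The components of a vector along some of the variables. -/
def restrictV (A : Finset (Idx n)) (X : CVec n) : CVec n := ∑ s ∈ A, coordOf s X • coordV s

lemma coordOf_restrictV (X : CVec n) (t : Idx n) : coordOf t (restrictV A X) = if t ∈ A then coordOf
    t X else 0 := by
  rw [restrictV, map_sum]
  simp [coordOf_coordV]

lemma conjV_restrictV (hA : ∀ s, s ∈ A ↔ s.swap ∈ A) (X : CVec n) : conjV (restrictV A X) =
    restrictV A (conjV X) :=
  ext_coordOf fun s => by
    rw [coordOf_conjV, coordOf_restrictV, coordOf_restrictV, coordOf_conjV]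
    by_cases hs : s ∈ A
    · rw [if_pos hs, if_pos ((hA s).1 hs)]
    · rw [if_neg hs, if_neg (mt (hA s).2 hs), star_zero]

lemma dirDeriv_restrictV (hP : ∀ s ∉ A, pderiv s P = 0) (X : CVec n) : dirDeriv (restrictV A X) P =
    dirDeriv X P := by
  refine sum_congr rfl fun s _ => ?_
  rw [coordOf_restrictV]
  split_ifs with hs
  · rfl
  · simp [hP s hs]

/-- The derivatives of a polynomial in some of the variables are polynomials, and only the
components of the directions along these variables matter. -/
lemma exists_iterCderiv_evalC (hP : P.IsHomogeneous k) (hA : ∀ s ∉ A, pderiv s P = 0)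
    (l : List (CVec n)) : ∃ Q : CPoly n, Q.IsHomogeneous (k - l.length) ∧
    (∀ s ∉ A, pderiv s Q = 0) ∧ iterCderiv l (evalC P) = evalC Q ∧ iterCderiv (l.map (restrictV A))
    (evalC P) = evalC Q := by
  induction l with
  | nil => exact ⟨P, hP, hA, rfl, rfl⟩
  | cons X l ih =>
    obtain ⟨Q, hQ, hQA, e1, e2⟩ := ih
    refine ⟨dirDeriv X Q, isHomogeneous_dirDeriv hQ X, fun s hs => ?_, ?_, ?_⟩
    · rw [dirDeriv, map_sum]
      refine sum_eq_zero fun t _ => ?_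
      rw [MvPolynomial.pderiv_C_mul, pderiv_comm, hQA s hs, map_zero, mul_zero]
    · change (fun x => cderiv (iterCderiv l (evalC P)) x X) = _
      rw [e1]
      exact funext fun x => cderiv_evalC X Q x
    · change (fun x => cderiv (iterCderiv (l.map (restrictV A)) (evalC P)) x (restrictV A X)) = _
      rw [e2, ← dirDeriv_restrictV hQA X]
      exact funext fun x => cderiv_evalC _ Q x

lemma cderiv_evalC_self (hP : P.IsHomogeneous k) (x : Cn n) : cderiv (evalC P) x (ofRealV x) = k *
    evalC P x := by
  rw [cderiv_evalC, evalC, evalC, dirDeriv, map_sum]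
  have h := congrArg (eval (Sum.elim x (star x))) hP.sum_X_mul_pderiv
  simp only [map_sum, map_mul, eval_X, nsmul_eq_mul, map_natCast] at h
  rw [← h]
  refine sum_congr rfl fun s _ => ?_
  rw [map_mul, eval_C, coordOf_ofRealV]

lemma evalC_eq_of_isHomogeneous_zero (hP : P.IsHomogeneous 0) (x : Cn n) : evalC P x = evalC P
    0 := by
  rw [MvPolynomial.totalDegree_eq_zero_iff_eq_C.1 (Nat.le_zero.1 hP.totalDegree_le)]
  simp [evalC]

/-- Euler's identity for a polynomial of degree two. -/
lemma iterCderiv_evalC_self (hP : P.IsHomogeneous 2) (x : Cn n) : iterCderiv [ofRealV x, ofRealV x]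
    (evalC P) 0 = 2 * evalC P x := by
  have h1 := isHomogeneous_dirDeriv hP (ofRealV x)
  have h2 := isHomogeneous_dirDeriv h1 (ofRealV x)
  have e : iterCderiv [ofRealV x, ofRealV x] (evalC P) =
      evalC (dirDeriv (ofRealV x) (dirDeriv (ofRealV x) P)) := by
    change (fun y => cderiv (fun y => cderiv (evalC P) y (ofRealV x)) y (ofRealV x)) = _
    rw [show (fun y => cderiv (evalC P) y (ofRealV x)) = _ from funext (cderiv_evalC _ P)]
    exact funext (cderiv_evalC _ _)
  have e2 : evalC (dirDeriv (ofRealV x) (dirDeriv (ofRealV x) P)) x = 2 * evalC P x := by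
    rw [← cderiv_evalC, cderiv_evalC_self h1, ← cderiv_evalC, cderiv_evalC_self hP]
    norm_num
  rw [e, ← e2, evalC_eq_of_isHomogeneous_zero h2 x]

/-! ### The normal form -/

section normalForm

variable [NeZero n]

namespace IsPscChart

variable (h : IsPscChart M p q Φ G)
include h

/-- The pairing of the quartic tensor with the contact covector `i dw`. -/
lemma tensor_eq (hy : y = 0) {τ : Tensor4 (chartImage M Φ) y}
    (hτ : IsQuarticTensor (chartImage M Φ) y τ) {w₄ w₃ t : CT (chartImage M Φ) y}
    {w₂ : K10 (chartImage M Φ) y} {w₁ : K01 (chartImage M Φ) y} (h₄ : IsKerVec q (w₄ : CVec n))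
    (h₃ : IsKerVec q (w₃ : CVec n)) (ht : Submodule.Quotient.mk t = τ w₄ w₃ w₂ w₁) : I *
    (t : CVec n).1 0 = iterCderiv [(w₄ : CVec n), w₃, w₂, w₁] (toC (quarticPart q G)) 0 := by
  subst hy
  obtain ⟨W, L₄, L₃, L₂, L₁, hWV, hW, h0W, hL₄, hL₃, hL₂, hK₂, hL₁, hK₁, e₄, e₃, e₂, e₁⟩ :=
    exists_fields h.isRealHypersurface (h.isPseudoconvex) h.zero_mem.1 Φ.open_target
      h.zero_target w₄ w₃ w₂ w₁
  have hdef := h.isDefiningFunction.mono hW hWV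
  have hz : (0 : Cn n) ∈ chartImage M Φ ∩ W := ⟨h.zero_mem.1, h0W⟩
  have h1 := hτ W _ L₄ L₃ L₂ L₁ hW h0W (isContactForm_cForm hdef) hL₄ hL₃ hL₂ hK₂ hL₁ hK₁
    w₄ w₃ w₂ w₁ e₄ e₃ e₂ e₁ t ht
  have h2 := cderiv_cderiv_leviFn hdef hz hW h0W (isContactForm_cForm hdef) hL₃ hL₂ hL₁ hK₁
    (e₄ ▸ w₄.2)
  rw [conjField_conjField] at h2
  rw [h2, kap_cForm hdef h0W, cForm_apply, h.dz_zero,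
    h.quarticVal_eq ⟨hK₂, W, hW, h0W, hL₂⟩ ⟨hK₁, W, hW, h0W, hL₁⟩ (e₃ ▸ h₃) (e₄ ▸ h₄)] at h1
  have e5 : conjV (conjField L₁ 0) = L₁ 0 := conjV_conjV _
  rw [e5, ← e₄, ← e₃, ← e₂, ← e₁, neg_mul_neg, ← mul_assoc, mul_neg, I_mul_I, neg_neg,
    one_mul] at h1
  exact h1

omit h

lemma contDiff_quarticPart : ContDiff ℝ ∞ (quarticPart q G) :=
  reCLM.contDiff.comp (contDiff_evalC _)

include h

lemma isRealQuarticPolynomial : IsRealQuarticPolynomial q (quarticPart q G) :=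
  ⟨_, isHomogeneous_taylorHom (A := kerVars n q) (p := 0) 4 (toC G),
    fun _ hs => mem_kerVars.1 (vars_taylorHom _ _ hs), fun x => congrFun h.toC_quarticPart x⟩

/-- The Levi form is nonnegative near the origin of the chart. -/
lemma leviNonneg : LeviNonneg (chartImage M Φ) Φ.target (cForm (graphFn G)) := by
  intro x hx W L hW hxW hL
  have hdef := h.isDefiningFunction.mono (Φ.open_target.inter hW) inter_subset_left
  have hx' : x ∈ chartImage M Φ ∩ (Φ.target ∩ W) := ⟨hx.1, hx.2, hxW⟩
  rw [I_mul_leviFn_conj hdef hdef.1 hx' hx'.2 (hL.mono inter_subset_right)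
    (isContactForm_cForm hdef), kap_cForm hdef hx'.2, ofReal_re]
  exact mul_nonneg (by simp) (h.levPsd x hx _ ((mem_H10_iff hdef hx').1 (hL.2 x ⟨hx.1, hxW⟩)).1)

/-- The quartic part of `G` is plurisubharmonic: its complex Hessian at `x` is half the value of the
quartic tensor on the vector `x`, twice, and this is nonnegative as a second derivative of the Levi
form at a minimum. -/
lemma isPlurisubharmonic : IsPlurisubharmonic (quarticPart q G) := by
  refine ⟨contDiff_quarticPart.of_le (mod_cast ENat.LEInfty.out), fun x a => ?_⟩
  change 0 ≤ (iterCderiv _ (toC (quarticPart q G)) x).re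
  have hsw : ∀ s : Idx n, s ∈ kerVars n q ↔ s.swap ∈ kerVars n q := fun s =>
    ⟨swap_mem_kerVars, fun hs => by simpa using swap_mem_kerVars hs⟩
  set r := restrictV (kerVars n q) with hr
  have hker : ∀ X, IsKerVec q (r X) := fun X s hs => by rw [hr, coordOf_restrictV, if_neg hs]
  set X : CVec n := ofRealV x
  have hP := isHomogeneous_taylorHom (A := kerVars n q) (p := (0 : Cn n)) 4 (toC G)
  obtain ⟨Q, hQ, -, e1, e2⟩ := exists_iterCderiv_evalC (A := kerVars n q) hP
    (fun s hs => pderiv_taylorHom_of_notMem hs _ _) [((a, 0) : CVec n), ((0, star a) : CVec n)]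
  obtain ⟨Q', -, -, e3, e4⟩ := exists_iterCderiv_evalC (A := kerVars n q) hP
    (fun s hs => pderiv_taylorHom_of_notMem hs _ _)
    ([X, X] ++ [((a, 0) : CVec n), ((0, star a) : CVec n)])
  have e5 : iterCderiv [r X, r X, r (a, 0), r (0, star a)] (toC (quarticPart q G)) 0 =
      2 * evalC Q x := by
    rw [← iterCderiv_evalC_self hQ, ← e1, ← iterCderiv_append, e3, ← e4, h.toC_quarticPart]
    rfl
  rw [h.toC_quarticPart, e1]
  have hc1 : conjV (r X) = r X := by rw [hr, conjV_restrictV hsw, conjV_ofRealV]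
  have hc2 : conjV (r (a, 0)) = r (0, star a) := by rw [hr, conjV_restrictV hsw]; simp [conjV]
  have hK : r (a, 0) ∈ K10 (chartImage M Φ) 0 := by
    refine h.mem_K10.2 ⟨funext fun j => ?_, fun j hj => ?_⟩
    · have := coordOf_restrictV (A := kerVars n q) ((a, 0) : CVec n) (inr j)
      simpa using this
    · exact hker _ (inl j) fun h1 => absurd (mem_kerVars.1 h1) (not_lt.2 hj)
  obtain ⟨τ, hτ⟩ := exists_isQuarticTensor h.isRealHypersurface (h.isPseudoconvex) h.zero_mem.1
  have hCT := h.mem_CT_of_isKerVec (hker X)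
  have hdef := h.isDefiningFunction
  obtain ⟨c, hc, hpair⟩ := hτ.nonneg h.isRealHypersurface (h.isPseudoconvex) h.zero_mem.1
    Φ.open_target h.zero_target (isContactForm_cForm hdef) h.leviNonneg (v₂ := ⟨r X, hCT⟩)
    (v₁ := ⟨r (a, 0), hK⟩) (w₁ := ⟨conjV (r (a, 0)), conjV_mem_K01 hK⟩) hc1 rfl
  obtain ⟨t, ht⟩ := mk_surjective _ (τ ⟨r X, hCT⟩ ⟨r X, hCT⟩ ⟨r (a, 0), hK⟩
    ⟨conjV (r (a, 0)), conjV_mem_K01 hK⟩)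
  have h1 := h.tensor_eq rfl hτ (hker X) (hker X) ht
  have h2 := hpair t ht
  rw [cForm_apply, h.dz_zero, neg_mul_neg, h1] at h2
  simp only [hc2, e5] at h2
  have h3 := congrArg Complex.re h2
  simp at h3
  linarith

lemma contDiffOn_remainder : ContDiffOn ℝ ∞ (remainder q G) Φ.target := by
  have h1 : ContDiff ℝ ∞ fun x : Cn n =>
      (∑ j : Fin n, if j ≠ 0 ∧ (j : ℕ) ≤ q then ‖x j‖ ^ 2 else 0) := by
    refine ContDiff.sum fun j _ => ?_
    split_ifs
    · exact (contDiff_norm_sq ℝ).comp (contDiff_apply ℝ ℂ j)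
    · exact contDiff_const
  exact (h.contDiffOn.sub h1.contDiffOn).sub contDiff_quarticPart.contDiffOn

omit h

lemma quarticPart_congr (hj : ∀ j, j ≠ 0 → x j = y j) : quarticPart q G x = quarticPart q G y := by
  refine congrArg Complex.re (MvPolynomial.eval₂Hom_congr' rfl (fun s hs _ => ?_) rfl)
  have h1 := ne_zero_of_lt (mem_kerVars.1 (vars_taylorHom _ _ hs))
  rcases s with j | j
  · exact hj j h1
  · exact congrArg star (hj j h1)

include h

lemma remainder_congr (h0 : (x 0).im = (y 0).im) (hj : ∀ j, j ≠ 0 → x j = y j) : remainder q G x =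
    remainder q G y := by
  rw [remainder, remainder, h.indep x y h0 hj, quarticPart_congr hj]
  have h1 : ∀ j : Fin n, (if j ≠ 0 ∧ (j : ℕ) ≤ q then ‖x j‖ ^ 2 else 0) =
      if j ≠ 0 ∧ (j : ℕ) ≤ q then ‖y j‖ ^ 2 else 0 := fun j => by
    split_ifs with hc
    · rw [hj j hc.1]
    · rfl
  rw [sum_congr rfl fun j _ => h1 j]

lemma isLittleOWeight_remainder : IsLittleOWeight (blockWeights n q) (toC (remainder q G)) :=
    fun l hl => by
  have e : (1 : ℝ≥0∞) = (4 : ℕ) * (4 : ℝ≥0∞)⁻¹ :=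
    (ENNReal.mul_inv_cancel (by norm_num) (by norm_num)).symm
  rw [e, weight_blockWeights_le] at hl
  exact h.iterCderiv_remainder_eq_zero l hl

/-- The pairing of the quartic tensor of `M` with the contact covector `i dw`. -/
lemma pairsTo (hτ : IsQuarticTensor M p τ) {v₄ v₃ : CT M p} (v₂ : K10 M p) (v₁ : K01 M p)
    (h₄ : (v₄ : CVec n) ∈ CK M p) (h₃ : (v₃ : CVec n) ∈ CK M p) : PairsTo
    (fun X => I * (pushV Φ p X).1 0) (τ v₄ v₃ v₂ v₁) (iterCderiv
    [pushV Φ p v₄, pushV Φ p v₃, pushV Φ p v₂, pushV Φ p v₁] (toC (quarticPart q G)) 0) := by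
  intro t ht
  have hM' := h.isRealHypersurface
  have h10 : ∀ {v}, v ∈ K10 M p → pushV Φ p v ∈ K10 (chartImage M Φ) (Φ p) := fun hv =>
    pushV_mem_K10 h.isCRMap h.hypersurface hM' h.mem_source h.mem hv
  have h01 : ∀ {v}, v ∈ K01 M p → pushV Φ p v ∈ K01 (chartImage M Φ) (Φ p) := fun {v} hv => by
    change conjV (pushV Φ p v) ∈ K10 (chartImage M Φ) (Φ p)
    rw [conjV_pushV]
    exact h10 hv
  have hCK : ∀ {v}, v ∈ CK M p → IsKerVec q (pushV Φ p v) := fun {v} hv => by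
    obtain ⟨a, ha, c, hc, rfl⟩ := mem_sup.1 hv
    refine h.isKerVec_of_mem_CK (h.map_eq ▸ ?_)
    rw [pushV_add]
    exact add_mem_sup (h10 ha) (h01 hc)
  have hCT : ∀ v : CT M p, pushV Φ p v ∈ CT (chartImage M Φ) (Φ p) := fun v =>
    pushV_mem_CT h.isCRMap h.mem_source v.2
  obtain ⟨τ', hτ'⟩ := exists_isQuarticTensor hM' (h.isPseudoconvex)
    ((h.isCRMap.2 p h.mem_source).2 h.mem)
  exact h.tensor_eq h.map_eq hτ' (w₄ := ⟨_, hCT v₄⟩) (w₃ := ⟨_, hCT v₃⟩)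
    (t := ⟨_, hCT t⟩) (w₂ := ⟨_, h10 v₂.2⟩) (w₁ := ⟨_, h01 v₁.2⟩) (hCK h₄) (hCK h₃)
    (hτ.push h.hypersurface h.pseudoconvex h.mem hM' h.isCRMap h.mem_source hτ' rfl rfl rfl rfl rfl
      ht)

end IsPscChart

/-- Near a point of Levi rank `q`, a pseudoconvex hypersurface has a graph chart in which the Levi
form is nonnegative. -/
lemma exists_isPscChart (hM : IsRealHypersurface M) (hpsc : IsPseudoconvex M) (hp : p ∈ M)
    (hq : leviRank M p = q) : ∃ Φ G, IsPscChart M p q Φ G := by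
  obtain ⟨U, ρ, hpU, hdef, hpsd⟩ := exists_levPsd hM hp (hpsc.localPsc hp)
  obtain ⟨Φ, G, h, hU, hdz⟩ := exists_isGraphChart hM hdef hpsd ⟨hp, hpU⟩ hq
  obtain ⟨V, -, hV, h0V, hV'⟩ := h.exists_levPsd hdef hpsd hU hdz
  have h' := h.restr hV h0V
  refine ⟨_, G, h', fun x hx a ha => hV' x ⟨⟨hx.1.1, hx.2.1⟩, hx.2.2⟩ a ha, hpsc⟩

end normalForm

/-! ### Vanishing orders along curves -/

section orders

open Asymptotics Filter

/-- A function all of whose Taylor terms have weight at least `d` is `O(tᵈ)` on the boxes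
`|x_j| ≤ t ^ w_j`. -/
lemma exists_bound_of_weight (w : Fin n → ℕ) (hw : ∀ j, 1 ≤ w j) (d : ℕ) (hf : SmoothNear f 0)
    (h : ∀ l : List (Idx n), (l.map fun s => w (varIndex s)).sum < d → iterCderiv (l.map coordV)
      f 0 = 0) :
    ∃ C, ∀ᶠ t in 𝓝[≥] (0 : ℝ), ∀ x, (∀ j, ‖x j‖ ≤ t ^ w j) → ‖f x‖ ≤ C * t ^ d := by
  have hsmall : ∀ {P : Cn n → Prop}, (∀ᶠ x in 𝓝 0, P x) → ∀ᶠ t in 𝓝[≥] (0 : ℝ),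
      0 ≤ t ∧ t ≤ 1 ∧ ∀ x, (∀ j, ‖x j‖ ≤ t ^ w j) → P x := by
    intro P hP
    obtain ⟨ε, hε, hball⟩ := Metric.eventually_nhds_iff.1 hP
    filter_upwards [self_mem_nhdsWithin, mem_nhdsWithin_of_mem_nhds (gt_mem_nhds hε),
      mem_nhdsWithin_of_mem_nhds (gt_mem_nhds one_pos)] with t h0 h1 h2
    refine ⟨h0, h2.le, fun x hx => hball ?_⟩
    rw [dist_zero_right]
    refine lt_of_le_of_lt ((pi_norm_le_iff_of_nonneg h0).2 fun j => (hx j).trans ?_) h1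
    exact pow_le_of_le_one h0 h2.le (by have := hw j; omega)
  induction d using Nat.strong_induction_on generalizing f with
  | _ d ih =>
    rcases d.eq_zero_or_pos with rfl | hd
    · refine ⟨‖f 0‖ + 1, ?_⟩
      filter_upwards [hsmall (hf.at.continuousAt.norm.eventually (gt_mem_nhds
        (lt_add_one ‖f 0‖)))] with t ht x hx
      simpa using (ht.2.2 x hx).le
    · have h1 : ∀ s : Idx n, ∃ C, ∀ᶠ t in 𝓝[≥] (0 : ℝ), ∀ x, (∀ j, ‖x j‖ ≤ t ^ w j) →
          ‖pd s f x‖ ≤ C * t ^ (d - w (varIndex s)) := fun s => by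
        refine ih _ (by have := hw (varIndex s); omega) (hf.pd s) fun l hl => ?_
        have := h (l ++ [s]) (by simp; omega)
        rwa [map_append, iterCderiv_append] at this
      choose C hC using h1
      refine ⟨∑ s, C s, ?_⟩
      filter_upwards [hsmall hf.diff, Filter.eventually_all.2 hC] with t ht hCt x hx
      obtain ⟨h0, h1, ht⟩ := ht
      have hseg : ∀ r ∈ Set.Icc (0 : ℝ) 1, ∀ j, ‖(r • x) j‖ ≤ t ^ w j := fun r hr j => by
        rw [Pi.smul_apply, norm_smul, Real.norm_of_nonneg hr.1]
        exact (mul_le_of_le_one_left (norm_nonneg _) hr.2).trans (hx j)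
      have h2 := norm_image_sub_le_of_norm_deriv_le_segment_01' (f := fun r : ℝ => f (r • x))
        (f' := fun r => cderiv f (r • x) (ofRealV x)) (C := (∑ s, C s) * t ^ d)
        (fun r hr => by
          rw [cderiv_ofRealV]
          have h3 : HasDerivAt (fun r : ℝ => r • x) x r := by
            simpa using (hasDerivAt_id r).smul_const x
          exact ((ht _ (hseg r hr)).hasFDerivAt.comp_hasDerivAt r h3).hasDerivWithinAt)
        (fun r hr => by
          rw [cderiv_eq_sum, sum_mul]
          refine norm_sum_le_of_le _ fun s _ => ?_
          rw [norm_smul, coordOf_ofRealV]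
          have h4 : ‖Sum.elim x (star x) s‖ ≤ t ^ w (varIndex s) := by
            rcases s with j | j
            · exact hx j
            · exact (norm_star (x j)).trans_le (hx j)
          have h5 := hCt s (r • x) (hseg r ⟨hr.1, hr.2.le⟩)
          refine (mul_le_mul h4 h5 (norm_nonneg _) (pow_nonneg h0 _)).trans ?_
          rw [mul_left_comm, ← pow_add]
          have h6 : 0 ≤ C s * t ^ (d - w (varIndex s)) := (norm_nonneg _).trans h5
          rcases h0.eq_or_lt with rfl | h0'
          · rw [zero_pow (by have := hw (varIndex s); omega), zero_pow (by omega)]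
          · exact mul_le_mul_of_nonneg_left (pow_le_pow_of_le_one h0 h1 (by omega))
              (nonneg_of_mul_nonneg_left h6 (pow_pos h0' _)))
      have h7 : f 0 = 0 := h [] (by simpa using hd)
      simpa [h7] using h2

/-- The order along a curve of a function all of whose Taylor terms have weight at least `d`. -/
lemma isBigO_comp_of_weight (w : Fin n → ℕ) (hw : ∀ j, 1 ≤ w j) {d : ℕ} (hf : SmoothNear f 0)
    (h : ∀ l : List (Idx n), (l.map fun s => w (varIndex s)).sum < d → iterCderiv (l.map coordV)
      f 0 = 0)
    {δ : ℂ → Cn n} (hδ : ∀ j, (fun t => δ t j) =O[𝓝 0] fun t => ‖t‖ ^ w j) : (fun t => f (δ t))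
    =O[𝓝 0] fun t => ‖t‖ ^ d := by
  obtain ⟨C, hC⟩ := exists_bound_of_weight w hw d hf h
  choose K hK using fun j => (hδ j).bound
  set L := 1 + ∑ j, |K j|
  have hL1 : 1 ≤ L := le_add_of_nonneg_right (Finset.sum_nonneg fun _ _ => abs_nonneg _)
  have hL : ∀ j, K j ≤ L := fun j => (le_abs_self _).trans
    ((Finset.single_le_sum (f := fun j => |K j|) (fun _ _ => abs_nonneg _) (mem_univ j)).trans
      (le_add_of_nonneg_left zero_le_one))
  have ht : Tendsto (fun t : ℂ => L * ‖t‖) (𝓝 0) (𝓝[≥] 0) := by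
    refine tendsto_nhdsWithin_iff.2 ⟨?_, Eventually.of_forall fun t =>
      Set.mem_Ici.2 (by positivity)⟩
    exact (Continuous.tendsto' (by fun_prop) _ _ (by simp))
  refine IsBigO.of_bound (C * L ^ d) ?_
  filter_upwards [ht.eventually hC, Filter.eventually_all.2 hK] with t h1 h2
  rw [norm_pow, norm_norm, mul_assoc, ← mul_pow]
  refine h1 _ fun j => (h2 j).trans ?_
  rw [norm_pow, norm_norm, mul_pow]
  exact mul_le_mul_of_nonneg_right ((hL j).trans (le_self_pow₀ hL1 (by have := hw j; omega)))
    (by positivity)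

lemma le_vanishingOrder {F : Type*} [NormedAddCommGroup F] {f : ℂ → F}
    (h : f =O[𝓝 0] fun t => ‖t‖ ^ m) : (m : ℕ∞) ≤ vanishingOrder f := le_sSup ⟨m, rfl, h⟩

lemma isBigO_pow_of_le (h : k ≤ m) : (fun t : ℂ => ‖t‖ ^ m) =O[𝓝 0] fun t => ‖t‖ ^ k := by
  refine IsBigO.of_bound 1 ?_
  filter_upwards [Metric.ball_mem_nhds (0 : ℂ) one_pos] with t ht
  rw [mem_ball_zero_iff] at ht
  simpa using pow_le_pow_of_le_one (norm_nonneg t) ht.le h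

lemma vanishingOrder_le {F : Type*} [NormedAddCommGroup F] {f : ℂ → F}
    (h : ¬ f =O[𝓝 0] fun t => ‖t‖ ^ (m + 1)) : vanishingOrder f ≤ m := by
  refine sSup_le ?_
  rintro _ ⟨k, rfl, hk⟩
  by_contra hkm
  exact h (hk.trans (isBigO_pow_of_le (by exact_mod_cast not_le.1 hkm)))

lemma isBigO_pow_smul {F : Type*} [NormedAddCommGroup F] [NormedSpace ℂ F] {η : ℂ → F}
    (hη : ContinuousAt η 0) : (fun t => t ^ k • η t) =O[𝓝 0] fun t => ‖t‖ ^ k := by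
  have h : (fun t : ℂ => t ^ k) =O[𝓝 0] fun t => ‖t‖ ^ k :=
    IsBigO.of_bound 1 (Eventually.of_forall fun t => by simp)
  simpa using h.smul (hη.tendsto.isBigO_one ℝ)

lemma not_isBigO_pow_succ {F : Type*} [NormedAddCommGroup F] [NormedSpace ℂ F] {η : ℂ → F}
    (hη : ContinuousAt η 0) (h : (fun t => t ^ k • η t) =O[𝓝 0] fun t => ‖t‖ ^ (k + 1)) : η 0 =
    0 := by
  obtain ⟨C, hC⟩ := h.bound
  have h1 : ∀ᶠ t in 𝓝[≠] (0 : ℂ), ‖η t‖ ≤ C * ‖t‖ := by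
    filter_upwards [mem_nhdsWithin_of_mem_nhds hC, self_mem_nhdsWithin] with t ht ht0
    have h2 : 0 < ‖t‖ ^ k := pow_pos (norm_pos_iff.2 ht0) k
    rw [norm_smul, norm_pow, norm_pow, norm_norm, pow_succ, mul_left_comm] at ht
    exact le_of_mul_le_mul_left ht h2
  have h2 := le_of_tendsto_of_tendsto (hη.norm.tendsto.mono_left nhdsWithin_le_nhds)
    ((Continuous.tendsto' (by fun_prop) (0 : ℂ) (0 : ℝ) (by simp) :
      Tendsto (fun t : ℂ => C * ‖t‖) (𝓝 0) (𝓝 0)).mono_left nhdsWithin_le_nhds) h1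
  exact norm_le_zero_iff.1 h2

lemma isBigO_re (g : ℂ → ℂ) : (fun t => (g t).re) =O[𝓝 0] g :=
  IsBigO.of_bound 1 (Eventually.of_forall fun t => by simpa using Complex.abs_re_le_norm (g t))

/-- A holomorphic function whose real part is `c |t| ^ N` up to higher order vanishes to higher
order, and `c = 0`. -/
lemma isBigO_of_re {F : ℂ → ℂ} (hF : AnalyticAt ℂ F 0) (h0 : F 0 = 0) {N : ℕ} {c : ℝ}
    (h : (fun t => (F t).re + c * ‖t‖ ^ N) =O[𝓝 0] fun t => ‖t‖ ^ (N + 1)) : c = 0 ∧ F =O[𝓝 0] fun t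
    => ‖t‖ ^ (N + 1) := by
  have hfin : F =O[𝓝 0] (fun t => ‖t‖ ^ (N + 1)) →
      c = 0 ∧ F =O[𝓝 0] fun t => ‖t‖ ^ (N + 1) := fun h1 => ⟨?_, h1⟩
  swap
  · have h2 := h.sub ((isBigO_re F).trans h1)
    have h3 : (fun t : ℂ => t ^ N • (c : ℂ)) =O[𝓝 0] fun t => ‖t‖ ^ (N + 1) := by
      refine IsBigO.trans (IsBigO.of_bound 1 (Eventually.of_forall fun t => ?_)) h2
      simp [mul_comm]
    exact_mod_cast not_isBigO_pow_succ continuousAt_const h3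
  by_cases hz : ∀ᶠ t in 𝓝 0, F t = 0
  · exact hfin ((isBigO_zero _ _).congr' (hz.mono fun _ h => h.symm) EventuallyEq.rfl)
  obtain ⟨m, b, hb, hb0, hFb⟩ := hF.exists_eventuallyEq_pow_smul_nonzero_iff.2 hz
  simp only [sub_zero] at hFb
  by_cases hm : N + 1 ≤ m
  · exact hfin (((isBigO_pow_smul hb.continuousAt).congr' (hFb.mono fun _ h => h.symm)
      EventuallyEq.rfl).trans
      (isBigO_pow_of_le hm))
  have hm0 : m ≠ 0 := by
    rintro rfl
    exact hb0 (by simpa [h0] using hFb.self_of_nhds.symm)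
  -- compare the leading terms along the rays
  have key : ∀ ζ : ℂ, ‖ζ‖ = 1 → (ζ * b 0).re + (if m = N then c else 0) = 0 := by
    intro ζ hζ
    obtain ⟨z, hz⟩ := IsAlgClosed.exists_pow_nat_eq ζ (Nat.pos_of_ne_zero hm0)
    have hz1 : ‖z‖ = 1 := (pow_eq_one_iff_of_nonneg (norm_nonneg z) hm0).1 (by
      rw [← norm_pow, hz, hζ])
    have ht : Tendsto (fun s : ℝ => (s : ℂ) * z) (𝓝[>] 0) (𝓝 0) :=
      (Continuous.tendsto' (by fun_prop) _ _ (by simp)).mono_left nhdsWithin_le_nhds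
    have h1 : (fun s : ℝ => ((ζ * b (s * z)).re + c * s ^ (N - m))) =O[𝓝[>] 0] fun s : ℝ => s := by
      obtain ⟨C, hC⟩ := h.bound
      refine IsBigO.of_bound |C| ?_
      filter_upwards [ht.eventually hC, ht.eventually hFb, self_mem_nhdsWithin,
        mem_nhdsWithin_of_mem_nhds (gt_mem_nhds one_pos)] with s h2 h3 hs hs1
      have hs : 0 < s := hs
      have hn : ‖(s : ℂ) * z‖ = s := by rw [norm_mul, hz1, mul_one, Complex.norm_of_nonneg hs.le]
      have hpow : s ^ N = s ^ m * s ^ (N - m) := by rw [← pow_add]; congr 1; omega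
      have e : (F (s * z)).re + c * s ^ N = s ^ m * ((ζ * b (s * z)).re + c * s ^ (N - m)) := by
        rw [h3, smul_eq_mul, mul_pow, hz, mul_assoc, ← ofReal_pow, re_ofReal_mul, hpow]
        ring
      rw [hn, e, norm_mul, Real.norm_of_nonneg (pow_nonneg hs.le m), Real.norm_of_nonneg
        (pow_nonneg hs.le _), pow_succ, hpow] at h2
      have h4 : s ^ m * ‖(ζ * b (s * z)).re + c * s ^ (N - m)‖ ≤ s ^ m * (|C| * ‖s‖) := by
        refine h2.trans ?_
        rw [Real.norm_of_nonneg hs.le, mul_assoc, mul_left_comm]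
        refine mul_le_mul_of_nonneg_left ?_ (pow_nonneg hs.le m)
        refine mul_le_mul (le_abs_self C) ?_ (by positivity) (abs_nonneg C)
        exact mul_le_of_le_one_left hs.le (pow_le_one₀ hs.le hs1.le)
      exact le_of_mul_le_mul_left h4 (pow_pos hs m)
    have h2 : Tendsto (fun s : ℝ => ((ζ * b (s * z)).re + c * s ^ (N - m))) (𝓝[>] 0)
        (𝓝 ((ζ * b 0).re + c * 0 ^ (N - m))) := by
      refine Tendsto.add (continuous_re.continuousAt.tendsto.comp
        (tendsto_const_nhds.mul (hb.continuousAt.tendsto.comp ht))) ?_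
      exact (Continuous.tendsto (by fun_prop) _).mono_left nhdsWithin_le_nhds
    have h3 := tendsto_nhds_unique h2 (h1.trans_tendsto
      ((tendsto_id (α := ℝ)).mono_left nhdsWithin_le_nhds))
    refine Eq.trans ?_ h3
    by_cases hmN : m = N
    · simp [hmN]
    · rw [if_neg hmN, zero_pow (by omega), mul_zero]
  have hn : ‖b 0‖ ≠ 0 := norm_ne_zero_iff.2 hb0
  have hre : ((star (b 0) / ‖b 0‖) * b 0).re = ‖b 0‖ := by
    rw [div_mul_eq_mul_div, star_def, conj_mul', ← ofReal_pow,
      ← Complex.ofReal_div, ofReal_re, pow_two, mul_div_assoc, div_self hn, mul_one]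
  have hu : ‖star (b 0) / (‖b 0‖ : ℂ)‖ = 1 := by
    rw [norm_div, norm_star, Complex.norm_real, norm_norm, div_self hn]
  have k1 := key _ hu
  have k2 := key (-(star (b 0) / ‖b 0‖)) (by rw [norm_neg, hu])
  rw [neg_mul, neg_re] at k2
  rw [hre] at k1 k2
  exact absurd (by linarith) hn

end orders

/-! ### Bounds for the type -/

section types

open Asymptotics Filter

lemma Flat.iterCderiv (h : Flat univ k f p) (l : List (Idx n)) (hl : l.length ≤ k) : iterCderiv
    (l.map coordV) f p = 0 := by
  induction l using reverseRecOn generalizing f k with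
  | nil => exact h.zero_apply
  | append_singleton l s ih =>
    rw [List.length_append, List.length_singleton] at hl
    obtain ⟨k, rfl⟩ := Nat.exists_eq_add_of_le' (le_trans (Nat.le_add_left 1 _) hl)
    rw [map_append, iterCderiv_append]
    exact ih (h.2 s (mem_univ s)) (by omega)

variable (h : IsDefiningFunction M U ρ) (hp : p ∈ M ∩ U)
include h hp

/-- The expansion of a defining function along a holomorphic curve: up to higher order it is the sum
of the real part of a holomorphic function and of the Levi form. -/
lemma exists_curve_expansion (hk : 1 ≤ k) {η : ℂ → Cn n} (hη : AnalyticAt ℂ η 0) : ∃ F : ℂ → ℂ,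
    AnalyticAt ℂ F 0 ∧ F 0 = 0 ∧ (fun t => ρ (t ^ k • η t + p) -
    ((F t).re + (lev ρ p (η 0) (star (η 0))).re * ‖t‖ ^ (2 * k))) =O[𝓝 0]
    (fun t => ‖t‖ ^ (2 * k + 1)) ∧ (fun t => F t - t ^ k • (2 * dz ρ p (η t))) =O[𝓝 0] fun t => ‖t‖
    ^ (k + 1) := by
  set f : Cn n → ℂ := fun y => toC ρ (y - -p)
  have sf : SmoothNear f 0 := by
    have h1 : Tendsto (fun y : Cn n => y - -p) (𝓝 0) (𝓝 p) :=
      Continuous.tendsto' (by fun_prop) _ _ (by simp)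
    filter_upwards [h1.eventually (h.eventually hp.2)] with y hy
    exact (contDiffAt_toC hy).comp y (contDiffAt_id.sub contDiffAt_const)
  have hr := h.eventually hp.2
  have sr : SmoothNear (toC ρ) p := hr.mono fun _ h => contDiffAt_toC h
  have hcs : ∀ X Y, cderiv (fun y => cderiv f y X) 0 Y =
      cderiv (fun y => cderiv (toC ρ) y X) p Y := fun X Y => by
    have e : (fun y => cderiv f y X) = fun y => cderiv (toC ρ) (y - -p) X :=
      funext fun y => cderiv_comp_sub _ _ _ _
    rw [e]
    exact (cderiv_comp_sub (fun y => cderiv (toC ρ) y X) _ _ _).trans (by simp)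
  have hd : ∀ X, DifferentiableAt ℝ (fun y => cderiv f y X) 0 := fun X =>
    (contDiffAt_cderiv_const X sf.at).diffAt
  set c : Fin n → Fin n → ℂ := fun j i =>
    cderiv (fun y => cderiv (toC ρ) y (coordV (inl j))) p (coordV (inl i))
  set Q : Cn n → ℂ := fun x => ∑ j, ∑ i, x j * x i * c j i
  have hT : ∀ x, evalC (taylorPoly univ 0 2 f) x =
      ((2 * dz ρ p x + Q x).re : ℂ) + lev ρ p x (star x) := by
    intro x
    have e2 : ∀ g : Cn n → ℂ, evalC (taylorHom univ 0 0 g) x = g 0 := fun g => by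
      simp [evalC, taylorHom]
    have e3 : ∀ g : Cn n → ℂ, evalC (taylorHom univ 0 1 g) x = cderiv g 0 (ofRealV x) := fun g => by
      rw [evalC_taylorHom_succ, cderiv_eq_sum]; simp [e2, coordOf_ofRealV, pd]
    have e4 : evalC (taylorHom univ 0 2 f) x =
        2⁻¹ * cderiv (fun y => cderiv f y (ofRealV x)) 0 (ofRealV x) := by
      rw [evalC_taylorHom_succ, cderiv_eq_sum]
      simp only [e3, coordOf_ofRealV, cderiv_cderiv_comm sf.at (ofRealV x), smul_eq_mul]
      norm_num
    have e5 : cderiv f 0 (ofRealV x) = 2 * (dz ρ p x).re := by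
      refine (cderiv_comp_sub _ _ _ _).trans ?_
      rw [zero_sub, neg_neg, cderiv_toC_eq hr.self_of_nhds]
      simp [ofRealV, add_conj]
    -- the second derivatives of types `(2, 0)`, `(1, 1)` and `(0, 2)`
    have e6 : cderiv (fun y => cderiv (toC ρ) y (x, 0)) p (x, 0) = Q x := by
      rw [cderiv_fst_eq_sum]
      exact sum_congr rfl fun j _ => by
        rw [cderiv_cderiv_comm sr.at, cderiv_fst_eq_sum, smul_eq_mul, mul_sum]
        exact sum_congr rfl fun i _ => (mul_assoc _ _ _).symm
    have e7 : cderiv (fun y => cderiv (toC ρ) y (0, star x)) p (0, star x) = star (Q x) := by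
      have e : (fun y => cderiv (toC ρ) y (0, star x)) =ᶠ[𝓝 p]
          fun y => star (cderiv (toC ρ) y (x, 0)) := hr.mono fun y hy => by
        change _ = star (cderiv _ y (x, 0))
        rw [← cderiv_conjV_toC hy]; simp [conjV]
      rw [cderiv_congr e, cderiv_conj (contDiffAt_cderiv_const _ sr.at).diffAt, ← e6]
      simp [conjV]
    have e8 := cderiv_cderiv_eq_lev hr x (star x)
    have e9 : ofRealV x = (x, 0) + (0, star x) := by simp [ofRealV]
    have e0 : f 0 = 0 := by simp [f, toC, (h.2.2.2 p hp.2).1 hp.1]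
    have e1 : evalC (taylorPoly univ 0 2 f) x =
        evalC (taylorHom univ 0 0 f) x + evalC (taylorHom univ 0 1 f) x +
          evalC (taylorHom univ 0 2 f) x := by
      simp [evalC, taylorPoly, Finset.sum_range_succ]
    rw [e1, e2, e3, e4, e5, e0, e9]
    simp only [cderiv_add_right]
    simp only [cderiv_fun_add (hd _) (hd _), hcs, e6, e7, e8, cderiv_cderiv_comm sr.at (x, 0) (0,
      star x)]
    apply Complex.ext <;> simp <;> ring
  set δ : ℂ → Cn n := fun t => t ^ k • η t
  have hδO : ∀ j, (fun t => δ t j) =O[𝓝 0] fun t => ‖t‖ ^ k := fun j =>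
    isBigO_pow_smul (analyticAt_pi_iff.1 hη j).continuousAt
  have hflat := flat_sub_taylorPoly (A := univ) 2 sf
  have hO : (fun t => f (δ t) - evalC (taylorPoly univ 0 2 f) (δ t - 0)) =O[𝓝 0]
      fun t => ‖t‖ ^ (3 * k) :=
    isBigO_comp_of_weight (fun _ => k) (fun _ => hk) (f := fun x => f x - _)
      (sf.sub (smoothNear_evalC_sub _ _ _)) (fun l hl => hflat.iterCderiv l (by
        have : l.length * k < 3 * k := by simpa using hl
        have := lt_of_mul_lt_mul_right this (Nat.zero_le k)
        omega)) hδO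
  have hηj : ∀ j, AnalyticAt ℂ (fun t => η t j) 0 := analyticAt_pi_iff.1 hη
  have hQan : AnalyticAt ℂ (fun t => Q (η t)) 0 :=
    analyticAt_fun_sum _ fun j _ => analyticAt_fun_sum _ fun i _ =>
      ((hηj j).mul (hηj i)).mul analyticAt_const
  have hdzan : AnalyticAt ℂ (fun t => dz ρ p (η t)) 0 :=
    analyticAt_fun_sum _ fun j _ => (hηj j).mul analyticAt_const
  have hQδ : ∀ t, Q (δ t) = t ^ (2 * k) • Q (η t) := fun t => by
    simp only [Q, δ, Pi.smul_apply, smul_eq_mul, mul_sum]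
    exact sum_congr rfl fun j _ => sum_congr rfl fun i _ => by ring
  have hdzδ : ∀ t, dz ρ p (δ t) = t ^ k * dz ρ p (η t) := fun t => dz_smul _ _
  have hdiff : (fun t => lev ρ p (η t) (star (η t)) - lev ρ p (η 0) (star (η 0))) =O[𝓝 0]
      fun t => ‖t‖ := by
    have h1 : DifferentiableAt ℝ (fun t => lev ρ p (η t) (star (η t))) 0 := by
      have h2 : ∀ j, DifferentiableAt ℝ (fun t => η t j) 0 := fun j =>
        (hηj j).differentiableAt.restrictScalars ℝ
      exact DifferentiableAt.fun_sum fun j _ => DifferentiableAt.fun_sum fun i _ =>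
        ((h2 j).mul (h2 i).star).mul_const _
    simpa using h1.isBigO_sub.norm_right
  refine ⟨fun t => 2 * dz ρ p (δ t) + Q (δ t), ?_, ?_, ?_, ?_⟩
  · simp only [hQδ, hdzδ]
    exact (analyticAt_const.mul ((analyticAt_id.pow k).mul hdzan)).add
      ((analyticAt_id.pow (2 * k)).smul hQan)
  · have h0 : δ 0 = 0 := by simp [δ, zero_pow (by omega : k ≠ 0)]
    simp [h0, Q, dz]
  · have h2 : (fun t : ℂ => (‖t‖ ^ (2 * k) : ℝ) *
        (lev ρ p (η t) (star (η t)) - lev ρ p (η 0) (star (η 0))).re) =O[𝓝 0]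
          fun t => ‖t‖ ^ (2 * k + 1) := by
      simpa only [pow_succ] using (isBigO_refl (fun t : ℂ => ‖t‖ ^ (2 * k)) (𝓝 0)).mul
        ((isBigO_re _).trans hdiff)
    have h3 : (fun t => (f (δ t) - evalC (taylorPoly univ 0 2 f) (δ t - 0)).re) =O[𝓝 0]
        fun t => ‖t‖ ^ (2 * k + 1) :=
      ((isBigO_re _).trans hO).trans (isBigO_pow_of_le (by omega))
    refine (h3.add h2).congr_left fun t => ?_
    have e : lev ρ p (δ t) (star (δ t)) = (‖t‖ ^ (2 * k) : ℝ) * lev ρ p (η t) (star (η t)) := by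
      simp only [δ, star_smul, lev_smul_left, lev_smul_right]
      rw [← mul_assoc, star_pow, ← mul_pow, star_def, conj_mul', ← pow_mul]
      push_cast; rfl
    rw [sub_zero, hT, e, sub_re, add_re, ofReal_re, re_ofReal_mul, sub_re]
    simp only [δ, sub_neg_eq_add, ofReal_re]
    ring
  · refine ((isBigO_pow_smul hQan.continuousAt).trans (isBigO_pow_of_le (by omega :
      k + 1 ≤ 2 * k))).congr_left fun t => ?_
    change _ = 2 * dz ρ p (δ t) + Q (δ t) - _
    rw [← hQδ, hdzδ, smul_eq_mul]
    ring

/-- The direction of a curve with order of contact larger than its own order is tangent to `M`. -/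
lemma dz_eq_zero_of_isBigO (hk : 1 ≤ k) {η : ℂ → Cn n} (hη : AnalyticAt ℂ η 0)
    (hO : (fun t => ρ (t ^ k • η t + p)) =O[𝓝 0] fun t => ‖t‖ ^ (k + 1)) : dz ρ p (η 0) = 0 := by
  obtain ⟨F, hF, hF0, h1, h2⟩ := exists_curve_expansion h hp hk hη
  have h3 : (fun t : ℂ => (lev ρ p (η 0) (star (η 0))).re * ‖t‖ ^ (2 * k)) =O[𝓝 0]
      fun t => ‖t‖ ^ (k + 1) := (isBigO_pow_of_le (by omega)).const_mul_left _
  have h4 := (isBigO_of_re hF hF0 (c := 0) (((hO.sub (h1.trans (isBigO_pow_of_le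
    (by omega : k + 1 ≤ 2 * k + 1)))).sub h3).congr_left fun t => by ring)).2
  have h5 : AnalyticAt ℂ (fun t => 2 * dz ρ p (η t)) 0 := analyticAt_const.mul
    (analyticAt_fun_sum _ fun j _ => (analyticAt_pi_iff.1 hη j).mul analyticAt_const)
  have h6 := not_isBigO_pow_succ (k := k) h5.continuousAt ((h4.sub h2).congr_left fun t => by ring)
  simpa using h6

/-- The direction of a curve with order of contact larger than twice its own order is a null vector
of the Levi form. -/
lemma lev_eq_zero_of_isBigO (hk : 1 ≤ k) {η : ℂ → Cn n} (hη : AnalyticAt ℂ η 0)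
    (hO : (fun t => ρ (t ^ k • η t + p)) =O[𝓝 0] fun t => ‖t‖ ^ (2 * k + 1)) :
    (lev ρ p (η 0) (star (η 0))).re = 0 := by
  obtain ⟨F, hF, hF0, h1, -⟩ := exists_curve_expansion h hp hk hη
  exact (isBigO_of_re hF hF0 ((hO.sub h1).congr_left fun t => by ring)).1

omit h hp

/-- A bound for the type: after factoring a power of the parameter from a curve, the order of
contact relative to the multiplicity is at most `m`. -/
lemma dAngeloType_le
    (hm : ∀ U ρ, p ∈ U → IsDefiningFunction M U ρ → ∀ k, 1 ≤ k → ∀ η : ℂ → Cn n, AnalyticAt ℂ η 0 →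
      (fun t => ρ (t ^ k • η t + p)) =O[𝓝 0] (fun t => ‖t‖ ^ (m * k + 1)) → η 0 = 0) :
    dAngeloType M p ≤ m := by
  refine iSup_le fun γ => iSup_le fun hγ => iSup_le fun U => iSup_le fun ρ => iSup_le fun hρ => ?_
  obtain ⟨hγa, hγ0, hγ⟩ := hγ
  obtain ⟨k, η, hη, hη0, he⟩ := (hγa.sub
    analyticAt_const).exists_eventuallyEq_pow_smul_nonzero_iff.2
    (show ¬∀ᶠ t in 𝓝 0, γ t - p = 0 by simpa only [sub_eq_zero] using hγ)
  simp only [sub_zero] at he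
  have hk : 1 ≤ k := Nat.one_le_iff_ne_zero.2 fun h0 => hη0 (by
    have h1 : γ 0 - p = (0 : ℂ) ^ k • η 0 := he.self_of_nhds
    simpa [h0, hγ0] using h1.symm)
  have h1 : vanishingOrder (fun t => ρ (γ t)) ≤ (m * k : ℕ) := vanishingOrder_le fun hO =>
    hη0 (hm U ρ hρ.1 hρ.2 k hk η hη (hO.congr' (he.mono fun t ht => by
      change ρ (γ t) = ρ (t ^ k • η t + p)
      rw [← ht, Pi.sub_apply, sub_add_cancel]) EventuallyEq.rfl))
  have h2 : (k : ℕ∞) ≤ vanishingOrder fun t => γ t - p := le_vanishingOrder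
    ((isBigO_pow_smul hη.continuousAt).congr' (he.mono fun _ h => h.symm) EventuallyEq.rfl)
  refine ENNReal.div_le_of_le_mul ?_
  refine (ENat.toENNReal_le.2 h1).trans ?_
  rw [ENat.toENNReal_coe, Nat.cast_mul]
  exact mul_le_mul_right (by simpa using ENat.toENNReal_le.2 h2) _

lemma regularType_le_dAngeloType (M : Set (Cn n)) (p : Cn n) : regularType M p ≤ dAngeloType M
    p := by
  refine iSup_le fun γ => iSup_le fun hγ => iSup_le fun U => iSup_le fun ρ => iSup_le fun hρ => ?_
  refine le_trans ?_ (le_iSup_of_le γ (le_iSup_of_le hγ.1 (le_iSup_of_le U (le_iSup_of_le ρ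
    (le_iSup_of_le hρ le_rfl)))))
  have h1 : vanishingOrder (fun t => γ t - p) ≤ (1 : ℕ) := vanishingOrder_le fun hO => hγ.2 <| by
    have h2 : (fun t => γ t - γ 0) =o[𝓝 0] fun t => t - 0 := by
      rw [hγ.1.2.1]
      refine hO.trans_isLittleO ?_
      simpa using isLittleO_norm_pow_id (E' := ℂ) one_lt_two
    exact (HasDerivAt.of_isLittleO (f' := (0 : Cn n)) (by simpa using h2)).deriv
  have h2 : (vanishingOrder (fun t => γ t - p) : ℝ≥0∞) ≤ 1 := by simpa using ENat.toENNReal_le.2 h1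
  simpa using ENNReal.div_le_div_left h2 _

/-- A defining function in holomorphic coordinates gives a defining function of `M`. -/
lemma isDefiningFunction_comp (hΦ : IsBiholomorphic Φ) (h : IsDefiningFunction (Φ.symm ⁻¹' M) U ρ) :
    IsDefiningFunction M (Φ.source ∩ Φ ⁻¹' U) fun x => ρ (Φ x) := by
  have hd : ∀ x ∈ Φ.source ∩ Φ ⁻¹' U, SmoothAt Φ x := fun x hx => (hΦ.1 x hx.1).contDiffAtR
  refine ⟨Φ.continuousOn.isOpen_inter_preimage Φ.open_source h.1, fun x hx =>
    ((h.contDiffAt hx.2).comp x (hd x hx)).contDiffWithinAt, fun x hx h0 => h.2.2.1 _ hx.2 ?_,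
    fun x hx => ?_⟩
  · ext v
    have h1 := fderiv_symm_fderiv hΦ.symm (Φ.map_source hx.1) v
    rw [OpenPartialHomeomorph.symm_symm, Φ.left_inv hx.1] at h1
    have h2 := ((h.contDiffAt hx.2).differentiableAt (by simp)).hasFDerivAt.comp x
      ((hΦ.1 x hx.1).differentiableAt.hasFDerivAt.restrictScalars ℝ)
    have h3 := congrArg (fun D => D (fderiv ℂ Φ.symm (Φ x) v)) (h2.fderiv.symm.trans h0)
    simp only [ContinuousLinearMap.comp_apply, coe_restrictScalars', h1] at h3
    simpa using h3
  · rw [← h.2.2.2 _ hx.2, Set.mem_preimage, Φ.left_inv hx.1]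

/-- Regular curves in holomorphic coordinates give lower bounds for the regular type. -/
lemma le_regularType (hΦ : IsBiholomorphic Φ) (hps : p ∈ Φ.source) (hp0 : Φ p = 0)
    (h0 : (0 : Cn n) ∈ U) (h : IsDefiningFunction (Φ.symm ⁻¹' M) U ρ) {δ : ℂ → Cn n}
    (hδ : AnalyticAt ℂ δ 0) (hδ0 : δ 0 = 0) (hδ' : deriv δ 0 ≠ 0)
    (hO : (fun t => ρ (δ t)) =O[𝓝 0] fun t => ‖t‖ ^ m) : (m : ℝ≥0∞) ≤ regularType M p := by
  have h0t : (0 : Cn n) ∈ Φ.target := hp0 ▸ Φ.map_source hps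
  have hs0 : Φ.symm 0 = p := by rw [← hp0, Φ.left_inv hps]
  have hsan : AnalyticAt ℂ Φ.symm (δ 0) := by rw [hδ0]; exact hΦ.2 0 h0t
  have hγ' : HasDerivAt (fun t => Φ.symm (δ t)) (fderiv ℂ Φ.symm 0 (deriv δ 0)) 0 := by
    have := hsan.differentiableAt.hasFDerivAt.comp_hasDerivAt 0 hδ.differentiableAt.hasDerivAt
    rwa [hδ0] at this
  have hne : deriv (fun t => Φ.symm (δ t)) 0 ≠ 0 := by
    rw [hγ'.deriv]
    intro h1
    have h2 := fderiv_symm_fderiv hΦ.symm (x := 0) h0t (deriv δ 0)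
    rw [h1, map_zero] at h2
    exact hδ' h2.symm
  have hcurve : IsCurveGerm p fun t => Φ.symm (δ t) :=
    ⟨hsan.comp hδ, by simp [hδ0, hs0], fun hc => hne (by
      rw [EventuallyEq.deriv_eq (f := fun _ => p) hc, deriv_const])⟩
  have hpU : p ∈ Φ.source ∩ Φ ⁻¹' U := ⟨hps, by rw [Set.mem_preimage, hp0]; exact h0⟩
  refine le_iSup_of_le _ (le_iSup_of_le ⟨hcurve, hne⟩ (le_iSup_of_le _ (le_iSup_of_le _
    (le_iSup_of_le ⟨hpU, isDefiningFunction_comp hΦ h⟩ ?_))))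
  · have h1 := le_vanishingOrder (hO.congr' (f₂ := fun t => ρ (Φ (Φ.symm (δ t)))) ?_
      EventuallyEq.rfl)
    · simpa using ENat.toENNReal_le.2 h1
    · have h2 := hδ.continuousAt.preimage_mem_nhds (t := Φ.target)
        (by rw [hδ0]; exact Φ.open_target.mem_nhds h0t)
      filter_upwards [h2] with t ht
      rw [Φ.right_inv ht]

end types

/-! ### Contact of complex lines with the weighted normal form -/

section lines

variable {u : Cn n}

lemma cderiv_eq_zero_of_line (hf : Differentiable ℝ f) (h : ∀ ζ : ℂ, f (ζ • u) = 0) (ζ : ℂ) : cderiv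
    f (ζ • u) ((u, 0) : CVec n) = 0 := by
  have h1 : ∀ ξ : ℂ, fderiv ℝ f (ζ • u) (ξ • u) = 0 := fun ξ => by
    rw [← (hf _).lineDeriv_eq_fderiv, lineDeriv]
    have : (fun t : ℝ => f (ζ • u + t • ξ • u)) = fun _ => 0 := by
      funext t
      rw [← smul_assoc t ξ u, ← add_smul, h]
    rw [this, deriv_const]
  have h2 := h1 1
  rw [one_smul] at h2
  simp [cderiv, h1, h2]

lemma evalC_dirDeriv_comm (X Y : CVec n) (P : CPoly n) : evalC (dirDeriv X (dirDeriv Y P)) = evalC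
    (dirDeriv Y (dirDeriv X P)) := by
  have e : ∀ X, (fun y => cderiv (evalC P) y X) = evalC (dirDeriv X P) := fun X =>
    funext (cderiv_evalC X P)
  funext x
  rw [← cderiv_evalC, ← cderiv_evalC, ← e, ← e, cderiv_cderiv_comm (contDiff_evalC P).contDiffAt]

/-- Euler's formula on a complex line on which the `(0,1)` derivative vanishes. -/
lemma evalC_line {Q : CPoly n} (hQ : Q.IsHomogeneous k)
    (hb : ∀ ζ : ℂ, evalC (dirDeriv (0, star u) Q) (ζ • u) = 0) (ζ : ℂ) : k * evalC Q (ζ • u) = ζ *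
    evalC (dirDeriv (u, 0) Q) (ζ • u) := by
  have e : ofRealV (ζ • u) = ζ • ((u, 0) : CVec n) + star ζ • ((0, star u) : CVec n) := by
    simp [ofRealV]
  rw [← cderiv_evalC_self hQ, e, cderiv_add_right, cderiv_smul_right, cderiv_smul_right,
    cderiv_evalC, cderiv_evalC, hb]
  simp

/-- A real quartic form whose Levi form along a complex line vanishes on that line is the real part
of a holomorphic monomial there. -/
lemma exists_re_pow_of_line (hP : P.IsHomogeneous 4) {φ : Cn n → ℝ} (hφ : toC φ = evalC P)
    (h0 : ∀ ζ : ℂ, iterCderiv [ofRealV (ζ • u), ofRealV (ζ • u), ((u, 0) : CVec n), (0, star u)]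
      (toC φ) 0 = 0) :
    ∃ κ : ℂ, ∀ ζ : ℂ, φ (ζ • u) = (κ * ζ ^ 4).re := by
  set a : CVec n := (u, 0)
  set b : CVec n := (0, star u)
  have hd : ∀ Q : CPoly n, Differentiable ℝ (evalC Q) := fun Q =>
    (contDiff_evalC Q).differentiable (by simp)
  -- the `(0,1)` derivative of each iterated `(1,0)` derivative vanishes on the line
  have step : ∀ Q : CPoly n, (∀ ζ : ℂ, evalC (dirDeriv b Q) (ζ • u) = 0) →
      ∀ ζ : ℂ, evalC (dirDeriv b (dirDeriv a Q)) (ζ • u) = 0 := fun Q hQ ζ => by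
    rw [evalC_dirDeriv_comm, ← cderiv_evalC]
    exact cderiv_eq_zero_of_line (hd _) hQ ζ
  have b1 : ∀ ζ : ℂ, evalC (dirDeriv b (dirDeriv a P)) (ζ • u) = 0 := fun ζ => by
    have e : iterCderiv [a, b] (toC φ) = evalC (dirDeriv a (dirDeriv b P)) := funext fun x => by
      rw [hφ, ← cderiv_evalC]
      exact congrArg (fun f => cderiv f x a) (funext (cderiv_evalC b P))
    have h1 := h0 ζ
    rw [show [ofRealV (ζ • u), ofRealV (ζ • u), a, b] = [ofRealV (ζ • u), ofRealV (ζ • u)] ++ [a, b]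
      from rfl, iterCderiv_append, e,
      iterCderiv_evalC_self (isHomogeneous_dirDeriv (isHomogeneous_dirDeriv hP b) a)] at h1
    rw [evalC_dirDeriv_comm]
    exact (mul_eq_zero.1 h1).resolve_left two_ne_zero
  have b2 := step _ b1
  have hom : ∀ {Q : CPoly n} {k : ℕ}, Q.IsHomogeneous k → ∀ X,
      (dirDeriv X Q).IsHomogeneous (k - 1) := isHomogeneous_dirDeriv
  have e1 := evalC_line (hom hP a) b1
  have e2 := evalC_line (hom (hom hP a) a) b2
  have e3 := evalC_line (hom (hom (hom hP a) a) a) (step _ b2)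
  refine ⟨evalC (dirDeriv a (dirDeriv a (dirDeriv a (dirDeriv a P)))) 0 / 12, fun ζ => ?_⟩
  set A := evalC (dirDeriv a (dirDeriv a (dirDeriv a (dirDeriv a P)))) 0
  have e4 : evalC (dirDeriv a P) (ζ • u) = ζ ^ 3 * A / 6 := by
    have h4 := evalC_eq_of_isHomogeneous_zero (hom (hom (hom (hom hP a) a) a) a) (ζ • u)
    have h1 := e1 ζ
    have h2 := e2 ζ
    have h3 := e3 ζ
    norm_num at h1 h2 h3
    rw [h4] at h3
    linear_combination h1 / 3 + ζ / 6 * h2 + ζ ^ 2 / 6 * h3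
  have e5 : cderiv (evalC P) (ζ • u) b = star (cderiv (evalC P) (ζ • u) a) := by
    rw [← hφ, show a = conjV b by simp [a, b, conjV], ← cderiv_conj (hφ ▸ hd P _)]
    congr 1
    funext y
    exact (Complex.conj_ofReal _).symm
  have e6 := cderiv_evalC_self hP (ζ • u)
  rw [show ofRealV (ζ • u) = ζ • a + star ζ • b by simp [ofRealV, a, b], cderiv_add_right,
    cderiv_smul_right, cderiv_smul_right, e5, cderiv_evalC, e4, ← hφ, smul_eq_mul, smul_eq_mul,
    ← star_mul', star_def, add_conj] at e6
  have e7 := Complex.ofReal_injective (e6.trans (by push_cast; rfl :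
    ((4 : ℕ) : ℂ) * toC φ (ζ • u) = ((4 * φ (ζ • u) : ℝ) : ℂ)))
  have e8 : (A / 12 * ζ ^ 4).re = (ζ * (ζ ^ 3 * A / 6)).re / 2 := by
    rw [show A / 12 * ζ ^ 4 = ζ * (ζ ^ 3 * A / 6) / ((2 : ℝ) : ℂ) by push_cast; ring,
      Complex.div_ofReal_re]
  linarith

/-- If all pure derivatives of order less than `m ≤ 5` along one coordinate axis vanish, then that
axis has order of contact at least `m`. -/
lemma le_regularType_single (hΦ : IsBiholomorphic Φ) (hps : p ∈ Φ.source) (hp0 : Φ p = 0)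
    (h0 : (0 : Cn n) ∈ U) (h : IsDefiningFunction (Φ.symm ⁻¹' M) U ρ) (j : Fin n) (hm : m ≤ 5)
    (hj : ∀ l : List (Idx n), (∀ s ∈ l, varIndex s = j) → l.length < m → iterCderiv (l.map coordV)
      (toC ρ) 0 = 0) :
    (m : ℝ≥0∞) ≤ regularType M p := by
  have hd : HasDerivAt (fun t : ℂ => t • (single j 1 : Cn n)) (single j 1) 0 := by
    simpa using (hasDerivAt_id (0 : ℂ)).smul_const (single j 1 : Cn n)
  refine le_regularType hΦ hps hp0 h0 h (δ := fun t => t • single j 1)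
    (analyticAt_id.smul analyticAt_const) (zero_smul _ _) ?_ ?_
  · rw [hd.deriv]; simp
  -- the weights `1` on the axis and `5` elsewhere single out the derivatives along the axis
  set w : Fin n → ℕ := fun i => if i = j then 1 else 5
  have hO := isBigO_comp_of_weight w (fun i => by dsimp only [w]; split_ifs <;> omega)
    (d := m) (f := toC ρ) (smoothNear_of_forall h.1 h0 fun y hy => h.contDiffAtC hy)
    (fun l hl => hj l ?_ ?_) (δ := fun t => t • single j 1) fun i => ?_
  · exact (isBigO_ofReal_left (f := fun t : ℂ => ρ (t • single j 1))).1 hO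
  · intro s hs
    by_contra hne
    have := List.single_le_sum (fun _ _ => Nat.zero_le _) _
      (List.mem_map_of_mem (f := fun s => w (varIndex s)) hs)
    simp only [w, if_neg hne] at this hl
    omega
  · refine lt_of_le_of_lt ?_ hl
    have := List.card_nsmul_le_sum (l.map fun s => w (varIndex s)) 1 fun x hx => by
      obtain ⟨s, -, rfl⟩ := List.mem_map.1 hx
      dsimp only [w]; split_ifs <;> omega
    simpa using this
  · by_cases hi : i = j
    · subst hi
      simpa [w] using (Asymptotics.isBigO_refl (fun t : ℂ => t) (𝓝 0)).norm_right
    · simpa [hi] using Asymptotics.isBigO_zero _ _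

variable [NeZero n]

namespace IsPscChart

variable (h : IsPscChart M p q Φ G)
include h

lemma isDefiningFunction_symm : IsDefiningFunction (Φ.symm ⁻¹' M) Φ.target (graphFn G) :=
  ⟨h.isDefiningFunction.1, h.isDefiningFunction.2.1, h.isDefiningFunction.2.2.1, fun x hx =>
    (and_iff_left hx).symm.trans (h.isDefiningFunction.2.2.2 x hx)⟩

/-- The derivatives of weight less than `1` of the defining function of the graph vanish. -/
lemma iterCderiv_graphFn_eq_zero (l : List (Idx n))
    (hl : (l.map fun s => blockWt q (varIndex s)).sum < 4) : iterCderiv (l.map coordV)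
    (toC (graphFn G)) 0 = 0 := by
  have hwt : ∀ s : Idx n, 1 ≤ blockWt q (varIndex s) := fun s => by
    rw [blockWt]; split_ifs <;> omega
  have hz : ∀ s ∈ l, s ∈ zVars n := fun s hs => mem_zVars.2 fun h0 => by
    have := List.single_le_sum (fun _ _ => Nat.zero_le _) _
      (List.mem_map_of_mem (f := fun s => blockWt q (varIndex s)) hs)
    simp only [blockWt, h0, Fin.val_zero, if_true] at this hl
    omega
  have hk : ∀ s ∈ zVars n, blockWt q (varIndex s) < 2 → s ∈ kerVars n q := fun s hs h2 => by
    rw [blockWt] at h2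
    refine mem_kerVars.2 (not_le.1 fun h3 => ?_)
    rw [if_neg fun h4 => mem_zVars.1 hs (Fin.ext (by simpa using h4)), if_pos h3] at h2
    omega
  rcases l.eq_nil_or_concat with rfl | ⟨m, s, rfl⟩
  · simp [iterCderiv, toC, graphFn, h.map_zero]
  rw [List.concat_eq_append] at *
  have hs := hz s (by simp)
  have e : pd s (toC (graphFn G)) =ᶠ[𝓝 0] pd s (toC G) := by
    filter_upwards [Φ.open_target.mem_nhds h.zero_target] with y hy
    rw [h.pd_graphFn hy, if_neg (mem_zVars.1 hs), sub_zero]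
  rw [map_append, iterCderiv_append, (iterCderiv_congr (f := iterCderiv ([s].map coordV)
    (toC (graphFn G))) e _).self_of_nhds]
  rcases m with _ | ⟨t, _ | ⟨r, _ | ⟨x, m⟩⟩⟩
  · exact h.pd_eq_zero s
  · refine (h.pd_pd_eq (hz t (by simp)) hs).trans (if_neg ?_)
    rintro ⟨rfl, h1⟩
    have h2 := mem_zVars.1 (hz t (by simp))
    simp only [List.nil_append, cons_append, map_cons, map_nil, sum_cons,
      sum_nil, varIndex_swap, blockWt, if_pos h1, if_neg fun h4 : (varIndex t : ℕ) = 0 =>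
        h2 (Fin.ext (by simpa using h4))]
      at hl
    omega
  · simp only [List.nil_append, cons_append, map_cons, map_nil, sum_cons,
      sum_nil] at hl
    have := hwt s; have := hwt t; have := hwt r
    exact h.pd_pd_pd_eq_zero (hz t (by simp))
      (hk r (hz r (by simp)) (by omega)) (hk s hs (by omega))
  · simp only [cons_append, map_cons, sum_cons, map_append, List.sum_append,
      map_nil, sum_nil] at hl
    have := hwt s; have := hwt t; have := hwt r; have := hwt x
    omega

/-- The coordinate axis `j` has order of contact at least the reciprocal of its weight. -/
lemma le_regularType (j : Fin n) (hm : m ≤ 4) (hj : m * blockWt q j ≤ 4) : (m : ℝ≥0∞) ≤ regularType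
    M p := by
  refine le_regularType_single h.isBiholomorphic h.mem_source h.map_eq h.zero_target
    h.isDefiningFunction_symm j (by omega) fun l hl hlm => h.iterCderiv_graphFn_eq_zero l ?_
  have e : (l.map fun s => blockWt q (varIndex s)) = l.map fun _ => blockWt q j :=
    List.map_congr_left fun s hs => by rw [hl s hs]
  have hw : 1 ≤ blockWt q j := by rw [blockWt]; split_ifs <;> omega
  rw [e, List.map_const', List.sum_replicate, smul_eq_mul]
  exact lt_of_lt_of_le (Nat.mul_lt_mul_of_pos_right hlm hw) hj

/-- If the quartic part is the real part of a holomorphic monomial on a complex line in the Levi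
kernel, then bending the line removes that monomial and gives a regular curve with order of contact
at least `5`. -/
lemma five_le_regularType (hu : u ≠ 0) (huq : ∀ j : Fin n, (j : ℕ) ≤ q → u j = 0) {κ : ℂ}
    (hκ : ∀ ζ : ℂ, quarticPart q G (ζ • u) = (κ * ζ ^ 4).re) : 5 ≤ regularType M p := by
  set δ : ℂ → Cn n := fun ζ => ζ • u + (κ / 2 * ζ ^ 4) • single 0 1
  have hδa : AnalyticAt ℂ δ 0 := (analyticAt_id.smul analyticAt_const).add
    ((analyticAt_const.mul (analyticAt_id.pow 4)).smul analyticAt_const)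
  have hδd : HasDerivAt δ u 0 := by
    have h1 := ((hasDerivAt_id (0 : ℂ)).smul_const u).add
      ((((hasDerivAt_id (0 : ℂ)).pow 4).const_mul (κ / 2)).smul_const (single 0 1 : Cn n))
    exact h1.congr_deriv (by simp)
  have hj : ∀ ζ (j : Fin n), j ≠ 0 → δ ζ j = (ζ • u) j := fun ζ j hj => by simp [δ, hj]
  have e0 : ∀ ζ, δ ζ 0 = κ / 2 * ζ ^ 4 := fun ζ => by simp [δ, huq 0 (by simp)]
  have e : ∀ ζ, graphFn G (δ ζ) = remainder q G (δ ζ) := fun ζ => by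
    have h1 : (∑ j : Fin n, if j ≠ 0 ∧ (j : ℕ) ≤ q then ‖δ ζ j‖ ^ 2 else 0) = 0 :=
      sum_eq_zero fun j _ => by
        split_ifs with hjq
        · simp [hj ζ j hjq.1, huq j hjq.2]
        · rfl
    have h2 : 2 * (κ / 2 * ζ ^ 4).re = (κ * ζ ^ 4).re := by
      rw [show κ * ζ ^ 4 = ((2 : ℝ) : ℂ) * (κ / 2 * ζ ^ 4) by push_cast; ring, re_ofReal_mul]
    rw [graphFn, remainder, h1, quarticPart_congr (hj ζ), hκ, e0, h2]
    ring
  have hw : ∀ j : Fin n, 1 ≤ blockWt q j := fun j => by rw [blockWt]; split_ifs <;> omega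
  refine LeviGeom.le_regularType (m := 5) h.isBiholomorphic h.mem_source h.map_eq h.zero_target
    h.isDefiningFunction_symm hδa (by simp [δ]) (by rwa [hδd.deriv]) ?_
  simp only [e]
  refine (isBigO_ofReal_left (f := fun t : ℂ => remainder q G (δ t))).1
    (isBigO_comp_of_weight (blockWt q) hw (f := toC (remainder q G)) ?_ (fun l hl =>
      h.iterCderiv_remainder_eq_zero l (by omega)) fun j => ?_)
  · exact smoothNear_of_forall Φ.open_target h.zero_target fun y hy =>
      contDiffAt_toC (h.contDiffOn_remainder.contDiffAt (Φ.open_target.mem_nhds hy))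
  by_cases h0 : j = 0
  · subst h0
    simp only [e0, blockWt, Fin.val_zero, if_true]
    exact (Asymptotics.isBigO_const_mul_self _ _ _).trans
      (Asymptotics.isBigO_of_le _ fun t => by simp)
  simp only [hj _ j h0, Pi.smul_apply, smul_eq_mul, mul_comm _ (u j)]
  by_cases hjq : (j : ℕ) ≤ q
  · simpa [huq j hjq] using Asymptotics.isBigO_zero _ _
  · rw [blockWt, if_neg fun h4 => h0 (Fin.ext (by simpa using h4)), if_neg hjq]
    exact (Asymptotics.isBigO_const_mul_self _ _ _).trans
      (Asymptotics.isBigO_of_le _ fun t => by simp)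

end IsPscChart

end lines

/-! ### D'Angelo type, regular type and Catlin's multitype -/

variable (hM : IsRealHypersurface M) (hpsc : IsPseudoconvex M) (hp : p ∈ M)
include hpsc

/-- Null vectors of the Levi form of any defining function are in the Levi kernel. -/
lemma mem_K10_of_lev_re (h : IsDefiningFunction M U ρ) (hp : p ∈ M ∩ U) {a : Cn n}
    (ha : dz ρ p a = 0) (h0 : (lev ρ p a (star a)).re = 0) : ((a, 0) : CVec n) ∈ K10 M p := by
  have hv : ((a, 0) : CVec n) ∈ H10 M p := (mem_H10_iff h hp).2 ⟨ha, rfl⟩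
  obtain ⟨V, hVU, hV, hpV, hpsd | hpsd⟩ := levPsd_or_neg h hp.1 hp.2 (hpsc.localPsc hp.1)
  · exact mem_K10_of_lev_self (h.mono hV hVU) hpsd ⟨hp.1, hpV⟩ hv h0
  · exact mem_K10_of_lev_self (neg_isDefiningFunction (h.mono hV hVU)) hpsd ⟨hp.1, hpV⟩ hv
      (by rw [lev_neg', neg_re, h0, neg_zero])

omit hpsc

lemma isRealHypersurface_push (h : IsCRMap M M' Φ) (hM : IsRealHypersurface M)
    (hM' : M' ⊆ Φ.target) : IsRealHypersurface M' := by
  intro y hy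
  have hyt := hM' hy
  obtain ⟨U, ρ, hyU, hρ⟩ := hM (Φ.symm y) ((h.symm.2 y hyt).2 hy)
  have h1 : IsDefiningFunction (Φ.symm.symm ⁻¹' M') (U ∩ Φ.source) ρ :=
    ⟨hρ.1.inter Φ.open_source, hρ.2.1.mono inter_subset_left, fun x hx => hρ.2.2.1 x hx.1,
      fun x hx => (h.2 x hx.2).trans (hρ.2.2.2 x hx.1)⟩
  have h2 := isDefiningFunction_comp h.1.symm h1
  refine ⟨_, _, ?_, h2⟩
  exact ⟨hyt, hyU, Φ.map_target hyt⟩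

include hM hpsc hp

/-- If the type is at most `4`, then the quartic tensor does not vanish on any complex line of the
Levi kernel. -/
lemma exists_tensor_ne_zero [NeZero n] (hq : leviRank M p = q) (hτ : IsQuarticTensor M p τ)
    (hT : dAngeloType M p ≤ 4) (v : K10 M p) (hv : v ≠ 0) : ∃ (a b : CT M p) (c : K10 M p)
    (d : K01 M p), (a : CVec n) ∈ span ℂ {(v : CVec n), conjV (v : CVec n)} ∧ (b : CVec n) ∈ span ℂ
    {(v : CVec n), conjV (v : CVec n)} ∧ (c : CVec n) ∈ span ℂ {(v : CVec n)} ∧ (d : CVec n) ∈ span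
    ℂ {conjV (v : CVec n)} ∧ τ a b c d ≠ 0 := by
  by_contra! hne
  obtain ⟨Φ, G, h⟩ := exists_isPscChart hM hpsc hp hq
  obtain ⟨U, ρ, hpU, hρ⟩ := hM p hp
  have hvK := pushV_mem_K10 h.isCRMap hM h.isRealHypersurface h.mem_source hp v.2
  rw [h.map_eq, h.mem_K10] at hvK
  set u := (pushV Φ p v).1
  have hvu : pushV Φ p v = (u, 0) := Prod.ext rfl hvK.1
  have hu : u ≠ 0 := fun h0 => hv (Subtype.ext (pushV_injective h.isBiholomorphic h.mem_source (by
    rw [hvu, h0]; simp [pushV])))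
  have hcv : pushV Φ p (conjV v) = (0, star u) := by rw [← conjV_pushV, hvu]; simp [conjV]
  have hvT : (v : CVec n) ∈ CT M p := H10_le_CT _ _ (K10_le_H10 _ _ v.2)
  have hcK := conjV_mem_K01 v.2
  obtain ⟨κ, hκ⟩ := exists_re_pow_of_line (isHomogeneous_taylorHom 4 (toC G)) h.toC_quarticPart
    (u := u) fun ζ => by
      set w : CVec n := ζ • (v : CVec n) + star ζ • conjV (v : CVec n)
      have hwT : w ∈ CT M p := add_mem (smul_mem _ _ hvT)
        (smul_mem _ _ (conjV_mem_CT hρ ⟨hp, hpU⟩ hvT))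
      have hwK : w ∈ CK M p := add_mem_sup (smul_mem _ _ v.2) (smul_mem _ _ hcK)
      have hws : w ∈ span ℂ {(v : CVec n), conjV (v : CVec n)} := mem_span_pair.2 ⟨ζ, star ζ, rfl⟩
      have h1 := h.pairsTo hτ (v₄ := ⟨w, hwT⟩) (v₃ := ⟨w, hwT⟩) v
        ⟨_, hcK⟩ hwK hwK 0 ((hne ⟨w, hwT⟩ ⟨w, hwT⟩ v ⟨_, hcK⟩ hws hws
          (mem_span_singleton_self _) (mem_span_singleton_self _)).symm)
      have hw : pushV Φ p w = ofRealV (ζ • u) := by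
        simp [w, pushV_add, pushV_smul, hvu, hcv, ofRealV]
      simp only [hw, hvu, hcv] at h1
      rw [← h1]
      simp [pushV]
  have h5 := (h.five_le_regularType hu hvK.2 hκ).trans
    ((regularType_le_dAngeloType M p).trans hT)
  exact absurd h5 (by norm_num)

/-- The type is `4` if the Levi kernel is not zero; otherwise it is `2`, or `1` in dimension one. -/
lemma regularType_and_dAngeloType [NeZero n] (hq : leviRank M p = q) (hT : dAngeloType M p ≤ 4) :
    regularType M p = dAngeloType M p ∧ (2 ≤ n → dAngeloType M p = 2 ∨ dAngeloType M p = 4) ∧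
    (K10 M p ≠ ⊥ → dAngeloType M p = 4) := by
  obtain ⟨Φ, G, h⟩ := exists_isPscChart hM hpsc hp hq
  obtain ⟨U, ρ, hpU, hρ⟩ := hM p hp
  have hH := finrank_H10 hρ ⟨hp, hpU⟩
  have hle := regularType_le_dAngeloType M p
  have key : ∀ (j : Fin n) (m : ℕ), m ≤ 4 → m * blockWt q j ≤ 4 → dAngeloType M p ≤ m →
      regularType M p = m ∧ dAngeloType M p = m := fun j m h4 hm hd => by
    have h1 := h.le_regularType j h4 hm
    exact ⟨le_antisymm (hle.trans hd) h1, le_antisymm hd (h1.trans hle)⟩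
  by_cases hK : K10 M p = ⊥
  · refine (or_iff_not_imp_left.2 fun hn => ?_ : n < 2 ∨ 2 ≤ n).elim (fun hn => ?_) fun hn => ?_
    · omega
    · have hbot : H10 M p = ⊥ := finrank_eq_zero.1 (by omega)
      obtain ⟨h1, h2⟩ := key 0 1 (by norm_num) (by simp [blockWt]) (dAngeloType_le
        fun U ρ hpU h k hk η hη hO => by
          have hm : ((η 0, 0) : CVec n) ∈ H10 M p := (mem_H10_iff h ⟨hp, hpU⟩).2
            ⟨dz_eq_zero_of_isBigO h ⟨hp, hpU⟩ hk hη (by simpa using hO), rfl⟩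
          rw [hbot, Submodule.mem_bot] at hm
          exact congrArg Prod.fst hm)
      exact ⟨h1.trans h2.symm, fun h => absurd h (by omega), fun h => absurd hK h⟩
    · have hq1 : 1 ≤ q := by
        rw [← hq, leviRank, hK, finrank_bot]; omega
      obtain ⟨h1, h2⟩ := key ⟨1, hn⟩ 2 (by norm_num) (by simp [blockWt, hq1]) (dAngeloType_le
        fun U ρ hpU h k hk η hη hO => by
          have hm := mem_K10_of_lev_re hpsc h ⟨hp, hpU⟩
            (dz_eq_zero_of_isBigO h ⟨hp, hpU⟩ hk hη (hO.trans (isBigO_pow_of_le (by omega))))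
            (lev_eq_zero_of_isBigO h ⟨hp, hpU⟩ hk hη hO)
          rw [hK, Submodule.mem_bot] at hm
          exact congrArg Prod.fst hm)
      exact ⟨h1.trans h2.symm, fun _ => Or.inl h2, fun h => absurd hK h⟩
  · have hKr : finrank ℂ (K10 M p) ≠ 0 := fun h0 => hK (finrank_eq_zero.1 h0)
    have hKle := Submodule.finrank_mono (K10_le_H10 M p)
    have hqn : q + 1 < n := by rw [← hq, leviRank]; omega
    obtain ⟨h1, h2⟩ := key ⟨n - 1, by omega⟩ 4 le_rfl (by
      rw [blockWt, if_neg (by simp; omega), if_neg (by simp; omega)]) hT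
    exact ⟨h1.trans h2.symm, fun _ => Or.inr h2, fun _ => h2⟩

omit hM hp

/-- At least `k` eigenvalues of the Levi form vanish if the derivatives of weight less than one of a
defining function include all first and second derivatives along `k` axes. -/
lemma leviRank_add_card_lt (h : IsDefiningFunction M U ρ) (hp : p ∈ M ∩ U) {J : Finset (Fin n)}
    (h1 : ∀ j ∈ J, dzc ρ j p = 0) (h2 : ∀ i ∈ J, ∀ j ∈ J, lvm ρ i j p = 0) : leviRank M p + J.card <
    n := by
  have hJ : ∀ j : J, ((single j.1 1, 0) : CVec n) ∈ K10 M p := fun j =>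
    mem_K10_of_lev_re hpsc h hp (by simp [dz, single_apply, h1 j j.2])
      (by simp [lev, single_apply, Pi.star_apply, h2 j j.2 j j.2])
  have hli : LinearIndependent ℂ fun j : J => (⟨_, hJ j⟩ : K10 M p) := by
    refine LinearIndependent.of_comp
      ((LinearMap.fst ℂ (Cn n) (Cn n)).comp (K10 M p).subtype) ?_
    have e := (Pi.basisFun ℂ (Fin n)).linearIndependent.comp (fun j : J => j.1)
      Subtype.val_injective
    convert e using 1
    funext j
    simp
  have h3 := hli.fintype_card_le_finrank
  rw [Fintype.card_coe] at h3
  have h4 := finrank_H10 h hp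
  have h5 := Submodule.finrank_mono (K10_le_H10 M p)
  rw [leviRank]
  omega

omit hpsc

lemma isAdmissibleWeight_blockWeights : IsAdmissibleWeight (blockWeights n q) := by
  refine ⟨fun i j hij => ?_, fun j => ?_, fun k => Or.inr ?_⟩
  · have : (i : ℕ) ≤ j := hij
    rw [blockWeights, blockWeights]
    split_ifs <;> first | omega | norm_num
  · rw [blockWeights]
    split_ifs <;> norm_num
  · obtain ⟨m, hm, he⟩ : ∃ m : ℕ, 0 < m ∧ blockWeights n q k = m := by
      rw [blockWeights]
      split_ifs
      exacts [⟨1, by simp⟩, ⟨2, by simp⟩, ⟨4, by simp⟩]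
    refine ⟨single k m, fun j hj => single_eq_of_ne hj.ne' _, by simpa using hm, ?_⟩
    rw [sum_eq_single k (fun j _ hj => by simp [hj]) (by simp), single_eq_same, he]
    exact ENNReal.mul_inv_cancel (by simpa using hm.ne') (by simp)

include hM hpsc hp

/-- The axes of weight larger than that of the quartic normal form are not possible: a first
difference at the first axis contradicts regularity of the defining function, one at an axis of
weight `2` the Levi rank, and one at an axis of weight `4` the bound on the type. -/
lemma isMultitype_blockWeights [NeZero n] (hq : leviRank M p = q) (hT : dAngeloType M p ≤ 4) :
    IsMultitype M p (blockWeights n q) := by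
  refine ⟨?_, fun b hb => ?_⟩
  · rintro _ ⟨Λ, ⟨⟨hmono, -, -⟩, Φ, U, ρ, hΦ, hps, hp0, h0, hUt, hρ, hO⟩, rfl⟩
    refine not_lt.1 fun hlt => ?_
    obtain ⟨k, -, hk⟩ := hlt
    dsimp at hk
    have hw : ∀ l : List (Idx n), (∀ s ∈ l, k ≤ varIndex s) →
        (l.length : ℝ≥0∞) ≤ blockWeights n q k → iterCderiv (l.map coordV) (toC ρ) 0 = 0 := by
      refine fun l hl hlen => hO l ?_
      calc weight Λ l ≤ l.length • (Λ k)⁻¹ := by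
            refine (List.sum_le_card_nsmul _ (Λ k)⁻¹ fun x hx => ?_).trans_eq (by simp)
            obtain ⟨s, hs, rfl⟩ := List.mem_map.1 hx
            exact ENNReal.inv_le_inv.2 (hmono (hl s hs))
        _ ≤ blockWeights n q k / Λ k := by
            rw [nsmul_eq_mul, ENNReal.div_eq_inv_mul, mul_comm]
            gcongr
        _ < 1 := ENNReal.div_lt_of_lt_mul (by rwa [one_mul])
    rcases eq_or_ne k 0 with rfl | hk0
    · obtain ⟨j, hj⟩ := dz_ne_zero hρ h0
      exact hj (hw [inl j] (by simp) (by simp [blockWeights]))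
    have hk0' : (k : ℕ) ≠ 0 := fun h => hk0 (Fin.ext (by simpa using h))
    by_cases hkq : (k : ℕ) ≤ q
    · have hbw : blockWeights n q k = 2 := by rw [blockWeights, if_neg hk0', if_pos hkq]
      have hCR : IsCRMap M (chartImage M Φ) Φ := ⟨hΦ, fun x hx => by
        simp [chartImage, Φ.map_source hx, Φ.left_inv hx]⟩
      have hM' := isRealHypersurface_push hCR hM inter_subset_right
      have hdef : IsDefiningFunction (chartImage M Φ) U ρ := ⟨hρ.1, hρ.2.1, hρ.2.2.1, fun x hx =>
        (and_iff_left (hUt hx)).trans (hρ.2.2.2 x hx)⟩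
      have h1 := leviRank_push hCR hM hM' hps hp
      rw [hp0, hq] at h1
      have h0M : (0 : Cn n) ∈ chartImage M Φ := hp0 ▸ (hCR.2 p hps).2 hp
      have h2 := leviRank_add_card_lt (isPseudoconvex_push hCR hpsc inter_subset_right) hdef
        ⟨h0M, h0⟩ (J := Finset.Ici k) (fun j hj => hw [inl j] (by simpa [varIndex] using hj)
          (by rw [hbw]; simp)) fun i hi j hj => hw [inr j, inl i]
            (by simp only [Finset.mem_Ici] at hi hj; simp [varIndex, hi, hj]) (by rw [hbw]; simp)
      rw [h1, Fin.card_Ici] at h2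
      omega
    · have hbw : blockWeights n q k = 4 := by rw [blockWeights, if_neg hk0', if_neg hkq]
      have h5 := (le_regularType_single hΦ hps hp0 h0 hρ k le_rfl fun l hl hlen =>
        hw l (fun s hs => (hl s hs).ge) (by rw [hbw]; exact_mod_cast Nat.le_of_lt_succ hlen)).trans
          ((regularType_le_dAngeloType M p).trans hT)
      exact absurd h5 (by norm_num)
  · obtain ⟨Φ, G, h⟩ := exists_isPscChart hM hpsc hp hq
    refine hb ⟨_, ⟨isAdmissibleWeight_blockWeights, Φ, Φ.target, graphFn G, h.isBiholomorphic,
      h.mem_source, h.map_eq, h.zero_target, subset_rfl, h.isDefiningFunction_symm,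
      fun l hl => h.iterCderiv_graphFn_eq_zero l ?_⟩, rfl⟩
    by_contra! h4
    refine absurd hl (not_lt.2 ?_)
    rw [weight_blockWeights]
    calc (1 : ℝ≥0∞) = (4 : ℕ) * 4⁻¹ := by
          exact_mod_cast (ENNReal.mul_inv_cancel (a := 4) (by norm_num) (by norm_num)).symm
      _ ≤ _ := by gcongr

omit hM hpsc hp

end LeviGeom

end

theorem theorem2p1 {n : ℕ} [NeZero n] (M : Set (Cn n)) (hM : IsRealHypersurface M)
    (hpsc : IsPseudoconvex M) (q : ℕ) (hq : q < n) :
    -- the sheaves, and their invariance under biholomorphic maps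
    IsSubmoduleSheaf M (S10 M q) ∧ IsIdealSheaf M (idealSheaf M q) ∧
    (∀ (M' : Set (Cn n)) (Φ : OpenPartialHomeomorph (Cn n) (Cn n)),
      IsRealHypersurface M' → IsCRMap M M' Φ → ∀ U ⊆ Φ.source, IsOpen U →
        (∀ X, S10 M q U X → S10 M' q (Φ '' U) (pushField Φ X)) ∧
        ∀ f, idealSheaf M q U f → idealSheaf M' q (Φ '' U) (fun y => f (Φ.symm y))) ∧
    -- (4), second part
    (∀ (U : Set (Cn n)) (f : Cn n → ℝ), IsOpen U → reIdealSheaf M q U f →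
      ∀ x ∈ M ∩ U, leviRank M x = q → f x = 0) ∧
    -- (5)
    (∀ U g, IsOpen U → IsIdealGenerator M q U g → idealSheaf M q U g) ∧
    (∀ J : Set (Cn n) → (Cn n → ℂ) → Prop, IsIdealSheaf M J →
      (∀ U g, IsOpen U → IsIdealGenerator M q U g → J U g) →
      ∀ U f, IsOpen U → idealSheaf M q U f → J U f) ∧
    -- (6)
    (∀ (U : Set (Cn n)) (F : Fin q → Cn n → CVec n) (L : Cn n → CVec n), IsOpen U →
      IsLeviNondegenerateFrame M U F → IsLeviOrthogonal M U F L → S10 M q U L) ∧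
    (∀ x ∈ M, leviRank M x = q → ∀ v : CVec n,
      v ∈ K10 M x ↔ ∃ U X, IsOpen U ∧ x ∈ U ∧ S10 M q U X ∧ X x = v) ∧
    -- the quartic tensor at a point of Levi rank `q`
    ∀ p ∈ M, leviRank M p = q → ∃ τ : Tensor4 M p,
      IsQuarticTensor M p τ ∧ (∀ τ', IsQuarticTensor M p τ' → τ' = τ) ∧
      -- its invariance
      (∀ (M' : Set (Cn n)) (Φ : OpenPartialHomeomorph (Cn n) (Cn n)),
        IsRealHypersurface M' → IsCRMap M M' Φ → p ∈ Φ.source →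
        ∀ τ' : Tensor4 M' (Φ p), IsQuarticTensor M' (Φ p) τ' →
        ∀ (v₄ v₃ t : CT M p) (v₂ : K10 M p) (v₁ : K01 M p)
          (w₄ w₃ s : CT M' (Φ p)) (w₂ : K10 M' (Φ p)) (w₁ : K01 M' (Φ p)),
          (w₄ : CVec n) = pushV Φ p v₄ → (w₃ : CVec n) = pushV Φ p v₃ →
          (w₂ : CVec n) = pushV Φ p v₂ → (w₁ : CVec n) = pushV Φ p v₁ →
          (s : CVec n) = pushV Φ p t →
          Submodule.Quotient.mk t = τ v₄ v₃ v₂ v₁ →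
          Submodule.Quotient.mk s = τ' w₄ w₃ w₂ w₁) ∧
      -- (7)
      (∀ (U : Set (Cn n)) (θ : Cn n → (CVec n →L[ℂ] ℂ)), IsOpen U → p ∈ U →
        IsContactForm M U θ → LeviNonneg M U θ →
        ∀ (v₂ : CT M p) (v₁ : K10 M p) (w₁ : K01 M p), conjV (v₂ : CVec n) = v₂ →
          (w₁ : CVec n) = conjV (v₁ : CVec n) →
          ∃ c : ℝ, 0 ≤ c ∧ PairsTo (θ p) (τ v₂ v₂ v₁ w₁) c) ∧
      -- (3)
      (∃ (Φ : OpenPartialHomeomorph (Cn n) (Cn n)) (φ R : Cn n → ℝ),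
        IsBiholomorphic Φ ∧ p ∈ Φ.source ∧ Φ p = 0 ∧
        IsRealQuarticPolynomial q φ ∧ IsPlurisubharmonic φ ∧
        ContDiffOn ℝ ∞ R Φ.target ∧
        (∀ x ∈ Φ.target, ∀ y ∈ Φ.target, (x 0).im = (y 0).im → (∀ j, j ≠ 0 → x j = y j) →
          R x = R y) ∧
        IsLittleOWeight (blockWeights n q) (fun x => (R x : ℂ)) ∧
        (∀ x ∈ Φ.target, Φ.symm x ∈ M ↔
          2 * (x 0).re =
            (∑ j : Fin n, if j ≠ 0 ∧ (j : ℕ) ≤ q then ‖x j‖ ^ 2 else 0) + φ x + R x) ∧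
        ∀ (v₄ v₃ : CT M p) (v₂ : K10 M p) (v₁ : K01 M p),
          (v₄ : CVec n) ∈ CK M p → (v₃ : CVec n) ∈ CK M p →
          -- `ℂQ_p` is identified with `ℂ` by the contact covector `i dw`
          PairsTo (fun X => Complex.I * (pushV Φ p X).1 0) (τ v₄ v₃ v₂ v₁)
            (iterCderiv [pushV Φ p v₄, pushV Φ p v₃, pushV Φ p v₂, pushV Φ p v₁]
              (fun x => (φ x : ℂ)) 0)) ∧
      -- the submanifold `S`
      (∃ (S U : Set (Cn n)) (m : ℕ) (f : Fin m → Cn n → ℝ), IsOpen U ∧ p ∈ U ∧ p ∈ S ∧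
        -- (4), first part
        S = {x | x ∈ M ∩ U ∧ ∀ j, f j x = 0} ∧
        (∀ j, reIdealSheaf M q U (f j)) ∧
        (∀ x ∈ M ∩ U, LinearIndependent ℝ fun j =>
          (fderiv ℝ (f j) x).toLinearMap.domRestrict (realTangent M x)) ∧
        -- (1)
        (∀ x ∈ M ∩ U, leviRank M x = q → x ∈ S) ∧
        -- (2)
        (∀ v : Cn n, v ∈ realTangent S p ↔
          ∃ V : CT M p, (V : CVec n) = ofRealV v ∧ ∀ v₃ v₂ v₁, τ V v₃ v₂ v₁ = 0) ∧
        -- (i)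
        (dAngeloType M p ≤ 4 → IsTotallyReal (realTangent S p ⊓ realVectors (CK M p)))) ∧
      -- points of type at most `4`
      (dAngeloType M p ≤ 4 →
        -- (ii)
        (∀ v : K10 M p, v ≠ 0 → ∃ (a b : CT M p) (c : K10 M p) (d : K01 M p),
          (a : CVec n) ∈ Submodule.span ℂ {(v : CVec n), conjV (v : CVec n)} ∧
          (b : CVec n) ∈ Submodule.span ℂ {(v : CVec n), conjV (v : CVec n)} ∧
          (c : CVec n) ∈ Submodule.span ℂ {(v : CVec n)} ∧
          (d : CVec n) ∈ Submodule.span ℂ {conjV (v : CVec n)} ∧ τ a b c d ≠ 0) ∧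
        regularType M p = dAngeloType M p ∧
        (2 ≤ n → dAngeloType M p = 2 ∨ dAngeloType M p = 4) ∧
        (K10 M p ≠ ⊥ → dAngeloType M p = 4) ∧
        -- (iii)
        IsMultitype M p (blockWeights n q)) := by
  refine ⟨isSubmoduleSheaf_S10 hM q, isIdealSheaf_idealSheaf M q,
    fun M' Φ hM' hΦ U hUs hU => ⟨fun X hX => S10_push hΦ hM hM' hU hUs hX,
      fun f hf => idealSheaf_push hΦ hM hM' hU hUs hf⟩,
    fun U f _ hf x hx hxq => reIdealSheaf_eq_zero hM hf hx hxq,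
    fun U g hU hg => idealSheaf_of_generator hU hg,
    fun J hJ hg U f hU hf => idealSheaf_minimal hJ hg hU hf,
    fun U F L hU hF hL => S10_of_isLeviOrthogonal hM hpsc hU hF hL,
    fun x hx hxq v => ⟨exists_S10_of_mem_K10 hM hpsc hx hxq, ?_⟩, fun p hp hpq => ?_⟩
  · rintro ⟨U, X, hU, hxU, hX, rfl⟩
    obtain ⟨W, ρ, hxW, hρ⟩ := hM x hx
    exact (hX.2 x ⟨hx, hxU⟩ hxq.le).mem_K10 hρ ⟨hx, hxW⟩ hU hxU hX.1
  obtain ⟨τ, hτ⟩ := exists_isQuarticTensor hM hpsc hp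
  have hne := exists_tensor_ne_zero hM hpsc hp hpq hτ
  refine ⟨τ, hτ, fun τ' hτ' => hτ.unique hM hpsc hp hτ',
    fun M' Φ hM' hΦ hps τ' hτ' v₄ v₃ t v₂ v₁ w₄ w₃ s w₂ w₁ e₄ e₃ e₂ e₁ es ht =>
      hτ.push hM hpsc hp hM' hΦ hps hτ' e₄ e₃ e₂ e₁ es ht,
    fun U θ hU hpU hθ hpos v₂ v₁ w₁ hv₂ hw₁ => hτ.nonneg hM hpsc hp hU hpU hθ hpos hv₂ hw₁,
    ?_, ?_, fun hT => ?_⟩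
  · obtain ⟨Φ, G, h⟩ := exists_isPscChart hM hpsc hp hpq
    exact ⟨Φ, quarticPart q G, remainder q G, h.isBiholomorphic, h.mem_source, h.map_eq,
      h.isRealQuarticPolynomial, h.isPlurisubharmonic,
      h.contDiffOn_remainder, fun x _ y _ h0 hj => h.remainder_congr h0 hj,
      h.isLittleOWeight_remainder,
      fun x hx => (h.mem_iff x hx).trans (by rw [remainder]; ring_nf),
      fun v₄ v₃ v₂ v₁ h₄ h₃ => h.pairsTo hτ v₂ v₁ h₄ h₃⟩
  · obtain ⟨S, U, m, f, hU, hpU, hpS, hS, hf, hli, hrank, htan⟩ :=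
      exists_submanifold hM hpsc hp hpq hτ
    refine ⟨S, U, m, f, hU, hpU, hpS, hS, hf, hli, hrank, htan, fun hT =>
      isTotallyReal_inf htan fun v hv => ?_⟩
    obtain ⟨a, b, c, d, ha, -, -, -, h0⟩ := hne hT v hv
    exact ⟨a, b, c, d, ha, h0⟩
  · obtain ⟨h1, h2, h3⟩ := regularType_and_dAngeloType hM hpsc hp hpq hT
    exact ⟨hne hT, h1, h2, h3, isMultitype_blockWeights hM hpsc hp hpq hT⟩
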